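/- **Setting.** Write $e(t)=\exp(2\pi i t)$. Let $L$ be an even lattice of signature $(b^+,b^-)$ with bilinear form $(\cdot,\cdot)$, $q(x)=\tfrac12(x,x)$, dual lattice $L'$ and discriminant group $D_L=L'/L$. Fix an isometry $g_0:L\otimes\mathbb R\to\mathbb R^{b^+,b^-}$ (standard basis vectors of norm $\pm1$). For an isometry $g$ of $L\otimes\mathbb R$ let $z^\perp$ and $z$ be the preimages under $g_0\circ g$ of $\mathbb R^{b^+,0}$ and $\mathbb R^{0,b^-}$, and write $x_{z^\perp},x_z$ for the projections. For $\eta\in L'$ and a homogeneous polynomial $P:\mathbb R^{b^+,0}\to\mathbb C$ of degree $m$ (evaluated at the positive coordinates) let, for $\tau=x+iy\in\mathbb H$ and $\zeta\in\mathbb C$ with $v=\operatorname{Im}\zeta$, $$\Theta_{L,\eta}(\tau,\zeta,g,P)=y^{b^- /2}e^{4\pi q(\eta_z)v^2/y}\sum_{\lambda\in L'}\exp(-\Delta/8\pi y)(P)\big(g(\lambda+v\eta/y)\big)\,e\big(q(\lambda_{z^\perp})\tau+q(\lambda_z)\bar\tau+\zeta(\lambda,\eta_{z^\perp})+\bar\zeta(\lambda,\eta_z)\big)\,\mathfrak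 e_{\lambda}.$$ Let $u,u'\in L$ with $q(u)=0$ and $(u,u')=1$, and let $K=L\cap u^\perp\cap u'^\perp$, so that $L$ is the orthogonal sum of a hyperbolic plane and $K$; identify $D_K=D_L$. Let $w^\perp$ and $w$ be the orthogonal complements of $u_{z^\perp}$ in $z^\perp$ and of $u_z$ in $z$, put $g_K(x)=g(x_{w^\perp}+x_w)$, define polynomials $P_{g_K,h}$ by $P(g(x))=\sum_h(x,u_{z^\perp})^hP_{g_K,h}(g_K(x))$, and put $\mu=-u'+\frac{u_{z^\perp}}{2u_{z^\perp}^2}+\frac{u_z}{2u_z^2}$. Define $\Theta_{K,\eta}(\tau,\zeta,g_K,P_{g_K,0})$ by the formula above with $K',g_K,w^\perp,w,b^--1,P_{g_K,0}$ in place of $L',g,z^\perp,z,b^-,P$. Let $\eta\in L'$ with $(\eta,u)=0$ and $q(\eta)>0$, put $\eta_K=\eta-(\eta,u')u$ and, for $\kappa\in K'$, $\kappa_\eta=\kappa-\frac{(\kappa,\eta)}{\eta^2}\eta_K$, which lies in $\Lambda':=(\eta^\perp\cap K)'$. Let $\phi=\sum a(\sigma,r,s)\,\mathfrak e_\sigma\,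 e(r\tau+s\zeta)$ be a vector-valued Jacobi cusp form (i.e. $a(\sigma,r,s)\ne0$ implies $4q(\eta)r>s^2$) of weight $k=m+(b^+-b^-)/2$ and index $\eta$ for the Weil representation of $L$. The Jacobi Petersson inner product is $$\langle\phi,\Theta\rangle_{\mathrm{Pet}}=\int_{\tau\in \mathrm{SL}_2(\mathbb Z)\backslash\mathbb H}\int_{\zeta\in\mathbb C/(\mathbb Z+\tau\mathbb Z)}\langle\phi,\Theta\rangle\,y^k e^{-4\pi q(\eta)v^2/y}\,\frac{d\zeta\,d\tau}{y^3}.$$ **Theorem.** There are functions $c_{\tilde\lambda}(g)$, for $\tilde\lambda\in\Lambda'$ and isometries $g$, such that the following holds for every $g$ for which all the polynomials $P_{g_K,h}$ are harmonic and satisfy $P_{g_K,h}(g_K(\lambda+C\eta))=P_{g_K,h}(g_K(\lambda))$ for all $\lambda\in K$ and $C\in\mathbb C$. The inner products $\langle\phi,\Theta_{L,\eta}(\cdot,\cdot,g,P)\rangle_{\mathrm{Pet}}$ and $\langle\phi,\Theta_{K,\eta}(\cdot,\cdot,g_K,P_{g_K,0})\rangle_{\mathrm{Pet}}$ converge absolutely,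 and there is an absolutely convergent Fourier expansion $$\langle\phi,\Theta_{L,\eta}(\cdot,\cdot,g,P)\rangle_{\mathrm{Pet}}=\sum_{\tilde\lambda\in\Lambda'}c_{\tilde\lambda}(g)\,e\big((\tilde\lambda,\mu)\big),$$ where $c_{\tilde\lambda}(g\circ E(u,\nu))=c_{\tilde\lambda}(g)$ for every $\nu\in\eta^\perp\cap(K\otimes\mathbb R)$, with $E(u,\nu)(x)=x-(x,u)\nu+(x,\nu)u-q(\nu)(x,u)u$. The constant term is $$c_0(g)=\frac{1}{\sqrt2\,|u_{z^\perp}|}\langle\phi,\Theta_{K,\eta}(\cdot,\cdot,g_K,P_{g_K,0})\rangle_{\mathrm{Pet}} .$$ If $q(\tilde\lambda)>0$, then $$\begin{aligned}c_{\tilde\lambda}(g)={}&\frac{1}{|u_{z^\perp}|\,|\eta_{w^\perp}|}\;e\Big(-\frac{(\eta,u_{z^\perp})(\tilde\lambda,\eta_{w^\perp})}{2u_{z^\perp}^2\,q(\eta_{w^\perp})}\Big)\sum_{h=0}^{m}\ \sum_{n\ge1,\;\tilde\lambda/n\in\Lambda'}\frac{n^{2h-m}}{(2i)^h}\,\overline{P_{g_K,h}(g_K(\tilde\lambda))}\\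 &\times\int_0^\infty y^{b^- /2+k-h-3}\exp\Big(-\frac{\pi n^2}{2yu_{z^\perp}^2}-\frac{\pi n^2(\eta,u_{z^\perp})^2}{4q(\eta_{w^\perp})u_{z^\perp}^4\,y}-\frac{4\pi y}{n^2}\Big(q(\tilde\lambda_{w^\perp})-\frac{(\tilde\lambda,\eta_{w^\perp})^2}{4q(\eta_{w^\perp})}\Big)\Big)dy\\ &\times\sum_{\lambda}e\Big(-\frac{(\lambda,\eta)(\eta,u')}{\eta^2}\Big)\,a\Big(\frac{\lambda}{n},\frac{q(\lambda)}{n^2},\frac{(\lambda,\eta)}{n}\Big),\end{aligned}$$ where all integrals converge absolutely and $\lambda$ runs over the classes in $nK'/\mathbb Z n\eta_K$ with $\lambda_\eta=\tilde\lambda$. In all remaining cases ($\tilde\lambda\neq0$, $q(\tilde\lambda)\le0$), $c_{\tilde\lambda}(g)=0$. -/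

import Mathlib

open MeasureTheory

noncomputable section

namespace JacobiUnfolding

/-- The real quadratic space of signature `(bp, bm)`; the coordinates are those given by the fixed
isometry `g₀`, so that the standard basis vectors have norm `(e_j, e_j) = 1` for `j ≤ bp` and
`(e_j, e_j) = -1` otherwise. Lattices are subgroups of this space. -/
abbrev QSpace (bp bm : ℕ) : Type :=
  EuclideanSpace ℝ (Fin bp) × EuclideanSpace ℝ (Fin bm)

variable {bp bm : ℕ}

/-- The bilinear form `(x, y)`. -/
def bil : LinearMap.BilinForm ℝ (QSpace bp bm) :=
  (innerₗ (EuclideanSpace ℝ (Fin bp))).compl₁₂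
      (LinearMap.fst ℝ _ _) (LinearMap.fst ℝ _ _) -
    (innerₗ (EuclideanSpace ℝ (Fin bm))).compl₁₂
      (LinearMap.snd ℝ _ _) (LinearMap.snd ℝ _ _)

/-- The quadratic form `q(x) = (x, x) / 2`. -/
def q (x : QSpace bp bm) : ℝ := bil x x / 2

/-- `e(t) = exp(2 π i t)`. -/
def ee (t : ℂ) : ℂ := Complex.exp (2 * Real.pi * Complex.I * t)

/-! ### Lattices -/

/-- The quadratic form takes integral values on `L`. -/
def IsEven (L : Submodule ℤ (QSpace bp bm)) : Prop := ∀ x ∈ L, ∃ n : ℤ, q x = n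

/-- The dual lattice `N'`, inside the real span of `N`. -/
def dualLat (N : Submodule ℤ (QSpace bp bm)) : Submodule ℤ (QSpace bp bm) :=
  bil.dualSubmodule N ⊓ (Submodule.span ℝ (N : Set (QSpace bp bm))).restrictScalars ℤ

/-- The sublattice `N ∩ v^⊥`. -/
def orthIn (N : Submodule ℤ (QSpace bp bm)) (v : QSpace bp bm) :
    Submodule ℤ (QSpace bp bm) :=
  N ⊓ (LinearMap.ker (bil v)).restrictScalars ℤ

/-- The discriminant group `D_L = L' / L`. -/
abbrev Disc (L : Submodule ℤ (QSpace bp bm)) : Type :=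
  ↥(dualLat L) ⧸ L.submoduleOf (dualLat L)

/-- A representative in `L'` of a class in `D_L`. -/
def rep {L : Submodule ℤ (QSpace bp bm)} (σ : Disc L) : QSpace bp bm :=
  ((Quotient.out σ : ↥(dualLat L)) : QSpace bp bm)

open Classical in
/-- The class in `D_L` of a vector of `L'`. -/
def cls (L : Submodule ℤ (QSpace bp bm)) (v : QSpace bp bm) : Disc L :=
  if h : v ∈ dualLat L then Submodule.Quotient.mk ⟨v, h⟩ else 0

/-! ### The Weil representation of the Jacobi group and Jacobi forms

Vectors of the group algebra `ℂ[D_L]` are functions on `D_L`, the basis vector `𝔢_σ` being the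
indicator function of `σ`. -/

/-- The action of `(T, 1)`, that is `𝔢_σ ↦ e(q(σ)) 𝔢_σ`. -/
def weilT (L : Submodule ℤ (QSpace bp bm)) (f : Disc L → ℂ) : Disc L → ℂ :=
  fun σ => ee (q (rep σ)) * f σ

/-- The action of `(S, √τ)`, that is
`𝔢_σ ↦ √i ^ (bm - bp) / √|D_L| * ∑_{σ'} e(-(σ, σ')) 𝔢_σ'`. -/
def weilS (L : Submodule ℤ (QSpace bp bm)) (f : Disc L → ℂ) : Disc L → ℂ :=
  fun σ' => Complex.I ^ ((((bm : ℝ) - bp) / 2 : ℝ) : ℂ) / (Real.sqrt (Nat.card (Disc L)) : ℂ) *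
    ∑ᶠ σ : Disc L, ee (-(bil (rep σ) (rep σ') : ℝ)) * f σ

/-- The action of the Heisenberg element `(h, r, t)`, that is
`𝔢_σ ↦ e(h (σ, η) + (t - h r) q(η)) 𝔢_{σ - r η}`. -/
def weilH (L : Submodule ℤ (QSpace bp bm)) (η : QSpace bp bm) (h r t : ℤ)
    (f : Disc L → ℂ) : Disc L → ℂ :=
  fun σ' => ee (h * (bil (rep (σ' + r • cls L η)) η : ℝ) + (t - h * r) * (q η : ℝ)) *
    f (σ' + r • cls L η)

/-- Vector-valued Jacobi forms `φ : ℍ × ℂ → ℂ[D_L]` of weight `k ∈ ½ℤ` and index `η ∈ L'`.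
(Only the values at `(τ, z)` with `Im τ > 0` matter. The Weil representation is defined on the
generators `T`, `S` of `Mp₂(ℤ)`, and the transformation law, whose factors are cocycles, is written
for them; powers are taken with the principal branch, so `τ ^ k = √τ ^ (2 k)`.) -/
structure IsJacobiForm (L : Submodule ℤ (QSpace bp bm)) (η : QSpace bp bm) (k : ℝ)
    (φ : ℂ → ℂ → Disc L → ℂ) : Prop where
  holo : ∀ σ, DifferentiableOn ℂ (fun p : ℂ × ℂ => φ p.1 p.2 σ) {p | 0 < p.1.im}
  heis : ∀ (h r t : ℤ) (τ z : ℂ), 0 < τ.im →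
    φ τ (z + h + r * τ) =
      ee (-(q η) * r ^ 2 * τ - 2 * q η * r * z - h * r * q η - t * q η) •
        weilH L η h r t (φ τ z)
  transT : ∀ τ z : ℂ, 0 < τ.im → φ (τ + 1) z = weilT L (φ τ z)
  transS : ∀ τ z : ℂ, 0 < τ.im →
    φ (-1 / τ) (z / τ) = (τ ^ (k : ℂ) * ee (q η * z ^ 2 / τ)) • weilS L (φ τ z)

/-- The Fourier coefficient `a(σ, r, s)` of `𝔢_σ e(r τ + s z)` in `φ`, for `r ∈ ℤ + q(σ)` and
`s ∈ ℤ + (σ, η)`, computed on `Im τ = 1`, `Im z = 0`. -/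
def jacCoeff {L : Submodule ℤ (QSpace bp bm)} (φ : ℂ → ℂ → Disc L → ℂ) (σ : Disc L)
    (r s : ℝ) : ℂ :=
  ∫ x in (0 : ℝ)..1, ∫ ξ in (0 : ℝ)..1,
    φ (x + Complex.I) ξ σ * ee (-(r * (x + Complex.I) + s * ξ))

/-- Jacobi cusp forms: `a(σ, r, s) ≠ 0` implies `4 q(η) r > s²`. -/
structure IsJacobiCuspForm (L : Submodule ℤ (QSpace bp bm)) (η : QSpace bp bm) (k : ℝ)
    (φ : ℂ → ℂ → Disc L → ℂ) : Prop extends IsJacobiForm L η k φ where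
  cusp : ∀ v ∈ dualLat L, ∀ n l : ℤ,
    jacCoeff φ (cls L v) (q v + n) (bil v η + l) ≠ 0 →
      (bil v η + l) ^ 2 < 4 * q η * (q v + n)

/-! ### Isometries and projections -/

/-- `g` is an isometry of the quadratic space. -/
def IsIsom (g : QSpace bp bm ≃ₗ[ℝ] QSpace bp bm) : Prop :=
  ∀ x y, bil (g x) (g y) = bil x y

/-- The projection `x_{z^⊥}` to `z^⊥`, the preimage under `g` of the positive coordinate space. -/
def posPart (g : QSpace bp bm ≃ₗ[ℝ] QSpace bp bm) (x : QSpace bp bm) : QSpace bp bm :=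
  g.symm ((g x).1, 0)

/-- The projection `x_z` to `z`, the preimage under `g` of the negative coordinate space. -/
def negPart (g : QSpace bp bm ≃ₗ[ℝ] QSpace bp bm) (x : QSpace bp bm) : QSpace bp bm :=
  g.symm (0, (g x).2)

/-- The projection `x_{w^⊥}`, where `w^⊥` is the orthogonal complement of `u_{z^⊥}` in `z^⊥`. -/
def wPos (g : QSpace bp bm ≃ₗ[ℝ] QSpace bp bm) (u x : QSpace bp bm) : QSpace bp bm :=
  posPart g x - (bil x (posPart g u) / bil (posPart g u) (posPart g u)) • posPart g u

/-- The projection `x_w`, where `w` is the orthogonal complement of `u_z` in `z`. -/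
def wNeg (g : QSpace bp bm ≃ₗ[ℝ] QSpace bp bm) (u x : QSpace bp bm) : QSpace bp bm :=
  negPart g x - (bil x (negPart g u) / bil (negPart g u) (negPart g u)) • negPart g u

/-- The linear map `g_K : x ↦ g(x_{w^⊥} + x_w)`. -/
def gSub (g : QSpace bp bm ≃ₗ[ℝ] QSpace bp bm) (u x : QSpace bp bm) : QSpace bp bm :=
  g (wPos g u x + wNeg g u x)

/-- The vector `μ = -u' + u_{z^⊥} / (2 u_{z^⊥}²) + u_z / (2 u_z²)`. -/
def mu (g : QSpace bp bm ≃ₗ[ℝ] QSpace bp bm) (u u' : QSpace bp bm) : QSpace bp bm :=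
  -u' + (1 / (2 * bil (posPart g u) (posPart g u))) • posPart g u +
    (1 / (2 * bil (negPart g u) (negPart g u))) • negPart g u

/-- The Eichler transformation `E(u, ν)`. -/
def eichler (u ν v : QSpace bp bm) : QSpace bp bm :=
  v - bil v u • ν + bil v ν • u - (q ν * bil v u) • u

/-! ### Polynomials -/

/-- The value of a polynomial on `ℝ^{bp,0}` at the positive coordinates of a vector. -/
def polyAt (p : MvPolynomial (Fin bp) ℂ) (x : QSpace bp bm) : ℂ :=
  MvPolynomial.eval (fun i => ((x.1 i : ℝ) : ℂ)) p

/-- The Laplace operator on `ℝ^{bp,0}`. -/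
def laplacian (p : MvPolynomial (Fin bp) ℂ) : MvPolynomial (Fin bp) ℂ :=
  ∑ i, MvPolynomial.pderiv i (MvPolynomial.pderiv i p)

/-- `exp(-Δ / (8 π y)) p`; the omitted terms of the exponential series vanish. -/
def heat (y : ℝ) (p : MvPolynomial (Fin bp) ℂ) : MvPolynomial (Fin bp) ℂ :=
  ∑ j ∈ Finset.range (p.totalDegree + 1),
    MvPolynomial.C (((-1 / (8 * Real.pi * y)) ^ j / (j.factorial : ℝ) : ℝ) : ℂ) *
      laplacian^[j] p

/-- For `ω ∈ ℝ^{bp,0}`, the polynomials `P_h` that do not depend on the direction `ω` and satisfy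
`P(x) = ∑_h (x, ω)^h P_h(x')`, where `x'` is the projection of `x` to `ω^⊥`: the coefficient of
`t^h` in `P(x' + (t / ω²) ω)`. -/
def polyCoeff (ω : EuclideanSpace ℝ (Fin bp)) (P : MvPolynomial (Fin bp) ℂ) (h : ℕ) :
    MvPolynomial (Fin bp) ℂ :=
  (MvPolynomial.aeval
    (fun i : Fin bp =>
      Polynomial.C (MvPolynomial.X i - MvPolynomial.C ((ω i / ‖ω‖ ^ 2 : ℝ) : ℂ) *
        ∑ j, MvPolynomial.C ((ω j : ℝ) : ℂ) * MvPolynomial.X j) +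
      Polynomial.C (MvPolynomial.C ((ω i / ‖ω‖ ^ 2 : ℝ) : ℂ)) * Polynomial.X) P :
        Polynomial (MvPolynomial (Fin bp) ℂ)).coeff h

/-- The polynomial `P_{g_K,h}`. It lives on `g(w^⊥)` and is extended to `ℝ^{bp,0}` so that it does
not depend on the direction of `g(u_{z^⊥})`; the Laplace operator of `ℝ^{bp,0}` then restricts to
the one of `g(w^⊥)`. -/
def subPoly (g : QSpace bp bm ≃ₗ[ℝ] QSpace bp bm) (u : QSpace bp bm)
    (P : MvPolynomial (Fin bp) ℂ) (h : ℕ) : MvPolynomial (Fin bp) ℂ :=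
  polyCoeff (g u).1 P h

/-! ### Jacobi theta functions -/

/-- A component of a Jacobi theta function: the sum over the set `S` of lattice vectors, for the
map `T` (an isometry `g`, or `g_K`), the projections `pos` and `neg` to the positive and negative
definite subspaces, and the rank `d` of the latter. -/
def thetaSum (d : ℝ) (S : Set (QSpace bp bm)) (T pos neg : QSpace bp bm → QSpace bp bm)
    (p : MvPolynomial (Fin bp) ℂ) (η : QSpace bp bm) (τ z : ℂ) : ℂ :=
  ((τ.im ^ (d / 2) * Real.exp (4 * Real.pi * q (neg η) * z.im ^ 2 / τ.im) : ℝ) : ℂ) *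
    ∑' v : S, polyAt (heat τ.im p) (T (v + (z.im / τ.im) • η)) *
      ee ((q (pos v) : ℝ) * τ + (q (neg v) : ℝ) * (starRingEnd ℂ) τ +
        z * (bil (v : QSpace bp bm) (pos η) : ℝ) +
        (starRingEnd ℂ) z * (bil (v : QSpace bp bm) (neg η) : ℝ))

/-- `Θ_{L,η}(τ, z, g, P)`, with values in `ℂ[D_L]`. -/
def thetaL (L : Submodule ℤ (QSpace bp bm)) (η : QSpace bp bm)
    (g : QSpace bp bm ≃ₗ[ℝ] QSpace bp bm) (P : MvPolynomial (Fin bp) ℂ) (τ z : ℂ) :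
    Disc L → ℂ :=
  fun σ => thetaSum bm {v | v ∈ dualLat L ∧ cls L v = σ} g (posPart g) (negPart g) P η τ z

/-- `Θ_{K,η}(τ, z, g_K, P_{g_K,0})`, with values in `ℂ[D_L]`, where `L = U ⊕ K` and `D_K` is
identified with `D_L` through the inclusion of `K'` in `L'`. -/
def thetaK (L K : Submodule ℤ (QSpace bp bm)) (u η : QSpace bp bm)
    (g : QSpace bp bm ≃ₗ[ℝ] QSpace bp bm) (P : MvPolynomial (Fin bp) ℂ) (τ z : ℂ) :
    Disc L → ℂ :=
  fun σ => thetaSum ((bm : ℝ) - 1) {v | v ∈ dualLat K ∧ cls L v = σ}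
    (gSub g u) (wPos g u) (wNeg g u) (subPoly g u P 0) η τ z

/-! ### The Jacobi Petersson inner product -/

/-- Pairs `(τ, z)` with `τ` in the standard fundamental domain of `SL₂(ℤ)` and `z` in the
period parallelogram `T(τ)` of `ℂ / (ℤ + τ ℤ)`. -/
def jacDomain : Set (ℂ × ℂ) :=
  {p | 0 < p.1.im ∧ |p.1.re| ≤ 1 / 2 ∧ 1 ≤ ‖p.1‖ ∧ 0 ≤ p.2.im ∧ p.2.im ≤ p.1.im ∧
    p.2.im * p.1.re / p.1.im ≤ p.2.re ∧ p.2.re ≤ 1 + p.2.im * p.1.re / p.1.im}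

/-- The integrand `⟨φ, Θ⟩ y^k exp(-4 π q(η) v² / y) y⁻³`, with `y = Im τ` and `v = Im z`. -/
def peterssonIntegrand {L : Submodule ℤ (QSpace bp bm)} (η : QSpace bp bm) (k : ℝ)
    (φ Θ : ℂ → ℂ → Disc L → ℂ) (p : ℂ × ℂ) : ℂ :=
  (∑ᶠ σ : Disc L, φ p.1 p.2 σ * (starRingEnd ℂ) (Θ p.1 p.2 σ)) *
    ((p.1.im ^ k * Real.exp (-4 * Real.pi * q η * p.2.im ^ 2 / p.1.im) / p.1.im ^ 3 : ℝ) : ℂ)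

/-- The Jacobi Petersson inner product `⟨φ, Θ⟩_Pet`. -/
def petersson {L : Submodule ℤ (QSpace bp bm)} (η : QSpace bp bm) (k : ℝ)
    (φ Θ : ℂ → ℂ → Disc L → ℂ) : ℂ :=
  ∫ p in jacDomain, peterssonIntegrand η k φ Θ p

/-! ### The Fourier coefficients -/

/-- The projection of `κ ∈ K'` to the orthogonal complement of `η`, namely
`κ - (κ, η) / η² * η_K` with `η_K = η - (η, u') u`. -/
def projEta (u u' η κ : QSpace bp bm) : QSpace bp bm :=
  κ - (bil κ η / bil η η) • (η - bil η u' • u)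

/-- The integrand of the `K`-Bessel-type integral attached to the divisor `n` of `lam`. -/
def besselIntegrand (g : QSpace bp bm ≃ₗ[ℝ] QSpace bp bm) (u η lam : QSpace bp bm) (k : ℝ)
    (h n : ℕ) (y : ℝ) : ℝ :=
  y ^ ((bm : ℝ) / 2 + k - h - 3) *
    Real.exp (-(Real.pi * n ^ 2 / (2 * y * bil (posPart g u) (posPart g u)))
      - Real.pi * n ^ 2 * bil η (posPart g u) ^ 2 /
          (4 * q (wPos g u η) * bil (posPart g u) (posPart g u) ^ 2 * y)
      - 4 * Real.pi * y / n ^ 2 *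
          (q (wPos g u lam) - bil lam (wPos g u η) ^ 2 / (4 * q (wPos g u η))))

/-- The coefficient attached to a vector `lam` of positive norm. For each divisor `n` the sum over
`κ` runs over the classes in `K' / ℤ η_K` of the vectors with `projEta κ = lam / n`, each of which
has exactly one representative with `0 ≤ (κ, η) < η²`. -/
def unfoldCoeff (L K : Submodule ℤ (QSpace bp bm)) (u u' η : QSpace bp bm)
    (P : MvPolynomial (Fin bp) ℂ) (m : ℕ) (k : ℝ) (φ : ℂ → ℂ → Disc L → ℂ)
    (g : QSpace bp bm ≃ₗ[ℝ] QSpace bp bm) (lam : QSpace bp bm) : ℂ :=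
  1 / (Real.sqrt (bil (posPart g u) (posPart g u)) *
      Real.sqrt (bil (wPos g u η) (wPos g u η)) : ℂ) *
    ee (-(bil η (posPart g u) * bil lam (wPos g u η) /
      (2 * bil (posPart g u) (posPart g u) * q (wPos g u η)) : ℝ)) *
    ∑ h ∈ Finset.range (m + 1),
      ∑ᶠ (n : ℕ) (_ : 1 ≤ n ∧ ((n : ℝ)⁻¹) • lam ∈ dualLat (orthIn K η)),
        (n : ℂ) ^ (2 * (h : ℤ) - m) / (2 * Complex.I) ^ h *
          (starRingEnd ℂ) (polyAt (subPoly g u P h) (gSub g u lam)) *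
          ((∫ y in Set.Ioi (0 : ℝ), besselIntegrand g u η lam k h n y : ℝ) : ℂ) *
          ∑ᶠ (κ : QSpace bp bm) (_ : κ ∈ dualLat K ∧ projEta u u' η κ = ((n : ℝ)⁻¹) • lam ∧
              0 ≤ bil κ η ∧ bil κ η < bil η η),
            ee (-(n * bil κ η * bil η u' / bil η η : ℝ)) *
              jacCoeff φ (cls L κ) (q κ) (bil κ η)

/-! ### The polynomials `P_h` have their defining property -/

theorem eval_polyCoeff (ω : EuclideanSpace ℝ (Fin bp)) (P : MvPolynomial (Fin bp) ℂ) (h : ℕ)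
    (a : Fin bp → ℂ) :
    MvPolynomial.eval a (polyCoeff ω P h) =
      (MvPolynomial.aeval (fun i : Fin bp =>
        Polynomial.C (a i - ((ω i / ‖ω‖ ^ 2 : ℝ) : ℂ) * ∑ j, ((ω j : ℝ) : ℂ) * a j) +
        Polynomial.C ((ω i / ‖ω‖ ^ 2 : ℝ) : ℂ) * Polynomial.X) P : Polynomial ℂ).coeff h := by
  unfold polyCoeff
  rw [← Polynomial.coeff_map]
  congr 1
  rw [MvPolynomial.aeval_def, MvPolynomial.aeval_def, ← Polynomial.coe_mapRingHom,
    MvPolynomial.hom_eval₂]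
  congr 1
  · ext c
    simp
  · funext i
    simp [Polynomial.map_sum]

theorem polyCoeff_spec (ω : EuclideanSpace ℝ (Fin bp)) (hω : ω ≠ 0)
    (P : MvPolynomial (Fin bp) ℂ) (m : ℕ) (hP : P.IsHomogeneous m)
    (x : EuclideanSpace ℝ (Fin bp)) :
    MvPolynomial.eval (fun i => ((x i : ℝ) : ℂ)) P =
      ∑ h ∈ Finset.range (m + 1), ((inner ℝ x ω : ℝ) : ℂ) ^ h *
        MvPolynomial.eval
          (fun i => (((x - (inner ℝ x ω / ‖ω‖ ^ 2) • ω) i : ℝ) : ℂ)) (polyCoeff ω P h) := by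
  have hn : ‖ω‖ ^ 2 ≠ 0 := by positivity
  have h0 : (∑ j, ω j * (x - (inner ℝ x ω / ‖ω‖ ^ 2) • ω) j) = 0 := by
    have : (∑ j, ω j * (x - (inner ℝ x ω / ‖ω‖ ^ 2) • ω) j) =
        inner ℝ (x - (inner ℝ x ω / ‖ω‖ ^ 2) • ω) ω := by
      simp [PiLp.inner_apply]
    rw [this, inner_sub_left, inner_smul_left, real_inner_self_eq_norm_sq]
    simp
    field_simp
    simp
  have h1 : (∑ j, ((ω j : ℝ) : ℂ) * (((x - (inner ℝ x ω / ‖ω‖ ^ 2) • ω) j : ℝ) : ℂ)) = 0 := by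
    exact_mod_cast h0
  simp_rw [eval_polyCoeff, h1]
  set F : Polynomial ℂ := MvPolynomial.aeval (fun i : Fin bp =>
        Polynomial.C ((((x - (inner ℝ x ω / ‖ω‖ ^ 2) • ω) i : ℝ) : ℂ) -
          ((ω i / ‖ω‖ ^ 2 : ℝ) : ℂ) * 0) +
        Polynomial.C ((ω i / ‖ω‖ ^ 2 : ℝ) : ℂ) * Polynomial.X) P with hF
  have hdeg : F.natDegree ≤ m * 1 := by
    refine MvPolynomial.aeval_natDegree_le P hP.totalDegree_le _ fun i => ?_
    compute_degree
  have key : F.eval ((inner ℝ x ω : ℝ) : ℂ) = MvPolynomial.eval (fun i => ((x i : ℝ) : ℂ)) P := by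
    rw [hF, MvPolynomial.aeval_def, ← Polynomial.coe_evalRingHom, MvPolynomial.hom_eval₂,
      MvPolynomial.eval, MvPolynomial.coe_eval₂Hom]
    congr 1
    · ext c
      simp
    · funext i
      simp
      ring
  rw [← key, Polynomial.eval_eq_sum_range' (n := m + 1) (by omega)]
  exact Finset.sum_congr rfl fun h _ => mul_comm _ _

theorem polyCoeff_const (ω : EuclideanSpace ℝ (Fin bp)) (hω : ω ≠ 0)
    (P : MvPolynomial (Fin bp) ℂ) (h : ℕ) (x : EuclideanSpace ℝ (Fin bp)) (t : ℝ) :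
    MvPolynomial.eval (fun i => (((x + t • ω) i : ℝ) : ℂ)) (polyCoeff ω P h) =
      MvPolynomial.eval (fun i => ((x i : ℝ) : ℂ)) (polyCoeff ω P h) := by
  have hn : ‖ω‖ ^ 2 ≠ 0 := by positivity
  have h0 : (∑ j, ω j * ω j) = ‖ω‖ ^ 2 := by
    rw [EuclideanSpace.real_norm_sq_eq]
    exact Finset.sum_congr rfl fun j _ => (sq _).symm
  rw [eval_polyCoeff, eval_polyCoeff]
  have h2 : ∀ i, (x + t • ω) i - ω i / ‖ω‖ ^ 2 * ∑ j, ω j * (x + t • ω) j =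
      x i - ω i / ‖ω‖ ^ 2 * ∑ j, ω j * x j := by
    intro i
    have h3 : ∑ j, ω j * (x + t • ω) j = (∑ j, ω j * x j) + t * ‖ω‖ ^ 2 := by
      rw [← h0, Finset.mul_sum, ← Finset.sum_add_distrib]
      refine Finset.sum_congr rfl fun j _ => ?_
      simp
      ring
    rw [h3]
    simp
    field_simp
    ring
  congr 3
  funext i
  congr 2
  exact_mod_cast h2 i

end JacobiUnfolding

end

open JacobiUnfolding

open MeasureTheory
open Complex (I)
open Real (exp sqrt)
open scoped Real UpperHalfPlane ComplexConjugate MatrixGroups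

noncomputable section

namespace JacobiUnfolding

variable {bp bm : ℕ}

section

/-! ### The exponential function `e` -/

theorem ee_add (a b : ℂ) : ee (a + b) = ee a * ee b := by
  simp only [ee, ← Complex.exp_add]; ring_nf

theorem ee_neg (a : ℂ) : ee (-a) = (ee a)⁻¹ := by
  simp only [ee, ← Complex.exp_neg]; ring_nf

@[simp] theorem ee_zero : ee 0 = 1 := by simp [ee]

theorem ee_ne_zero (a : ℂ) : ee a ≠ 0 := Complex.exp_ne_zero _

@[simp] theorem ee_int (n : ℤ) : ee n = 1 := by
  rw [ee, mul_comm, Complex.exp_int_mul_two_pi_mul_I]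

theorem ee_add_int (a : ℂ) (n : ℤ) : ee (a + n) = ee a := by rw [ee_add, ee_int, mul_one]

theorem norm_ee (a : ℂ) : ‖ee a‖ = exp (-2 * π * a.im) := by
  rw [ee, Complex.norm_exp]; congr 1; simp

@[simp] theorem norm_ee_ofReal (a : ℝ) : ‖ee a‖ = 1 := by simp [norm_ee]

theorem conj_ee (a : ℂ) : conj (ee a) = ee (-conj a) := by
  rw [ee, ee, ← Complex.exp_conj]; congr 1; simp [map_ofNat conj 2]

theorem conj_ee_ofReal (a : ℝ) : conj (ee a) = ee (-a : ℝ) := by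
  rw [conj_ee]; simp

theorem ee_eq_one_iff (a : ℝ) : ee a = 1 ↔ ∃ n : ℤ, a = n := by
  rw [ee, Complex.exp_eq_one_iff]
  constructor
  · rintro ⟨n, hn⟩
    refine ⟨n, ?_⟩
    have h : (2 * π * I : ℂ) ≠ 0 := Complex.two_pi_I_ne_zero
    have : (a : ℂ) = n := by
      rw [mul_comm (n : ℂ)] at hn; exact mul_left_cancel₀ h hn
    exact_mod_cast this
  · rintro ⟨n, rfl⟩
    exact ⟨n, by push_cast; ring⟩

theorem ee_congr {a b : ℝ} (h : ∃ n : ℤ, a - b = n) : ee a = ee b := by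
  obtain ⟨n, hn⟩ := h
  have : (a : ℂ) = b + n := by
    have : a = b + n := by linarith
    rw [this]; push_cast; rfl
  rw [this, ee_add_int]

@[fun_prop] theorem continuous_ee : Continuous ee := by unfold ee; fun_prop

@[fun_prop] theorem differentiable_ee : Differentiable ℂ ee := by unfold ee; fun_prop

/-! ### The quadratic space -/

theorem bil_apply (x y : QSpace bp bm) : bil x y = inner ℝ x.1 y.1 - inner ℝ x.2 y.2 := by
  simp [bil]

theorem bil_comm (x y : QSpace bp bm) : bil x y = bil y x := by
  simp only [bil_apply, real_inner_comm]

theorem q_add (x y : QSpace bp bm) : q (x + y) = q x + q y + bil x y := by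
  simp only [q, map_add, LinearMap.add_apply, bil_comm y x]; ring

theorem q_smul (c : ℝ) (x : QSpace bp bm) : q (c • x) = c ^ 2 * q x := by
  simp only [q, map_smul, LinearMap.smul_apply, smul_eq_mul]; ring

theorem bil_self (x : QSpace bp bm) : bil x x = 2 * q x := by simp only [q]; ring

@[simp] theorem q_zero : q (0 : QSpace bp bm) = 0 := by simp [q]

theorem bil_smul_left (c : ℝ) (x y : QSpace bp bm) : bil (c • x) y = c * bil x y := by simp

theorem bil_zsmul_left (c : ℤ) (x y : QSpace bp bm) : bil (c • x) y = c * bil x y := by simp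

theorem eq_zero_of_bil (x : QSpace bp bm) (h : ∀ y, bil x y = 0) : x = 0 := by
  have h1 := h (x.1, 0)
  have h2 := h (0, x.2)
  simp only [bil_apply, inner_zero_right, sub_zero, zero_sub, neg_eq_zero, inner_self_eq_zero]
    at h1 h2
  exact Prod.ext h1 h2

theorem bil_nondegenerate : (bil : LinearMap.BilinForm ℝ (QSpace bp bm)).Nondegenerate :=
  ⟨fun x h => eq_zero_of_bil x h, fun x h => eq_zero_of_bil x fun y => by rw [bil_comm]; exact h y⟩

theorem bil_isSymm : (bil : LinearMap.BilinForm ℝ (QSpace bp bm)).IsSymm :=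
  ⟨fun x y => bil_comm x y⟩

@[fun_prop] theorem continuous_bil {X : Type*} [TopologicalSpace X] {f g : X → QSpace bp bm}
    (hf : Continuous f) (hg : Continuous g) : Continuous fun x => bil (f x) (g x) := by
  simp only [bil_apply]; fun_prop

/-! ### Lattices -/

section Lattice
variable (L : Submodule ℤ (QSpace bp bm))

theorem dual_bil_int {L : Submodule ℤ (QSpace bp bm)} {v w : QSpace bp bm}
    (hv : v ∈ dualLat L) (hw : w ∈ L) : ∃ n : ℤ, bil v w = n := by
  obtain ⟨n, hn⟩ := Submodule.mem_one.1 (hv.1 w hw)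
  exact ⟨n, by rw [← hn]; rfl⟩

theorem dual_bil_int' {L : Submodule ℤ (QSpace bp bm)} {v w : QSpace bp bm}
    (hv : v ∈ dualLat L) (hw : w ∈ L) : ∃ n : ℤ, bil w v = n := by
  rw [bil_comm]; exact dual_bil_int hv hw

theorem mem_dualLat_iff' {L : Submodule ℤ (QSpace bp bm)} {v : QSpace bp bm} :
    v ∈ dualLat L ↔ (∀ w ∈ L, ∃ n : ℤ, bil v w = n) ∧
      v ∈ Submodule.span ℝ (L : Set (QSpace bp bm)) := by
  refine ⟨fun h => ⟨fun w hw => dual_bil_int h hw, h.2⟩, fun h => ⟨fun w hw => ?_, h.2⟩⟩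
  obtain ⟨n, hn⟩ := h.1 w hw
  exact Submodule.mem_one.2 ⟨n, by rw [hn]; rfl⟩

theorem even_bil_int {L : Submodule ℤ (QSpace bp bm)} (hL : IsEven L) {v w : QSpace bp bm}
    (hv : v ∈ L) (hw : w ∈ L) : ∃ n : ℤ, bil v w = n := by
  obtain ⟨a, ha⟩ := hL _ (L.add_mem hv hw)
  obtain ⟨b, hb⟩ := hL _ hv
  obtain ⟨c, hc⟩ := hL _ hw
  refine ⟨a - b - c, ?_⟩
  have := q_add v w
  push_cast
  linarith

theorem le_dualLat {L : Submodule ℤ (QSpace bp bm)} (hL : IsEven L) : L ≤ dualLat L := fun _ hv =>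
  mem_dualLat_iff'.2 ⟨fun _ hw => even_bil_int hL hv hw, Submodule.subset_span hv⟩

variable [DiscreteTopology L] [IsZLattice ℝ L]

theorem dualLat_eq : dualLat L = bil.dualSubmodule L := by
  unfold dualLat
  rw [IsZLattice.span_top]
  simp

theorem mem_dualLat_iff {v : QSpace bp bm} :
    v ∈ dualLat L ↔ ∀ w ∈ L, ∃ n : ℤ, bil v w = n := by
  rw [mem_dualLat_iff', IsZLattice.span_top]; simp

theorem exists_real_basis : ∃ (n : ℕ) (b : Module.Basis (Fin n) ℝ (QSpace bp bm)),
    L = Submodule.span ℤ (Set.range b) := by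
  have := ZLattice.module_free ℝ L
  have := ZLattice.module_finite ℝ L
  let b := Module.finBasis ℤ L
  exact ⟨_, b.ofZLatticeBasis ℝ L, (b.ofZLatticeBasis_span ℝ).symm⟩

theorem mem_of_dual_bil {v : QSpace bp bm} (h : ∀ w ∈ dualLat L, ∃ n : ℤ, bil v w = n) :
    v ∈ L := by
  obtain ⟨n, b, hb⟩ := exists_real_basis L
  have h2 := LinearMap.BilinForm.dualSubmodule_dualSubmodule_of_basis (R := ℤ)
    (bil : LinearMap.BilinForm ℝ (QSpace bp bm)) bil_nondegenerate bil_isSymm b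
  rw [← hb, ← dualLat_eq L] at h2
  rw [← h2]
  intro w hw
  obtain ⟨n, hn⟩ := h w hw
  exact Submodule.mem_one.2 ⟨n, by rw [hn]; rfl⟩

instance dualLat_discrete : DiscreteTopology (dualLat L) := by
  obtain ⟨n, b, hb⟩ := exists_real_basis L
  have := LinearMap.BilinForm.dualSubmodule_span_of_basis (R := ℤ)
    (bil : LinearMap.BilinForm ℝ (QSpace bp bm)) bil_nondegenerate b
  rw [← hb, ← dualLat_eq L] at this
  rw [this]
  infer_instance

theorem disc_finite (hL : IsEven L) : Finite (Disc L) := by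
  have : IsZLattice ℝ (dualLat L) := ⟨by
    rw [eq_top_iff, ← IsZLattice.span_top (K := ℝ) (L := L)]
    exact Submodule.span_mono (le_dualLat hL)⟩
  have := ZLattice.module_free ℝ (dualLat L)
  have := ZLattice.module_finite ℝ (dualLat L)
  have := ZLattice.module_free ℝ L
  have := ZLattice.module_finite ℝ L
  have hr : Module.finrank ℤ (L.submoduleOf (dualLat L)) = Module.finrank ℤ (dualLat L) := by
    rw [(Submodule.submoduleOfEquivOfLe (le_dualLat hL)).finrank_eq, ZLattice.rank ℝ,
      ZLattice.rank ℝ]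
  exact Submodule.finiteQuotientOfFreeOfRankEq _ hr

end Lattice

section Classes
variable {L : Submodule ℤ (QSpace bp bm)}

theorem cls_of_mem {v : QSpace bp bm} (h : v ∈ dualLat L) :
    cls L v = Submodule.Quotient.mk ⟨v, h⟩ := by simp [cls, h]

theorem cls_eq_iff {v w : QSpace bp bm} (hv : v ∈ dualLat L) (hw : w ∈ dualLat L) :
    cls L v = cls L w ↔ v - w ∈ L := by
  rw [cls_of_mem hv, cls_of_mem hw, Submodule.Quotient.eq]; rfl

theorem rep_mem (σ : Disc L) : rep σ ∈ dualLat L := (Quotient.out σ : ↥(dualLat L)).2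

@[simp] theorem cls_rep (σ : Disc L) : cls L (rep σ) = σ := by
  rw [cls_of_mem (rep_mem σ)]; exact Quotient.out_eq σ

theorem cls_add {v w : QSpace bp bm} (hv : v ∈ dualLat L) (hw : w ∈ dualLat L) :
    cls L (v + w) = cls L v + cls L w := by
  rw [cls_of_mem hv, cls_of_mem hw, cls_of_mem (add_mem hv hw)]; rfl

theorem cls_zsmul {v : QSpace bp bm} (n : ℤ) (hv : v ∈ dualLat L) :
    cls L (n • v) = n • cls L v := by
  rw [cls_of_mem hv, cls_of_mem (Submodule.smul_mem _ n hv)]; rfl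

theorem rep_cls_sub {v : QSpace bp bm} (hv : v ∈ dualLat L) : rep (cls L v) - v ∈ L :=
  (cls_eq_iff (rep_mem _) hv).1 (cls_rep _)

theorem rep_sub_mem {v : QSpace bp bm} (hv : v ∈ dualLat L) {σ : Disc L} (h : cls L v = σ) :
    rep σ - v ∈ L := h ▸ rep_cls_sub hv

/-- `e((σ, w))` depends only on the class of `w`. -/
theorem ee_bil_congr {v v' w w' : QSpace bp bm} (hv : v ∈ dualLat L) (hv' : v' ∈ dualLat L)
    (hw : w ∈ dualLat L) (hw' : w' ∈ dualLat L)
    (h : cls L v = cls L v') (h' : cls L w = cls L w') :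
    ee (bil v w : ℝ) = ee (bil v' w' : ℝ) := by
  obtain ⟨a, ha⟩ := dual_bil_int' hw ((cls_eq_iff hv hv').1 h)
  obtain ⟨b, hb⟩ := dual_bil_int hv' ((cls_eq_iff hw hw').1 h')
  refine ee_congr ⟨a + b, ?_⟩
  simp only [map_sub, LinearMap.sub_apply] at ha hb
  push_cast
  linarith

/-- `e(q(v))` depends only on the class of `v`. -/
theorem q_congr (hL : IsEven L) {v v' : QSpace bp bm} (hv' : v' ∈ dualLat L)
    (h : v - v' ∈ L) : ∃ n : ℤ, q v - q v' = n := by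
  obtain ⟨a, ha⟩ := hL _ h
  obtain ⟨b, hb⟩ := dual_bil_int' hv' h
  refine ⟨a + b, ?_⟩
  have := q_add (v - v') v'
  rw [sub_add_cancel] at this
  push_cast
  linarith

open Classical in
theorem sum_ee_bil [DiscreteTopology L] [IsZLattice ℝ L] [Fintype (Disc L)] (σ' : Disc L) :
    ∑ σ : Disc L, ee (bil (rep σ) (rep σ') : ℝ) = if σ' = 0 then (Fintype.card (Disc L) : ℂ) else 0 := by
  have hlin : ∀ (σ τ : Disc L), ee (bil (rep (σ + τ)) (rep σ') : ℝ) =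
      ee (bil (rep σ) (rep σ') : ℝ) * ee (bil (rep τ) (rep σ') : ℝ) := fun σ τ => by
    rw [← ee_add, ← Complex.ofReal_add, ← LinearMap.add_apply, ← map_add]
    refine ee_bil_congr (rep_mem _) (add_mem (rep_mem _) (rep_mem _)) (rep_mem _) (rep_mem _)
      ?_ rfl
    rw [cls_add (rep_mem _) (rep_mem _)]; simp
  split_ifs with h
  · subst h
    have h0 : rep (0 : Disc L) ∈ L := by
      have := rep_sub_mem (L := L) (v := 0) (zero_mem _) (σ := 0) (by rw [cls_of_mem (zero_mem _)]; rfl)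
      simpa using this
    have : ∀ σ : Disc L, ee (bil (rep σ) (rep (0 : Disc L)) : ℝ) = 1 := fun σ =>
      (ee_eq_one_iff _).2 (dual_bil_int (rep_mem σ) h0)
    simp [this]
  · obtain ⟨τ, hτ⟩ : ∃ τ : Disc L, ee (bil (rep τ) (rep σ') : ℝ) ≠ 1 := by
      by_contra! hc
      apply h
      have : rep σ' ∈ L := mem_of_dual_bil L fun w hw => by
        have h1 := hc (cls L w)
        rw [ee_bil_congr (rep_mem _) hw (rep_mem _) (rep_mem _) (cls_rep _) rfl,
          ee_eq_one_iff] at h1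
        rwa [bil_comm] at h1
      rw [← cls_rep σ', cls_of_mem (rep_mem _)]
      exact (Submodule.Quotient.mk_eq_zero _).2 this
    have h1 : ∑ σ : Disc L, ee (bil (rep σ) (rep σ') : ℝ) =
        ∑ σ : Disc L, ee (bil (rep (σ + τ)) (rep σ') : ℝ) :=
      (Equiv.sum_comp (Equiv.addRight τ) _).symm
    simp_rw [hlin, ← Finset.sum_mul] at h1
    by_contra h2
    exact hτ ((mul_eq_left₀ h2).1 h1.symm)

theorem exists_smul_mem [DiscreteTopology L] [IsZLattice ℝ L] (hL : IsEven L) :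
    ∃ d : ℕ, 0 < d ∧ ∀ v ∈ dualLat L, (d : ℤ) • v ∈ L := by
  have := disc_finite L hL
  refine ⟨Nat.card (Disc L), Nat.card_pos, fun v hv => ?_⟩
  have h : (Nat.card (Disc L) : ℕ) • (cls L v) = 0 := card_nsmul_eq_zero'
  rw [← natCast_zsmul, ← cls_zsmul _ hv] at h
  have h0 : cls L (0 : QSpace bp bm) = 0 := by rw [cls_of_mem (zero_mem _)]; rfl
  rw [← h0, cls_eq_iff (Submodule.smul_mem _ _ hv) (zero_mem _), sub_zero] at h
  exact h

end Classes

end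

section

/-! ### Splitting off a hyperbolic plane -/

/-- The lattice `L` contains a hyperbolic plane spanned by `u` and `u'`, with orthogonal
complement `K`, and `η ∈ L'` is a vector of positive norm orthogonal to `u`. -/
structure Splitting (L K : Submodule ℤ (QSpace bp bm)) (u u' η : QSpace bp bm) : Prop where
  even : IsEven L
  u_mem : u ∈ L
  u'_mem : u' ∈ L
  q_u : q u = 0
  bil_uu' : bil u u' = 1
  K_eq : K = orthIn (orthIn L u) u'
  η_mem : η ∈ dualLat L
  η_u : bil η u = 0
  η_pos : 0 < q η

/-- The component `η - (η, u') u` of `η` in `K'`. -/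
def etaK (u u' η : QSpace bp bm) : QSpace bp bm := η - bil η u' • u

namespace Splitting
variable {L K : Submodule ℤ (QSpace bp bm)} {u u' η : QSpace bp bm}

section
variable (H : Splitting L K u u' η)
include H

theorem bil_uu : bil u u = 0 := by rw [bil_self, H.q_u, mul_zero]

theorem bil_u'u : bil u' u = 1 := by rw [bil_comm, H.bil_uu']

theorem bil_uη : bil u η = 0 := by rw [bil_comm, H.η_u]

theorem mem_K {v : QSpace bp bm} : v ∈ K ↔ v ∈ L ∧ bil v u = 0 ∧ bil v u' = 0 := by
  rw [H.K_eq, bil_comm v u, bil_comm v u']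
  simp [orthIn, and_assoc]

theorem K_le : K ≤ L := fun _ hv => (H.mem_K.1 hv).1

theorem span_K_orth {x : QSpace bp bm} (hx : x ∈ Submodule.span ℝ (K : Set (QSpace bp bm))) :
    bil x u = 0 ∧ bil x u' = 0 := by
  induction hx using Submodule.span_induction with
  | mem x hx => exact (H.mem_K.1 hx).2
  | zero => simp
  | add x y _ _ hx hy => simp [hx, hy]
  | smul c x _ hx => simp [hx]

/-- The projection of `L` to `K`. -/
theorem proj_mem_K {x : QSpace bp bm} (hx : x ∈ L) :
    x - (bil x u' - bil x u * bil u' u') • u - bil x u • u' ∈ K := by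
  obtain ⟨a, ha⟩ := even_bil_int H.even hx H.u'_mem
  obtain ⟨b, hb⟩ := even_bil_int H.even hx H.u_mem
  obtain ⟨c, hc⟩ := even_bil_int H.even H.u'_mem H.u'_mem
  refine H.mem_K.2 ⟨?_, ?_, ?_⟩
  · have h1 : (bil x u' - bil x u * bil u' u') • u = (a - b * c : ℤ) • u := by
      rw [ha, hb, hc, ← Int.cast_smul_eq_zsmul ℝ]; push_cast; rfl
    have h2 : bil x u • u' = (b : ℤ) • u' := by rw [hb, ← Int.cast_smul_eq_zsmul ℝ]
    rw [h1, h2]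
    exact L.sub_mem (L.sub_mem hx (L.smul_mem _ H.u_mem)) (L.smul_mem _ H.u'_mem)
  · simp [H.bil_uu, H.bil_u'u]
  · simp [H.bil_uu']

theorem dualK_orth {v : QSpace bp bm} (hv : v ∈ dualLat K) : bil v u = 0 ∧ bil v u' = 0 :=
  H.span_K_orth hv.2

theorem mem_dualLat_of_mem_dualK [DiscreteTopology L] [IsZLattice ℝ L]
    {v : QSpace bp bm} (hv : v ∈ dualLat K) : v ∈ dualLat L := by
  rw [mem_dualLat_iff]
  intro w hw
  obtain ⟨n, hn⟩ := dual_bil_int hv (H.proj_mem_K hw)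
  refine ⟨n, ?_⟩
  rw [← hn]
  simp [H.dualK_orth hv]

theorem span_K_iff [DiscreteTopology L] [IsZLattice ℝ L] {x : QSpace bp bm} :
    x ∈ Submodule.span ℝ (K : Set (QSpace bp bm)) ↔ bil x u = 0 ∧ bil x u' = 0 := by
  refine ⟨H.span_K_orth, fun ⟨h1, h2⟩ => ?_⟩
  have key : ∀ y : QSpace bp bm,
      y - (bil y u' - bil y u * bil u' u') • u - bil y u • u' ∈
        Submodule.span ℝ (K : Set (QSpace bp bm)) := by
    intro y
    have hy : y ∈ Submodule.span ℝ (L : Set (QSpace bp bm)) := by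
      rw [IsZLattice.span_top]; trivial
    induction hy using Submodule.span_induction with
    | mem x hx => exact Submodule.subset_span (H.proj_mem_K hx)
    | zero => simp
    | add x y _ _ hx hy =>
      convert Submodule.add_mem _ hx hy using 1
      simp only [map_add, LinearMap.add_apply]; module
    | smul c x _ hx =>
      convert Submodule.smul_mem _ c hx using 1
      simp only [map_smul, LinearMap.smul_apply, smul_eq_mul]; module
  have := key x
  simpa [h1, h2] using this

theorem sub_mem_dualK [DiscreteTopology L] [IsZLattice ℝ L]
    {v : QSpace bp bm} (hv : v ∈ dualLat L) (h : bil v u = 0) :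
    v - bil v u' • u ∈ dualLat K := by
  refine mem_dualLat_iff'.2 ⟨fun w hw => ?_, H.span_K_iff.2 ?_⟩
  · obtain ⟨hw1, hw2, -⟩ := H.mem_K.1 hw
    obtain ⟨n, hn⟩ := dual_bil_int hv hw1
    exact ⟨n, by simp [hn, bil_comm u w, hw2]⟩
  · simp [h, H.bil_uu, H.bil_uu']

theorem bil_u'_int {v : QSpace bp bm} (hv : v ∈ dualLat L) : ∃ n : ℤ, bil v u' = n :=
  dual_bil_int hv H.u'_mem

theorem etaK_mem [DiscreteTopology L] [IsZLattice ℝ L] : etaK u u' η ∈ dualLat K :=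
  H.sub_mem_dualK H.η_mem H.η_u

theorem η_sub_etaK_mem : η - etaK u u' η ∈ L := by
  obtain ⟨n, hn⟩ := H.bil_u'_int H.η_mem
  have : η - etaK u u' η = n • u := by
    rw [etaK, hn, ← Int.cast_smul_eq_zsmul ℝ]; module
  rw [this]; exact L.smul_mem _ H.u_mem

theorem bil_etaK {v : QSpace bp bm} (hv : bil v u = 0) : bil v (etaK u u' η) = bil v η := by
  simp [etaK, hv]

theorem bil_etaK_self : bil (etaK u u' η) (etaK u u' η) = bil η η := by
  simp [etaK, H.η_u, H.bil_uu, H.bil_uη]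

theorem q_etaK : q (etaK u u' η) = q η := by
  simp only [q, H.bil_etaK_self]

theorem bil_etaK_u : bil (etaK u u' η) u = 0 := by
  simp [etaK, H.η_u, H.bil_uu]

theorem bil_etaK_u' : bil (etaK u u' η) u' = 0 := by
  simp [etaK, H.bil_uu']

theorem etaK_η : bil (etaK u u' η) η = bil η η := by
  rw [← H.bil_etaK H.bil_etaK_u, H.bil_etaK_self]

theorem bil_ηη_pos : 0 < bil η η := by rw [bil_self]; linarith [H.η_pos]

theorem exists_smul_dualK_mem [DiscreteTopology L] [IsZLattice ℝ L] :
    ∃ d : ℕ, 0 < d ∧ ∀ v ∈ dualLat K, (d : ℤ) • v ∈ K := by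
  obtain ⟨d, hd, h⟩ := exists_smul_mem H.even
  refine ⟨d, hd, fun v hv => H.mem_K.2 ⟨h v (H.mem_dualLat_of_mem_dualK hv), ?_, ?_⟩⟩ <;>
  rw [bil_zsmul_left] <;> simp [H.dualK_orth hv]

theorem orthIn_mem {v : QSpace bp bm} : v ∈ orthIn K η ↔ v ∈ K ∧ bil v η = 0 := by
  rw [bil_comm]; simp [orthIn]

theorem span_orthIn {x : QSpace bp bm}
    (hx : x ∈ Submodule.span ℝ (orthIn K η : Set (QSpace bp bm))) :
    bil x u = 0 ∧ bil x u' = 0 ∧ bil x η = 0 := by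
  induction hx using Submodule.span_induction with
  | mem x hx => exact ⟨(H.mem_K.1 (H.orthIn_mem.1 hx).1).2.1, (H.mem_K.1 (H.orthIn_mem.1 hx).1).2.2,
      (H.orthIn_mem.1 hx).2⟩
  | zero => simp
  | add x y _ _ hx hy => simp [hx, hy]
  | smul c x _ hx => simp [hx]

theorem projEta_mem [DiscreteTopology L] [IsZLattice ℝ L] {κ : QSpace bp bm}
    (hκ : κ ∈ dualLat K) : projEta u u' η κ ∈ dualLat (orthIn K η) := by
  have hpe : ∀ x, projEta u u' η x = x - (bil x η / bil η η) • etaK u u' η := fun x => rfl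
  refine mem_dualLat_iff'.2 ⟨fun w hw => ?_, ?_⟩
  · obtain ⟨hwK, hwη⟩ := H.orthIn_mem.1 hw
    obtain ⟨n, hn⟩ := dual_bil_int hκ hwK
    refine ⟨n, ?_⟩
    rw [hpe]
    simp only [map_sub, map_smul, LinearMap.sub_apply, LinearMap.smul_apply, smul_eq_mul, hn]
    rw [bil_comm (etaK u u' η) w, H.bil_etaK (H.mem_K.1 hwK).2.1, hwη]; simp
  · obtain ⟨d, hd, hdK⟩ := H.exists_smul_dualK_mem
    have hdη := hdK _ H.etaK_mem
    have hne : bil η η ≠ 0 := H.bil_ηη_pos.ne'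
    have hd0 : (d : ℝ) ≠ 0 := by positivity
    have main : ∀ x ∈ K, projEta u u' η x ∈
        Submodule.span ℝ (orthIn K η : Set (QSpace bp bm)) := by
      intro x hx
      obtain ⟨e, he⟩ := even_bil_int H.even (H.K_le hdη) (H.K_le hdη)
      obtain ⟨f, hf⟩ := even_bil_int H.even (H.K_le hx) (H.K_le hdη)
      have hxu := (H.mem_K.1 hx).2.1
      have he' : (e : ℝ) = d ^ 2 * bil η η := by
        rw [← he, bil_zsmul_left, bil_comm, bil_zsmul_left, H.bil_etaK_self]; push_cast; ring
      have hf' : (f : ℝ) = d * bil x η := by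
        rw [← hf, bil_comm, bil_zsmul_left, bil_comm, H.bil_etaK hxu]; push_cast; ring
      have hmem : e • x - f • ((d : ℤ) • etaK u u' η) ∈ orthIn K η := by
        refine H.orthIn_mem.2 ⟨K.sub_mem (K.smul_mem _ hx) (K.smul_mem _ hdη), ?_⟩
        simp only [map_sub, LinearMap.sub_apply, bil_zsmul_left, H.etaK_η, he', hf']
        push_cast; ring
      have : projEta u u' η x = (1 / (d ^ 2 * bil η η)) •
          (e • x - f • ((d : ℤ) • etaK u u' η)) := by
        rw [hpe, ← Int.cast_smul_eq_zsmul ℝ e, ← Int.cast_smul_eq_zsmul ℝ f,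
          ← Int.cast_smul_eq_zsmul ℝ (d : ℤ), he', hf', smul_sub, smul_smul, smul_smul, smul_smul]
        congr 1
        · field_simp; simp
        · push_cast; congr 1; field_simp
      rw [this]
      exact Submodule.smul_mem _ _ (Submodule.subset_span hmem)
    have : ∀ x ∈ Submodule.span ℝ (K : Set (QSpace bp bm)), projEta u u' η x ∈
        Submodule.span ℝ (orthIn K η : Set (QSpace bp bm)) := by
      intro x hx
      induction hx using Submodule.span_induction with
      | mem x hx => exact main x hx
      | zero => simp [hpe]
      | add x y _ _ hx hy =>
        convert Submodule.add_mem _ hx hy using 1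
        simp only [hpe, map_add, LinearMap.add_apply]; module
      | smul c x _ hx =>
        convert Submodule.smul_mem _ c hx using 1
        simp only [hpe, map_smul, LinearMap.smul_apply, smul_eq_mul, mul_div_assoc]; module
    exact this _ hκ.2

end
end Splitting

/-! ### Positive and negative parts in coordinates -/

theorem inner_sub_proj {E : Type*} [NormedAddCommGroup E] [InnerProductSpace ℝ E] (x w : E) :
    inner ℝ (x - (inner ℝ x w / ‖w‖ ^ 2) • w) w = 0 := by
  rcases eq_or_ne w 0 with rfl | h
  · simp
  · have : ‖w‖ ^ 2 ≠ 0 := by positivity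
    rw [inner_sub_left, inner_smul_left, real_inner_self_eq_norm_sq]
    simp; field_simp; simp

section Isom
variable {g : QSpace bp bm ≃ₗ[ℝ] QSpace bp bm} (hg : IsIsom g)
include hg

theorem bil_posPart (x y : QSpace bp bm) : bil x (posPart g y) = inner ℝ (g x).1 (g y).1 := by
  rw [← hg]; simp [posPart, bil_apply]

theorem bil_negPart (x y : QSpace bp bm) : bil x (negPart g y) = -inner ℝ (g x).2 (g y).2 := by
  rw [← hg]; simp [negPart, bil_apply]

theorem bil_posPart_self (y : QSpace bp bm) :
    bil (posPart g y) (posPart g y) = ‖(g y).1‖ ^ 2 := by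
  rw [bil_posPart hg, posPart, LinearEquiv.apply_symm_apply]; simp

theorem bil_negPart_self (y : QSpace bp bm) :
    bil (negPart g y) (negPart g y) = -‖(g y).2‖ ^ 2 := by
  rw [bil_negPart hg, negPart, LinearEquiv.apply_symm_apply]; simp

theorem q_isom (x : QSpace bp bm) : q x = (‖(g x).1‖ ^ 2 - ‖(g x).2‖ ^ 2) / 2 := by
  rw [q, ← hg, bil_apply]; simp

theorem q_posPart (x : QSpace bp bm) : q (posPart g x) = ‖(g x).1‖ ^ 2 / 2 := by
  rw [q, bil_posPart_self hg]

theorem q_negPart (x : QSpace bp bm) : q (negPart g x) = -(‖(g x).2‖ ^ 2 / 2) := by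
  rw [q, bil_negPart_self hg]; ring

theorem g_wPos (u x : QSpace bp bm) : g (wPos g u x) =
    ((g x).1 - (inner ℝ (g x).1 (g u).1 / ‖(g u).1‖ ^ 2) • (g u).1, 0) := by
  rw [wPos, map_sub, map_smul, bil_posPart hg, bil_posPart_self hg]
  simp [posPart]

theorem g_wNeg (u x : QSpace bp bm) : g (wNeg g u x) =
    (0, (g x).2 - (inner ℝ (g x).2 (g u).2 / ‖(g u).2‖ ^ 2) • (g u).2) := by
  rw [wNeg, map_sub, map_smul, bil_negPart hg, bil_negPart_self hg, neg_div_neg_eq]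
  simp [negPart]

theorem gSub_eq (u x : QSpace bp bm) : gSub g u x =
    ((g x).1 - (inner ℝ (g x).1 (g u).1 / ‖(g u).1‖ ^ 2) • (g u).1,
      (g x).2 - (inner ℝ (g x).2 (g u).2 / ‖(g u).2‖ ^ 2) • (g u).2) := by
  rw [gSub, map_add, g_wPos hg, g_wNeg hg]; simp

theorem gSub_add (u x y : QSpace bp bm) : gSub g u (x + y) = gSub g u x + gSub g u y := by
  simp only [gSub_eq hg, map_add, Prod.fst_add, Prod.snd_add, inner_add_left, add_div]
  ext1 <;> simp only [Prod.fst_add, Prod.snd_add] <;> module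

theorem gSub_smul (u : QSpace bp bm) (c : ℝ) (x : QSpace bp bm) :
    gSub g u (c • x) = c • gSub g u x := by
  simp only [gSub_eq hg, map_smul, Prod.smul_fst, Prod.smul_snd, real_inner_smul_left,
    mul_div_assoc]
  ext1 <;> simp only [Prod.smul_fst, Prod.smul_snd] <;> module

theorem gSub_fst_orth (u x : QSpace bp bm) : inner ℝ (gSub g u x).1 (g u).1 = 0 := by
  rw [gSub_eq hg]; exact inner_sub_proj _ _

theorem gSub_snd_orth (u x : QSpace bp bm) : inner ℝ (gSub g u x).2 (g u).2 = 0 := by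
  rw [gSub_eq hg]; exact inner_sub_proj _ _

theorem g_wPos' (u x : QSpace bp bm) : g (wPos g u x) = ((gSub g u x).1, 0) := by
  rw [g_wPos hg, gSub_eq hg]

theorem g_wNeg' (u x : QSpace bp bm) : g (wNeg g u x) = (0, (gSub g u x).2) := by
  rw [g_wNeg hg, gSub_eq hg]

theorem q_wPos (u x : QSpace bp bm) : q (wPos g u x) = ‖(gSub g u x).1‖ ^ 2 / 2 := by
  rw [q_isom hg, g_wPos' hg]; simp

theorem q_wNeg (u x : QSpace bp bm) : q (wNeg g u x) = -(‖(gSub g u x).2‖ ^ 2 / 2) := by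
  rw [q_isom hg, g_wNeg' hg]; simp; ring

theorem bil_wPos (u x y : QSpace bp bm) :
    bil x (wPos g u y) = inner ℝ (gSub g u x).1 (gSub g u y).1 := by
  rw [← hg, g_wPos' hg, bil_apply]
  simp only [inner_zero_right, sub_zero]
  have : (g x).1 = (gSub g u x).1 + (inner ℝ (g x).1 (g u).1 / ‖(g u).1‖ ^ 2) • (g u).1 := by
    rw [gSub_eq hg]; simp
  rw [this, inner_add_left, inner_smul_left, real_inner_comm (gSub g u y).1 (g u).1,
    gSub_fst_orth hg]
  simp

theorem bil_wNeg (u x y : QSpace bp bm) :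
    bil x (wNeg g u y) = -inner ℝ (gSub g u x).2 (gSub g u y).2 := by
  rw [← hg, g_wNeg' hg, bil_apply]
  simp only [inner_zero_right, zero_sub, neg_inj]
  have : (g x).2 = (gSub g u x).2 + (inner ℝ (g x).2 (g u).2 / ‖(g u).2‖ ^ 2) • (g u).2 := by
    rw [gSub_eq hg]; simp
  rw [this, inner_add_left, inner_smul_left, real_inner_comm (gSub g u y).2 (g u).2,
    gSub_snd_orth hg]
  simp

end Isom

namespace Splitting
variable {L K : Submodule ℤ (QSpace bp bm)} {u u' η : QSpace bp bm}
  {g : QSpace bp bm ≃ₗ[ℝ] QSpace bp bm}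

section
variable (H : Splitting L K u u' η) (hg : IsIsom g)
include H hg

theorem norm_eq : ‖(g u).2‖ = ‖(g u).1‖ := by
  have := q_isom hg u
  rw [H.q_u] at this
  have h : ‖(g u).2‖ ^ 2 = ‖(g u).1‖ ^ 2 := by linarith
  exact (pow_left_inj₀ (norm_nonneg _) (norm_nonneg _) two_ne_zero).1 h

theorem norm_pos : 0 < ‖(g u).1‖ := by
  rw [norm_pos_iff]
  intro h
  have h2 : (g u).2 = 0 := by rw [← norm_eq_zero, H.norm_eq hg, h, norm_zero]
  have : g u = 0 := Prod.ext h h2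
  have hu : u = 0 := g.map_eq_zero_iff.1 this
  have := H.bil_uu'
  rw [hu] at this; simp at this

theorem inner_eq {x : QSpace bp bm} (hx : bil x u = 0) :
    inner ℝ (g x).2 (g u).2 = inner ℝ (g x).1 (g u).1 := by
  have := hg x u
  rw [hx, bil_apply] at this; linarith

/-- The vectors orthogonal to `u`, in the coordinates adapted to `u`. -/
theorem g_add_smul {x : QSpace bp bm} (hx : bil x u = 0) (β : ℝ) :
    g (x + β • u) = gSub g u x +
      (bil x (posPart g u) / bil (posPart g u) (posPart g u) + β) • g u := by
  rw [gSub_eq hg, map_add, map_smul, bil_posPart hg, bil_posPart_self hg, H.inner_eq hg hx,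
    H.norm_eq hg]
  ext1 <;> simp only [Prod.fst_add, Prod.snd_add, Prod.smul_fst, Prod.smul_snd] <;> module

theorem gSub_u : gSub g u u = 0 := by
  have h := H.norm_pos hg
  rw [gSub_eq hg, real_inner_self_eq_norm_sq, real_inner_self_eq_norm_sq, H.norm_eq hg,
    div_self (by positivity)]
  simp

theorem gSub_etaK : gSub g u (etaK u u' η) = gSub g u η := by
  have : η = etaK u u' η + bil η u' • u := by rw [etaK]; module
  conv_rhs => rw [this]
  rw [gSub_add hg, gSub_smul hg, H.gSub_u hg]; simp

theorem q_eq_gSub {x : QSpace bp bm} (hx : bil x u = 0) :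
    q x = (‖(gSub g u x).1‖ ^ 2 - ‖(gSub g u x).2‖ ^ 2) / 2 := by
  have h0 := H.g_add_smul hg hx 0
  rw [zero_smul, add_zero] at h0
  rw [q_isom hg, h0]
  simp only [Prod.fst_add, Prod.snd_add, Prod.smul_fst, Prod.smul_snd, norm_add_sq_real,
    inner_smul_right, gSub_fst_orth hg, gSub_snd_orth hg, norm_smul, H.norm_eq hg]
  ring

theorem eq_zero_of_gSub {x : QSpace bp bm} (h1 : bil x u = 0) (h2 : bil x u' = 0)
    (h : gSub g u x = 0) : x = 0 := by
  have h0 := H.g_add_smul hg h1 0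
  rw [h, zero_add, zero_smul, add_zero, add_zero, ← map_smul] at h0
  have hx := g.injective h0
  have := h2
  rw [hx, bil_smul_left, H.bil_uu', mul_one] at this
  rw [this, zero_smul] at hx
  exact hx

theorem exists_norm_le_gSub : ∃ C : ℝ, 0 < C ∧ ∀ x : QSpace bp bm, bil x u = 0 → bil x u' = 0 →
    C * ‖x‖ ≤ ‖gSub g u x‖ := by
  let f : QSpace bp bm →ₗ[ℝ] QSpace bp bm :=
    { toFun := gSub g u, map_add' := gSub_add hg u, map_smul' := gSub_smul hg u }
  let W : Submodule ℝ (QSpace bp bm) := LinearMap.ker (bil u) ⊓ LinearMap.ker (bil u')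
  have hW : ∀ x : QSpace bp bm, x ∈ W ↔ bil x u = 0 ∧ bil x u' = 0 := fun x => by
    simp [W, bil_comm x]
  have hinj : LinearMap.ker (f.domRestrict W) = ⊥ := by
    rw [eq_bot_iff]
    rintro ⟨x, hx⟩ hfx
    have := H.eq_zero_of_gSub hg ((hW x).1 hx).1 ((hW x).1 hx).2 (by simpa [f] using hfx)
    simp [this]
  obtain ⟨C, hC, h⟩ := LinearMap.exists_antilipschitzWith _ hinj
  refine ⟨(C : ℝ)⁻¹, by positivity, fun x h1 h2 => ?_⟩
  have := h.le_mul_dist ⟨x, (hW x).2 ⟨h1, h2⟩⟩ 0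
  simp only [dist_zero_right, map_zero] at this
  rw [inv_mul_le_iff₀ (by positivity)]
  exact this

end
end Splitting

end

section

/-! ### Hermite polynomials and their Gaussian integrals -/

/-- The Hermite polynomials of variance `c`, `exp(-(c / 2) d² / dx²) x^n`. -/
def herm (c : ℂ) : ℕ → Polynomial ℂ
  | 0 => 1
  | 1 => Polynomial.X
  | n + 2 => Polynomial.X * herm c (n + 1) - Polynomial.C (c * (n + 1)) * herm c n

theorem herm_succ (c : ℂ) (n : ℕ) :
    herm c (n + 1) = Polynomial.X * herm c n - Polynomial.C (c * n) * herm c (n - 1) := by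
  cases n with
  | zero => simp [herm]
  | succ n => rw [herm]; simp

theorem derivative_herm (c : ℂ) (n : ℕ) :
    Polynomial.derivative (herm c n) = Polynomial.C (n : ℂ) * herm c (n - 1) := by
  induction n using Nat.strong_induction_on with
  | _ n ih =>
    match n with
    | 0 => simp [herm]
    | 1 => simp [herm]
    | n + 2 =>
      rw [herm, Polynomial.derivative_sub, Polynomial.derivative_mul, Polynomial.derivative_mul,
        ih (n + 1) (by omega), ih n (by omega)]
      have h := herm_succ c n
      simp only [Nat.add_sub_cancel, Polynomial.derivative_X, Polynomial.derivative_C,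
        show n + 2 - 1 = n + 1 from rfl]
      rw [h]
      simp only [map_mul, map_natCast, Nat.cast_add, Nat.cast_one, map_add, map_one]
      push_cast
      ring

theorem herm_zero (n : ℕ) : herm 0 n = Polynomial.X ^ n := by
  induction n with
  | zero => simp [herm]
  | succ n ih => rw [herm_succ, ih]; simp [pow_succ']

theorem integrable_polynomial_mul_gauss (p : Polynomial ℂ) {b : ℂ} (hb : 0 < b.re) (ξ : ℝ) :
    Integrable fun x : ℝ => p.eval (x : ℂ) * Complex.exp (-b * x ^ 2 + (ξ * I) * x) := by
  induction p using Polynomial.induction_on' with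
  | add p q hp hq =>
    exact (hp.add hq).congr (ae_of_all _ fun x => by simp [add_mul])
  | monomial n a =>
    suffices h : Integrable fun x : ℝ => (x : ℂ) ^ n *
        Complex.exp (-b * x ^ 2 + (ξ * I) * x) from
      (h.const_mul a).congr (ae_of_all _ fun x => by simp [mul_assoc])
    have h := integrable_rpow_mul_exp_neg_mul_sq hb (s := (n : ℝ)) (by
      have : (0 : ℝ) ≤ n := Nat.cast_nonneg n
      linarith)
    refine h.norm.mono (by fun_prop) (.of_forall fun x => le_of_eq ?_)
    rw [norm_norm, norm_mul, norm_mul, Complex.norm_exp, Real.norm_eq_abs (exp _),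
      Real.abs_exp, Real.rpow_natCast, norm_pow, norm_pow, Complex.norm_real]
    congr 2
    have : (-b * (x : ℂ) ^ 2 + (ξ * I) * x) =
      ((-x ^ 2 : ℝ) : ℂ) * b + ((ξ * x : ℝ) : ℂ) * I := by push_cast; ring
    rw [this, Complex.add_re, Complex.re_ofReal_mul, Complex.re_ofReal_mul]
    simp; ring

theorem integrable_herm_gauss (p : Polynomial ℂ) {τ : ℂ} (hτ : 0 < τ.im) (ξ : ℝ) :
    Integrable fun x : ℝ => p.eval (x : ℂ) *
      Complex.exp (π * I * τ * x ^ 2 - 2 * π * I * ξ * x) := by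
  have := integrable_polynomial_mul_gauss p (b := -(π * I * τ)) (by
    simpa using mul_pos Real.pi_pos hτ) (-(2 * π * ξ))
  convert this using 4
  push_cast; ring

/-- The Fourier transform of a Hermite polynomial times a Gaussian. -/
theorem integral_herm_gauss (c : ℂ) {τ : ℂ} (hτ : 0 < τ.im) (ξ : ℝ) (n : ℕ) :
    τ ^ n * ∫ x : ℝ, (herm c n).eval (x : ℂ) *
      Complex.exp (π * I * τ * x ^ 2 - 2 * π * I * ξ * x) =
    (herm (c * τ ^ 2 - I * τ / (2 * π)) n).eval (ξ : ℂ) *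
      (1 / (-I * τ) ^ (1 / 2 : ℂ) * Complex.exp (-(π * I * ξ ^ 2 / τ))) := by
  have hτ0 : τ ≠ 0 := by rintro rfl; simp at hτ
  have hpi : (π : ℂ) ≠ 0 := by exact_mod_cast Real.pi_ne_zero
  set G : ℝ → ℂ := fun x =>
    Complex.exp (π * I * τ * x ^ 2 - 2 * π * I * ξ * x) with hG
  have hint : ∀ p : Polynomial ℂ, Integrable fun x : ℝ => p.eval (x : ℂ) * G x := fun p =>
    integrable_herm_gauss p hτ ξ
  have hX : ∀ n : ℕ, τ * ∫ x : ℝ, (Polynomial.X * herm c n).eval (x : ℂ) * G x =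
      ξ * (∫ x : ℝ, (herm c n).eval (x : ℂ) * G x) -
        n / (2 * π * I) * ∫ x : ℝ, (herm c (n - 1)).eval (x : ℂ) * G x := by
    intro n
    have hd : ∀ x : ℝ, HasDerivAt (fun x : ℝ => (herm c n).eval (x : ℂ) * G x)
        (n * ((herm c (n - 1)).eval (x : ℂ) * G x) + (2 * π * I * τ) *
          ((Polynomial.X * herm c n).eval (x : ℂ) * G x) -
          (2 * π * I * ξ) * ((herm c n).eval (x : ℂ) * G x)) x := by
      intro x
      have h1 : HasDerivAt (fun x : ℝ => (herm c n).eval (x : ℂ))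
          ((Polynomial.derivative (herm c n)).eval (x : ℂ)) x :=
        ((herm c n).hasDerivAt (x : ℂ)).comp_ofReal
      have h2 : HasDerivAt G (G x * (π * I * τ * (2 * x) -
          2 * π * I * ξ)) x := by
        have : HasDerivAt (fun z : ℂ => π * I * τ * z ^ 2 -
            2 * π * I * ξ * z) (π * I * τ * (2 * x) -
            2 * π * I * ξ) (x : ℂ) := by
          have ha := ((hasDerivAt_id (x : ℂ)).pow 2).const_mul (π * I * τ)
          have hb := (hasDerivAt_id (x : ℂ)).const_mul (2 * π * I * ξ)
          refine (ha.sub hb).congr_deriv ?_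
          simp
        exact (this.cexp).comp_ofReal
      refine (h1.mul h2).congr_deriv ?_
      rw [derivative_herm]
      simp only [Polynomial.eval_mul, Polynomial.eval_C, Polynomial.eval_X]
      ring
    have hA := (hint (herm c (n - 1))).const_mul (n : ℂ)
    have hB := (hint (Polynomial.X * herm c n)).const_mul (2 * π * I * τ)
    have hC := (hint (herm c n)).const_mul (2 * π * I * ξ)
    have hAB := hA.add hB
    have h0 := integral_eq_zero_of_hasDerivAt_of_integrable hd (hAB.sub hC) (hint _)
    rw [integral_sub (by exact hAB) hC, integral_add hA hB, integral_const_mul,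
      integral_const_mul, integral_const_mul] at h0
    have hI := Complex.I_ne_zero
    have h2 : (2 * π * I : ℂ) ≠ 0 := Complex.two_pi_I_ne_zero
    refine mul_left_cancel₀ h2 ?_
    rw [mul_sub, ← mul_assoc _ ((n : ℂ) / _), mul_div_cancel₀ _ h2]
    linear_combination h0
  have hrec : ∀ n : ℕ, τ * ∫ x : ℝ, (herm c (n + 1)).eval (x : ℂ) * G x =
      ξ * (∫ x : ℝ, (herm c n).eval (x : ℂ) * G x) -
        n * (c * τ + 1 / (2 * π * I)) *
          ∫ x : ℝ, (herm c (n - 1)).eval (x : ℂ) * G x := by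
    intro n
    have : ∀ x : ℝ, (herm c (n + 1)).eval (x : ℂ) * G x =
        (Polynomial.X * herm c n).eval (x : ℂ) * G x -
          (c * n) * ((herm c (n - 1)).eval (x : ℂ) * G x) := fun x => by
      rw [herm_succ]
      simp only [Polynomial.eval_sub, Polynomial.eval_mul, Polynomial.eval_C]
      ring
    simp_rw [this]
    rw [integral_sub (hint _) ((hint _).const_mul _), integral_const_mul, mul_sub, hX]
    ring
  have h0 : ∫ x : ℝ, G x =
      1 / (-I * τ) ^ (1 / 2 : ℂ) * Complex.exp (-(π * I * ξ ^ 2 / τ)) := by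
    have hb : (π * I * τ).re < 0 := by
      simpa using mul_pos Real.pi_pos hτ
    have := integral_cexp_quadratic hb (-(2 * π * I * ξ)) 0
    have hG2 : ∀ x : ℝ, G x = Complex.exp (π * I * τ * x ^ 2 +
        -(2 * π * I * ξ) * x + 0) := fun x => by
      show Complex.exp _ = Complex.exp _
      congr 1; ring
    simp_rw [hG2]
    rw [this]
    congr 1
    · have : (π : ℂ) / -(π * I * τ) = (-I * τ)⁻¹ := by
        field_simp
      rw [this, Complex.inv_cpow, one_div ((-I * τ) ^ _)]
      intro h
      have h1 := (Complex.arg_eq_pi_iff.1 h).1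
      simp at h1; linarith
    · congr 1
      rw [zero_sub, neg_inj]
      field_simp
      ring
  have key : ∀ n, (τ ^ n * ∫ x : ℝ, (herm c n).eval (x : ℂ) * G x =
      (herm (c * τ ^ 2 - I * τ / (2 * π)) n).eval (ξ : ℂ) * ∫ x : ℝ, G x) ∧
      (τ ^ (n + 1) * ∫ x : ℝ, (herm c (n + 1)).eval (x : ℂ) * G x =
      (herm (c * τ ^ 2 - I * τ / (2 * π)) (n + 1)).eval (ξ : ℂ) * ∫ x : ℝ, G x) := by
    intro n
    induction n with
    | zero =>
      refine ⟨by simp [herm], ?_⟩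
      have := hrec 0
      simp only [herm, Polynomial.eval_one, one_mul, Nat.cast_zero, zero_mul,
        sub_zero] at this
      simp only [zero_add, pow_one, herm, Polynomial.eval_X] at this ⊢
      rw [this]
    | succ n ih =>
      refine ⟨ih.2, ?_⟩
      have h := hrec (n + 1)
      rw [show n + 1 - 1 = n from rfl] at h
      have hc : τ * (c * τ + 1 / (2 * π * I)) =
          c * τ ^ 2 - I * τ / (2 * π) := by
        have hI : (1 : ℂ) / (2 * π * I) = -I / (2 * π) := by
          rw [div_eq_div_iff Complex.two_pi_I_ne_zero (by simp)]
          ring_nf; rw [Complex.I_sq]; ring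
        rw [hI]; ring
      rw [pow_succ, mul_assoc, h, herm, ← hc]
      simp only [Polynomial.eval_sub, Polynomial.eval_mul, Polynomial.eval_C, Polynomial.eval_X]
      push_cast
      rw [sub_mul]
      have e1 := ih.1
      have e2 := ih.2
      rw [← hc] at e1 e2
      linear_combination (ξ : ℂ) * e2 -
        τ * (c * τ + 1 / (2 * π * I)) * (n + 1) * e1
  rw [(key n).1, h0]

/-! ### The heat operator on polynomials -/

section Heat
open MvPolynomial

theorem pderiv_comm (i j : Fin bp) (p : MvPolynomial (Fin bp) ℂ) :
    pderiv i (pderiv j p) = pderiv j (pderiv i p) := by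
  induction p using MvPolynomial.induction_on with
  | C a => simp
  | add p q hp hq => simp [hp, hq]
  | mul_X p k hp =>
    simp only [Derivation.leibniz, map_add, smul_eq_mul, hp, pderiv_X]
    simp only [Pi.single_apply]
    split_ifs <;> simp <;> ring

/-- The Laplace operator as a linear map. -/
def lap : MvPolynomial (Fin bp) ℂ →ₗ[ℂ] MvPolynomial (Fin bp) ℂ :=
  ∑ i, (pderiv i).toLinearMap ∘ₗ (pderiv i).toLinearMap

theorem lap_apply (p : MvPolynomial (Fin bp) ℂ) : lap p = laplacian p := by
  simp [lap, laplacian]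

theorem laplacian_iterate (p : MvPolynomial (Fin bp) ℂ) (j : ℕ) :
    laplacian^[j] p = (lap ^ j) p := by
  induction j with
  | zero => simp
  | succ j ih => rw [Function.iterate_succ_apply', ih, pow_succ', Module.End.mul_apply, lap_apply]

theorem pderiv_lap (i : Fin bp) (p : MvPolynomial (Fin bp) ℂ) :
    pderiv i (lap p) = lap (pderiv i p) := by
  rw [lap_apply, lap_apply, laplacian, laplacian, map_sum]
  refine Finset.sum_congr rfl fun j _ => ?_
  rw [pderiv_comm i j, pderiv_comm i j]

theorem pderiv_lap_pow (i : Fin bp) (j : ℕ) (p : MvPolynomial (Fin bp) ℂ) :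
    pderiv i ((lap ^ j) p) = (lap ^ j) (pderiv i p) := by
  induction j with
  | zero => simp
  | succ j ih => rw [pow_succ', Module.End.mul_apply, Module.End.mul_apply, pderiv_lap, ih]

theorem lap_X_mul (i : Fin bp) (p : MvPolynomial (Fin bp) ℂ) :
    lap (X i * p) = X i * lap p + 2 * pderiv i p := by
  rw [lap_apply, lap_apply, laplacian, laplacian, Finset.mul_sum,
    ← Finset.add_sum_erase _ _ (Finset.mem_univ i), ← Finset.add_sum_erase _ _ (Finset.mem_univ i)]
  have : ∀ j ∈ Finset.univ.erase i, pderiv j (pderiv j (X i * p)) =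
      X i * pderiv j (pderiv j p) := by
    intro j hj
    have hji : i ≠ j := (Finset.ne_of_mem_erase hj).symm
    simp [Derivation.leibniz, pderiv_X_of_ne hji]
  rw [Finset.sum_congr rfl this]
  simp [Derivation.leibniz]
  ring

theorem lap_pow_X_mul (i : Fin bp) (j : ℕ) (p : MvPolynomial (Fin bp) ℂ) :
    (lap ^ j) (X i * p) = X i * (lap ^ j) p + C (2 * (j : ℂ)) * pderiv i ((lap ^ (j - 1)) p) := by
  induction j with
  | zero => simp
  | succ j ih =>
    rw [pow_succ', Module.End.mul_apply, ih, map_add, lap_X_mul, ← smul_eq_C_mul, map_smul,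
      smul_eq_C_mul, ← pderiv_lap, ← Module.End.mul_apply, ← Module.End.mul_apply, ← pow_succ',
      ← pow_succ']
    cases j with
    | zero => simp; left; rfl
    | succ j =>
      simp only [Nat.add_sub_cancel]
      have : (C (2 * ((j + 1 + 1 : ℕ) : ℂ)) : MvPolynomial (Fin bp) ℂ) =
        C (2 * ((j + 1 : ℕ) : ℂ)) + 2 := by
        rw [← map_ofNat C 2, ← map_add]; congr 1; push_cast; ring
      rw [this]; ring

theorem lap_pow_homogeneous {n : ℕ} {p : MvPolynomial (Fin bp) ℂ} (hp : p.IsHomogeneous n)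
    (j : ℕ) : ((lap ^ j) p).IsHomogeneous (n - 2 * j) ∧ (n < j → (lap ^ j) p = 0) := by
  have hlap : ∀ (n : ℕ) (p : MvPolynomial (Fin bp) ℂ), p.IsHomogeneous n →
      (lap p).IsHomogeneous (n - 2) ∧ (n = 0 → lap p = 0) := by
    intro n p hp
    rw [lap_apply, laplacian]
    refine ⟨IsHomogeneous.sum _ _ _ fun i _ => ?_, ?_⟩
    · have := (hp.pderiv (i := i)).pderiv (i := i)
      rwa [Nat.sub_sub] at this
    · rintro rfl
      obtain ⟨c, rfl⟩ : ∃ c, p = C c := ⟨_, totalDegree_eq_zero_iff_eq_C.1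
        ((totalDegree_zero_iff_isHomogeneous _).2 hp)⟩
      simp
  induction j with
  | zero => simpa using hp
  | succ j ih =>
    rw [pow_succ', Module.End.mul_apply]
    obtain ⟨h1, h2⟩ := hlap _ _ ih.1
    refine ⟨?_, fun h => h2 (by omega)⟩
    rwa [Nat.sub_sub] at h1

theorem lap_pow_eq_zero (p : MvPolynomial (Fin bp) ℂ) {j : ℕ} (hj : p.totalDegree < j) :
    (lap ^ j) p = 0 := by
  conv_lhs => rw [← sum_homogeneousComponent p]
  rw [map_sum]
  refine Finset.sum_eq_zero fun i hi => ?_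
  refine (lap_pow_homogeneous (homogeneousComponent_isHomogeneous i p) j).2 ?_
  have := Finset.mem_range.1 hi
  omega

/-- The operator `exp(-(c / 2) Δ)` on polynomials. -/
def heatOp (c : ℂ) (p : MvPolynomial (Fin bp) ℂ) : MvPolynomial (Fin bp) ℂ :=
  ∑ j ∈ Finset.range (p.totalDegree + 1), C ((-c / 2) ^ j / (j.factorial : ℂ)) * (lap ^ j) p

theorem heatOp_eq_sum (c : ℂ) (p : MvPolynomial (Fin bp) ℂ) {M : ℕ} (hM : p.totalDegree < M) :
    heatOp c p = ∑ j ∈ Finset.range M, C ((-c / 2) ^ j / (j.factorial : ℂ)) * (lap ^ j) p := by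
  refine Finset.sum_subset (fun j hj => Finset.mem_range.2 ?_) fun j _ hj => ?_
  · have := Finset.mem_range.1 hj; omega
  · rw [lap_pow_eq_zero p, mul_zero]
    have := mt Finset.mem_range.2 hj; omega

theorem heat_eq_heatOp (y : ℝ) (p : MvPolynomial (Fin bp) ℂ) :
    heat y p = heatOp ((1 / (4 * π * y) : ℝ) : ℂ) p := by
  rw [heat, heatOp]
  refine Finset.sum_congr rfl fun j _ => ?_
  rw [laplacian_iterate]
  congr 2
  push_cast
  congr 2
  rw [show (8 : ℂ) * π * y = (4 * π * y) * 2 by ring, ← div_div]; ring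

theorem heatOp_add (c : ℂ) (p r : MvPolynomial (Fin bp) ℂ) :
    heatOp c (p + r) = heatOp c p + heatOp c r := by
  set M := p.totalDegree + r.totalDegree + 1
  rw [heatOp_eq_sum c p (M := M) (by omega), heatOp_eq_sum c r (M := M) (by omega),
    heatOp_eq_sum c (p + r) (M := M) (by have := totalDegree_add p r; omega),
    ← Finset.sum_add_distrib]
  simp [mul_add]

theorem heatOp_smul (c a : ℂ) (p : MvPolynomial (Fin bp) ℂ) :
    heatOp c (a • p) = a • heatOp c p := by
  rw [heatOp_eq_sum c (a • p) (M := p.totalDegree + 1)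
    (by have := totalDegree_smul_le a p; omega), heatOp, Finset.smul_sum]
  simp

/-- The heat operator as a linear map. -/
def heatLin (c : ℂ) : MvPolynomial (Fin bp) ℂ →ₗ[ℂ] MvPolynomial (Fin bp) ℂ where
  toFun := heatOp c
  map_add' := heatOp_add c
  map_smul' := heatOp_smul c

theorem heatLin_eq_sum (c : ℂ) (p : MvPolynomial (Fin bp) ℂ) {M : ℕ} (hM : p.totalDegree < M) :
    heatLin c p = ∑ j ∈ Finset.range M, C ((-c / 2) ^ j / (j.factorial : ℂ)) * (lap ^ j) p :=
  heatOp_eq_sum c p hM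

theorem heatLin_of_lap {c : ℂ} {p : MvPolynomial (Fin bp) ℂ} (h : lap p = 0) :
    heatLin c p = p := by
  rw [heatLin_eq_sum c p (Nat.lt_succ_self _), Finset.sum_range_succ']
  simp [pow_succ, h]

theorem pderiv_heatLin (c : ℂ) (i : Fin bp) (p : MvPolynomial (Fin bp) ℂ) :
    pderiv i (heatLin c p) = heatLin c (pderiv i p) := by
  set M := p.totalDegree + (pderiv i p).totalDegree + 1
  rw [heatLin_eq_sum c p (M := M) (by omega), heatLin_eq_sum c (pderiv i p) (M := M) (by omega),
    map_sum]
  refine Finset.sum_congr rfl fun j _ => ?_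
  rw [pderiv_C_mul, pderiv_lap_pow]

theorem heatLin_X_mul (c : ℂ) (i : Fin bp) (p : MvPolynomial (Fin bp) ℂ) :
    heatLin c (X i * p) = X i * heatLin c p - C c * heatLin c (pderiv i p) := by
  set M := p.totalDegree + (X i * p).totalDegree + 1
  rw [← pderiv_heatLin, heatLin_eq_sum c p (M := M) (by omega),
    heatLin_eq_sum c (X i * p) (M := M + 1) (by omega)]
  simp_rw [lap_pow_X_mul, mul_add]
  rw [Finset.sum_add_distrib, Finset.sum_range_succ, lap_pow_eq_zero p (by omega : _ < M),
    Finset.sum_range_succ' _ M, map_sum, Finset.mul_sum, Finset.mul_sum]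
  simp only [mul_zero, add_zero, Nat.cast_zero, map_zero, zero_mul, Nat.add_sub_cancel]
  rw [sub_eq_add_neg, ← Finset.sum_neg_distrib]
  congr 1
  · exact Finset.sum_congr rfl fun j _ => by ring
  · refine Finset.sum_congr rfl fun j _ => ?_
    rw [pderiv_C_mul, ← mul_assoc, ← mul_assoc, ← neg_mul, ← C_mul, ← C_mul, ← C_neg]
    congr 2
    rw [pow_succ, Nat.factorial_succ]
    have : (j.factorial : ℂ) ≠ 0 := by exact_mod_cast j.factorial_ne_zero
    have h2 : ((j : ℂ) + 1) ≠ 0 := by exact_mod_cast j.succ_ne_zero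
    push_cast
    field_simp

theorem eval_heatLin_monomial (c : ℂ) (α : Fin bp →₀ ℕ) (x : Fin bp → ℂ) :
    eval x (heatLin c (monomial α 1)) = ∏ i, (herm c (α i)).eval (x i) := by
  induction hn : α.degree using Nat.strong_induction_on generalizing α with
  | _ n ih =>
    by_cases hα : α = 0
    · subst hα
      have : (monomial (0 : Fin bp →₀ ℕ) (1 : ℂ)) = 1 := rfl
      rw [this, heatLin_of_lap (by rw [lap_apply]; simp [laplacian])]
      simp [herm]
    · obtain ⟨i, hi⟩ : ∃ i, α i ≠ 0 := by
        by_contra! h; exact hα (Finsupp.ext h)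
      obtain ⟨β, rfl⟩ : ∃ β, α = β + Finsupp.single i 1 :=
        ⟨α - Finsupp.single i 1, (tsub_add_cancel_of_le (Finsupp.single_le_iff.2 (by omega))).symm⟩
      have hdeg : (β + Finsupp.single i 1).degree = β.degree + 1 := by
        rw [map_add, Finsupp.degree_single]
      have hmon : (monomial (β + Finsupp.single i 1) (1 : ℂ)) = X i * monomial β 1 := by
        rw [X, monomial_mul, one_mul, add_comm]
      have hpd : pderiv i (monomial β (1 : ℂ)) =
          (β i : ℂ) • monomial (β - Finsupp.single i 1) 1 := by
        rw [pderiv_monomial, smul_monomial]; simp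
      rw [hmon, heatLin_X_mul, hpd, map_smul]
      simp only [eval_sub, eval_mul, eval_X, eval_C, smul_eval]
      rw [ih β.degree (by omega) β rfl]
      have hprod : ∀ γ : Fin bp →₀ ℕ, (∀ j ≠ i, γ j = β j) →
          ∏ j, (herm c (γ j)).eval (x j) = (herm c (γ i)).eval (x i) *
            ∏ j ∈ Finset.univ.erase i, (herm c (β j)).eval (x j) := by
        intro γ hγ
        rw [← Finset.mul_prod_erase _ _ (Finset.mem_univ i)]
        congr 1
        exact Finset.prod_congr rfl fun j hj => by rw [hγ j (Finset.ne_of_mem_erase hj)]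
      have hsucc := congrArg (Polynomial.eval (x i)) (herm_succ c (β i))
      simp only [Polynomial.eval_sub, Polynomial.eval_mul, Polynomial.eval_C, Polynomial.eval_X]
        at hsucc
      rw [hprod (β + Finsupp.single i 1) (fun j hj => by
          simp [Finsupp.single_eq_of_ne hj]), hprod β (fun _ _ => rfl)]
      have hev : (β + Finsupp.single i 1 : Fin bp →₀ ℕ) i = β i + 1 := by simp
      rw [hev, hsucc]
      by_cases hb : β i = 0
      · simp [hb]; ring
      · rw [ih (β - Finsupp.single i 1).degree _ _ rfl, hprod (β - Finsupp.single i 1) (fun j hj => by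
          simp [Finsupp.single_eq_of_ne hj])]
        · have : (β - Finsupp.single i 1 : Fin bp →₀ ℕ) i = β i - 1 := by simp
          rw [this]; ring
        · have h1 : (β - Finsupp.single i 1) + Finsupp.single i 1 = β :=
            tsub_add_cancel_of_le (Finsupp.single_le_iff.2 (by omega))
          have h2 := congrArg Finsupp.degree h1
          rw [map_add, Finsupp.degree_single] at h2
          omega

theorem eval_heatLin (c : ℂ) (p : MvPolynomial (Fin bp) ℂ) (x : Fin bp → ℂ) :
    eval x (heatLin c p) = ∑ α ∈ p.support, coeff α p * ∏ i, (herm c (α i)).eval (x i) := by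
  conv_lhs => rw [p.as_sum]
  rw [map_sum, map_sum]
  refine Finset.sum_congr rfl fun α _ => ?_
  rw [← mul_one (coeff α p), ← smul_eq_mul, ← smul_monomial, map_smul, smul_eval,
    eval_heatLin_monomial]
  simp

end Heat

end

section

/-! ### The expansion of a polynomial in powers of a linear form -/

section Split
open MvPolynomial

/-- The linear form `(x, ω)`. -/
def linForm (ω : EuclideanSpace ℝ (Fin bp)) : MvPolynomial (Fin bp) ℂ :=
  ∑ j, C ((ω j : ℝ) : ℂ) * X j

/-- The derivative in the direction `ω`. -/
def dirDeriv (ω : EuclideanSpace ℝ (Fin bp)) :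
    Derivation ℂ (MvPolynomial (Fin bp) ℂ) (MvPolynomial (Fin bp) ℂ) :=
  mkDerivation ℂ fun j => C ((ω j : ℝ) : ℂ)

theorem dirDeriv_C (ω : EuclideanSpace ℝ (Fin bp)) (c : ℂ) : dirDeriv ω (C c) = 0 :=
  (dirDeriv ω).map_algebraMap c

theorem dirDeriv_X (ω : EuclideanSpace ℝ (Fin bp)) (i : Fin bp) :
    dirDeriv ω (X i) = C ((ω i : ℝ) : ℂ) := mkDerivation_X _ _ _

theorem dirDeriv_C_mul (ω : EuclideanSpace ℝ (Fin bp)) (c : ℂ) (p : MvPolynomial (Fin bp) ℂ) :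
    dirDeriv ω (C c * p) = C c * dirDeriv ω p := by
  rw [Derivation.leibniz, dirDeriv_C, smul_zero, add_zero, smul_eq_mul]

theorem dirDeriv_apply (ω : EuclideanSpace ℝ (Fin bp)) (p : MvPolynomial (Fin bp) ℂ) :
    dirDeriv ω p = ∑ j, C ((ω j : ℝ) : ℂ) * pderiv j p := by
  induction p using MvPolynomial.induction_on with
  | C a => rw [dirDeriv_C]; simp
  | add p q hp hq => simp only [map_add, hp, hq, mul_add, Finset.sum_add_distrib]
  | mul_X p i hp =>
    rw [Derivation.leibniz, dirDeriv_X, hp, smul_eq_mul, smul_eq_mul]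
    simp only [Derivation.leibniz, smul_eq_mul, mul_add, Finset.sum_add_distrib, pderiv_X]
    congr 1
    · rw [Finset.sum_eq_single i]
      · simp; ring
      · intro j _ hj; simp [hj.symm]
      · simp
    · rw [Finset.mul_sum]; exact Finset.sum_congr rfl fun j _ => by ring

theorem dirDeriv_linForm (ω : EuclideanSpace ℝ (Fin bp)) :
    dirDeriv ω (linForm ω) = C ((‖ω‖ ^ 2 : ℝ) : ℂ) := by
  rw [linForm, map_sum, EuclideanSpace.real_norm_sq_eq]
  push_cast
  rw [map_sum]
  refine Finset.sum_congr rfl fun j _ => ?_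
  rw [dirDeriv_C_mul, dirDeriv_X, ← C_mul, sq]

theorem heatLin_linForm_mul (c : ℂ) (ω : EuclideanSpace ℝ (Fin bp))
    (p : MvPolynomial (Fin bp) ℂ) :
    heatLin c (linForm ω * p) = linForm ω * heatLin c p - C c * heatLin c (dirDeriv ω p) := by
  rw [linForm, Finset.sum_mul, map_sum, Finset.sum_mul, dirDeriv_apply, map_sum, Finset.mul_sum,
    ← Finset.sum_sub_distrib]
  refine Finset.sum_congr rfl fun j _ => ?_
  have hC : ∀ (a : ℂ) (r : MvPolynomial (Fin bp) ℂ), heatLin c (C a * r) = C a * heatLin c r :=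
    fun a r => by rw [← smul_eq_C_mul, map_smul, smul_eq_C_mul]
  rw [mul_assoc, hC, hC, heatLin_X_mul]
  ring

theorem eval_heatLin_linForm_pow (c : ℂ) (ω : EuclideanSpace ℝ (Fin bp))
    {Q : MvPolynomial (Fin bp) ℂ} (hQ : lap Q = 0) (hω : dirDeriv ω Q = 0) (x : Fin bp → ℂ)
    (h : ℕ) : eval x (heatLin c (linForm ω ^ h * Q)) =
      (herm (c * (‖ω‖ ^ 2 : ℝ)) h).eval (eval x (linForm ω)) * eval x Q := by
  induction h using Nat.strong_induction_on with
  | _ h ih =>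
    match h with
    | 0 => simp [herm, heatLin_of_lap hQ]
    | 1 =>
      rw [pow_one, heatLin_linForm_mul, heatLin_of_lap hQ, hω]
      simp [herm]
    | h + 2 =>
      have hd : dirDeriv ω (linForm ω ^ (h + 1) * Q) =
          (((h : ℂ) + 1) * (‖ω‖ ^ 2 : ℝ)) • (linForm ω ^ h * Q) := by
        rw [Derivation.leibniz, hω, Derivation.leibniz_pow, dirDeriv_linForm, smul_eq_C_mul]
        simp only [smul_eq_mul, mul_zero, zero_add, Nat.add_sub_cancel, C_mul, C_add, C_1,
          map_natCast, nsmul_eq_mul]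
        push_cast; ring
      rw [show linForm ω ^ (h + 2) * Q = linForm ω * (linForm ω ^ (h + 1) * Q) by ring,
        heatLin_linForm_mul, hd, map_smul, herm]
      simp only [eval_sub, eval_mul, eval_C, smul_eval, ih h (by omega), ih (h + 1) (by omega),
        Polynomial.eval_sub, Polynomial.eval_mul, Polynomial.eval_X, Polynomial.eval_C]
      ring

theorem dirDeriv_polyCoeff {ω : EuclideanSpace ℝ (Fin bp)} (hω : ω ≠ 0)
    (P : MvPolynomial (Fin bp) ℂ) (h : ℕ) : dirDeriv ω (polyCoeff ω P h) = 0 := by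
  have hn : ‖ω‖ ^ 2 ≠ 0 := by positivity
  unfold polyCoeff
  induction P using MvPolynomial.induction_on generalizing h with
  | C a =>
    rw [aeval_C, Polynomial.algebraMap_apply, Polynomial.coeff_C]
    split_ifs
    · exact (dirDeriv ω).map_algebraMap a
    · simp
  | add p q hp hq => rw [map_add, Polynomial.coeff_add, map_add, hp, hq, add_zero]
  | mul_X p i hp =>
    have h0 : dirDeriv ω (X i - C ((ω i / ‖ω‖ ^ 2 : ℝ) : ℂ) *
        ∑ j, C ((ω j : ℝ) : ℂ) * X j) = 0 := by
      have := dirDeriv_linForm ω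
      rw [linForm] at this
      rw [map_sub, dirDeriv_X, dirDeriv_C_mul, this, ← C_mul, ← C_sub,
        ← Complex.ofReal_mul, div_mul_cancel₀ _ hn, sub_self, C_0]
    have h1 : dirDeriv ω (C ((ω i / ‖ω‖ ^ 2 : ℝ) : ℂ)) = 0 := dirDeriv_C _ _
    rw [map_mul, aeval_X, mul_add, ← mul_assoc, Polynomial.coeff_add, map_add,
      Polynomial.coeff_mul_C, Derivation.leibniz, hp, h0]
    cases h with
    | zero => simp
    | succ h => rw [Polynomial.coeff_mul_X, Polynomial.coeff_mul_C, Derivation.leibniz, hp, h1]; simp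

theorem polyCoeff_eq_zero {ω : EuclideanSpace ℝ (Fin bp)} {P : MvPolynomial (Fin bp) ℂ} {m : ℕ}
    (hP : P.IsHomogeneous m) {h : ℕ} (hm : m < h) : polyCoeff ω P h = 0 := by
  refine MvPolynomial.funext fun a => ?_
  rw [eval_polyCoeff, map_zero]
  refine Polynomial.coeff_eq_zero_of_natDegree_lt (lt_of_le_of_lt ?_ hm)
  refine (MvPolynomial.aeval_natDegree_le (n := 1) P hP.totalDegree_le _ fun i => ?_).trans
    (mul_one m).le
  compute_degree

theorem sum_linForm_polyCoeff (ω : EuclideanSpace ℝ (Fin bp))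
    {P : MvPolynomial (Fin bp) ℂ} {m : ℕ} (hP : P.IsHomogeneous m) :
    P = ∑ h ∈ Finset.range (m + 1), linForm ω ^ h * polyCoeff ω P h := by
  refine MvPolynomial.funext fun a => ?_
  simp only [map_sum, map_mul, map_pow, eval_polyCoeff]
  set F : Polynomial ℂ := MvPolynomial.aeval (fun i : Fin bp =>
        Polynomial.C (a i - ((ω i / ‖ω‖ ^ 2 : ℝ) : ℂ) * ∑ j, ((ω j : ℝ) : ℂ) * a j) +
        Polynomial.C ((ω i / ‖ω‖ ^ 2 : ℝ) : ℂ) * Polynomial.X) P with hF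
  have hdeg : F.natDegree ≤ m * 1 := by
    refine MvPolynomial.aeval_natDegree_le P hP.totalDegree_le _ fun i => ?_
    compute_degree
  have hl : eval a (linForm ω) = ∑ j, ((ω j : ℝ) : ℂ) * a j := by simp [linForm]
  generalize eval a (linForm ω) = t at hl ⊢
  rw [← hl] at hF
  have key : F.eval t = eval a P := by
    rw [hF, MvPolynomial.aeval_def, ← Polynomial.coe_evalRingHom, MvPolynomial.hom_eval₂,
      MvPolynomial.eval, MvPolynomial.coe_eval₂Hom]
    congr 1
    · ext c
      simp
    · funext i
      simp
  rw [← key, Polynomial.eval_eq_sum_range' (n := m + 1) (by omega)]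
  exact Finset.sum_congr rfl fun h _ => mul_comm _ _

theorem eval_smul_of_homogeneous {p : MvPolynomial (Fin bp) ℂ} {n : ℕ} (hp : p.IsHomogeneous n)
    (c : ℂ) (x : Fin bp → ℂ) : eval (fun i => c * x i) p = c ^ n * eval x p := by
  rw [eval_eq, eval_eq, Finset.mul_sum]
  refine Finset.sum_congr rfl fun d hd => ?_
  have : d.degree = n := by
    by_contra h; exact (mem_support_iff.1 hd) (hp.coeff_eq_zero h)
  rw [← this, Finsupp.degree_apply]
  simp only [mul_pow, Finset.prod_mul_distrib, Finset.prod_pow_eq_pow_sum]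
  ring

/-- Homogeneity of the polynomials `P_h`. -/
theorem eval_polyCoeff_smul (ω : EuclideanSpace ℝ (Fin bp))
    {P : MvPolynomial (Fin bp) ℂ} {m : ℕ} (hP : P.IsHomogeneous m) {h : ℕ} (hm : h ≤ m)
    {c : ℂ} (hc : c ≠ 0) (x : Fin bp → ℂ) :
    eval (fun i => c * x i) (polyCoeff ω P h) = c ^ (m - h) * eval x (polyCoeff ω P h) := by
  rw [eval_polyCoeff, eval_polyCoeff]
  set F : Polynomial ℂ := MvPolynomial.aeval (fun i : Fin bp =>
        Polynomial.C (x i - ((ω i / ‖ω‖ ^ 2 : ℝ) : ℂ) * ∑ j, ((ω j : ℝ) : ℂ) * x j) +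
        Polynomial.C ((ω i / ‖ω‖ ^ 2 : ℝ) : ℂ) * Polynomial.X) P with hF
  set G : Polynomial ℂ := MvPolynomial.aeval (fun i : Fin bp =>
        Polynomial.C (c * x i - ((ω i / ‖ω‖ ^ 2 : ℝ) : ℂ) * ∑ j, ((ω j : ℝ) : ℂ) * (c * x j)) +
        Polynomial.C ((ω i / ‖ω‖ ^ 2 : ℝ) : ℂ) * Polynomial.X) P with hG
  have heval : ∀ (y : Fin bp → ℂ) (t : ℂ), (MvPolynomial.aeval (fun i : Fin bp =>
        Polynomial.C (y i - ((ω i / ‖ω‖ ^ 2 : ℝ) : ℂ) * ∑ j, ((ω j : ℝ) : ℂ) * y j) +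
        Polynomial.C ((ω i / ‖ω‖ ^ 2 : ℝ) : ℂ) * Polynomial.X) P : Polynomial ℂ).eval t =
        eval (fun i => y i - ((ω i / ‖ω‖ ^ 2 : ℝ) : ℂ) * (∑ j, ((ω j : ℝ) : ℂ) * y j) +
          ((ω i / ‖ω‖ ^ 2 : ℝ) : ℂ) * t) P := by
    intro y t
    generalize (∑ j, ((ω j : ℝ) : ℂ) * y j) = s
    rw [MvPolynomial.aeval_def, ← Polynomial.coe_evalRingHom, MvPolynomial.hom_eval₂,
      MvPolynomial.eval, MvPolynomial.coe_eval₂Hom]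
    congr 1
    · ext c
      simp
    · funext i
      simp
  have key : G.comp (Polynomial.C c * Polynomial.X) = Polynomial.C (c ^ m) * F := by
    refine Polynomial.funext fun t => ?_
    rw [Polynomial.eval_comp, Polynomial.eval_mul, Polynomial.eval_mul, Polynomial.eval_C,
      Polynomial.eval_C, Polynomial.eval_X, hG, hF, heval x t, heval (fun i => c * x i),
      ← eval_smul_of_homogeneous hP]
    congr 2
    funext i
    have : ∑ j, ((ω j : ℝ) : ℂ) * (c * x j) = c * ∑ j, ((ω j : ℝ) : ℂ) * x j := by
      rw [Finset.mul_sum]; exact Finset.sum_congr rfl fun j _ => by ring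
    rw [this]; ring
  have h2 := congrArg (fun p => Polynomial.coeff p h) key
  simp only [Polynomial.comp_C_mul_X_coeff, Polynomial.coeff_C_mul] at h2
  have h3 : c ^ h ≠ 0 := pow_ne_zero _ hc
  refine mul_right_cancel₀ h3 ?_
  rw [h2, mul_right_comm, ← pow_add, Nat.sub_add_cancel hm]

/-- The heat operator on a polynomial whose components `P_h` are harmonic. -/
theorem eval_heat_split {ω : EuclideanSpace ℝ (Fin bp)} (hω : ω ≠ 0)
    {P : MvPolynomial (Fin bp) ℂ} {m : ℕ} (hP : P.IsHomogeneous m)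
    (hlap : ∀ h, laplacian (polyCoeff ω P h) = 0) (c : ℂ) {x : EuclideanSpace ℝ (Fin bp)}
    (hx : inner ℝ x ω = 0) (t : ℝ) :
    eval (fun i => (((x + t • ω) i : ℝ) : ℂ)) (heatLin c P) =
      ∑ h ∈ Finset.range (m + 1), (herm (c * (‖ω‖ ^ 2 : ℝ)) h).eval ((t * ‖ω‖ ^ 2 : ℝ) : ℂ) *
        eval (fun i => ((x i : ℝ) : ℂ)) (polyCoeff ω P h) := by
  conv_lhs => rw [sum_linForm_polyCoeff ω hP]
  rw [map_sum, map_sum]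
  refine Finset.sum_congr rfl fun h _ => ?_
  rw [eval_heatLin_linForm_pow c ω (by rw [lap_apply, hlap]) (dirDeriv_polyCoeff hω P h),
    polyCoeff_const ω hω]
  congr 2
  have h1 : (∑ j, ω j * (x + t • ω) j) = t * ‖ω‖ ^ 2 := by
    have : (∑ j, ω j * (x + t • ω) j) = inner ℝ (x + t • ω) ω := by
      simp [PiLp.inner_apply]
    rw [this, inner_add_left, hx, inner_smul_left, real_inner_self_eq_norm_sq]
    simp
  rw [← h1]
  simp [linForm]

end Split

/-! ### Growth of polynomials -/

theorem norm_eval_le (p : MvPolynomial (Fin bp) ℂ) {d : ℕ} (hd : p.totalDegree ≤ d) :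
    ∃ C : ℝ, 0 ≤ C ∧ ∀ x : EuclideanSpace ℝ (Fin bp),
      ‖MvPolynomial.eval (fun i => ((x i : ℝ) : ℂ)) p‖ ≤ C * (1 + ‖x‖) ^ d := by
  refine ⟨∑ α ∈ p.support, ‖p.coeff α‖, by positivity, fun x => ?_⟩
  rw [MvPolynomial.eval_eq, Finset.sum_mul]
  refine (norm_sum_le _ _).trans (Finset.sum_le_sum fun α hα => ?_)
  rw [norm_mul, norm_prod]
  refine mul_le_mul_of_nonneg_left ?_ (norm_nonneg _)
  calc ∏ i ∈ α.support, ‖((x i : ℝ) : ℂ) ^ α i‖ ≤ ∏ i ∈ α.support, (1 + ‖x‖) ^ α i := by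
        refine Finset.prod_le_prod (fun _ _ => norm_nonneg _) fun i _ => ?_
        rw [norm_pow, Complex.norm_real]
        have := EuclideanSpace.norm_eq x
        have h2 : ‖x i‖ ≤ ‖x‖ := PiLp.norm_apply_le x i
        gcongr; linarith
    _ = (1 + ‖x‖) ^ (∑ i ∈ α.support, α i) := Finset.prod_pow_eq_pow_sum _ _ _
    _ ≤ (1 + ‖x‖) ^ d := by
        refine pow_le_pow_right₀ (by linarith [norm_nonneg x]) ?_
        exact (MvPolynomial.le_totalDegree hα).trans hd

theorem norm_eval_heatLin_le (p : MvPolynomial (Fin bp) ℂ) :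
    ∃ (C : ℝ) (d : ℕ), 0 ≤ C ∧ ∀ (c : ℂ) (x : EuclideanSpace ℝ (Fin bp)),
      ‖MvPolynomial.eval (fun i => ((x i : ℝ) : ℂ)) (heatLin c p)‖ ≤
        C * (1 + ‖c‖) ^ d * (1 + ‖x‖) ^ d := by
  have h1 : ∀ j : ℕ, ∃ (C : ℝ), 0 ≤ C ∧ ∀ x : EuclideanSpace ℝ (Fin bp),
      ‖MvPolynomial.eval (fun i => ((x i : ℝ) : ℂ)) ((lap ^ j) p)‖ ≤
        C * (1 + ‖x‖) ^ ((lap ^ j) p).totalDegree := fun j => norm_eval_le _ le_rfl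
  choose C hC hCx using h1
  set D := p.totalDegree + ∑ j ∈ Finset.range (p.totalDegree + 1), ((lap ^ j) p).totalDegree
    with hD
  refine ⟨∑ j ∈ Finset.range (p.totalDegree + 1), C j, D, Finset.sum_nonneg fun j _ => hC j,
    fun c x => ?_⟩
  rw [heatLin_eq_sum c p (Nat.lt_succ_self _), map_sum, Finset.sum_mul, Finset.sum_mul]
  refine (norm_sum_le _ _).trans (Finset.sum_le_sum fun j hj => ?_)
  rw [MvPolynomial.eval_mul, MvPolynomial.eval_C, norm_mul, mul_comm (C j), mul_assoc]
  refine mul_le_mul ?_ ((hCx j x).trans ?_) (norm_nonneg _) (by positivity)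
  · rw [norm_div, norm_pow, Complex.norm_natCast]
    calc ‖-c / 2‖ ^ j / (j.factorial : ℝ) ≤ ‖-c / 2‖ ^ j / 1 := by
          gcongr; exact_mod_cast j.factorial_pos
      _ ≤ (1 + ‖c‖) ^ j := by
          rw [div_one, norm_div, norm_neg]
          have := norm_nonneg c
          gcongr
          simp; linarith
      _ ≤ (1 + ‖c‖) ^ D := by
          refine pow_le_pow_right₀ (by linarith [norm_nonneg c]) ?_
          have := Finset.mem_range.1 hj; omega
  · refine mul_le_mul_of_nonneg_left (pow_le_pow_right₀ (by linarith [norm_nonneg x]) ?_) (hC j)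
    have := Finset.single_le_sum (f := fun j => ((lap ^ j) p).totalDegree)
      (fun _ _ => Nat.zero_le _) hj
    have h2 : ((lap ^ j) p).totalDegree ≤
        ∑ j ∈ Finset.range (p.totalDegree + 1), ((lap ^ j) p).totalDegree := this
    omega

end

section

/-! ### Fourier series in several variables -/

section Fourier
variable {ι : Type*}

/-- The half-open unit cube. -/
def cube (ι : Type*) : Set (ι → ℝ) := {x | ∀ i, x i ∈ Set.Ioc (0 : ℝ) 1}

theorem cube_eq : cube ι = Set.univ.pi fun _ => Set.Ioc (0 : ℝ) 1 := by
  ext x; simp [cube]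

theorem iUnion_cube : (⋃ n : ι → ℤ, (fun x => x + fun i => (n i : ℝ)) '' cube ι) = Set.univ := by
  refine Set.eq_univ_of_forall fun x => Set.mem_iUnion.2 ⟨fun i => ⌈x i⌉ - 1, ?_⟩
  refine ⟨x - fun i => ((⌈x i⌉ - 1 : ℤ) : ℝ), fun i => ?_, by simp⟩
  have h1 := Int.le_ceil (x i)
  have h2 := Int.ceil_lt_add_one (x i)
  simp only [Pi.sub_apply, Set.mem_Ioc, Int.cast_sub, Int.cast_one]
  constructor <;> linarith

theorem pairwise_disjoint_cube :
    Pairwise (Function.onFun Disjoint fun n : ι → ℤ => (fun x => x + fun i => (n i : ℝ)) '' cube ι) := by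
  intro n m hnm
  rw [Function.onFun, Set.disjoint_left]
  rintro _ ⟨x, hx, rfl⟩ ⟨y, hy, hxy⟩
  refine hnm (funext fun i => ?_)
  have h1 := hx i
  have h2 := hy i
  have h3 := congrFun hxy i
  simp only [Pi.add_apply, Set.mem_Ioc] at h1 h2 h3
  have h4 : (n i : ℝ) - m i < 1 := by linarith
  have h5 : (m i : ℝ) - n i < 1 := by linarith
  have h6 : n i - m i < 1 := by exact_mod_cast h4
  have h7 : m i - n i < 1 := by exact_mod_cast h5
  omega

variable [Fintype ι]

/-- The character `e(∑ n_i x_i)`. -/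
def chr (n : ι → ℤ) (x : ι → ℝ) : ℂ := ee ((∑ i, n i * x i : ℝ) : ℂ)

theorem measurableSet_cube : MeasurableSet (cube ι) := by
  rw [cube_eq]; exact MeasurableSet.univ_pi fun _ => measurableSet_Ioc

theorem volume_cube : volume (cube ι) = 1 := by
  rw [cube_eq, volume_pi_pi]; simp

theorem integrableOn_cube {f : (ι → ℝ) → ℂ} (hf : Continuous f) : IntegrableOn f (cube ι) :=
  (hf.continuousOn.integrableOn_compact (isCompact_univ_pi fun _ : ι =>
    (isCompact_Icc : IsCompact (Set.Icc (0 : ℝ) 1)))).mono_set (by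
      rw [cube_eq]; exact Set.pi_mono fun _ _ => Set.Ioc_subset_Icc_self)

theorem continuous_chr (n : ι → ℤ) : Continuous (chr n) := by
  unfold chr
  exact continuous_ee.comp (Complex.continuous_ofReal.comp (by fun_prop))

theorem norm_chr (n : ι → ℤ) (x : ι → ℝ) : ‖chr n x‖ = 1 := norm_ee_ofReal _

theorem mFourier_coe (n : ι → ℤ) (x : ι → ℝ) :
    UnitAddTorus.mFourier n (fun i => (x i : UnitAddCircle)) = chr n x := by
  simp only [UnitAddTorus.mFourier, ContinuousMap.coe_mk, fourier_coe_apply, chr, ee]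
  rw [← Complex.exp_sum]
  congr 1
  push_cast
  rw [Finset.mul_sum]
  exact Finset.sum_congr rfl fun i _ => by ring

theorem hasSum_fourier_of_periodic {f : (ι → ℝ) → ℂ} (hf : Continuous f)
    (hp : ∀ (n : ι → ℤ) x, f (x + fun i => (n i : ℝ)) = f x)
    (hs : Summable fun n : ι → ℤ => ∫ t in cube ι, f t * chr (-n) t) (x : ι → ℝ) :
    HasSum (fun n : ι → ℤ => (∫ t in cube ι, f t * chr (-n) t) * chr n x) (f x) := by
  have hq : Topology.IsQuotientMap
      (fun (x : ι → ℝ) (i : ι) => (x i : UnitAddCircle)) :=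
    (IsOpenQuotientMap.piMap (fun _ : ι =>
      (QuotientAddGroup.isOpenQuotientMap_mk :
        IsOpenQuotientMap (QuotientAddGroup.mk : ℝ → UnitAddCircle)))).isQuotientMap
  have hfac : ∀ a b : ι → ℝ, (fun i => (a i : UnitAddCircle)) = (fun i => (b i : UnitAddCircle)) →
      f a = f b := by
    intro a b hab
    have h1 : ∀ i, ∃ n : ℤ, a i = b i + n := fun i => by
      have := congrFun hab i
      rw [QuotientAddGroup.eq_iff_sub_mem, AddSubgroup.mem_zmultiples_iff] at this
      obtain ⟨n, hn⟩ := this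
      exact ⟨n, by simp at hn; linarith⟩
    choose n hn using h1
    rw [← hp n b]
    exact congrArg f (funext hn)
  let g : C(UnitAddTorus ι, ℂ) := Topology.IsQuotientMap.lift
    (f := ⟨fun (x : ι → ℝ) (i : ι) => (x i : UnitAddCircle), hq.continuous⟩) hq ⟨f, hf⟩ hfac
  have hg : ∀ a : ι → ℝ, g (fun i => (a i : UnitAddCircle)) = f a := fun a =>
    DFunLike.congr_fun (Topology.IsQuotientMap.lift_comp
      (f := ⟨fun (x : ι → ℝ) (i : ι) => (x i : UnitAddCircle), hq.continuous⟩) hq ⟨f, hf⟩ hfac) a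
  have hc : ∀ n, UnitAddTorus.mFourierCoeff g n = ∫ t in cube ι, f t * chr (-n) t := fun n => by
    rw [UnitAddTorus.mFourierCoeff_eq_integral g n 0]
    simp only [mFourier_coe, hg, Pi.zero_apply, zero_add, smul_eq_mul, cube, mul_comm (f _)]
  have := UnitAddTorus.hasSum_mFourier_series_apply_of_summable (f := g)
    (by simpa only [funext hc] using hs) (fun i => (x i : UnitAddCircle))
  simpa only [hc, mFourier_coe, hg, smul_eq_mul] using this

theorem hasSum_integral_cube {F : (ι → ℝ) → ℂ} (hF : Integrable F) :
    HasSum (fun n : ι → ℤ => ∫ t in cube ι, F (t + fun i => (n i : ℝ))) (∫ t, F t) := by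
  have h1 : ∀ n : ι → ℤ, ∫ t in (fun x => x + fun i => (n i : ℝ)) '' cube ι, F t =
      ∫ t in cube ι, F (t + fun i => (n i : ℝ)) := fun n =>
    (measurePreserving_add_right volume _).setIntegral_image_emb
      (measurableEmbedding_addRight _) F _
  have := hasSum_integral_iUnion (μ := volume) (f := F)
    (s := fun n : ι → ℤ => (fun x => x + fun i => (n i : ℝ)) '' cube ι)
    (fun n => (measurableEmbedding_addRight _).measurableSet_image.2 measurableSet_cube)
    pairwise_disjoint_cube hF.integrableOn
  rw [iUnion_cube, setIntegral_univ] at this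
  simpa only [h1] using this

/-- Poisson summation in several variables. -/
theorem hasSum_poisson {F : (ι → ℝ) → ℂ} (hF : Continuous F) (hi : Integrable F)
    (hb : ∀ R : ℝ, ∃ w : (ι → ℤ) → ℝ, Summable w ∧
      ∀ n x, ‖x‖ ≤ R → ‖F (x + fun i => (n i : ℝ))‖ ≤ w n)
    (hs : Summable fun n : ι → ℤ => ∫ t, F t * chr (-n) t) :
    HasSum (fun n : ι → ℤ => ∫ t, F t * chr (-n) t) (∑' n : ι → ℤ, F fun i => (n i : ℝ)) := by
  set G : (ι → ℝ) → ℂ := fun x => ∑' n : ι → ℤ, F (x + fun i => (n i : ℝ)) with hG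
  have hGc : Continuous G := by
    refine continuous_iff_continuousAt.2 fun x => ?_
    obtain ⟨w, hw, hwb⟩ := hb (‖x‖ + 1)
    have hc : ContinuousOn G (Metric.ball x 1) := by
      refine continuousOn_tsum (fun n => (by fun_prop)) hw fun n y hy => hwb n y ?_
      have := norm_sub_norm_le y x
      rw [Metric.mem_ball, dist_eq_norm] at hy
      linarith
    exact hc.continuousAt (Metric.ball_mem_nhds x one_pos)
  have hGp : ∀ (n : ι → ℤ) x, G (x + fun i => (n i : ℝ)) = G x := fun n x => by
    rw [hG]
    simp only
    rw [← (Equiv.addLeft n).tsum_eq (fun m : ι → ℤ => F (x + fun i => (m i : ℝ)))]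
    refine tsum_congr fun m => congrArg F ?_
    ext i; simp; ring
  have hper : ∀ (m n : ι → ℤ) (t : ι → ℝ), chr m (t + fun i => (n i : ℝ)) = chr m t := by
    intro m n t
    refine ee_congr ⟨∑ i, m i * n i, ?_⟩
    push_cast
    rw [← Finset.sum_sub_distrib]
    exact Finset.sum_congr rfl fun i _ => by simp; ring
  have hcoef : ∀ m : ι → ℤ, ∫ t in cube ι, G t * chr (-m) t = ∫ t, F t * chr (-m) t := by
    intro m
    have hint : Integrable fun t => F t * chr (-m) t :=
      hi.mul_bdd (c := 1) (continuous_chr _).aestronglyMeasurable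
        (ae_of_all _ fun t => (norm_chr _ _).le)
    have h1 := hasSum_integral_cube hint
    obtain ⟨w, hw, hwb⟩ := hb 1
    have hcub : ∀ t ∈ cube ι, ‖t‖ ≤ 1 := fun t ht =>
      (pi_norm_le_iff_of_nonneg zero_le_one).2 fun i => by
        rw [Real.norm_of_nonneg (ht i).1.le]; exact (ht i).2
    have h2 := hasSum_integral_of_summable_integral_norm (μ := volume.restrict (cube ι))
      (F := fun (n : ι → ℤ) t => F (t + fun i => (n i : ℝ)) * chr (-m) t)
      (fun n => integrableOn_cube (by have := continuous_chr (-m); fun_prop))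
      (Summable.of_nonneg_of_le (fun n => integral_nonneg fun t => norm_nonneg _)
        (fun n => ?_) hw)
    · rw [← h1.tsum_eq]
      simp only [hper, hG, tsum_mul_right] at h2 ⊢
      exact h2.tsum_eq.symm
    · calc _ ≤ ∫ t in cube ι, w n := by
            refine setIntegral_mono_on (integrableOn_cube (by
              have := continuous_chr (-m); fun_prop)).norm (by
                simp [integrableOn_const_iff, volume_cube]) measurableSet_cube fun t ht => ?_
            rw [norm_mul, norm_chr, mul_one]; exact hwb n t (hcub t ht)
        _ = w n := by simp [Measure.real, volume_cube]
  have h := hasSum_fourier_of_periodic hGc hGp (by simpa only [hcoef] using hs) 0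
  simp only [hcoef] at h
  simpa [chr, hG] using h

end Fourier

end

section

/-! ### Decay of Gaussians and sums over lattices -/

section Decay

theorem gauss_decay (d j : ℕ) : ∃ C : ℝ, 0 < C ∧ ∀ y : ℝ, 0 < y → ∀ t : ℝ, 0 ≤ t →
    (1 + t) ^ d * exp (-(π * y * t ^ 2)) ≤
      C * (1 + 1 / y) ^ (d + j) * (1 / (1 + t ^ 2) ^ j) := by
  refine ⟨2 ^ d * ((d + j).factorial * exp 1), by positivity, fun y hy t ht => ?_⟩
  have h1 : (1 + t) ^ d ≤ 2 ^ d * (1 + t ^ 2) ^ d := by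
    rw [← mul_pow]
    refine pow_le_pow_left₀ (by linarith) ?_ _
    nlinarith [sq_nonneg (t - 1)]
  have h2 : (1 + t ^ 2) ^ (d + j) ≤ (1 + 1 / y) ^ (d + j) * (1 + y * t ^ 2) ^ (d + j) := by
    rw [← mul_pow]
    refine pow_le_pow_left₀ (by positivity) ?_ _
    have h3 : (1 + 1 / y) * (1 + y * t ^ 2) = 1 + t ^ 2 + (1 / y + y * t ^ 2) := by
      field_simp; ring
    rw [h3]
    have : 0 ≤ 1 / y + y * t ^ 2 := by positivity
    linarith
  have h3 : (1 + y * t ^ 2) ^ (d + j) * exp (-(π * y * t ^ 2)) ≤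
      (d + j).factorial * exp 1 := by
    have h4 := Real.pow_div_factorial_le_exp (1 + y * t ^ 2) (by positivity) (d + j)
    rw [div_le_iff₀ (by positivity)] at h4
    have h5 : exp (-(π * y * t ^ 2)) ≤ exp (-(y * t ^ 2)) := by
      refine Real.exp_le_exp.2 (neg_le_neg ?_)
      have : 0 ≤ y * t ^ 2 := by positivity
      nlinarith [Real.pi_gt_three]
    calc _ ≤ (exp (1 + y * t ^ 2) * (d + j).factorial) * exp (-(y * t ^ 2)) :=
          mul_le_mul h4 h5 (Real.exp_pos _).le (by positivity)
      _ = (d + j).factorial * exp 1 := by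
          rw [Real.exp_add, Real.exp_neg]; field_simp
  have h6 : (0 : ℝ) < (1 + t ^ 2) ^ j := by positivity
  rw [mul_one_div, le_div_iff₀ h6]
  calc (1 + t) ^ d * exp (-(π * y * t ^ 2)) * (1 + t ^ 2) ^ j
      ≤ (2 ^ d * (1 + t ^ 2) ^ d) * exp (-(π * y * t ^ 2)) * (1 + t ^ 2) ^ j := by
        gcongr
    _ = 2 ^ d * ((1 + t ^ 2) ^ (d + j) * exp (-(π * y * t ^ 2))) := by ring
    _ ≤ 2 ^ d * (((1 + 1 / y) ^ (d + j) * (1 + y * t ^ 2) ^ (d + j)) *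
          exp (-(π * y * t ^ 2))) := by gcongr
    _ = 2 ^ d * (1 + 1 / y) ^ (d + j) * ((1 + y * t ^ 2) ^ (d + j) *
          exp (-(π * y * t ^ 2))) := by ring
    _ ≤ 2 ^ d * (1 + 1 / y) ^ (d + j) * ((d + j).factorial * exp 1) := by gcongr
    _ = _ := by ring

/-- The weight `(1 + |x|²)⁻ʲ`. -/
def wt {E : Type*} [NormedAddCommGroup E] (j : ℕ) (x : E) : ℝ := 1 / (1 + ‖x‖ ^ 2) ^ j

variable {E : Type*} [NormedAddCommGroup E]

theorem wt_pos (j : ℕ) (x : E) : 0 < wt j x := by unfold wt; positivity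

theorem wt_shift (j : ℕ) (v b : E) : wt j (v + b) ≤ 2 ^ j * (1 + ‖b‖ ^ 2) ^ j * wt j v := by
  unfold wt
  rw [mul_one_div, div_le_div_iff₀ (by positivity) (by positivity), one_mul, ← mul_pow, ← mul_pow]
  refine pow_le_pow_left₀ (by positivity) ?_ _
  have h : ‖v‖ ≤ ‖v + b‖ + ‖b‖ := by simpa using norm_sub_le (v + b) b
  have h2 : ‖v‖ ^ 2 ≤ (‖v + b‖ + ‖b‖) ^ 2 := pow_le_pow_left₀ (norm_nonneg _) h 2
  nlinarith [sq_nonneg (‖v + b‖ - ‖b‖), mul_nonneg (sq_nonneg ‖b‖) (sq_nonneg ‖v + b‖)]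

theorem wt_scale (j : ℕ) {c : ℝ} (hc : 0 < c) {t : ℝ} {x : E} (ht : c * ‖x‖ ≤ t) :
    1 / (1 + t ^ 2) ^ j ≤ (1 + 1 / c ^ 2) ^ j * wt j x := by
  unfold wt
  rw [mul_one_div, div_le_div_iff₀ (by positivity) (by positivity), one_mul, ← mul_pow]
  refine pow_le_pow_left₀ (by positivity) ?_ _
  have h2 : (c * ‖x‖) ^ 2 ≤ t ^ 2 := pow_le_pow_left₀ (by positivity) ht 2
  have h3 : ‖x‖ ^ 2 ≤ 1 / c ^ 2 * t ^ 2 := by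
    rw [one_div, inv_mul_eq_div, le_div_iff₀ (by positivity)]; linarith
  have : 0 ≤ 1 / c ^ 2 := by positivity
  nlinarith [sq_nonneg t]

theorem summable_wt [NormedSpace ℝ E] [FiniteDimensional ℝ E] (N : Submodule ℤ E)
    [DiscreteTopology N] {j : ℕ} (hj : Module.finrank ℤ N < 2 * j) :
    Summable fun v : N => wt j (v : E) := by
  classical
  have h1 := ZLattice.summable_norm_pow_inv N (2 * j) hj
  refine Summable.of_nonneg_of_le (fun v => (wt_pos _ _).le) (fun v => ?_)
    (h1.add (summable_of_hasFiniteSupport (f := fun v : N => if v = 0 then (1 : ℝ) else 0)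
      ((Set.finite_singleton 0).subset (by intro v; simp))))
  by_cases hv : v = 0
  · subst hv; simp [wt]
  · have : 0 < ‖v‖ := norm_pos_iff.2 hv
    simp only [hv, if_false, add_zero, wt]
    rw [one_div, inv_pow]
    refine inv_anti₀ (by positivity) ?_
    rw [pow_mul]
    refine pow_le_pow_left₀ (by positivity) ?_ _
    simp

end Decay

/-! ### Linear changes of variables -/

theorem exists_integral_comp_linearEquiv {ι ι' : Type*} [Fintype ι] [Fintype ι']
    (e : (ι → ℝ) ≃ₗ[ℝ] (ι' → ℝ)) :
    ∃ C : ℝ, 0 < C ∧ (∀ f : (ι' → ℝ) → ℂ, ∫ t, f (e t) = C * ∫ s, f s) ∧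
      ∀ f : (ι' → ℝ) → ℂ, Integrable f → Integrable fun t => f (e t) := by
  let E := e.toContinuousLinearEquiv
  have hm : MeasurableEmbedding E := E.toHomeomorph.measurableEmbedding
  have : Measure.IsAddHaarMeasure (Measure.map E volume) :=
    E.isAddHaarMeasure_map volume
  have hc := Measure.isAddLeftInvariant_eq_smul (Measure.map E volume)
    (volume : Measure (ι' → ℝ))
  have hc0 := Measure.addHaarScalarFactor_pos_of_isAddHaarMeasure (Measure.map E volume)
    (volume : Measure (ι' → ℝ))
  set c := Measure.addHaarScalarFactor (Measure.map E volume) (volume : Measure (ι' → ℝ))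
  refine ⟨c, hc0, fun f => ?_, fun f hf => ?_⟩
  · have := hm.integral_map (μ := volume) f
    rw [hc, integral_smul_nnreal_measure] at this
    exact this.symm
  · have h := (hf.smul_measure_nnreal (c := c))
    rw [← hc, hm.integrable_map_iff] at h
    exact h

end

/-! ### Gaussians times heat polynomials -/

/-- The function `x ↦ exp(-Δ/8πy)(P)(x) e(q(x₊) τ + q(x₋) τ̄)`. -/
def gaussPoly (P : MvPolynomial (Fin bp) ℂ) (τ : ℂ) (x : QSpace bp bm) : ℂ :=
  polyAt (heat τ.im P) x * Complex.exp (π * I *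
    (τ * (‖x.1‖ ^ 2 : ℝ) - conj τ * (‖x.2‖ ^ 2 : ℝ)))

theorem norm_exp_gauss (τ : ℂ) (a b : ℝ) : ‖Complex.exp (π * I *
    (τ * a - conj τ * b))‖ = exp (-(π * τ.im * (a + b))) := by
  rw [Complex.norm_exp]
  congr 1
  simp
  ring

theorem norm_gaussPoly_le (P : MvPolynomial (Fin bp) ℂ) (j : ℕ) {c : ℝ} (hc : 0 < c) :
    ∃ (C : ℝ) (d : ℕ), 0 < C ∧ ∀ τ : ℂ, 0 < τ.im → ∀ x x' : QSpace bp bm, c * ‖x'‖ ≤ ‖x‖ →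
      ‖gaussPoly P τ x‖ ≤ C * (1 + 1 / τ.im) ^ d * wt j x' := by
  obtain ⟨C, d, hC, h1⟩ := norm_eval_heatLin_le P
  obtain ⟨C', hC', h2⟩ := gauss_decay d j
  refine ⟨(C + 1) * C' * (1 + 1 / c ^ 2) ^ j, d + (d + j), by positivity, fun τ hτ x x' hx => ?_⟩
  rw [gaussPoly, norm_mul, norm_exp_gauss, polyAt, heat_eq_heatOp]
  have hx1 : ‖x.1‖ ≤ ‖x‖ := norm_fst_le x
  have hx2 : ‖x‖ ^ 2 ≤ ‖x.1‖ ^ 2 + ‖x.2‖ ^ 2 := by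
    rcases max_cases ‖x.1‖ ‖x.2‖ with h | h <;> rw [Prod.norm_def, h.1] <;> nlinarith [sq_nonneg ‖x.1‖, sq_nonneg ‖x.2‖]
  have hy : ‖(((1 / (4 * π * τ.im) : ℝ)) : ℂ)‖ ≤ 1 / τ.im := by
    rw [Complex.norm_real, Real.norm_of_nonneg (by positivity)]
    refine one_div_le_one_div_of_le hτ ?_
    nlinarith [Real.pi_gt_three]
  have h3 : ‖MvPolynomial.eval (fun i => ((x.1 i : ℝ) : ℂ))
      (heatOp (((1 / (4 * π * τ.im) : ℝ)) : ℂ) P)‖ ≤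
      (C + 1) * (1 + 1 / τ.im) ^ d * (1 + ‖x‖) ^ d := by
    refine (h1 _ x.1).trans ?_
    have := norm_nonneg (((1 / (4 * π * τ.im) : ℝ)) : ℂ)
    gcongr
    linarith
  have h4 : exp (-(π * τ.im * (‖x.1‖ ^ 2 + ‖x.2‖ ^ 2))) ≤
      exp (-(π * τ.im * ‖x‖ ^ 2)) := by
    refine Real.exp_le_exp.2 (neg_le_neg ?_)
    exact mul_le_mul_of_nonneg_left hx2 (by positivity)
  have h5 := h2 τ.im hτ ‖x‖ (norm_nonneg _)
  have h6 := wt_scale j hc hx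
  calc _ ≤ ((C + 1) * (1 + 1 / τ.im) ^ d * (1 + ‖x‖) ^ d) *
        exp (-(π * τ.im * ‖x‖ ^ 2)) := by gcongr
    _ = (C + 1) * (1 + 1 / τ.im) ^ d *
        ((1 + ‖x‖) ^ d * exp (-(π * τ.im * ‖x‖ ^ 2))) := by ring
    _ ≤ (C + 1) * (1 + 1 / τ.im) ^ d * (C' * (1 + 1 / τ.im) ^ (d + j) *
        ((1 + 1 / c ^ 2) ^ j * wt j x')) := by
      refine mul_le_mul_of_nonneg_left (h5.trans ?_) (by positivity)
      gcongr
    _ = _ := by ring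

theorem continuous_herm_eval (n : ℕ) :
    Continuous fun p : ℂ × ℂ => (herm p.1 n).eval p.2 := by
  induction n using Nat.strong_induction_on with
  | _ n ih =>
    match n with
    | 0 => simpa [herm] using continuous_const
    | 1 => simpa [herm] using continuous_snd
    | n + 2 =>
      have h1 := ih (n + 1) (by omega)
      have h0 := ih n (by omega)
      simp only [herm, Polynomial.eval_sub, Polynomial.eval_mul, Polynomial.eval_X,
        Polynomial.eval_C]
      fun_prop

theorem continuousOn_gaussPoly (P : MvPolynomial (Fin bp) ℂ) :
    ContinuousOn (fun p : ℂ × QSpace bp bm => gaussPoly P p.1 p.2) {p | 0 < p.1.im} := by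
  unfold gaussPoly
  refine ContinuousOn.mul ?_ (Continuous.continuousOn ?_)
  · simp only [polyAt, heat_eq_heatOp]
    change ContinuousOn (fun p : ℂ × QSpace bp bm => MvPolynomial.eval _ (heatLin _ P)) _
    simp only [eval_heatLin]
    refine continuousOn_finsetSum _ fun α _ => continuousOn_const.mul
      (continuousOn_finsetProd _ fun i _ => ?_)
    refine (continuous_herm_eval (α i)).comp_continuousOn (ContinuousOn.prodMk ?_ ?_)
    · refine Complex.continuous_ofReal.comp_continuousOn ?_
      refine continuousOn_const.div (Continuous.continuousOn (by fun_prop)) fun p hp => ?_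
      have : 0 < p.1.im := hp
      positivity
    · exact (Complex.continuous_ofReal.comp (by fun_prop)).continuousOn
  · have := Complex.continuous_conj
    fun_prop

theorem gaussPoly_add_one (P : MvPolynomial (Fin bp) ℂ) (τ : ℂ) (x : QSpace bp bm) :
    gaussPoly P (τ + 1) x =
      gaussPoly P τ x * ee (((‖x.1‖ ^ 2 - ‖x.2‖ ^ 2) / 2 : ℝ) : ℂ) := by
  simp only [gaussPoly, ee]
  rw [mul_assoc (polyAt (heat τ.im P) x), ← Complex.exp_add]
  congr 2
  · simp
  · push_cast
    simp only [map_add, map_one]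
    ring

/-- Coordinates on the quadratic space. -/
def coordEquiv (bp bm : ℕ) : (Fin bp ⊕ Fin bm → ℝ) ≃ₗ[ℝ] QSpace bp bm where
  toFun s := (WithLp.toLp 2 fun i => s (.inl i), WithLp.toLp 2 fun i => s (.inr i))
  invFun x := Sum.elim (fun i => x.1 i) fun i => x.2 i
  map_add' _ _ := rfl
  map_smul' _ _ := rfl
  left_inv s := by ext i; cases i <;> rfl
  right_inv x := rfl

theorem coordEquiv_fst (s : Fin bp ⊕ Fin bm → ℝ) (i : Fin bp) :
    (coordEquiv bp bm s).1 i = s (.inl i) := rfl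

theorem coordEquiv_snd (s : Fin bp ⊕ Fin bm → ℝ) (j : Fin bm) :
    (coordEquiv bp bm s).2 j = s (.inr j) := rfl

theorem herm_eval_neg (c x : ℂ) (n : ℕ) :
    (herm c n).eval (-x) = (-1) ^ n * (herm c n).eval x := by
  induction n using Nat.strong_induction_on with
  | _ n ih =>
    match n with
    | 0 => simp [herm]
    | 1 => simp [herm]
    | n + 2 =>
      simp only [herm, Polynomial.eval_sub, Polynomial.eval_mul, Polynomial.eval_X,
        Polynomial.eval_C, ih (n + 1) (by omega), ih n (by omega)]
      ring

theorem inv_sqrt_neg_inv {τ : ℂ} (hτ : 0 < τ.im) :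
    1 / (-I * (-1 / τ)) ^ (1 / 2 : ℂ) = (-I * τ) ^ (1 / 2 : ℂ) := by
  have h0 : τ ≠ 0 := fun h => by simp [h] at hτ
  have h1 : -I * (-1 / τ) = (-I * τ)⁻¹ := by
    rw [mul_inv, inv_neg, Complex.inv_I]; field_simp
  have h2 : (-I * τ).arg ≠ π := by
    intro h
    rw [Complex.arg_eq_pi_iff] at h
    simp at h; linarith [h.1]
  rw [h1, Complex.inv_cpow _ _ h2, one_div, inv_inv]

/-- The automorphy factor of a Gaussian of signature `(bp, bm)`. -/
def gaussFactor (bp bm : ℕ) (τ : ℂ) : ℂ :=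
  ((-I * τ) ^ (1 / 2 : ℂ)) ^ bp * conj ((-I * τ) ^ (1 / 2 : ℂ)) ^ bm

theorem neg_inv_im {τ : ℂ} : (-1 / τ).im = τ.im / Complex.normSq τ := by
  rw [neg_div, one_div, Complex.neg_im, Complex.inv_im]; ring

theorem integral_herm_gauss_neg_inv {τ : ℂ} (hτ : 0 < τ.im) (n : ℕ) (ξ : ℝ) :
    ∫ x : ℝ, (herm ((1 / (4 * π * (-1 / τ).im) : ℝ) : ℂ) n).eval (x : ℂ) *
      Complex.exp (π * I * (-1 / τ) * x ^ 2 -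
        2 * π * I * (-ξ : ℝ) * x) =
    τ ^ n * (herm ((1 / (4 * π * τ.im) : ℝ) : ℂ) n).eval (ξ : ℂ) *
      ((-I * τ) ^ (1 / 2 : ℂ) * Complex.exp (π * I * τ * ξ ^ 2)) := by
  have h0 : τ ≠ 0 := fun h => by simp [h] at hτ
  have hn : 0 < Complex.normSq τ := Complex.normSq_pos.2 h0
  have hτ' : 0 < (-1 / τ).im := by rw [neg_inv_im]; positivity
  have key := integral_herm_gauss ((1 / (4 * π * (-1 / τ).im) : ℝ) : ℂ) hτ' (-ξ) n
  have hc : ((1 / (4 * π * (-1 / τ).im) : ℝ) : ℂ) * (-1 / τ) ^ 2 -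
      I * (-1 / τ) / (2 * π) = ((1 / (4 * π * τ.im) : ℝ) : ℂ) := by
    rw [neg_inv_im]
    have h1 : (Complex.normSq τ : ℂ) = τ * conj τ := (Complex.mul_conj τ).symm
    have h2 : conj τ = τ - 2 * I * τ.im := by
      apply Complex.ext <;> simp; ring
    have h3 : (τ.im : ℂ) ≠ 0 := by exact_mod_cast hτ.ne'
    have h4 : (π : ℂ) ≠ 0 := by exact_mod_cast Real.pi_ne_zero
    push_cast
    rw [show (1 : ℂ) / (4 * π * (τ.im / Complex.normSq τ)) =
      Complex.normSq τ / (4 * π * τ.im) by field_simp, h1, h2]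
    field_simp
    ring
  rw [hc, inv_sqrt_neg_inv hτ] at key
  have h5 : (-1 / τ) ^ n ≠ 0 := pow_ne_zero _ (div_ne_zero (by norm_num) h0)
  refine mul_left_cancel₀ h5 (key.trans ?_)
  rw [show ((-ξ : ℝ) : ℂ) = -(ξ : ℂ) by push_cast; rfl, herm_eval_neg]
  rw [show -(π * I * (-(ξ : ℂ)) ^ 2 / (-1 / τ)) = π * I * τ * ξ ^ 2 by
    field_simp]
  rw [div_pow]
  field_simp

theorem gaussPoly_eq_sum (P : MvPolynomial (Fin bp) ℂ) (τ : ℂ) (x : QSpace bp bm) :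
    gaussPoly P τ x = ∑ α ∈ P.support, P.coeff α *
      ((∏ i, (herm ((1 / (4 * π * τ.im) : ℝ) : ℂ) (α i)).eval ((x.1 i : ℝ) : ℂ) *
        Complex.exp (π * I * τ * ((x.1 i : ℝ) : ℂ) ^ 2)) *
      ∏ j, Complex.exp (-(π * I * conj τ * ((x.2 j : ℝ) : ℂ) ^ 2))) := by
  have h1 : polyAt (heat τ.im P) x = MvPolynomial.eval (fun i => ((x.1 i : ℝ) : ℂ))
      (heatLin ((1 / (4 * π * τ.im) : ℝ) : ℂ) P) := by
    rw [polyAt, heat_eq_heatOp]; rfl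
  rw [gaussPoly, h1, eval_heatLin, Finset.sum_mul]
  refine Finset.sum_congr rfl fun α _ => ?_
  rw [mul_assoc, Finset.prod_mul_distrib, mul_assoc (∏ i, _), ← Complex.exp_sum,
    ← Complex.exp_sum, ← Complex.exp_add]
  congr 3
  rw [EuclideanSpace.real_norm_sq_eq, EuclideanSpace.real_norm_sq_eq]
  push_cast
  rw [Finset.sum_neg_distrib, ← Finset.mul_sum, ← Finset.mul_sum]
  ring

/-- The Fourier transform of a Gaussian times a heat polynomial. -/
theorem integral_gaussPoly {P : MvPolynomial (Fin bp) ℂ} {m : ℕ} (hP : P.IsHomogeneous m)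
    {τ : ℂ} (hτ : 0 < τ.im) (ξ : QSpace bp bm) :
    Integrable (fun s : Fin bp ⊕ Fin bm → ℝ => gaussPoly P (-1 / τ) (coordEquiv bp bm s) *
      ee (bil ξ (coordEquiv bp bm s) : ℝ)) ∧
    ∫ s : Fin bp ⊕ Fin bm → ℝ, gaussPoly P (-1 / τ) (coordEquiv bp bm s) *
      ee (bil ξ (coordEquiv bp bm s) : ℝ) = τ ^ m * gaussFactor bp bm τ * gaussPoly P τ ξ := by
  have h0 : τ ≠ 0 := fun h => by simp [h] at hτ
  have hn : 0 < Complex.normSq τ := Complex.normSq_pos.2 h0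
  have hτ' : 0 < (-1 / τ).im := by rw [neg_inv_im]; positivity
  have hcτ : 0 < (-conj τ).im := by simpa using hτ
  have hcτ' : -conj (-1 / τ) = -1 / (-conj τ) := by
    rw [map_div₀, map_neg, map_one]; field_simp
  set c' := ((1 / (4 * π * (-1 / τ).im) : ℝ) : ℂ) with hc'
  let f : (Fin bp →₀ ℕ) → Fin bp ⊕ Fin bm → ℝ → ℂ := fun α i => Sum.elim
    (fun i x => (herm c' (α i)).eval (x : ℂ) * Complex.exp (π * I * (-1 / τ) * x ^ 2 -
        2 * π * I * (-ξ.1 i : ℝ) * x))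
    (fun j x => (herm ((1 / (4 * π * (-1 / (-conj τ)).im) : ℝ) : ℂ) 0).eval (x : ℂ) *
      Complex.exp (π * I * (-1 / (-conj τ)) * x ^ 2 -
        2 * π * I * (-(-ξ.2 j) : ℝ) * x)) i
  have hint : ∀ α i, Integrable (f α i) := by
    rintro α (i | j)
    · exact integrable_herm_gauss _ hτ' _
    · exact integrable_herm_gauss _ (by rw [← hcτ', Complex.neg_im, Complex.conj_im, neg_neg]; exact hτ') _
  have hf : ∀ s : Fin bp ⊕ Fin bm → ℝ, gaussPoly P (-1 / τ) (coordEquiv bp bm s) *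
      ee (bil ξ (coordEquiv bp bm s) : ℝ) = ∑ α ∈ P.support, P.coeff α * ∏ i, f α i (s i) := by
    intro s
    have he : ee (bil ξ (coordEquiv bp bm s) : ℝ) =
        (∏ i, Complex.exp (-(2 * π * I * (-ξ.1 i : ℝ) * s (.inl i)))) *
        ∏ j, Complex.exp (-(2 * π * I * (-(-ξ.2 j) : ℝ) * s (.inr j))) := by
      rw [← Complex.exp_sum, ← Complex.exp_sum, ← Complex.exp_add, ee, bil_apply]
      congr 1
      simp only [PiLp.inner_apply, RCLike.inner_apply, conj_trivial, coordEquiv_fst,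
        coordEquiv_snd]
      push_cast
      rw [mul_sub, Finset.mul_sum, Finset.mul_sum, sub_eq_add_neg, ← Finset.sum_neg_distrib]
      congr 1 <;> exact Finset.sum_congr rfl fun i _ => by ring
    rw [gaussPoly_eq_sum, he, Finset.sum_mul]
    refine Finset.sum_congr rfl fun α _ => ?_
    rw [Fintype.prod_sum_type, mul_assoc, mul_mul_mul_comm, ← Finset.prod_mul_distrib,
      ← Finset.prod_mul_distrib]
    congr 3
    · refine funext fun i => ?_
      simp only [f, Sum.elim_inl, coordEquiv_fst]
      rw [mul_assoc, ← Complex.exp_add, sub_eq_add_neg]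
    · refine funext fun j => ?_
      simp only [f, Sum.elim_inr, sub_eq_add_neg, Complex.exp_add, herm, Polynomial.eval_one,
        one_mul]
      rw [← hcτ']
      congr 2
      rw [coordEquiv_snd]
      ring
  have hprod : ∀ α, Integrable (fun s : Fin bp ⊕ Fin bm → ℝ => ∏ i, f α i (s i)) volume :=
    fun α => Integrable.fintype_prod (hint α)
  simp_rw [hf]
  refine ⟨integrable_finsetSum _ fun α _ => (hprod α).const_mul _, ?_⟩
  rw [integral_finsetSum _ fun α _ => (hprod α).const_mul _,
    gaussPoly_eq_sum, Finset.mul_sum]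
  refine Finset.sum_congr rfl fun α hα => ?_
  have hdeg : ∑ i, α i = m := by
    have : α.degree = m := by
      by_contra h
      exact (MvPolynomial.mem_support_iff.1 hα) (hP.coeff_eq_zero h)
    rw [← this, Finsupp.degree_eq_sum]
  rw [integral_const_mul, integral_fintype_prod_volume_eq_prod, Fintype.prod_sum_type]
  have hl : ∀ i, ∫ x, f α (.inl i) x = τ ^ (α i) *
      (herm ((1 / (4 * π * τ.im) : ℝ) : ℂ) (α i)).eval ((ξ.1 i : ℝ) : ℂ) *
      ((-I * τ) ^ (1 / 2 : ℂ) * Complex.exp (π * I * τ * ((ξ.1 i : ℝ) : ℂ) ^ 2)) :=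
    fun i => integral_herm_gauss_neg_inv hτ (α i) (ξ.1 i)
  have hconj : (-I * -conj τ) ^ (1 / 2 : ℂ) =
      conj ((-I * τ) ^ (1 / 2 : ℂ)) := by
    have h2 : (-I * τ).arg ≠ π := by
      intro h
      rw [Complex.arg_eq_pi_iff] at h
      simp at h; linarith [h.1]
    have := Complex.cpow_conj (-I * τ) (1 / 2 : ℂ) h2
    rw [← Complex.conj_conj ((-I * -conj τ) ^ (1 / 2 : ℂ))]
    congr 1
    rw [show -I * -conj τ = conj (-I * τ) by simp,
      ← this]
    rw [map_div₀, map_one, map_ofNat]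
  have hr : ∀ j, ∫ x, f α (.inr j) x = conj ((-I * τ) ^ (1 / 2 : ℂ)) *
      Complex.exp (-(π * I * conj τ * ((ξ.2 j : ℝ) : ℂ) ^ 2)) := fun j => by
    have := integral_herm_gauss_neg_inv hcτ 0 (-ξ.2 j)
    rw [hconj] at this
    refine this.trans ?_
    simp [herm]
  simp only [hl, hr, Finset.prod_mul_distrib, Finset.prod_const, Finset.card_univ,
    Fintype.card_fin, Finset.prod_pow_eq_pow_sum, hdeg, gaussFactor]
  ring

/-! ### Poisson summation for lattices in quadratic spaces -/

theorem exists_norm_le_equiv {E F : Type*} [NormedAddCommGroup E] [NormedSpace ℝ E]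
    [FiniteDimensional ℝ E] [NormedAddCommGroup F] [NormedSpace ℝ F] (g : E ≃ₗ[ℝ] F) :
    ∃ c : ℝ, 0 < c ∧ ∀ x, c * ‖x‖ ≤ ‖g x‖ := by
  have := g.finiteDimensional
  obtain ⟨C, hC, h⟩ := (LinearMap.toContinuousLinearMap
    (g.symm : F →ₗ[ℝ] E)).isBoundedLinearMap.bound
  refine ⟨1 / C, by positivity, fun x => ?_⟩
  have := h (g x)
  simp at this
  rw [one_div, inv_mul_le_iff₀ hC]
  exact this

/-- Poisson summation over a lattice `L` in a quadratic space. -/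
theorem exists_lattice_poisson (L : Submodule ℤ (QSpace bp bm)) [DiscreteTopology L]
    [IsZLattice ℝ L] {g : QSpace bp bm ≃ₗ[ℝ] QSpace bp bm} (hg : IsIsom g) :
    ∃ C : ℝ, 0 < C ∧ ∀ h : QSpace bp bm → ℂ, Continuous h →
      Integrable (fun s => h (coordEquiv bp bm s)) →
      (∃ (M : ℝ) (j : ℕ), 0 ≤ M ∧ Module.finrank ℤ L < 2 * j ∧ ∀ z, ‖h z‖ ≤ M * wt j z) →
      (Summable fun w : dualLat L =>
        ∫ s, h (coordEquiv bp bm s) * ee (bil (g w) (coordEquiv bp bm s) : ℝ)) →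
      ∀ x, HasSum (fun w : dualLat L =>
        C * (∫ s, h (coordEquiv bp bm s) * ee (bil (g w) (coordEquiv bp bm s) : ℝ)) *
          ee ((-bil (w : QSpace bp bm) x : ℝ) : ℂ)) (∑' v : L, h (g (v + x))) := by
  obtain ⟨n, b, hb⟩ := exists_real_basis L
  subst hb
  set L := Submodule.span ℤ (Set.range b) with hL
  let e : (Fin n → ℝ) ≃ₗ[ℝ] (Fin bp ⊕ Fin bm → ℝ) :=
    b.equivFun.symm.trans (g.trans (coordEquiv bp bm).symm)
  obtain ⟨C, hC, hCe, hCi⟩ := exists_integral_comp_linearEquiv e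
  refine ⟨C, hC, fun h hc hi hM hs x => ?_⟩
  obtain ⟨M, j, hM0, hj, hM⟩ := hM
  let lat : (Fin n → ℤ) ≃ L := (b.restrictScalars ℤ).equivFun.symm.toEquiv
  have hlat : ∀ k : Fin n → ℤ, ((lat k : L) : QSpace bp bm) =
      b.equivFun.symm (fun i => (k i : ℝ)) := fun k => by
    simp only [lat, LinearEquiv.coe_toEquiv, Module.Basis.equivFun_symm_apply,
      AddSubmonoidClass.coe_finsetSum, Submodule.coe_smul, Module.Basis.restrictScalars_apply,
      Int.cast_smul_eq_zsmul]
  let db := (bil : LinearMap.BilinForm ℝ (QSpace bp bm)).dualBasis bil_nondegenerate b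
  have hdb : ∀ (c : Fin n → ℝ) (i : Fin n), bil (∑ i, c i • db i) (b i) = c i := fun c i => by
    rw [map_sum, LinearMap.sum_apply, Finset.sum_eq_single i]
    · simp [db, LinearMap.BilinForm.apply_dualBasis_left]
    · intro k _ hk
      simp [db, LinearMap.BilinForm.apply_dualBasis_left, hk.symm]
    · simp
  have hmem : ∀ k : Fin n → ℤ, ∑ i, (k i : ℝ) • db i ∈ dualLat L := fun k => by
    rw [mem_dualLat_iff]
    intro w hw
    obtain ⟨k', hk'⟩ := lat.surjective ⟨w, hw⟩
    have : w = b.equivFun.symm (fun i => (k' i : ℝ)) := by rw [← hlat, hk']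
    rw [this, Module.Basis.equivFun_symm_apply, map_sum]
    refine ⟨∑ i, k' i * k i, ?_⟩
    push_cast
    exact Finset.sum_congr rfl fun i _ => by rw [map_smul, smul_eq_mul, hdb]
  let dual : (Fin n → ℤ) ≃ dualLat L := Equiv.ofBijective (fun k => ⟨_, hmem k⟩) (by
    constructor
    · intro k k' hk
      ext i
      have h1 := congrArg (fun v : dualLat L => bil (v : QSpace bp bm) (b i)) hk
      simp only [hdb] at h1
      exact_mod_cast h1
    · rintro ⟨w, hw⟩
      have h1 : ∀ i, ∃ k : ℤ, bil w (b i) = k := fun i =>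
        dual_bil_int hw (Submodule.subset_span ⟨i, rfl⟩)
      choose k hk using h1
      refine ⟨k, Subtype.ext ?_⟩
      have h2 : ∀ y, bil (∑ i, (k i : ℝ) • db i - w) y = 0 := by
        intro y
        rw [← b.sum_repr y, map_sum]
        refine Finset.sum_eq_zero fun i _ => ?_
        rw [map_smul, map_sub, LinearMap.sub_apply, hdb, hk, sub_self, smul_zero]
      exact sub_eq_zero.1 (eq_zero_of_bil _ h2))
  have hdual : ∀ (k : Fin n → ℤ) (t : Fin n → ℝ),
      chr k t = ee (bil (dual k : QSpace bp bm) (b.equivFun.symm t) : ℝ) := fun k t => by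
    rw [chr, Module.Basis.equivFun_symm_apply, map_sum]
    congr 2
    refine Finset.sum_congr rfl fun i _ => ?_
    rw [map_smul, smul_eq_mul, mul_comm]
    exact congrArg (t i * ·) (hdb (fun i => (k i : ℝ)) i).symm
  have hgc : Continuous g := g.toContinuousLinearEquiv.continuous
  have hbc : Continuous b.equivFun.symm := b.equivFun.symm.toContinuousLinearEquiv.continuous
  set F : (Fin n → ℝ) → ℂ := fun t => h (g (b.equivFun.symm t + x)) with hF
  have hFe : ∀ t, F t = h (coordEquiv bp bm (e t + (coordEquiv bp bm).symm (g x))) := fun t => by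
    simp [hF, e]
  have hFi : Integrable F := by
    have := hCi _ (hi.comp_add_right ((coordEquiv bp bm).symm (g x)))
    exact this.congr (ae_of_all _ fun t => (hFe t).symm)
  have hcoef : ∀ k : Fin n → ℤ, ∫ t, F t * chr k t =
      C * (∫ s, h (coordEquiv bp bm s) * ee (bil (g (dual k)) (coordEquiv bp bm s) : ℝ)) *
        ee ((-bil (dual k : QSpace bp bm) x : ℝ) : ℂ) := by
    intro k
    have h1 : ∀ t, F t * chr k t = (fun s => h (coordEquiv bp bm s) *
        ee (bil (g (dual k)) (coordEquiv bp bm s) : ℝ) *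
        ee ((-bil (dual k : QSpace bp bm) x : ℝ) : ℂ)) (e t + (coordEquiv bp bm).symm (g x)) := by
      intro t
      simp only [hFe, hdual]
      rw [mul_assoc, ← ee_add, ← Complex.ofReal_add]
      congr 3
      have hg' : ∀ x y, bil (g x) (g y) = bil x y := hg
      simp only [e, map_add, LinearEquiv.trans_apply, LinearEquiv.apply_symm_apply, hg']
      ring
    simp_rw [h1]
    rw [hCe (fun s => (fun s => h (coordEquiv bp bm s) *
        ee (bil (g (dual k)) (coordEquiv bp bm s) : ℝ) *
        ee ((-bil (dual k : QSpace bp bm) x : ℝ) : ℂ)) (s + (coordEquiv bp bm).symm (g x))),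
      integral_add_right_eq_self (μ := volume) (fun s => h (coordEquiv bp bm s) *
        ee (bil (g (dual k)) (coordEquiv bp bm s) : ℝ) *
        ee ((-bil (dual k : QSpace bp bm) x : ℝ) : ℂ)), integral_mul_const, mul_assoc]
  have hbd : ∀ R : ℝ, ∃ w : (Fin n → ℤ) → ℝ, Summable w ∧
      ∀ k t, ‖t‖ ≤ R → ‖F (t + fun i => (k i : ℝ))‖ ≤ w k := by
    intro R
    obtain ⟨c, hc0, hcg⟩ := exists_norm_le_equiv g
    obtain ⟨D, hD, hDb⟩ := (LinearMap.toContinuousLinearMap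
      (b.equivFun.symm : (Fin n → ℝ) →ₗ[ℝ] QSpace bp bm)).isBoundedLinearMap.bound
    have hsum := ((summable_wt L hj).comp_injective lat.injective).mul_left
      (M * ((1 + 1 / c ^ 2) ^ j * (2 ^ j * (1 + (D * R + ‖x‖) ^ 2) ^ j)))
    refine ⟨_, hsum, fun k t ht => ?_⟩
    have h1 : wt j (g (b.equivFun.symm (t + fun i => (k i : ℝ)) + x)) ≤
        (1 + 1 / c ^ 2) ^ j * wt j (b.equivFun.symm (t + fun i => (k i : ℝ)) + x) :=
      wt_scale j hc0 (hcg _)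
    have h2 : b.equivFun.symm (t + fun i => (k i : ℝ)) + x =
        ((lat k : L) : QSpace bp bm) + (b.equivFun.symm t + x) := by
      rw [hlat, map_add]; abel
    have h3 := wt_shift j ((lat k : L) : QSpace bp bm) (b.equivFun.symm t + x)
    have h4 : ‖b.equivFun.symm t + x‖ ≤ D * R + ‖x‖ :=
      (norm_add_le _ _).trans (add_le_add_left ((hDb t).trans (by gcongr)) _)
    refine (hM _).trans ?_
    rw [mul_assoc]
    refine mul_le_mul_of_nonneg_left (h1.trans ?_) hM0
    rw [mul_assoc]
    refine mul_le_mul_of_nonneg_left ?_ (by positivity)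
    rw [h2]
    refine h3.trans (mul_le_mul_of_nonneg_right ?_ (wt_pos _ _).le)
    gcongr
  have hsum : Summable fun k : Fin n → ℤ => ∫ t, F t * chr k t := by
    simp_rw [hcoef]
    refine Summable.of_norm ?_
    have := ((dual.summable_iff.2 hs).mul_left (C : ℂ)).norm
    refine this.congr fun k => ?_
    simp [norm_ee_ofReal, -Complex.ofReal_neg]
  have key := hasSum_poisson (F := F) (by fun_prop) hFi hbd
    ((Equiv.neg (Fin n → ℤ)).summable_iff.2 hsum)
  rw [← (Equiv.neg (Fin n → ℤ)).hasSum_iff] at key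
  simp only [Function.comp_def, Equiv.neg_apply, neg_neg, hcoef] at key
  have h5 : ∑' k : Fin n → ℤ, F (fun i => (k i : ℝ)) = ∑' v : L, h (g (v + x)) := by
    rw [← lat.tsum_eq (fun v : L => h (g (v + x)))]
    exact tsum_congr fun k => by rw [hlat]
  rw [h5] at key
  exact (dual.hasSum_iff).1 key

section

/-! ### Theta functions with characteristics -/

/-- The vectors of the dual lattice in a given class. -/
def coset (L : Submodule ℤ (QSpace bp bm)) (σ : Disc L) : Set (QSpace bp bm) :=
  {v | v ∈ dualLat L ∧ cls L v = σ}

/-- A summand of a theta function with characteristics. -/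
def thetaTerm (g : QSpace bp bm ≃ₗ[ℝ] QSpace bp bm) (P : MvPolynomial (Fin bp) ℂ) (τ : ℂ)
    (A B v : QSpace bp bm) : ℂ :=
  gaussPoly P τ (g (v + B)) * ee ((bil (v + (1 / 2 : ℝ) • B) A : ℝ) : ℂ)

/-- The theta function with characteristics `A, B`. -/
def thetaChar (L : Submodule ℤ (QSpace bp bm)) (g : QSpace bp bm ≃ₗ[ℝ] QSpace bp bm)
    (P : MvPolynomial (Fin bp) ℂ) (τ : ℂ) (A B : QSpace bp bm) (σ : Disc L) : ℂ :=
  ((τ.im ^ ((bm : ℝ) / 2) : ℝ) : ℂ) * ∑' v : coset L σ, thetaTerm g P τ A B v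

theorem tsum_dualLat_eq {L : Submodule ℤ (QSpace bp bm)} [Fintype (Disc L)] {f : QSpace bp bm → ℂ}
    (hf : Summable fun v : dualLat L => f v) :
    ∑' v : dualLat L, f v = ∑ σ : Disc L, ∑' v : coset L σ, f v := by
  have h1 : ∀ σ, Summable ((coset L σ).indicator f) := fun σ =>
    summable_subtype_iff_indicator.1 (hf.comp_injective
      (i := fun v : coset L σ => (⟨v, v.2.1⟩ : dualLat L)) fun v w h =>
        Subtype.ext (by simpa using h))
  have h2 : ∑' v : dualLat L, f v = ∑' v, (dualLat L : Set (QSpace bp bm)).indicator f v :=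
    tsum_subtype (dualLat L : Set (QSpace bp bm)) f
  rw [h2]
  simp_rw [tsum_subtype]
  rw [← Summable.tsum_finsetSum fun σ _ => h1 σ]
  refine tsum_congr fun v => ?_
  by_cases hv : v ∈ dualLat L
  · rw [Set.indicator_of_mem (show v ∈ (dualLat L : Set (QSpace bp bm)) from hv),
      Finset.sum_eq_single (cls L v)]
    · rw [Set.indicator_of_mem]; exact ⟨hv, rfl⟩
    · intro σ _ hσ
      exact Set.indicator_of_notMem (fun h => hσ h.2.symm) _
    · simp
  · rw [Set.indicator_of_notMem (show v ∉ (dualLat L : Set (QSpace bp bm)) from hv)]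
    exact (Finset.sum_eq_zero fun σ _ => Set.indicator_of_notMem (fun h => hv h.1) _).symm

section Bounds

theorem norm_thetaTerm_le (g : QSpace bp bm ≃ₗ[ℝ] QSpace bp bm) (P : MvPolynomial (Fin bp) ℂ)
    (j : ℕ) : ∃ (C : ℝ) (d : ℕ), 0 < C ∧ ∀ τ : ℂ, 0 < τ.im → ∀ A B v : QSpace bp bm,
      ‖thetaTerm g P τ A B v‖ ≤ C * (1 + 1 / τ.im) ^ d * (1 + ‖B‖ ^ 2) ^ j * wt j v := by
  obtain ⟨c, hc, hcg⟩ := exists_norm_le_equiv g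
  obtain ⟨C, d, hC, h⟩ := norm_gaussPoly_le P j hc
  refine ⟨C * 2 ^ j, d, by positivity, fun τ hτ A B v => ?_⟩
  rw [thetaTerm, norm_mul, norm_ee_ofReal, mul_one]
  refine (h τ hτ _ _ (hcg (v + B))).trans ?_
  calc _ ≤ C * (1 + 1 / τ.im) ^ d * (2 ^ j * (1 + ‖B‖ ^ 2) ^ j * wt j v) := by
        gcongr; exact wt_shift j v B
    _ = _ := by ring

variable (L : Submodule ℤ (QSpace bp bm)) [DiscreteTopology L] [IsZLattice ℝ L]

theorem summable_wt_coset {j : ℕ} (hj : Module.finrank ℤ (dualLat L) < 2 * j) (σ : Disc L) :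
    Summable fun v : coset L σ => wt j (v : QSpace bp bm) :=
  (summable_wt (dualLat L) hj).comp_injective
    (i := fun v : coset L σ => (⟨v, v.2.1⟩ : dualLat L)) fun v w h =>
      Subtype.ext (by simpa using h)

theorem summable_thetaTerm (g : QSpace bp bm ≃ₗ[ℝ] QSpace bp bm) (P : MvPolynomial (Fin bp) ℂ)
    {τ : ℂ} (hτ : 0 < τ.im) (A B : QSpace bp bm) :
    Summable fun v : dualLat L => thetaTerm g P τ A B v := by
  obtain ⟨C, d, -, h⟩ := norm_thetaTerm_le g P (Module.finrank ℤ (dualLat L) + 1)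
  exact Summable.of_norm_bounded ((summable_wt (dualLat L)
    (j := Module.finrank ℤ (dualLat L) + 1) (by omega)).mul_left _) fun v => h τ hτ A B v

theorem summable_thetaTerm_coset (g : QSpace bp bm ≃ₗ[ℝ] QSpace bp bm)
    (P : MvPolynomial (Fin bp) ℂ) {τ : ℂ} (hτ : 0 < τ.im) (A B : QSpace bp bm) (σ : Disc L) :
    Summable fun v : coset L σ => thetaTerm g P τ A B v :=
  (summable_thetaTerm L g P hτ A B).comp_injective
    (i := fun v : coset L σ => (⟨v, v.2.1⟩ : dualLat L)) fun v w h =>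
      Subtype.ext (by simpa using h)

theorem norm_thetaChar_le (g : QSpace bp bm ≃ₗ[ℝ] QSpace bp bm) (P : MvPolynomial (Fin bp) ℂ) :
    ∃ (C : ℝ) (d : ℕ), 0 < C ∧ ∀ τ : ℂ, 0 < τ.im → ∀ (A B : QSpace bp bm) (σ : Disc L),
      ‖thetaChar L g P τ A B σ‖ ≤
        C * τ.im ^ ((bm : ℝ) / 2) * (1 + 1 / τ.im) ^ d * (1 + ‖B‖ ^ 2) ^ d := by
  set j := Module.finrank ℤ (dualLat L) + 1 with hj
  obtain ⟨C, d, hC, h⟩ := norm_thetaTerm_le g P j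
  have hs := summable_wt (dualLat L) (j := j) (by omega)
  set W := ∑' v : dualLat L, wt j (v : QSpace bp bm) with hW
  have hW0 : 0 ≤ W := tsum_nonneg fun v => (wt_pos _ _).le
  refine ⟨C * (W + 1), d + j, by positivity, fun τ hτ A B σ => ?_⟩
  have hsσ := summable_wt_coset L (j := j) (by omega) σ
  have hle : ∑' v : coset L σ, wt j (v : QSpace bp bm) ≤ W :=
    Summable.tsum_le_tsum_of_inj (fun v : coset L σ => (⟨v, v.2.1⟩ : dualLat L))
      (fun v w h => Subtype.ext (by simpa using h)) (fun _ _ => (wt_pos _ _).le)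
      (fun _ => le_rfl) hsσ hs
  have h1 : ‖∑' v : coset L σ, thetaTerm g P τ A B v‖ ≤
      C * (1 + 1 / τ.im) ^ d * (1 + ‖B‖ ^ 2) ^ j * W := by
    refine (tsum_of_norm_bounded (hsσ.hasSum.mul_left
      (C * (1 + 1 / τ.im) ^ d * (1 + ‖B‖ ^ 2) ^ j)) fun v => h τ hτ A B v).trans ?_
    gcongr
  have hy : (1 : ℝ) ≤ 1 + 1 / τ.im := by
    have : 0 < 1 / τ.im := by positivity
    linarith
  have hB : (1 : ℝ) ≤ 1 + ‖B‖ ^ 2 := by nlinarith [sq_nonneg ‖B‖]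
  rw [thetaChar, norm_mul, Complex.norm_real, Real.norm_of_nonneg (by positivity)]
  calc _ ≤ τ.im ^ ((bm : ℝ) / 2) * (C * (1 + 1 / τ.im) ^ (d + j) * (1 + ‖B‖ ^ 2) ^ (d + j) *
        (W + 1)) := by
        refine mul_le_mul_of_nonneg_left (h1.trans ?_) (by positivity)
        gcongr <;> first | assumption | omega | linarith
    _ = _ := by ring

theorem continuousOn_thetaChar (g : QSpace bp bm ≃ₗ[ℝ] QSpace bp bm)
    (P : MvPolynomial (Fin bp) ℂ) (σ : Disc L) :
    ContinuousOn (fun p : ℂ × QSpace bp bm × QSpace bp bm => thetaChar L g P p.1 p.2.1 p.2.2 σ)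
      {p | 0 < p.1.im} := by
  unfold thetaChar
  have hgc : Continuous g := g.toContinuousLinearEquiv.continuous
  refine ContinuousOn.mul ?_ ?_
  · exact Complex.continuous_ofReal.comp_continuousOn
      ((by fun_prop : Continuous fun p : ℂ × QSpace bp bm × QSpace bp bm => p.1.im).continuousOn.rpow_const
        fun p hp => Or.inl (ne_of_gt hp))
  · intro p hp
    have hp' : 0 < p.1.im := hp
    refine ContinuousAt.continuousWithinAt ?_
    set U : Set (ℂ × QSpace bp bm × QSpace bp bm) :=
      {r | p.1.im / 2 < r.1.im ∧ ‖r.2.2‖ < ‖p.2.2‖ + 1} with hU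
    have hU1 : IsOpen {r : ℂ × QSpace bp bm × QSpace bp bm | p.1.im / 2 < r.1.im} :=
      isOpen_lt continuous_const (by fun_prop)
    have hU2 : IsOpen {r : ℂ × QSpace bp bm × QSpace bp bm | ‖r.2.2‖ < ‖p.2.2‖ + 1} :=
      isOpen_lt (by fun_prop) continuous_const
    have hUo : IsOpen U := hU1.inter hU2
    obtain ⟨C, d, hC, h⟩ := norm_thetaTerm_le g P (Module.finrank ℤ (dualLat L) + 1)
    set j := Module.finrank ℤ (dualLat L) + 1 with hj
    have hc : ContinuousOn (fun p : ℂ × QSpace bp bm × QSpace bp bm =>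
        ∑' v : coset L σ, thetaTerm g P p.1 p.2.1 p.2.2 v) U := by
      refine continuousOn_tsum (u := fun v : coset L σ => C * (1 + 1 / (p.1.im / 2)) ^ d *
        (1 + (‖p.2.2‖ + 1) ^ 2) ^ j * wt j (v : QSpace bp bm)) (fun v => ?_)
        ((summable_wt_coset L (by omega) σ).mul_left _) fun v r hr => ?_
      · refine ContinuousOn.mul ?_ (continuous_ee.comp (Complex.continuous_ofReal.comp
          (continuous_bil (by fun_prop) (by fun_prop)))).continuousOn
        refine (continuousOn_gaussPoly P).comp (f := fun r : ℂ × QSpace bp bm × QSpace bp bm =>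
          (r.1, g (v + r.2.2))) (Continuous.continuousOn (by fun_prop)) fun r hr => ?_
        exact lt_trans (by positivity) hr.1
      · have h0 : 0 < r.1.im := lt_trans (by positivity) hr.1
        refine (h r.1 h0 _ _ v).trans (mul_le_mul_of_nonneg_right ?_ (wt_pos _ _).le)
        have h1 := hr.1.le
        have h2 := hr.2.le
        gcongr
    exact hc.continuousAt (hUo.mem_nhds ⟨by linarith, by linarith⟩)

end Bounds

end

section

section Laws
variable (L : Submodule ℤ (QSpace bp bm)) [DiscreteTopology L] [IsZLattice ℝ L]

omit [DiscreteTopology L] [IsZLattice ℝ L] in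
theorem thetaChar_add_one (hL : IsEven L) {g : QSpace bp bm ≃ₗ[ℝ] QSpace bp bm} (hg : IsIsom g)
    (P : MvPolynomial (Fin bp) ℂ) (τ : ℂ) (A B : QSpace bp bm) :
    thetaChar L g P (τ + 1) (A - B) B = weilT L (thetaChar L g P τ A B) := by
  funext σ
  rw [weilT, thetaChar, thetaChar, mul_left_comm (ee _)]
  congr 1
  · simp
  · rw [← tsum_mul_left]
    refine tsum_congr fun v => ?_
    rw [thetaTerm, thetaTerm, gaussPoly_add_one, ← q_isom hg, mul_assoc, ← ee_add,
      mul_left_comm (ee _), ← ee_add, ← Complex.ofReal_add, ← Complex.ofReal_add]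
    congr 1
    refine ee_congr ?_
    obtain ⟨n, hn⟩ := q_congr hL v.2.1 (rep_sub_mem v.2.1 v.2.2)
    refine ⟨-n, ?_⟩
    rw [Int.cast_neg, ← hn, q_add]
    have : bil ((v : QSpace bp bm) + (1 / 2 : ℝ) • B) (A - B) =
        bil ((v : QSpace bp bm) + (1 / 2 : ℝ) • B) A - bil (v : QSpace bp bm) B - q B := by
      simp only [map_sub, map_add, LinearMap.add_apply, map_smul, LinearMap.smul_apply, smul_eq_mul,
        bil_self]
      ring
    rw [this]
    ring

omit [DiscreteTopology L] [IsZLattice ℝ L] in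
theorem thetaChar_shift (g : QSpace bp bm ≃ₗ[ℝ] QSpace bp bm)
    (P : MvPolynomial (Fin bp) ℂ) (τ : ℂ) (A B : QSpace bp bm) {a b : QSpace bp bm}
    (ha : a ∈ dualLat L) (hb : b ∈ dualLat L) (σ : Disc L) :
    thetaChar L g P τ (A + a) (B + b) σ =
      ee (((bil B a - bil b A - bil b a) / 2 + bil (rep (σ + cls L b)) a : ℝ) : ℂ) *
        thetaChar L g P τ A B (σ + cls L b) := by
  rw [thetaChar, thetaChar, mul_left_comm (ee _)]
  congr 1
  rw [← tsum_mul_left]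
  let e : coset L σ ≃ coset L (σ + cls L b) :=
    { toFun := fun v => ⟨v + b, add_mem v.2.1 hb, by rw [cls_add v.2.1 hb, v.2.2]⟩
      invFun := fun v => ⟨v - b, sub_mem v.2.1 hb, by
        have h1 := cls_add (sub_mem v.2.1 hb) hb
        rw [sub_add_cancel, v.2.2] at h1
        exact (add_right_cancel h1).symm⟩
      left_inv := fun v => by simp
      right_inv := fun v => by simp }
  refine (tsum_congr fun v => ?_).trans (e.tsum_eq _)
  have h1 : (v : QSpace bp bm) + (B + b) = ((e v : coset L (σ + cls L b)) : QSpace bp bm) + B := by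
    simp [e]; abel
  rw [thetaTerm, thetaTerm, h1, mul_left_comm, ← ee_add, ← Complex.ofReal_add]
  congr 1
  refine ee_congr ?_
  have h2 : rep (σ + cls L b) - ((e v : coset L (σ + cls L b)) : QSpace bp bm) ∈ L :=
    rep_sub_mem (e v).2.1 (e v).2.2
  obtain ⟨n, hn⟩ := dual_bil_int ha h2
  refine ⟨-n, ?_⟩
  rw [Int.cast_neg, ← hn, bil_comm a]
  have h3 : ((e v : coset L (σ + cls L b)) : QSpace bp bm) = v + b := rfl
  simp only [h3, map_sub, map_add, LinearMap.add_apply, LinearMap.sub_apply, map_smul,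
    LinearMap.smul_apply, smul_eq_mul]
  ring

theorem exists_tsum_gaussPoly {g : QSpace bp bm ≃ₗ[ℝ] QSpace bp bm}
    (hg : IsIsom g) : ∃ C : ℝ, 0 < C ∧ ∀ (P : MvPolynomial (Fin bp) ℂ) (m : ℕ),
      P.IsHomogeneous m → ∀ τ : ℂ, 0 < τ.im → ∀ x B : QSpace bp bm,
      ∑' v : L, gaussPoly P (-1 / τ) (g (v + x)) * ee ((bil ((v : QSpace bp bm) + x) B : ℝ) : ℂ) =
        C * (τ ^ m * gaussFactor bp bm τ) * ∑' w : dualLat L, gaussPoly P τ (g (w + B)) *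
          ee ((-bil (w : QSpace bp bm) x : ℝ) : ℂ) := by
  obtain ⟨C, hC, key⟩ := exists_lattice_poisson L hg
  refine ⟨C, hC, fun P m hP τ hτ x B => ?_⟩
  have h0 : τ ≠ 0 := fun h => by simp [h] at hτ
  have hn : 0 < Complex.normSq τ := Complex.normSq_pos.2 h0
  have hτ' : 0 < (-1 / τ).im := by rw [neg_inv_im]; positivity
  have hg' : ∀ x y, bil (g x) (g y) = bil x y := hg
  have hft : ∀ w : QSpace bp bm, ∫ s : Fin bp ⊕ Fin bm → ℝ,
        gaussPoly P (-1 / τ) (coordEquiv bp bm s) * ee (bil (coordEquiv bp bm s) (g B) : ℝ) *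
        ee (bil (g w) (coordEquiv bp bm s) : ℝ) =
      τ ^ m * gaussFactor bp bm τ * gaussPoly P τ (g (w + B)) := by
    intro w
    rw [← (integral_gaussPoly hP hτ (g (w + B))).2]
    refine integral_congr_ae (ae_of_all _ fun s => ?_)
    simp only
    rw [mul_assoc, ← ee_add, ← Complex.ofReal_add, map_add, map_add, LinearMap.add_apply,
      bil_comm _ (g B), add_comm]
  have hint : Integrable (fun s : Fin bp ⊕ Fin bm → ℝ =>
      gaussPoly P (-1 / τ) (coordEquiv bp bm s) * ee (bil (coordEquiv bp bm s) (g B) : ℝ)) :=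
    (integral_gaussPoly hP hτ (g B)).1.congr (ae_of_all _ fun s => by
      simp only; rw [bil_comm])
  have hsum := summable_thetaTerm L g P hτ 0 B
  have hcont : Continuous fun z : QSpace bp bm => gaussPoly P (-1 / τ) z * ee (bil z (g B) : ℝ) := by
    refine Continuous.mul ?_ (continuous_ee.comp (Complex.continuous_ofReal.comp
      (continuous_bil continuous_id continuous_const)))
    exact (continuousOn_gaussPoly P).comp_continuous (f := fun z => (-1 / τ, z))
      (by fun_prop) fun z => hτ'
  have hdecay : ∃ (M : ℝ) (j : ℕ), 0 ≤ M ∧ Module.finrank ℤ L < 2 * j ∧ ∀ z : QSpace bp bm,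
      ‖gaussPoly P (-1 / τ) z * ee (bil z (g B) : ℝ)‖ ≤ M * wt j z := by
    obtain ⟨C', d, hC', h⟩ := norm_gaussPoly_le P (Module.finrank ℤ L + 1) one_pos
    refine ⟨C' * (1 + 1 / (-1 / τ).im) ^ d, Module.finrank ℤ L + 1, by positivity, by omega,
      fun z => ?_⟩
    rw [norm_mul, norm_ee_ofReal, mul_one]
    exact h _ hτ' z z (by simp)
  have hs : Summable fun w : dualLat L => ∫ s : Fin bp ⊕ Fin bm → ℝ,
        gaussPoly P (-1 / τ) (coordEquiv bp bm s) * ee (bil (coordEquiv bp bm s) (g B) : ℝ) *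
        ee (bil (g w) (coordEquiv bp bm s) : ℝ) := by
    have h1 : Summable fun w : dualLat L => gaussPoly P τ (g (w + B)) := by
      refine Summable.of_norm (hsum.norm.congr fun w => ?_)
      rw [thetaTerm, norm_mul, norm_ee_ofReal, mul_one]
    exact (h1.mul_left (τ ^ m * gaussFactor bp bm τ)).congr fun w => (hft w).symm
  have hk := (key _ hcont hint hdecay hs x).tsum_eq
  simp_rw [hft, hg'] at hk
  rw [← hk, ← tsum_mul_left]
  exact tsum_congr fun w => by ring

theorem exists_thetaChar_neg_inv (hL : IsEven L) [Fintype (Disc L)]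
    {g : QSpace bp bm ≃ₗ[ℝ] QSpace bp bm}
    (hg : IsIsom g) : ∃ C : ℝ, 0 < C ∧ ∀ (P : MvPolynomial (Fin bp) ℂ) (m : ℕ),
      P.IsHomogeneous m → ∀ τ : ℂ, 0 < τ.im → ∀ (A B : QSpace bp bm) (σ' : Disc L),
      thetaChar L g P (-1 / τ) B (-A) σ' =
        C * (τ ^ m * gaussFactor bp bm τ * ((Complex.normSq τ ^ (-((bm : ℝ) / 2)) : ℝ) : ℂ)) *
          ∑ σ : Disc L, ee ((-bil (rep σ) (rep σ') : ℝ) : ℂ) * thetaChar L g P τ A B σ := by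
  obtain ⟨C, hC, key⟩ := exists_tsum_gaussPoly L hg
  refine ⟨C, hC, fun P m hP τ hτ A B σ' => ?_⟩
  have h0 : τ ≠ 0 := fun h => by simp [h] at hτ
  have hn : 0 < Complex.normSq τ := Complex.normSq_pos.2 h0
  have hsum := summable_thetaTerm L g P hτ A B
  have h5 := key P m hP τ hτ (rep σ' - A) B
  rw [thetaChar, neg_inv_im, Real.div_rpow hτ.le hn.le]
  have hsplit : ∑' v : coset L σ', thetaTerm g P (-1 / τ) B (-A) v =
      ee ((bil A B / 2 : ℝ) : ℂ) * ∑' v : L, gaussPoly P (-1 / τ) (g (v + (rep σ' - A))) *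
        ee (bil ((v : QSpace bp bm) + (rep σ' - A)) B : ℝ) := by
    let e : L ≃ coset L σ' :=
      { toFun := fun v => ⟨v + rep σ', add_mem (le_dualLat hL v.2) (rep_mem _), by
          conv_rhs => rw [← cls_rep σ']
          rw [cls_eq_iff (add_mem (le_dualLat hL v.2) (rep_mem _)) (rep_mem _)]
          simp⟩
        invFun := fun v => ⟨v - rep σ', by
          rw [← neg_sub]; exact neg_mem (rep_sub_mem v.2.1 v.2.2)⟩
        left_inv := fun v => by simp
        right_inv := fun v => by simp }
    rw [← tsum_mul_left]
    refine (e.tsum_eq _).symm.trans (tsum_congr fun v => ?_)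
    have h1 : ((e v : coset L σ') : QSpace bp bm) = v + rep σ' := rfl
    rw [thetaTerm, h1, mul_left_comm, ← ee_add, ← Complex.ofReal_add,
      show (v : QSpace bp bm) + rep σ' + -A = v + (rep σ' - A) by abel]
    congr 3
    simp only [map_sub, map_add, LinearMap.add_apply, LinearMap.sub_apply, map_smul,
      LinearMap.smul_apply, smul_eq_mul, map_neg, LinearMap.neg_apply, smul_neg]
    ring
  have hdual : ∀ w : dualLat L,
      gaussPoly P τ (g (w + B)) * ee ((-bil (w : QSpace bp bm) (rep σ' - A) : ℝ) : ℂ) =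
      ee ((-(bil A B / 2) : ℝ) : ℂ) *
        (thetaTerm g P τ A B w * ee ((-bil (w : QSpace bp bm) (rep σ') : ℝ) : ℂ)) := by
    intro w
    have h1 : ee ((-bil (w : QSpace bp bm) (rep σ' - A) : ℝ) : ℂ) =
        ee ((-(bil A B / 2) : ℝ) : ℂ) * ee ((bil ((w : QSpace bp bm) + (1 / 2 : ℝ) • B) A : ℝ) : ℂ) *
          ee ((-bil (w : QSpace bp bm) (rep σ') : ℝ) : ℂ) := by
      rw [← ee_add, ← ee_add, ← Complex.ofReal_add, ← Complex.ofReal_add]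
      congr 2
      simp only [map_sub, map_add, LinearMap.add_apply, map_smul,
        LinearMap.smul_apply, smul_eq_mul, bil_comm A B]
      ring
    rw [h1, thetaTerm]
    ring
  have hS : ∑' w : dualLat L, thetaTerm g P τ A B w *
      ee ((-bil (w : QSpace bp bm) (rep σ') : ℝ) : ℂ) =
      ∑ σ : Disc L, ee ((-bil (rep σ) (rep σ') : ℝ) : ℂ) *
        ∑' v : coset L σ, thetaTerm g P τ A B v := by
    rw [tsum_dualLat_eq (f := fun w => thetaTerm g P τ A B w *
      ee ((-bil (w : QSpace bp bm) (rep σ') : ℝ) : ℂ))]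
    · refine Finset.sum_congr rfl fun σ _ => ?_
      rw [← tsum_mul_left]
      refine tsum_congr fun v => ?_
      rw [mul_comm]
      congr 1
      have := ee_bil_congr v.2.1 (rep_mem σ) (rep_mem σ') (rep_mem σ')
        (v.2.2.trans (cls_rep σ).symm) rfl
      rw [Complex.ofReal_neg, ee_neg, this, ← ee_neg, Complex.ofReal_neg]
    · exact Summable.of_norm (hsum.norm.congr fun w => by
        rw [norm_mul, norm_ee_ofReal, mul_one])
  simp_rw [hdual] at h5
  rw [tsum_mul_left, hS] at h5
  rw [hsplit, h5, Real.rpow_neg hn.le]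
  simp only [thetaChar]
  have h6 : ee ((bil A B / 2 : ℝ) : ℂ) * ee ((-(bil A B / 2) : ℝ) : ℂ) = 1 := by
    rw [← ee_add, ← Complex.ofReal_add, add_neg_cancel, Complex.ofReal_zero, ee_zero]
  have h7 : ∀ σ, ee ((-bil (rep σ) (rep σ') : ℝ) : ℂ) * (((τ.im ^ ((bm : ℝ) / 2) : ℝ) : ℂ) *
      ∑' v : coset L σ, thetaTerm g P τ A B v) = ((τ.im ^ ((bm : ℝ) / 2) : ℝ) : ℂ) *
      (ee ((-bil (rep σ) (rep σ') : ℝ) : ℂ) * ∑' v : coset L σ, thetaTerm g P τ A B v) :=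
    fun σ => mul_left_comm _ _ _
  simp_rw [h7]
  rw [← Finset.mul_sum]
  rw [Complex.ofReal_div, Complex.ofReal_inv]
  linear_combination (((τ.im ^ ((bm : ℝ) / 2) : ℝ) : ℂ) / ((Complex.normSq τ ^ ((bm : ℝ) / 2) : ℝ) : ℂ) *
    (C * (τ ^ m * gaussFactor bp bm τ)) * ∑ σ : Disc L, ee ((-bil (rep σ) (rep σ') : ℝ) : ℂ) *
        ∑' v : coset L σ, thetaTerm g P τ A B v) * h6

end Laws

end

section

theorem log_neg_I_mul {τ : ℂ} (hτ : 0 < τ.im) :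
    Complex.log (-I * τ) = Complex.log τ - π / 2 * I := by
  have h0 : τ ≠ 0 := fun h => by simp [h] at hτ
  have h1 : -I * τ = Complex.exp (Complex.log τ - π / 2 * I) := by
    rw [Complex.exp_sub, Complex.exp_log h0, Complex.exp_pi_div_two_mul_I, div_eq_mul_inv,
      Complex.inv_I]; ring
  have h2 : 0 < τ.arg := lt_of_le_of_ne (Complex.arg_nonneg_iff.2 hτ.le) fun h => by
    have := Complex.arg_eq_zero_iff.1 h.symm
    linarith [this.2]
  have h3 := Complex.arg_le_pi τ
  rw [h1, Complex.log_exp]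
  · simp [Complex.log_im]; linarith [Real.pi_pos]
  · simp [Complex.log_im]; linarith [Real.pi_pos]

theorem gaussFactor_eq (m : ℕ) {τ : ℂ} (hτ : 0 < τ.im) {k : ℝ} (hk : k = m + ((bp : ℝ) - bm) / 2) :
    τ ^ m * gaussFactor bp bm τ * ((Complex.normSq τ ^ (-((bm : ℝ) / 2)) : ℝ) : ℂ) =
      τ ^ (k : ℂ) * I ^ ((((bm : ℝ) - bp) / 2 : ℝ) : ℂ) := by
  have h0 : τ ≠ 0 := fun h => by simp [h] at hτ
  have hn : 0 < Complex.normSq τ := Complex.normSq_pos.2 h0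
  have hI : -I * τ ≠ 0 := mul_ne_zero (by simp) h0
  have hc : conj (Complex.log τ) = 2 * ((Real.log ‖τ‖ : ℝ) : ℂ) - Complex.log τ := by
    apply Complex.ext
    · simp [Complex.log_re]; ring
    · simp
  have hns : Real.log (Complex.normSq τ) = 2 * Real.log ‖τ‖ := by
    rw [Complex.normSq_eq_norm_sq, Real.log_pow]; norm_num
  have hm : τ ^ m = Complex.exp (m * Complex.log τ) := by
    rw [Complex.exp_nat_mul, Complex.exp_log h0]
  rw [hm, gaussFactor, Complex.cpow_def_of_ne_zero hI, log_neg_I_mul hτ, ← Complex.exp_conj,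
    Real.rpow_def_of_pos hn, hns, Complex.cpow_def_of_ne_zero h0,
    Complex.cpow_def_of_ne_zero Complex.I_ne_zero, Complex.log_I, Complex.ofReal_exp,
    ← Complex.exp_nat_mul, ← Complex.exp_nat_mul, ← Complex.exp_add, ← Complex.exp_add,
    ← Complex.exp_add, ← Complex.exp_add]
  congr 1
  rw [map_mul, map_sub, hc, map_mul, map_div₀, map_div₀, map_one, map_ofNat, Complex.conj_ofReal,
    Complex.conj_I, hk]
  push_cast
  ring

theorem sum_ee_neg_bil {L : Submodule ℤ (QSpace bp bm)} [DiscreteTopology L] [IsZLattice ℝ L]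
    [Fintype (Disc L)] [DecidableEq (Disc L)] (σ' : Disc L) :
    ∑ σ : Disc L, ee ((-bil (rep σ) (rep σ') : ℝ) : ℂ) =
      if σ' = 0 then (Fintype.card (Disc L) : ℂ) else 0 := by
  have h := congrArg conj (sum_ee_bil σ')
  rw [map_sum] at h
  simp_rw [conj_ee_ofReal] at h
  rw [h]
  split_ifs <;> simp

theorem rep_zero_mem (L : Submodule ℤ (QSpace bp bm)) : rep (0 : Disc L) ∈ L := by
  have := rep_sub_mem (L := L) (v := 0) (zero_mem _) (σ := 0) (by
    rw [cls_of_mem (zero_mem _)]; rfl)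
  simpa using this

theorem thetaChar_one_I_pos (L : Submodule ℤ (QSpace bp bm)) [DiscreteTopology L] [IsZLattice ℝ L]
    (g : QSpace bp bm ≃ₗ[ℝ] QSpace bp bm) :
    thetaChar L g 1 I 0 0 (0 : Disc L) ≠ 0 := by
  have h1 : ∀ v : QSpace bp bm, thetaTerm g 1 I 0 0 v =
      ((exp (-(π * (‖(g v).1‖ ^ 2 + ‖(g v).2‖ ^ 2))) : ℝ) : ℂ) := by
    intro v
    simp only [thetaTerm, gaussPoly, polyAt, heat, add_zero, map_zero, Complex.ofReal_zero,
      ee_zero, mul_one, MvPolynomial.totalDegree_one, zero_add, Finset.sum_range_one, pow_zero,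
      Nat.factorial_zero, Nat.cast_one, div_one, Complex.ofReal_one, Function.iterate_zero, id, one_mul, map_one, Complex.conj_I, Complex.ofReal_exp]
    congr 1
    push_cast
    linear_combination (π * ((‖(g v).1‖ : ℂ) ^ 2 + (‖(g v).2‖ : ℂ) ^ 2)) * Complex.I_sq
  have hs := summable_thetaTerm_coset L g 1 (τ := I) (by simp) 0 0 0
  simp only [h1] at hs
  rw [thetaChar]
  simp only [h1, ← Complex.ofReal_tsum, Complex.I_im, Real.one_rpow, Complex.ofReal_one, one_mul]
  rw [Complex.ofReal_ne_zero]
  have h0 : (0 : QSpace bp bm) ∈ coset L 0 := ⟨zero_mem _, by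
    rw [cls_of_mem (zero_mem _)]; rfl⟩
  exact ne_of_gt ((Complex.summable_ofReal.1 hs).tsum_pos (fun _ => (Real.exp_pos _).le) ⟨0, h0⟩
    (Real.exp_pos _))

variable (L : Submodule ℤ (QSpace bp bm)) [DiscreteTopology L] [IsZLattice ℝ L]

/-- The transformation of theta functions with characteristics under `τ ↦ -1 / τ`. -/
theorem thetaChar_neg_inv (hL : IsEven L) {g : QSpace bp bm ≃ₗ[ℝ] QSpace bp bm} (hg : IsIsom g)
    {P : MvPolynomial (Fin bp) ℂ} {m : ℕ} (hP : P.IsHomogeneous m) {k : ℝ}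
    (hk : k = m + ((bp : ℝ) - bm) / 2) {τ : ℂ} (hτ : 0 < τ.im) (A B : QSpace bp bm) :
    thetaChar L g P (-1 / τ) B (-A) = τ ^ (k : ℂ) • weilS L (thetaChar L g P τ A B) := by
  classical
  have := disc_finite L hL
  have := Fintype.ofFinite (Disc L)
  obtain ⟨C, hC, key⟩ := exists_thetaChar_neg_inv L hL hg
  have hC2 : (C : ℂ) = 1 / (sqrt (Nat.card (Disc L)) : ℂ) := by
    set t := thetaChar L g 1 I 0 0 with ht
    have h1 : ∀ σ', t σ' = C * ∑ σ, ee ((-bil (rep σ) (rep σ') : ℝ) : ℂ) * t σ := fun σ' => by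
      have h2 := key 1 0 (MvPolynomial.isHomogeneous_one _ _) I (by simp) 0 0 σ'
      have h3 : -1 / I = I := by
        rw [div_eq_mul_inv, Complex.inv_I]; ring
      have h4 : gaussFactor bp bm I = 1 := by simp [gaussFactor]
      rw [h3, h4, neg_zero] at h2
      simpa using h2
    have h2 : ∑ σ', t σ' = C * (Fintype.card (Disc L) * t 0) := by
      calc ∑ σ', t σ' = ∑ σ', C * ∑ σ, ee ((-bil (rep σ) (rep σ') : ℝ) : ℂ) * t σ :=
            Finset.sum_congr rfl fun σ' _ => h1 σ'
        _ = C * ∑ σ, (∑ σ', ee ((-bil (rep σ') (rep σ) : ℝ) : ℂ)) * t σ := by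
            rw [← Finset.mul_sum, Finset.sum_comm]
            congr 1
            refine Finset.sum_congr rfl fun σ _ => ?_
            rw [Finset.sum_mul]
            exact Finset.sum_congr rfl fun σ' _ => by rw [bil_comm]
        _ = _ := by
            simp_rw [sum_ee_neg_bil]
            simp [ite_mul, Finset.sum_ite_eq']
    have h3 : t 0 = C * ∑ σ, t σ := by
      rw [h1 0]
      congr 1
      refine Finset.sum_congr rfl fun σ _ => ?_
      obtain ⟨n, hn⟩ := dual_bil_int (rep_mem σ) (rep_zero_mem L)
      rw [hn, ← Int.cast_neg, Complex.ofReal_intCast, ee_int, one_mul]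
    rw [h2] at h3
    have h4 : (C : ℂ) * C * Fintype.card (Disc L) = 1 := by
      refine mul_right_cancel₀ (thetaChar_one_I_pos L g) ?_
      rw [one_mul]
      linear_combination -h3
    have h5 : C * C * Fintype.card (Disc L) = 1 := by exact_mod_cast h4
    have hcard : (0 : ℝ) < Fintype.card (Disc L) := by exact_mod_cast Fintype.card_pos
    have h6 : C = 1 / sqrt (Fintype.card (Disc L)) := by
      rw [eq_div_iff (Real.sqrt_ne_zero'.2 hcard)]
      have h7 : (C * sqrt (Fintype.card (Disc L))) ^ 2 = 1 := by
        rw [mul_pow, Real.sq_sqrt hcard.le]; linarith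
      nlinarith [mul_pos hC (Real.sqrt_pos.2 hcard)]
    rw [h6, Nat.card_eq_fintype_card]
    push_cast
    rfl
  funext σ'
  rw [key P m hP τ hτ A B σ', gaussFactor_eq m hτ hk, hC2, Pi.smul_apply, weilS,
    finsum_eq_sum_of_fintype, smul_eq_mul]
  simp only [Complex.ofReal_neg]
  ring

end

section

/-! ### Unitarity of the Weil representation -/

section Weil
variable (L : Submodule ℤ (QSpace bp bm))

theorem cls_sub {v w : QSpace bp bm} (hv : v ∈ dualLat L) (hw : w ∈ dualLat L) :
    cls L (v - w) = cls L v - cls L w := by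
  rw [eq_sub_iff_add_eq, ← cls_add (sub_mem hv hw) hw, sub_add_cancel]

theorem weilS_smul [Finite (Disc L)] (c : ℂ) (f : Disc L → ℂ) : weilS L (c • f) = c • weilS L f := by
  funext σ'
  have := Fintype.ofFinite (Disc L)
  simp only [weilS, Pi.smul_apply, smul_eq_mul, finsum_eq_sum_of_fintype]
  rw [mul_left_comm, Finset.mul_sum (a := c)]
  simp_rw [mul_left_comm c]

theorem sum_weilT [Fintype (Disc L)] (f h : Disc L → ℂ) :
    ∑ σ, weilT L f σ * conj (weilT L h σ) = ∑ σ, f σ * conj (h σ) := by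
  refine Finset.sum_congr rfl fun σ _ => ?_
  rw [weilT, weilT, map_mul, mul_mul_mul_comm, Complex.mul_conj, Complex.normSq_eq_norm_sq,
    norm_ee_ofReal]
  simp

theorem norm_I_cpow (x : ℝ) : ‖I ^ (x : ℂ)‖ = 1 := by
  rw [Complex.norm_cpow_real]; simp

theorem sum_weilS [DiscreteTopology L] [IsZLattice ℝ L] [Fintype (Disc L)] (f h : Disc L → ℂ) :
    ∑ σ, weilS L f σ * conj (weilS L h σ) = ∑ σ, f σ * conj (h σ) := by
  classical
  have hcard : (0 : ℝ) < Nat.card (Disc L) := by exact_mod_cast Nat.card_pos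
  set c : ℂ := I ^ ((((bm : ℝ) - bp) / 2 : ℝ) : ℂ) / (sqrt (Nat.card (Disc L)) : ℂ)
    with hc
  have hcc : c * conj c * Nat.card (Disc L) = 1 := by
    rw [Complex.mul_conj, Complex.normSq_eq_norm_sq, hc, norm_div, norm_I_cpow, Complex.norm_real,
      Real.norm_of_nonneg (Real.sqrt_nonneg _), div_pow, Real.sq_sqrt hcard.le]
    push_cast
    field_simp
  have h1 : ∀ σ₁ σ₂ : Disc L, ∑ σ' : Disc L, ee ((-(bil (rep σ₁) (rep σ') : ℝ) : ℝ) : ℂ) *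
      conj (ee ((-(bil (rep σ₂) (rep σ') : ℝ) : ℝ) : ℂ)) =
      if σ₁ = σ₂ then (Nat.card (Disc L) : ℂ) else 0 := by
    intro σ₁ σ₂
    have h2 : ∀ σ' : Disc L, ee ((-(bil (rep σ₁) (rep σ') : ℝ) : ℝ) : ℂ) *
      conj (ee ((-(bil (rep σ₂) (rep σ') : ℝ) : ℝ) : ℂ)) =
      ee ((bil (rep σ') (rep (σ₂ - σ₁)) : ℝ) : ℂ) := by
      intro σ'
      rw [conj_ee_ofReal, ← ee_add, ← Complex.ofReal_add]
      have h3 := ee_bil_congr (rep_mem σ') (rep_mem σ') (rep_mem (σ₂ - σ₁))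
        (sub_mem (rep_mem σ₂) (rep_mem σ₁)) rfl (by
          rw [cls_rep, cls_sub L (rep_mem _) (rep_mem _), cls_rep, cls_rep])
      rw [h3]
      congr 2
      rw [map_sub, bil_comm _ (rep σ₁), bil_comm _ (rep σ₂)]
      ring
    simp_rw [h2, sum_ee_bil, sub_eq_zero, Nat.card_eq_fintype_card, eq_comm]
  simp only [weilS, ← hc, finsum_eq_sum_of_fintype]
  calc ∑ σ', c * (∑ σ, ee (-(bil (rep σ) (rep σ') : ℝ)) * f σ) *
        conj (c * ∑ σ, ee (-(bil (rep σ) (rep σ') : ℝ)) * h σ)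
      = ∑ σ', ∑ σ₁, ∑ σ₂, c * conj c * (f σ₁ * conj (h σ₂)) *
        (ee ((-(bil (rep σ₁) (rep σ') : ℝ) : ℝ) : ℂ) *
          conj (ee ((-(bil (rep σ₂) (rep σ') : ℝ) : ℝ) : ℂ))) := by
        refine Finset.sum_congr rfl fun σ' _ => ?_
        rw [map_mul, map_sum, mul_mul_mul_comm, Finset.sum_mul_sum, Finset.mul_sum]
        refine Finset.sum_congr rfl fun σ₁ _ => ?_
        rw [Finset.mul_sum]
        refine Finset.sum_congr rfl fun σ₂ _ => ?_
        rw [map_mul, Complex.ofReal_neg, Complex.ofReal_neg]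
        ring
    _ = ∑ σ₁, ∑ σ₂, c * conj c * (f σ₁ * conj (h σ₂)) *
        (if σ₁ = σ₂ then (Nat.card (Disc L) : ℂ) else 0) := by
        rw [Finset.sum_comm]
        refine Finset.sum_congr rfl fun σ₁ _ => ?_
        rw [Finset.sum_comm]
        refine Finset.sum_congr rfl fun σ₂ _ => ?_
        rw [← h1, Finset.mul_sum]
    _ = ∑ σ, f σ * conj (h σ) := by
        refine Finset.sum_congr rfl fun σ₁ _ => ?_
        simp only [mul_ite, mul_zero, Finset.sum_ite_eq, Finset.mem_univ, if_true]
        linear_combination (f σ₁ * conj (h σ₁)) * hcc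

end Weil

/-! ### Jacobi forms in real coordinates -/

section Phi
variable {L : Submodule ℤ (QSpace bp bm)} {η : QSpace bp bm} {k : ℝ} {φ : ℂ → ℂ → Disc L → ℂ}

/-- The function `e(q(η)(ω² τ + ω ρ)) φ(τ, ρ + τ ω)`. -/
def phiChar (η : QSpace bp bm) (φ : ℂ → ℂ → Disc L → ℂ) (τ : ℂ) (ρ ω : ℝ) (σ : Disc L) : ℂ :=
  ee (q η * (ω ^ 2 * τ + ω * ρ)) * φ τ (ρ + τ * ω) σ

theorem phiChar_eq_smul (η : QSpace bp bm) (φ : ℂ → ℂ → Disc L → ℂ) (τ : ℂ) (ρ ω : ℝ) :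
    phiChar η φ τ ρ ω = ee (q η * (ω ^ 2 * τ + ω * ρ)) • φ τ (ρ + τ * ω) := rfl

theorem phiChar_add_one (hφ : IsJacobiForm L η k φ) {τ : ℂ} (hτ : 0 < τ.im) (ρ ω : ℝ) :
    phiChar η φ (τ + 1) (ρ - ω) ω = weilT L (phiChar η φ τ ρ ω) := by
  funext σ
  have h1 : (((ρ - ω : ℝ) : ℂ) + (τ + 1) * ω) = ρ + τ * ω := by push_cast; ring
  rw [phiChar, h1, hφ.transT τ _ hτ, weilT, weilT, phiChar, mul_left_comm]
  congr 3
  push_cast; ring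

theorem phiChar_neg_inv [Finite (Disc L)] (hφ : IsJacobiForm L η k φ) {τ : ℂ} (hτ : 0 < τ.im) (ρ ω : ℝ) :
    phiChar η φ (-1 / τ) ω (-ρ) = τ ^ (k : ℂ) • weilS L (phiChar η φ τ ρ ω) := by
  have h0 : τ ≠ 0 := fun h => by simp [h] at hτ
  have h1 : ((ω : ℂ) + -1 / τ * ((-ρ : ℝ) : ℂ)) = (ρ + τ * ω) / τ := by
    push_cast; field_simp; ring
  rw [phiChar_eq_smul, h1, hφ.transS τ _ hτ, phiChar_eq_smul, weilS_smul, smul_smul, smul_smul,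
    mul_left_comm, ← ee_add]
  congr 3
  push_cast
  field_simp
  ring

theorem phiChar_shift (hφ : IsJacobiForm L η k φ) {τ : ℂ} (hτ : 0 < τ.im)
    (ρ ω : ℝ) (h r : ℤ) (σ : Disc L) :
    phiChar η φ τ (ρ + h) (ω + r) σ =
      ee ((q η * (ω * h - ρ * r - h * r) + bil (rep (σ + r • cls L η)) η * h : ℝ) : ℂ) *
        phiChar η φ τ ρ ω (σ + r • cls L η) := by
  have h1 : (((ρ + h : ℝ) : ℂ) + τ * ((ω + r : ℝ) : ℂ)) = (ρ + τ * ω) + h + r * τ := by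
    push_cast; ring
  have h2 := congrFun (hφ.heis h r 0 τ (ρ + τ * ω) hτ) σ
  rw [phiChar, h1, h2, Pi.smul_apply, weilH, phiChar, smul_eq_mul, ← mul_assoc, ← mul_assoc,
    ← mul_assoc, ← ee_add, ← ee_add, ← ee_add]
  congr 2
  push_cast
  ring

theorem continuousOn_phi (hφ : IsJacobiForm L η k φ) (σ : Disc L) :
    ContinuousOn (fun p : ℂ × ℂ => φ p.1 p.2 σ) {p | 0 < p.1.im} := (hφ.holo σ).continuousOn

theorem continuousOn_phiChar (hφ : IsJacobiForm L η k φ) (σ : Disc L) :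
    ContinuousOn (fun p : ℂ × ℝ × ℝ => phiChar η φ p.1 p.2.1 p.2.2 σ) {p | 0 < p.1.im} := by
  unfold phiChar
  refine ContinuousOn.mul (continuous_ee.comp (by fun_prop)).continuousOn ?_
  exact (continuousOn_phi hφ σ).comp (f := fun p : ℂ × ℝ × ℝ =>
    (p.1, (p.2.1 : ℂ) + p.1 * p.2.2)) (Continuous.continuousOn (by fun_prop)) fun p hp => hp

end Phi

end

section

/-! ### Integrals over the unit square -/

section Square

theorem integrable_square {f : ℝ → ℝ → ℂ} (hf : Continuous (Function.uncurry f)) :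
    Integrable (Function.uncurry f) ((volume.restrict (Set.Ioc (0 : ℝ) 1)).prod
      (volume.restrict (Set.Ioc (0 : ℝ) 1))) := by
  rw [Measure.prod_restrict]
  have h : IntegrableOn (Function.uncurry f) (Set.Icc (0 : ℝ) 1 ×ˢ Set.Icc (0 : ℝ) 1)
      (volume.prod volume) :=
    hf.continuousOn.integrableOn_compact (isCompact_Icc.prod isCompact_Icc)
  exact h.mono_set (Set.prod_mono Set.Ioc_subset_Icc_self Set.Ioc_subset_Icc_self)

theorem intervalIntegral_swap {f : ℝ → ℝ → ℂ} (hf : Continuous (Function.uncurry f)) :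
    ∫ x in (0 : ℝ)..1, ∫ y in (0 : ℝ)..1, f x y = ∫ y in (0 : ℝ)..1, ∫ x in (0 : ℝ)..1, f x y := by
  simp only [intervalIntegral.integral_of_le zero_le_one]
  exact integral_integral_swap (integrable_square hf)

theorem integral_cube_two {f : (Fin 2 → ℝ) → ℂ} (hf : Continuous f) :
    ∫ t in cube (Fin 2), f t = ∫ x in (0 : ℝ)..1, ∫ y in (0 : ℝ)..1, f ![x, y] := by
  have hm := (volume_preserving_finTwoArrow ℝ).symm
  have h1 := hm.setIntegral_preimage_emb (MeasurableEquiv.measurableEmbedding _) f (cube (Fin 2))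
  have h2 : (MeasurableEquiv.finTwoArrow (α := ℝ)).symm ⁻¹' cube (Fin 2) =
      Set.Ioc (0 : ℝ) 1 ×ˢ Set.Ioc (0 : ℝ) 1 := by
    ext p
    simp [cube, Fin.forall_fin_two, MeasurableEquiv.finTwoArrow]
  have hc : Continuous (Function.uncurry fun x y : ℝ => f ![x, y]) := by
    refine hf.comp (continuous_pi fun i => ?_)
    fin_cases i <;> simp <;> fun_prop
  rw [h2] at h1
  rw [← h1]
  simp only [intervalIntegral.integral_of_le zero_le_one]
  rw [Measure.volume_eq_prod, ← Measure.prod_restrict, integral_prod]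
  · rfl
  · exact integrable_square hc

end Square

/-! ### Fourier coefficients of Jacobi forms -/

theorem integral_horizontal_eq {f : ℂ → ℂ} {a b : ℝ}
    (hf : DifferentiableOn ℂ f {z | z.im ∈ Set.uIcc a b})
    (hp : ∀ z : ℂ, f (z + 1) = f z) :
    ∫ x in (0 : ℝ)..1, f (x + a * I) = ∫ x in (0 : ℝ)..1, f (x + b * I) := by
  have h := Complex.integral_boundary_rect_eq_zero_of_differentiableOn f
    (a * I) (1 + b * I) (hf.mono fun z hz => by
      have := hz.2
      simpa using this)
  have h1 : ∀ y : ℝ, f (((1 + b * I : ℂ).re : ℝ) + y * I) =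
      f (((a * I : ℂ).re : ℝ) + y * I) := fun y => by
    rw [← hp (((a * I : ℂ).re : ℝ) + y * I)]; congr 1; simp; ring
  simp only [h1, add_sub_cancel_right] at h
  simp only [Complex.mul_re, Complex.mul_im, Complex.add_re, Complex.add_im, Complex.ofReal_re,
    Complex.ofReal_im, Complex.I_re, Complex.I_im, Complex.one_re, Complex.one_im, mul_zero,
    mul_one, add_zero, zero_add, sub_self] at h
  exact sub_eq_zero.1 h

section Coeff
variable {L : Submodule ℤ (QSpace bp bm)} {η : QSpace bp bm} {k : ℝ} {φ : ℂ → ℂ → Disc L → ℂ}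

/-- The Fourier coefficient computed on `Im τ = y`, `Im z = t`. -/
def coeffAt (φ : ℂ → ℂ → Disc L → ℂ) (σ : Disc L) (r s y t : ℝ) : ℂ :=
  ∫ x in (0 : ℝ)..1, ∫ ξ in (0 : ℝ)..1, φ (x + y * I) (ξ + t * I) σ *
    ee (-(r * (x + y * I) + s * (ξ + t * I)))

theorem phi_add_one_right (hφ : IsJacobiForm L η k φ) {τ : ℂ} (hτ : 0 < τ.im) (z : ℂ) (σ : Disc L) :
    φ τ (z + 1) σ = ee (bil (rep σ) η : ℝ) * φ τ z σ := by
  have h := congrFun (hφ.heis 1 0 0 τ z hτ) σ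
  simpa [weilH, ee_zero] using h

theorem phi_add_one_left (hφ : IsJacobiForm L η k φ) {τ : ℂ} (hτ : 0 < τ.im) (z : ℂ) (σ : Disc L) :
    φ (τ + 1) z σ = ee (q (rep σ) : ℝ) * φ τ z σ := congrFun (hφ.transT τ z hτ) σ

theorem ee_mul_add_one {r r₀ : ℝ} (hr : ∃ n : ℤ, r = r₀ + n) (a b : ℂ) :
    ee r₀ * ee (-(r * (a + 1) + b)) = ee (-(r * a + b)) := by
  obtain ⟨n, rfl⟩ := hr
  have h := ee_add_int (r₀ + -(((r₀ + n : ℝ) : ℂ) * (a + 1) + b)) n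
  rw [← ee_add, ← h]
  congr 1
  push_cast
  ring

theorem coeffAt_eq (hφ : IsJacobiForm L η k φ) (σ : Disc L) {r s : ℝ}
    (hr : ∃ n : ℤ, r = q (rep σ) + n) (hs : ∃ n : ℤ, s = bil (rep σ) η + n) {y : ℝ} (hy : 0 < y)
    (t : ℝ) : coeffAt φ σ r s y t = jacCoeff φ σ r s := by
  have him : ∀ (x y : ℝ), ((x : ℂ) + y * I).im = y := fun x y => by simp
  have hd : DifferentiableOn ℂ (fun p : ℂ × ℂ => φ p.1 p.2 σ * ee (-(r * p.1 + s * p.2)))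
      {p | 0 < p.1.im} :=
    (hφ.holo σ).mul ((differentiable_ee.comp (by fun_prop)).differentiableOn)
  have h1 : coeffAt φ σ r s y t = coeffAt φ σ r s y 0 := by
    unfold coeffAt
    refine intervalIntegral.integral_congr fun x _ => ?_
    refine integral_horizontal_eq
      (f := fun z => φ (x + y * I) z σ * ee (-(r * (x + y * I) + s * z)))
      (fun z _ => ?_) fun z => ?_
    · refine DifferentiableAt.differentiableWithinAt ?_
      have hmem : ((x : ℂ) + y * I, z) ∈ {p : ℂ × ℂ | 0 < p.1.im} := by simpa using hy
      have hopen : IsOpen {p : ℂ × ℂ | 0 < p.1.im} := isOpen_lt continuous_const (by fun_prop)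
      exact ((hd _ hmem).differentiableAt (hopen.mem_nhds hmem)).comp z
        (f := fun z => ((x : ℂ) + y * I, z)) (by fun_prop)
    · rw [phi_add_one_right hφ (by simpa using hy), mul_right_comm, add_comm (_ * (_ + _)),
        ee_mul_add_one hs, mul_comm, add_comm ((s : ℂ) * z)]
  have hsw : ∀ y : ℝ, 0 < y → coeffAt φ σ r s y 0 = ∫ ξ in (0 : ℝ)..1, ∫ x in (0 : ℝ)..1,
      φ (x + y * I) (ξ + (0 : ℝ) * I) σ *
        ee (-(r * (x + y * I) + s * (ξ + (0 : ℝ) * I))) := by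
    intro y hy
    refine intervalIntegral_swap ?_
    exact hd.continuousOn.comp_continuous (f := fun p : ℝ × ℝ =>
      ((p.1 : ℂ) + y * I, (p.2 : ℂ) + (0 : ℝ) * I)) (by fun_prop)
      fun p => by simpa using hy
  have h2 : coeffAt φ σ r s y 0 = coeffAt φ σ r s 1 0 := by
    rw [hsw y hy, hsw 1 one_pos]
    refine intervalIntegral.integral_congr fun ξ _ => ?_
    have hpos : ∀ z : ℂ, z.im ∈ Set.uIcc y 1 → 0 < z.im := fun z hz =>
      lt_of_lt_of_le (lt_min hy one_pos) hz.1
    set z₀ : ℂ := (ξ : ℂ) + (0 : ℝ) * I with hz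
    let f : ℂ → ℂ := fun τ => if 0 < τ.im then φ τ z₀ σ * ee (-(r * τ + s * z₀)) else 0
    have hf : ∀ (x y : ℝ), 0 < y → f (x + y * I) = φ (x + y * I) z₀ σ *
        ee (-(r * (x + y * I) + s * z₀)) := fun x y hy => by simp [f, hy]
    have := integral_horizontal_eq (f := f) (a := y) (b := 1) (fun z hz => ?_) fun z => ?_
    · simp only [hf _ _ hy, hf _ _ one_pos] at this
      exact this
    · have hmem : (z, z₀) ∈ {p : ℂ × ℂ | 0 < p.1.im} := hpos z hz
      have hopen : IsOpen {p : ℂ × ℂ | 0 < p.1.im} := isOpen_lt continuous_const (by fun_prop)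
      have hopen' : IsOpen {z : ℂ | 0 < z.im} := isOpen_lt continuous_const (by fun_prop)
      refine DifferentiableAt.differentiableWithinAt ?_
      refine DifferentiableAt.congr_of_eventuallyEq
        (((hd _ hmem).differentiableAt (hopen.mem_nhds hmem)).comp z
        (f := fun z => (z, z₀)) (by fun_prop)) ?_
      filter_upwards [hopen'.mem_nhds (hpos z hz)] with w hw
      have hw' : 0 < w.im := hw
      simp [f, hw']
    · by_cases hz0 : 0 < z.im
      · simp only [f, Complex.add_im, Complex.one_im, add_zero, hz0, if_true]
        rw [phi_add_one_left hφ hz0, mul_right_comm, ee_mul_add_one hr, mul_comm]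
      · simp [f, hz0]
  rw [h1, h2]
  simp [coeffAt, jacCoeff]

theorem norm_jacCoeff_le (hφ : IsJacobiForm L η k φ) (σ : Disc L) {y : ℝ} (hy : 0 < y) :
    ∃ C : ℝ, 0 < C ∧ ∀ r s : ℝ, (∃ n : ℤ, r = q (rep σ) + n) → (∃ n : ℤ, s = bil (rep σ) η + n) →
      ‖jacCoeff φ σ r s‖ ≤ C * exp (2 * π * r * y) := by
  have hc : ContinuousOn (fun p : ℝ × ℝ =>
      φ ((p.1 : ℂ) + y * I) ((p.2 : ℂ) + (0 : ℝ) * I) σ)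
      (Set.Icc (0 : ℝ) 1 ×ˢ Set.Icc (0 : ℝ) 1) := by
    refine ((continuousOn_phi hφ σ).comp_continuous (f := fun p : ℝ × ℝ =>
      ((p.1 : ℂ) + y * I, (p.2 : ℂ) + (0 : ℝ) * I)) (by fun_prop)
      fun p => by simpa using hy).continuousOn
  obtain ⟨C, hC⟩ := (isCompact_Icc.prod isCompact_Icc).exists_bound_of_continuousOn hc
  refine ⟨max C 1, by positivity, fun r s hr hs => ?_⟩
  rw [← coeffAt_eq hφ σ hr hs hy 0, coeffAt]
  have hsub : ∀ x ∈ Set.uIoc (0 : ℝ) 1, x ∈ Set.Icc (0 : ℝ) 1 := fun x hx => by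
    rw [Set.uIoc_of_le zero_le_one] at hx; exact Set.Ioc_subset_Icc_self hx
  refine (intervalIntegral.norm_integral_le_of_norm_le_const
    (C := max C 1 * exp (2 * π * r * y)) fun x hx => ?_).trans (by simp)
  refine (intervalIntegral.norm_integral_le_of_norm_le_const
    (C := max C 1 * exp (2 * π * r * y)) fun ξ hξ => ?_).trans (by simp)
  rw [norm_mul, norm_ee]
  refine mul_le_mul ((hC (x, ξ) ⟨hsub x hx, hsub ξ hξ⟩).trans (le_max_left _ _))
    (Real.exp_le_exp.2 (le_of_eq ?_)) (Real.exp_pos _).le (by positivity)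
  simp
  ring

theorem hasSum_phi (hφ : IsJacobiForm L η k φ) (σ : Disc L) {τ : ℂ} (hτ : 0 < τ.im) (z : ℂ)
    (hs : Summable fun n : Fin 2 → ℤ => jacCoeff φ σ (q (rep σ) + n 0) (bil (rep σ) η + n 1) *
      ee ((q (rep σ) + n 0 : ℝ) * τ + (bil (rep σ) η + n 1 : ℝ) * z)) :
    HasSum (fun n : Fin 2 → ℤ => jacCoeff φ σ (q (rep σ) + n 0) (bil (rep σ) η + n 1) *
      ee ((q (rep σ) + n 0 : ℝ) * τ + (bil (rep σ) η + n 1 : ℝ) * z)) (φ τ z σ) := by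
  set r₀ := q (rep σ) with hr₀
  set s₀ := bil (rep σ) η with hs₀
  set y := τ.im with hy
  set t := z.im with ht
  set f : (Fin 2 → ℝ) → ℂ := fun x => φ (x 0 + y * I) (x 1 + t * I) σ *
    ee (-(r₀ * (x 0 + y * I) + s₀ * (x 1 + t * I))) with hf
  have hfc : Continuous f := by
    refine Continuous.mul ?_ (continuous_ee.comp (by fun_prop))
    exact (continuousOn_phi hφ σ).comp_continuous (f := fun x : Fin 2 → ℝ =>
      ((x 0 : ℂ) + y * I, (x 1 : ℂ) + t * I)) (by fun_prop)
      fun p => by simpa using hτ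
  have hfp : ∀ (n : Fin 2 → ℤ) x, f (x + fun i => (n i : ℝ)) = f x := by
    have h1 : ∀ (n : ℤ) (a b : ℂ), 0 < a.im → φ (a + n) b σ * ee (-(r₀ * (a + n))) =
        φ a b σ * ee (-(r₀ * a)) := by
      have hstep : ∀ (a b : ℂ), 0 < a.im → φ (a + 1) b σ * ee (-(r₀ * (a + 1))) =
          φ a b σ * ee (-(r₀ * a)) := fun a b ha => by
        rw [phi_add_one_left hφ ha, mul_right_comm, ← ee_add, mul_comm]
        congr 2; rw [← hr₀]; ring
      intro n
      induction n using Int.induction_on with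
      | zero => simp
      | succ n ih =>
        intro a b ha
        rw [← ih a b ha, ← hstep (a + (n : ℤ)) b (by simpa using ha)]
        push_cast; rw [add_assoc]
      | pred n ih =>
        intro a b ha
        rw [← ih a b ha, ← hstep (a + (-n - 1 : ℤ)) b (by simpa using ha)]
        push_cast; ring_nf
    have h2 : ∀ (n : ℤ) (a b : ℂ), 0 < a.im → φ a (b + n) σ * ee (-(s₀ * (b + n))) =
        φ a b σ * ee (-(s₀ * b)) := by
      have hstep : ∀ (a b : ℂ), 0 < a.im → φ a (b + 1) σ * ee (-(s₀ * (b + 1))) =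
          φ a b σ * ee (-(s₀ * b)) := fun a b ha => by
        rw [phi_add_one_right hφ ha, mul_right_comm, ← ee_add, mul_comm]
        congr 2; rw [← hs₀]; ring
      intro n
      induction n using Int.induction_on with
      | zero => simp
      | succ n ih =>
        intro a b ha
        rw [← ih a b ha, ← hstep a (b + (n : ℤ)) ha]
        push_cast; rw [add_assoc]
      | pred n ih =>
        intro a b ha
        rw [← ih a b ha, ← hstep a (b + (-n - 1 : ℤ)) ha]
        push_cast; ring_nf
    intro n x
    simp only [hf, Pi.add_apply]
    have ha : 0 < ((x 0 : ℂ) + y * I).im := by simpa using hτ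
    have e1 : (((x 0 + n 0 : ℝ) : ℂ) + y * I) = (x 0 + y * I) + (n 0 : ℤ) := by
      push_cast; ring
    have e2 : (((x 1 + n 1 : ℝ) : ℂ) + t * I) = (x 1 + t * I) + (n 1 : ℤ) := by
      push_cast; ring
    rw [e1, e2, neg_add, ee_add, ← mul_assoc, h1 _ _ _ ha, mul_right_comm, h2 _ _ _ ha,
      mul_right_comm, mul_assoc, ← ee_add, ← neg_add]
  have hcoef : ∀ n : Fin 2 → ℤ, ∫ x in cube (Fin 2), f x * chr (-n) x =
      jacCoeff φ σ (r₀ + n 0) (s₀ + n 1) * ee (n 0 * (y * I) + n 1 * (t * I)) := by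
    intro n
    rw [integral_cube_two (by have := continuous_chr (-n); fun_prop),
      ← coeffAt_eq hφ σ ⟨n 0, rfl⟩ ⟨n 1, rfl⟩ hτ t, coeffAt,
      ← intervalIntegral.integral_mul_const]
    refine intervalIntegral.integral_congr fun x _ => ?_
    beta_reduce
    rw [← intervalIntegral.integral_mul_const]
    refine intervalIntegral.integral_congr fun ξ _ => ?_
    simp only [hf, chr, Fin.sum_univ_two, Matrix.cons_val_zero, Matrix.cons_val_one, Pi.neg_apply]
    rw [mul_assoc, mul_assoc, ← ee_add, ← ee_add]
    congr 2
    push_cast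
    ring
  have hterm : ∀ n : Fin 2 → ℤ, jacCoeff φ σ (r₀ + n 0) (s₀ + n 1) *
      ee ((r₀ + n 0 : ℝ) * τ + (s₀ + n 1 : ℝ) * z) =
      ((jacCoeff φ σ (r₀ + n 0) (s₀ + n 1) * ee (n 0 * (y * I) + n 1 * (t * I))) *
        chr n ![τ.re, z.re]) * ee (r₀ * τ + s₀ * z) := by
    intro n
    rw [chr, mul_assoc, mul_assoc, ← ee_add, ← ee_add]
    congr 2
    simp only [Fin.sum_univ_two, Matrix.cons_val_zero, Matrix.cons_val_one]
    have h1 : τ = τ.re + y * I := (Complex.re_add_im τ).symm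
    have h2 : z = z.re + t * I := (Complex.re_add_im z).symm
    conv_lhs => rw [h1, h2]
    conv_rhs => rw [h1, h2]
    push_cast
    simp
    ring
  have hsum' : Summable fun n : Fin 2 → ℤ => ∫ x in cube (Fin 2), f x * chr (-n) x := by
    have h := (hs.mul_right (ee (r₀ * τ + s₀ * z))⁻¹).norm
    refine Summable.of_norm (h.congr fun n => ?_)
    rw [hterm, mul_assoc, mul_inv_cancel₀ (ee_ne_zero _), mul_one, norm_mul, norm_chr, mul_one,
      hcoef]
  have key := (hasSum_fourier_of_periodic hfc hfp hsum' ![τ.re, z.re]).mul_right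
    (ee (r₀ * τ + s₀ * z))
  simp only [hcoef, ← hterm] at key
  have hval : f ![τ.re, z.re] * ee (r₀ * τ + s₀ * z) = φ τ z σ := by
    simp only [hf, Matrix.cons_val_zero, Matrix.cons_val_one]
    rw [hy, ht, Complex.re_add_im, Complex.re_add_im, mul_assoc, ← ee_add, neg_add_cancel, ee_zero,
      mul_one]
  rwa [hval] at key

end Coeff

end

section

/-! ### Decay of Jacobi cusp forms -/

theorem finite_setOf_abs_add_le (a M : ℝ) : {n : ℤ | |a + n| ≤ M}.Finite := by
  refine (Set.finite_Icc ⌈-M - a⌉ ⌊M - a⌋).subset fun n hn => ?_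
  have := abs_le.1 (show |a + (n : ℝ)| ≤ M from hn)
  exact ⟨Int.ceil_le.2 (by linarith [this.1]), Int.le_floor.2 (by linarith [this.2])⟩

theorem exists_form_ge {Q : ℝ} (hQ : 0 < Q) (r₀ s₀ : ℝ) : ∃ ε : ℝ, 0 < ε ∧ ∀ n l : ℤ,
    (s₀ + l) ^ 2 < 4 * Q * (r₀ + n) → ∀ ω ∈ Set.Icc (0 : ℝ) 1,
      ε * (1 + (r₀ + n)) ≤ (r₀ + n) + (s₀ + l) * ω + Q * ω ^ 2 := by
  have hfin : {p : ℤ × ℤ | (s₀ + p.2) ^ 2 < 4 * Q * (r₀ + p.1) ∧ r₀ + p.1 ≤ 8 * Q}.Finite := by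
    refine ((finite_setOf_abs_add_le r₀ (8 * Q)).prod
      (finite_setOf_abs_add_le s₀ (6 * Q))).subset fun p hp => ⟨?_, ?_⟩
    · have h1 : 0 < r₀ + p.1 := by nlinarith [hp.1, sq_nonneg (s₀ + p.2)]
      exact (abs_of_pos h1).le.trans hp.2
    · refine abs_le_of_sq_le_sq (?_ : (s₀ + (p.2 : ℝ)) ^ 2 ≤ (6 * Q) ^ 2) (by positivity)
      nlinarith [hp.1, hp.2]
  obtain ⟨d, hd, hdle⟩ : ∃ d : ℝ, 0 < d ∧ ∀ n l : ℤ, (s₀ + l) ^ 2 < 4 * Q * (r₀ + n) →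
      r₀ + n ≤ 8 * Q → d ≤ r₀ + n - (s₀ + l) ^ 2 / (4 * Q) := by
    rcases Set.eq_empty_or_nonempty
      {p : ℤ × ℤ | (s₀ + p.2) ^ 2 < 4 * Q * (r₀ + p.1) ∧ r₀ + p.1 ≤ 8 * Q} with h | h
    · refine ⟨1, one_pos, fun n l h1 h2 => ?_⟩
      exact absurd (show (n, l) ∈ {p : ℤ × ℤ | (s₀ + p.2) ^ 2 < 4 * Q * (r₀ + p.1) ∧
        r₀ + p.1 ≤ 8 * Q} from ⟨h1, h2⟩) (by simp [h])
    · obtain ⟨p, hp, hmin⟩ := Set.exists_min_image _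
        (fun p : ℤ × ℤ => r₀ + p.1 - (s₀ + p.2) ^ 2 / (4 * Q)) hfin h
      refine ⟨_, ?_, fun n l h1 h2 => hmin (n, l) ⟨h1, h2⟩⟩
      rw [sub_pos, div_lt_iff₀ (by positivity)]
      linarith [hp.1]
  refine ⟨min (min (1 / 8) Q) (d / (1 + 8 * Q)), by positivity, fun n l h ω hω => ?_⟩
  set r := r₀ + n
  set s := s₀ + (l : ℝ)
  have hr : 0 < r := by nlinarith [sq_nonneg s]
  set ε := min (min (1 / 8) Q) (d / (1 + 8 * Q))
  have e1 : ε ≤ 1 / 8 := (min_le_left _ _).trans (min_le_left _ _)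
  have e2 : ε ≤ Q := (min_le_left _ _).trans (min_le_right _ _)
  have e3 : ε ≤ d / (1 + 8 * Q) := min_le_right _ _
  have e0 : 0 ≤ ε := by positivity
  rcases le_total r (8 * Q) with h8 | h8
  · have h1 := hdle n l h h8
    have h2 : r + s * ω + Q * ω ^ 2 = r - s ^ 2 / (4 * Q) + Q * (ω + s / (2 * Q)) ^ 2 := by
      field_simp; ring
    have h3 : ε * (1 + 8 * Q) ≤ d := by rwa [le_div_iff₀ (by positivity)] at e3
    have h4 : 0 ≤ Q * (ω + s / (2 * Q)) ^ 2 := by positivity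
    have h5 : ε * (1 + r) ≤ ε * (1 + 8 * Q) := by gcongr
    linarith
  · have h1 : |s| ≤ r / 2 + 2 * Q := by
      refine abs_le_of_sq_le_sq ?_ (by positivity)
      nlinarith [sq_nonneg (r / 2 - 2 * Q)]
    have h2 : -|s| ≤ s * ω := by
      have := abs_le.1 (show |s * ω| ≤ |s| by
        rw [abs_mul, abs_of_nonneg hω.1]
        exact mul_le_of_le_one_right (abs_nonneg _) hω.2)
      exact this.1
    have h3 : 0 ≤ Q * ω ^ 2 := by positivity
    have h4 : ε * r ≤ 1 / 8 * r := by gcongr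
    nlinarith

theorem summable_inv_one_add_sq (a : ℝ) : Summable fun n : ℤ => (1 + (a + n) ^ 2)⁻¹ := by
  refine Summable.of_norm_bounded_eventually
    ((Real.summable_one_div_int_add_rpow a 2).2 one_lt_two) ?_
  have : {n : ℤ | |a + n| ≤ 0}ᶜ ∈ Filter.cofinite := (finite_setOf_abs_add_le a 0).compl_mem_cofinite
  filter_upwards [this] with n hn
  have hn' : 0 < |a + n| := by simpa using hn
  rw [Real.norm_of_nonneg (by positivity), one_div, add_comm (n : ℝ), Real.rpow_two, sq_abs]
  have : 0 < (a + n) ^ 2 := by rw [← sq_abs]; positivity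
  gcongr
  linarith

theorem one_add_pow_mul_exp_le {c : ℝ} (hc : 0 < c) (d : ℕ) :
    ∃ M : ℝ, 0 < M ∧ ∀ r : ℝ, 0 ≤ r → (1 + r) ^ d * exp (-(c * r)) ≤ M := by
  have hc' : 0 < c / (d + 1) := by positivity
  refine ⟨(1 + 1 / (c / (d + 1))) ^ d, by positivity, fun r hr => ?_⟩
  have h1 : 1 + r ≤ (1 + 1 / (c / (d + 1))) * exp (c / (d + 1) * r) := by
    have := Real.add_one_le_exp (c / (d + 1) * r)
    calc 1 + r ≤ (1 + 1 / (c / (d + 1))) * (c / (d + 1) * r + 1) := by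
          have : 1 / (c / (d + 1)) * (c / (d + 1) * r) = r := by field_simp
          have h2 : 0 ≤ c / (d + 1) * r := by positivity
          have h3 : 0 ≤ 1 / (c / (d + 1)) := by positivity
          nlinarith
      _ ≤ _ := by gcongr
  calc (1 + r) ^ d * exp (-(c * r))
      ≤ ((1 + 1 / (c / (d + 1))) * exp (c / (d + 1) * r)) ^ d * exp (-(c * r)) := by gcongr
    _ = (1 + 1 / (c / (d + 1))) ^ d * exp (d * (c / (d + 1) * r) - c * r) := by
        rw [mul_pow, ← Real.exp_nat_mul, mul_assoc, ← Real.exp_add, sub_eq_add_neg]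
    _ ≤ (1 + 1 / (c / (d + 1))) ^ d * 1 := by
        gcongr
        rw [Real.exp_le_one_iff]
        have : d * (c / (d + 1) * r) - c * r = -(c / (d + 1) * r) := by field_simp; ring
        rw [this]
        have : 0 ≤ c / (d + 1) * r := by positivity
        linarith
    _ = _ := mul_one _

/-- A bound for powers of `y` near `0` and `∞`. -/
theorem exists_rpow_le (a : ℝ) : ∃ N : ℕ, ∀ y : ℝ, 0 < y →
    y ^ a ≤ ((1 + y) * (1 + 1 / y)) ^ N := by
  obtain ⟨N, hN⟩ := exists_nat_gt |a|
  refine ⟨N, fun y hy => ?_⟩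
  rw [← Real.rpow_natCast]
  rcases le_total 1 y with h1 | h1
  · refine (Real.rpow_le_rpow_of_exponent_le h1 ((le_abs_self a).trans hN.le)).trans ?_
    refine Real.rpow_le_rpow hy.le ?_ (by positivity)
    have : 0 < 1 / y := by positivity
    nlinarith
  · have h2 : y ^ a = (1 / y) ^ (-a) := by
      rw [one_div, Real.inv_rpow hy.le, Real.rpow_neg hy.le, inv_inv]
    rw [h2]
    refine (Real.rpow_le_rpow_of_exponent_le (by rwa [le_div_iff₀ hy, one_mul])
      ((neg_le_abs a).trans hN.le)).trans ?_
    refine Real.rpow_le_rpow (by positivity) ?_ (by positivity)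
    have : 0 < 1 / y := by positivity
    nlinarith

section Decay
variable {L : Submodule ℤ (QSpace bp bm)} {η : QSpace bp bm} {k : ℝ} {φ : ℂ → ℂ → Disc L → ℂ}

theorem exists_phiChar_le_of_mem_Icc (hφ : IsJacobiCuspForm L η k φ) (hη : 0 < q η) (σ : Disc L) :
    ∃ C ε : ℝ, 0 < C ∧ 0 < ε ∧ ∀ (τ : ℂ) (ρ ω : ℝ), 1 / 2 ≤ τ.im → ω ∈ Set.Icc (0 : ℝ) 1 →
      ‖phiChar η φ τ ρ ω σ‖ ≤ C * exp (-(ε * τ.im)) := by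
  obtain ⟨ε, hε, hform⟩ := exists_form_ge hη (q (rep σ)) (bil (rep σ) η)
  obtain ⟨C, hC, hcoef⟩ := norm_jacCoeff_le hφ.toIsJacobiForm σ (y := ε / 4) (by positivity)
  obtain ⟨M, hM, hMle⟩ := one_add_pow_mul_exp_le (c := 2 * π * (ε / 4)) (by positivity) 3
  set r₀ := q (rep σ)
  set s₀ := bil (rep σ) η
  let W : (Fin 2 → ℤ) → ℝ := fun n =>
    (1 + (r₀ + n 0) ^ 2)⁻¹ * (1 + (s₀ + n 1) ^ 2)⁻¹
  have hW : Summable W := by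
    have h := (summable_inv_one_add_sq r₀).mul_of_nonneg (summable_inv_one_add_sq s₀)
      (fun n => by positivity) (fun n => by positivity)
    exact ((finTwoArrowEquiv ℤ).summable_iff (f := fun p : ℤ × ℤ =>
      (1 + (r₀ + p.1) ^ 2)⁻¹ * (1 + (s₀ + p.2) ^ 2)⁻¹)).2 h
  have hterm : ∀ (τ : ℂ) (ρ ω : ℝ), 1 / 2 ≤ τ.im → ω ∈ Set.Icc (0 : ℝ) 1 → ∀ n : Fin 2 → ℤ,
      ‖ee (q η * (ω ^ 2 * τ + ω * ρ)) * (jacCoeff φ σ (r₀ + n 0) (s₀ + n 1) *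
        ee ((r₀ + n 0 : ℝ) * τ + (s₀ + n 1 : ℝ) * (ρ + τ * ω)))‖ ≤
      C * (M * (1 + 4 * q η)) * exp (-(2 * π * ε * τ.im)) * W n := by
    intro τ ρ ω hτ hω n
    by_cases h0 : jacCoeff φ σ (r₀ + n 0) (s₀ + n 1) = 0
    · rw [h0, zero_mul, mul_zero, norm_zero]
      have : 0 ≤ W n := by positivity
      positivity
    have hc := hφ.cusp (rep σ) (rep_mem σ) (n 0) (n 1) (by rwa [cls_rep])
    have hf := hform _ _ hc ω hω
    have hb := hcoef _ _ ⟨n 0, rfl⟩ ⟨n 1, rfl⟩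
    set r := r₀ + n 0
    set s := s₀ + n 1
    have hr : 0 < r := by nlinarith [sq_nonneg s]
    rw [mul_left_comm, ← ee_add, norm_mul, norm_ee]
    have him : (q η * (ω ^ 2 * τ + ω * ρ) + ((r : ℝ) * τ + (s : ℝ) * (ρ + τ * ω)) : ℂ).im =
        τ.im * (r + s * ω + q η * ω ^ 2) := by
      simp [pow_two]
      ring
    rw [him]
    have h1 : ‖jacCoeff φ σ r s‖ * exp (-2 * π * (τ.im * (r + s * ω + q η * ω ^ 2))) ≤
        C * exp (2 * π * r * (ε / 4)) *
          exp (-2 * π * (τ.im * (ε * (1 + r)))) := by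
      refine mul_le_mul hb (Real.exp_le_exp.2 ?_) (Real.exp_pos _).le (by positivity)
      have : 0 < τ.im := by linarith
      have := mul_le_mul_of_nonneg_left hf this.le
      nlinarith [Real.pi_pos]
    refine h1.trans ?_
    have h2 : C * exp (2 * π * r * (ε / 4)) *
          exp (-2 * π * (τ.im * (ε * (1 + r)))) ≤
        C * (exp (-(2 * π * ε * τ.im)) * exp (-(2 * π * (ε / 4) * r))) := by
      rw [mul_assoc, ← Real.exp_add, ← Real.exp_add]
      refine mul_le_mul_of_nonneg_left (Real.exp_le_exp.2 ?_) hC.le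
      have : 0 ≤ π * ε * r * (2 * τ.im - 1) := by
        have : 0 ≤ 2 * τ.im - 1 := by linarith
        positivity
      nlinarith
    refine h2.trans ?_
    have h3 := hMle r hr.le
    have h4 : (1 + r ^ 2) * (1 + s ^ 2) ≤ (1 + 4 * q η) * (1 + r) ^ 3 := by
      have h5 : 1 + s ^ 2 ≤ (1 + 4 * q η) * (1 + r) := by nlinarith
      have h6 : 1 + r ^ 2 ≤ (1 + r) ^ 2 := by nlinarith
      calc (1 + r ^ 2) * (1 + s ^ 2) ≤ (1 + r) ^ 2 * ((1 + 4 * q η) * (1 + r)) := by gcongr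
        _ = _ := by ring
    have h7 : exp (-(2 * π * (ε / 4) * r)) ≤ M * (1 + 4 * q η) * W n := by
      change _ ≤ M * (1 + 4 * q η) * ((1 + r ^ 2)⁻¹ * (1 + s ^ 2)⁻¹)
      rw [← mul_inv, ← div_eq_mul_inv, le_div_iff₀ (by positivity)]
      calc exp (-(2 * π * (ε / 4) * r)) * ((1 + r ^ 2) * (1 + s ^ 2))
          ≤ exp (-(2 * π * (ε / 4) * r)) * ((1 + 4 * q η) * (1 + r) ^ 3) := by gcongr
        _ = ((1 + r) ^ 3 * exp (-(2 * π * (ε / 4) * r))) * (1 + 4 * q η) := by ring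
        _ ≤ _ := by gcongr
    calc _ ≤ C * (exp (-(2 * π * ε * τ.im)) * (M * (1 + 4 * q η) * W n)) := by gcongr
      _ = _ := by ring
  have hW0 : 0 ≤ ∑' n, W n := tsum_nonneg fun n => by positivity
  refine ⟨C * (M * (1 + 4 * q η)) * (∑' n, W n + 1), 2 * π * ε, by positivity, by positivity,
    fun τ ρ ω hτ hω => ?_⟩
  have ht := hterm τ ρ ω hτ hω
  have hsum : Summable fun n : Fin 2 → ℤ => jacCoeff φ σ (r₀ + n 0) (s₀ + n 1) *
        ee ((r₀ + n 0 : ℝ) * τ + (s₀ + n 1 : ℝ) * (ρ + τ * ω)) := by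
    have h := Summable.of_norm_bounded (hW.mul_left _) ht
    exact (summable_mul_left_iff (ee_ne_zero _)).1 h
  have hs := (hasSum_phi hφ.toIsJacobiForm σ (τ := τ) (by linarith) (ρ + τ * ω) hsum).mul_left
    (ee (q η * (ω ^ 2 * τ + ω * ρ)))
  have hle := hs.norm_le_of_bounded (hW.hasSum.mul_left _) ht
  refine hle.trans ?_
  rw [mul_right_comm]
  gcongr
  linarith

theorem norm_phiChar_shift (hφ : IsJacobiForm L η k φ) {τ : ℂ} (hτ : 0 < τ.im)
    (ρ ω : ℝ) (r : ℤ) (σ : Disc L) :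
    ‖phiChar η φ τ ρ (ω + r) σ‖ = ‖phiChar η φ τ ρ ω (σ + r • cls L η)‖ := by
  have h := phiChar_shift hφ hτ ρ ω 0 r σ
  rw [Int.cast_zero, add_zero] at h
  rw [h, norm_mul, norm_ee, Complex.ofReal_im, mul_zero, Real.exp_zero, one_mul]

theorem exists_phiChar_le_of_le [Finite (Disc L)] (hφ : IsJacobiCuspForm L η k φ) (hη : 0 < q η) :
    ∃ C ε : ℝ, 0 < C ∧ 0 < ε ∧ ∀ (τ : ℂ) (ρ ω : ℝ) (σ : Disc L), 1 / 2 ≤ τ.im →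
      ‖phiChar η φ τ ρ ω σ‖ ≤ C * exp (-(ε * τ.im)) := by
  have := Fintype.ofFinite (Disc L)
  choose C ε hC hε h using exists_phiChar_le_of_mem_Icc hφ hη
  have hne : (Finset.univ : Finset (Disc L)).Nonempty := ⟨0, Finset.mem_univ _⟩
  refine ⟨Finset.univ.sup' hne C, Finset.univ.inf' hne ε,
    (hC 0).trans_le (Finset.le_sup' C (Finset.mem_univ 0)),
    (Finset.lt_inf'_iff hne).2 fun σ _ => hε σ, fun τ ρ ω σ hτ => ?_⟩
  have hτ0 : 0 < τ.im := by linarith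
  have e : phiChar η φ τ ρ ω σ = phiChar η φ τ ρ (Int.fract ω + (⌊ω⌋ : ℤ)) σ := by
    rw [Int.fract_add_floor]
  rw [e, norm_phiChar_shift hφ.toIsJacobiForm hτ0]
  set σ' := σ + ⌊ω⌋ • cls L η
  refine (h σ' τ ρ (Int.fract ω) hτ ⟨Int.fract_nonneg _, (Int.fract_lt_one _).le⟩).trans ?_
  refine mul_le_mul (Finset.le_sup' C (Finset.mem_univ σ')) (Real.exp_le_exp.2 ?_)
    (Real.exp_pos _).le ((hC σ').le.trans (Finset.le_sup' C (Finset.mem_univ σ')))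
  have := Finset.inf'_le ε (Finset.mem_univ σ')
  gcongr

end Decay

end

section

/-! ### Invariant pairings -/

theorem SL2Z_induction {p : SL(2, ℤ) → Prop} (hS : p ModularGroup.S) (hT : p ModularGroup.T)
    (h1 : p 1) (hmul : ∀ a b, p a → p b → p (a * b)) (hinv : ∀ a, p a → p a⁻¹) (γ : SL(2, ℤ)) :
    p γ := by
  have hγ : γ ∈ Subgroup.closure {ModularGroup.S, ModularGroup.T} := by
    rw [SpecialLinearGroup.SL2Z_generators]; trivial
  induction hγ using Subgroup.closure_induction with
  | mem x hx =>
    rcases hx with rfl | rfl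
    · exact hS
    · exact hT
  | one => exact h1
  | mul x y _ _ hx hy => exact hmul x y hx hy
  | inv x _ hx => exact hinv x hx

theorem coe_T_smul (τ : ℍ) : ((ModularGroup.T • τ : ℍ) : ℂ) = τ + 1 := by
  rw [UpperHalfPlane.modular_T_smul, UpperHalfPlane.coe_vadd]
  push_cast; ring

theorem coe_S_smul (τ : ℍ) : ((ModularGroup.S • τ : ℍ) : ℂ) = -1 / τ := by
  rw [UpperHalfPlane.modular_S_smul]
  simp [div_eq_mul_inv]

section Pairing
variable (L : Submodule ℤ (QSpace bp bm)) [Finite (Disc L)]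

theorem pairing_add_one (f h : Disc L → ℂ) :
    ∑ᶠ σ, weilT L f σ * conj (weilT L h σ) = ∑ᶠ σ, f σ * conj (h σ) := by
  have := Fintype.ofFinite (Disc L)
  simp only [finsum_eq_sum_of_fintype]
  exact sum_weilT L f h

theorem pairing_neg_inv [DiscreteTopology L] [IsZLattice ℝ L] {τ : ℂ} (hτ : 0 < τ.im) (k : ℝ) (f h : Disc L → ℂ) :
    ((((-1 / τ).im ^ k : ℝ) : ℂ)) * ∑ᶠ σ, (τ ^ (k : ℂ) • weilS L f) σ *
      conj ((τ ^ (k : ℂ) • weilS L h) σ) =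
    ((τ.im ^ k : ℝ) : ℂ) * ∑ᶠ σ, f σ * conj (h σ) := by
  have := Fintype.ofFinite (Disc L)
  have h0 : τ ≠ 0 := fun h => by simp [h] at hτ
  have hn : 0 < ‖τ‖ := norm_pos_iff.2 h0
  simp only [finsum_eq_sum_of_fintype, Pi.smul_apply, smul_eq_mul, map_mul]
  rw [Finset.sum_congr rfl fun σ _ => mul_mul_mul_comm (τ ^ (k : ℂ)) (weilS L f σ) _ _, ← Finset.mul_sum, sum_weilS, Complex.mul_conj, Complex.normSq_eq_norm_sq,
    Complex.norm_cpow_real, neg_inv_im, Complex.normSq_eq_norm_sq, ← mul_assoc,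
    Real.div_rpow hτ.le (by positivity), ← Real.rpow_natCast (‖τ‖ ^ k), ← Real.rpow_mul hn.le,
    ← Real.rpow_natCast ‖τ‖ 2, ← Real.rpow_mul hn.le, mul_comm k]
  rw [← Complex.ofReal_mul, div_mul_cancel₀ _ (by positivity)]

end Pairing

/-! ### Growth of Jacobi cusp forms at the boundary -/

section Growth
variable {L : Submodule ℤ (QSpace bp bm)} {η : QSpace bp bm} {k : ℝ} {φ : ℂ → ℂ → Disc L → ℂ}

theorem forall_pairing_le_iff [DiscreteTopology L] [IsZLattice ℝ L] [Finite (Disc L)]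
    (hφ : IsJacobiForm L η k φ) (γ : SL(2, ℤ)) (τ : ℍ) (B : ℝ) :
    (∀ ρ ω : ℝ, ‖((((γ • τ : ℍ) : ℂ).im ^ k : ℝ) : ℂ) *
        ∑ᶠ σ, phiChar η φ (γ • τ : ℍ) ρ ω σ *
          conj (phiChar η φ (γ • τ : ℍ) ρ ω σ)‖ ≤ B) ↔
      ∀ ρ ω : ℝ, ‖(((τ : ℂ).im ^ k : ℝ) : ℂ) *
        ∑ᶠ σ, phiChar η φ τ ρ ω σ * conj (phiChar η φ τ ρ ω σ)‖ ≤ B := by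
  set H : ℍ → ℝ → ℝ → ℂ := fun τ ρ ω => (((τ : ℂ).im ^ k : ℝ) : ℂ) *
        ∑ᶠ σ, phiChar η φ τ ρ ω σ * conj (phiChar η φ τ ρ ω σ) with hH
  have hT : ∀ τ ρ ω, H (ModularGroup.T • τ) (ρ - ω) ω = H τ ρ ω := fun τ ρ ω => by
    simp only [hH]
    rw [coe_T_smul, phiChar_add_one hφ τ.im_pos, pairing_add_one]
    simp
  have hS : ∀ τ ρ ω, H (ModularGroup.S • τ) ω (-ρ) = H τ ρ ω := fun τ ρ ω => by
    simp only [hH]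
    rw [coe_S_smul, phiChar_neg_inv hφ τ.im_pos, pairing_neg_inv L τ.im_pos]
  change (∀ ρ ω, ‖H (γ • τ) ρ ω‖ ≤ B) ↔ ∀ ρ ω, ‖H τ ρ ω‖ ≤ B
  revert τ
  refine SL2Z_induction (p := fun γ => ∀ τ : ℍ,
    (∀ ρ ω, ‖H (γ • τ) ρ ω‖ ≤ B) ↔ ∀ ρ ω, ‖H τ ρ ω‖ ≤ B) (fun τ => ?_) (fun τ => ?_)
    (fun τ => by rw [one_smul]) (fun a b ha hb τ => ?_) (fun a ha τ => ?_) γ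
  · refine ⟨fun h ρ ω => hS τ ρ ω ▸ h _ _, fun h ρ ω => ?_⟩
    have := hS τ (-ω) ρ
    rw [neg_neg] at this
    exact this ▸ h _ _
  · refine ⟨fun h ρ ω => hT τ ρ ω ▸ h _ _, fun h ρ ω => ?_⟩
    have := hT τ (ρ + ω) ω
    rw [add_sub_cancel_right] at this
    exact this ▸ h _ _
  · rw [mul_smul, ha, hb]
  · rw [← ha, smul_inv_smul]

theorem norm_pairing_self [Finite (Disc L)] (f : Disc L → ℂ) :
    ‖∑ᶠ σ, f σ * conj (f σ)‖ = ∑ᶠ σ, ‖f σ‖ ^ 2 := by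
  have := Fintype.ofFinite (Disc L)
  simp only [finsum_eq_sum_of_fintype, Complex.mul_conj, Complex.normSq_eq_norm_sq]
  rw [← Complex.ofReal_sum, Complex.norm_real, Real.norm_of_nonneg (by positivity)]

/-- A cusp form is rapidly decreasing at `∞` and of moderate growth at the real line. -/
theorem exists_norm_phiChar_le [DiscreteTopology L] [IsZLattice ℝ L] [Finite (Disc L)]
    (hφ : IsJacobiCuspForm L η k φ) (hη : 0 < q η) :
    ∃ (C ε : ℝ) (d : ℕ), 0 < C ∧ 0 < ε ∧ ∀ (τ : ℂ) (ρ ω : ℝ) (σ : Disc L), 0 < τ.im →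
      ‖phiChar η φ τ ρ ω σ‖ ≤ C * (1 + 1 / τ.im) ^ d * exp (-(ε * τ.im)) := by
  have := Fintype.ofFinite (Disc L)
  obtain ⟨C, ε, hC, hε, h⟩ := exists_phiChar_le_of_le hφ hη
  obtain ⟨N, hk⟩ := exists_rpow_le k
  obtain ⟨M, hM, hMle⟩ := one_add_pow_mul_exp_le (c := 2 * ε) (by positivity) N
  set B : ℝ := 3 ^ N * M * (Fintype.card (Disc L) * C ^ 2) with hB
  have hbound : ∀ (τ : ℍ) (ρ ω : ℝ), ‖(((τ : ℂ).im ^ k : ℝ) : ℂ) *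
        ∑ᶠ σ, phiChar η φ τ ρ ω σ * conj (phiChar η φ τ ρ ω σ)‖ ≤ B := by
    intro τ
    obtain ⟨γ, hγ⟩ := ModularGroup.exists_one_half_le_im_smul τ
    refine (forall_pairing_le_iff hφ.toIsJacobiForm γ τ B).1 fun ρ ω => ?_
    set y := ((γ • τ : ℍ) : ℂ).im with hy
    have hy2 : 1 / 2 ≤ y := hγ
    have hy0 : 0 < y := by linarith
    rw [norm_mul, norm_pairing_self, Complex.norm_real, Real.norm_of_nonneg (by positivity),
      finsum_eq_sum_of_fintype]
    have h1 : ∑ σ, ‖phiChar η φ (γ • τ : ℍ) ρ ω σ‖ ^ 2 ≤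
        Fintype.card (Disc L) * C ^ 2 * exp (-(2 * ε * y)) := by
      refine (Finset.sum_le_card_nsmul _ _ ((C * exp (-(ε * y))) ^ 2) fun σ _ => ?_).trans
        (le_of_eq ?_)
      · exact pow_le_pow_left₀ (norm_nonneg _) (h _ ρ ω σ hy2) 2
      · rw [Finset.card_univ, nsmul_eq_mul, mul_pow, ← Real.exp_nat_mul]
        push_cast
        ring_nf
    have h2 : y ^ k ≤ 3 ^ N * (1 + y) ^ N := by
      refine (hk y hy0).trans ?_
      rw [mul_comm, mul_pow]
      have : 1 / y ≤ 2 := by rw [div_le_iff₀ hy0]; linarith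
      gcongr
      linarith
    calc _ ≤ 3 ^ N * (1 + y) ^ N * (Fintype.card (Disc L) * C ^ 2 * exp (-(2 * ε * y))) := by
          gcongr
      _ = 3 ^ N * ((1 + y) ^ N * exp (-(2 * ε * y))) * (Fintype.card (Disc L) * C ^ 2) := by
          ring
      _ ≤ 3 ^ N * M * (Fintype.card (Disc L) * C ^ 2) := by gcongr; exact hMle y hy0.le
  have hB0 : 0 ≤ B := by positivity
  refine ⟨C + sqrt (B * 2 ^ N) * exp ε, ε, N, by positivity, hε,
    fun τ ρ ω σ hτ => ?_⟩
  set y := τ.im with hy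
  have hge : 1 ≤ (1 + 1 / y) ^ N := one_le_pow₀ (by have : 0 < 1 / y := by positivity
                                                    linarith)
  rcases le_total (1 / 2) y with h1 | h1
  · refine (h τ ρ ω σ h1).trans ?_
    have h3 : 0 ≤ sqrt (B * 2 ^ N) * exp ε := by positivity
    gcongr
    nlinarith
  · have hb := hbound ⟨τ, hτ⟩ ρ ω
    rw [norm_mul, norm_pairing_self, Complex.norm_real, Real.norm_of_nonneg (by positivity),
      finsum_eq_sum_of_fintype] at hb
    have h2 : y ^ k * ‖phiChar η φ τ ρ ω σ‖ ^ 2 ≤ B := by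
      refine le_trans ?_ hb
      gcongr
      exact Finset.single_le_sum (f := fun σ => ‖phiChar η φ τ ρ ω σ‖ ^ 2)
        (fun σ _ => by positivity) (Finset.mem_univ σ)
    have h3 : ‖phiChar η φ τ ρ ω σ‖ ^ 2 ≤ (sqrt (B * 2 ^ N) * (1 + 1 / y) ^ N) ^ 2 := by
      rw [mul_pow, Real.sq_sqrt (by positivity)]
      have h4 : (y ^ k)⁻¹ ≤ 2 ^ N * (1 + 1 / y) ^ N := by
        have := hk (1 / y) (by positivity)
        rw [one_div_one_div, one_div, Real.inv_rpow hτ.le, mul_pow, mul_comm] at this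
        refine this.trans ?_
        rw [one_div]
        gcongr
        linarith
      have h5 : ‖phiChar η φ τ ρ ω σ‖ ^ 2 ≤ B * (y ^ k)⁻¹ := by
        rw [← div_eq_mul_inv, le_div_iff₀ (by positivity), mul_comm]; exact h2
      calc _ ≤ B * (2 ^ N * (1 + 1 / y) ^ N) := h5.trans (by gcongr)
        _ ≤ B * 2 ^ N * ((1 + 1 / y) ^ N) ^ 2 := by
          rw [← mul_assoc]
          gcongr
          nlinarith
    have h6 := abs_le_of_sq_le_sq h3 (by positivity)
    rw [abs_of_nonneg (norm_nonneg _)] at h6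
    refine h6.trans ?_
    have h7 : 1 ≤ exp ε * exp (-(ε * y)) := by
      rw [← Real.exp_add, Real.one_le_exp_iff]
      nlinarith
    have h8 : sqrt (B * 2 ^ N) * (1 + 1 / y) ^ N ≤
        sqrt (B * 2 ^ N) * (1 + 1 / y) ^ N * (exp ε * exp (-(ε * y))) :=
      le_mul_of_one_le_right (by positivity) h7
    have h9 : 0 ≤ C * (1 + 1 / y) ^ N * exp (-(ε * y)) := by positivity
    nlinarith

end Growth

end

section

/-! ### Modular families of functions on the torus -/

/-- The integral over the unit square. -/
def squareIntegral (f : ℝ → ℝ → ℂ) : ℂ := ∫ x in (0 : ℝ)..1, ∫ y in (0 : ℝ)..1, f x y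

/-- Continuous functions on `ℝ²` with period lattice `ℤ²`. -/
structure IsBiperiodic (f : ℝ → ℝ → ℂ) : Prop where
  cont : Continuous (Function.uncurry f)
  left : ∀ x y, f (x + 1) y = f x y
  right : ∀ x y, f x (y + 1) = f x y

theorem squareIntegral_sub {f : ℝ → ℝ → ℂ} (hf : IsBiperiodic f) :
    squareIntegral (fun x y => f (x - y) y) = squareIntegral f := by
  have hc := hf.cont
  rw [squareIntegral, squareIntegral, intervalIntegral_swap, intervalIntegral_swap hc]
  · refine intervalIntegral.integral_congr fun y _ => ?_
    rw [intervalIntegral.integral_comp_sub_right (fun x => f x y) y]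
    have hp : Function.Periodic (fun x => f x y) 1 := fun x => hf.left x y
    have := hp.intervalIntegral_add_eq (0 - y) 0
    rwa [zero_add, show (0 : ℝ) - y + 1 = 1 - y by ring] at this
  · exact hc.comp (g := Function.uncurry f) (f := fun p : ℝ × ℝ => (p.1 - p.2, p.2)) (by fun_prop)

theorem squareIntegral_swap_neg {f : ℝ → ℝ → ℂ} (hf : IsBiperiodic f) :
    squareIntegral (fun x y => f y (-x)) = squareIntegral f := by
  have hc := hf.cont
  rw [squareIntegral, squareIntegral,
    intervalIntegral.integral_comp_neg (fun x => ∫ y in (0 : ℝ)..1, f y x), neg_zero,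
    intervalIntegral_swap hc]
  have hp : Function.Periodic (fun x => ∫ y in (0 : ℝ)..1, f y x) 1 := fun x => by
    simp only [hf.right]
  have := hp.intervalIntegral_add_eq (-1) 0
  rwa [zero_add, neg_add_cancel] at this

/-- Families of functions on the tori `ℝ²/ℤ²`, parametrized by `ℍ`, which are invariant under the
natural action of `SL₂(ℤ)`. -/
structure IsTorusFamily (f : ℍ → ℝ → ℝ → ℂ) : Prop where
  cont : Continuous fun p : ℍ × ℝ × ℝ => f p.1 p.2.1 p.2.2
  per : ∀ τ α β (a b : ℤ), f τ (α + a) (β + b) = f τ α β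
  transT : ∀ τ α β, f (ModularGroup.T • τ) (α - β) β = f τ α β
  transS : ∀ τ α β, f (ModularGroup.S • τ) β (-α) = f τ α β

/-- The Fourier coefficients of a family of functions on tori. -/
def torusCoeff (f : ℍ → ℝ → ℝ → ℂ) (w : Fin 2 → ℤ) (τ : ℍ) : ℂ :=
  squareIntegral fun α β => f τ α β * ee ((-w 0 * α + w 1 * β : ℝ) : ℂ)

section Torus
variable {f : ℍ → ℝ → ℝ → ℂ}

theorem IsTorusFamily.isBiperiodic (hf : IsTorusFamily f) (w : Fin 2 → ℤ) (τ : ℍ) :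
    IsBiperiodic fun α β => f τ α β * ee ((-w 0 * α + w 1 * β : ℝ) : ℂ) where
  cont := by
    refine Continuous.mul ?_ (continuous_ee.comp (by fun_prop))
    exact hf.cont.comp (f := fun p : ℝ × ℝ => (τ, p.1, p.2)) (by fun_prop)
  left x y := by
    have := hf.per τ x y 1 0
    simp only [Int.cast_one, Int.cast_zero, add_zero] at this
    rw [this]
    congr 1
    exact ee_congr ⟨-w 0, by push_cast; ring⟩
  right x y := by
    have := hf.per τ x y 0 1
    simp only [Int.cast_one, Int.cast_zero, add_zero] at this
    rw [this]
    congr 1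
    exact ee_congr ⟨w 1, by ring⟩

theorem IsTorusFamily.torusCoeff_T_smul (hf : IsTorusFamily f) (w : Fin 2 → ℤ)
    (τ : ℍ) :
    torusCoeff f w (ModularGroup.T • τ) = torusCoeff f (Matrix.vecMul w ModularGroup.T) τ := by
  rw [torusCoeff, ← squareIntegral_sub (hf.isBiperiodic w _), torusCoeff]
  congr 1
  funext α β
  rw [hf.transT]
  congr 3
  simp [Matrix.vecMul, dotProduct, Fin.sum_univ_two, ModularGroup.T]
  ring

theorem IsTorusFamily.torusCoeff_S_smul (hf : IsTorusFamily f) (w : Fin 2 → ℤ)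
    (τ : ℍ) :
    torusCoeff f w (ModularGroup.S • τ) = torusCoeff f (Matrix.vecMul w ModularGroup.S) τ := by
  rw [torusCoeff, ← squareIntegral_swap_neg (hf.isBiperiodic w _), torusCoeff]
  congr 1
  funext α β
  rw [hf.transS]
  congr 3
  simp [Matrix.vecMul, dotProduct, Fin.sum_univ_two, ModularGroup.S]
  ring

theorem IsTorusFamily.torusCoeff_smul (hf : IsTorusFamily f) (γ : SL(2, ℤ)) (w : Fin 2 → ℤ)
    (τ : ℍ) :
    torusCoeff f w (γ • τ) = torusCoeff f (Matrix.vecMul w γ) τ := by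
  revert w τ
  refine SL2Z_induction (p := fun γ => ∀ (w : Fin 2 → ℤ) (τ : ℍ),
    torusCoeff f w (γ • τ) = torusCoeff f (Matrix.vecMul w γ) τ) hf.torusCoeff_S_smul
    hf.torusCoeff_T_smul (fun w τ => by simp) (fun a b ha hb w τ => ?_) (fun a ha w τ => ?_) γ
  · rw [mul_smul, ha, hb, Matrix.vecMul_vecMul]; rfl
  · have h := ha (Matrix.vecMul w (a⁻¹ : SL(2, ℤ))) (a⁻¹ • τ)
    rw [smul_inv_smul, Matrix.vecMul_vecMul, ← Matrix.SpecialLinearGroup.coe_mul,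
      inv_mul_cancel] at h
    simpa using h.symm

theorem IsTorusFamily.continuous_torusCoeff (hf : IsTorusFamily f) (w : Fin 2 → ℤ) :
    Continuous (torusCoeff f w) := by
  unfold torusCoeff squareIntegral
  refine intervalIntegral.continuous_parametric_intervalIntegral_of_continuous'
    (f := fun (τ : ℍ) (α : ℝ) => ∫ β in (0 : ℝ)..1,
      f τ α β * ee ((-w 0 * α + w 1 * β : ℝ) : ℂ)) ?_ 0 1
  refine intervalIntegral.continuous_parametric_intervalIntegral_of_continuous'
    (f := fun (p : ℍ × ℝ) (β : ℝ) =>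
      f p.1 p.2 β * ee ((-w 0 * p.2 + w 1 * β : ℝ) : ℂ)) ?_ 0 1
  refine Continuous.mul ?_ (continuous_ee.comp (by fun_prop))
  exact hf.cont.comp (f := fun p : (ℍ × ℝ) × ℝ => (p.1.1, p.1.2, p.2)) (by fun_prop)

/-- Fourier inversion at the origin of the torus. -/
theorem IsTorusFamily.hasSum_torusCoeff (hf : IsTorusFamily f) (τ : ℍ)
    (hs : Summable fun w => torusCoeff f w τ) :
    HasSum (fun w => torusCoeff f w τ) (f τ 0 0) := by
  have hc : Continuous fun x : Fin 2 → ℝ => f τ (x 0) (x 1) :=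
    hf.cont.comp (f := fun x : Fin 2 → ℝ => (τ, x 0, x 1)) (by fun_prop)
  let e : (Fin 2 → ℤ) ≃ (Fin 2 → ℤ) :=
    { toFun := fun w => ![w 0, -w 1]
      invFun := fun w => ![w 0, -w 1]
      left_inv := fun w => by ext i; fin_cases i <;> simp
      right_inv := fun w => by ext i; fin_cases i <;> simp }
  have hcoef : ∀ w, ∫ t in cube (Fin 2), f τ (t 0) (t 1) * chr (-w) t = torusCoeff f (e w) τ := by
    intro w
    have hcw : Continuous fun t : Fin 2 → ℝ => f τ (t 0) (t 1) * chr (-w) t :=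
      hc.mul (continuous_chr _)
    rw [integral_cube_two hcw, torusCoeff, squareIntegral]
    simp [chr, e, Fin.sum_univ_two, add_comm]
  have h := hasSum_fourier_of_periodic hc (fun n x => hf.per τ (x 0) (x 1) (n 0) (n 1))
    (by simp only [hcoef]; exact e.summable_iff.2 hs) 0
  have h0 : ∀ w : Fin 2 → ℤ, chr w 0 = 1 := fun w => by simp [chr, ee_zero]
  simp only [hcoef, h0, mul_one] at h
  exact e.hasSum_iff.1 h

end Torus

end

section

/-! ### Unfolding -/

theorem countable_SL2Z : Countable SL(2, ℤ) :=
  inferInstanceAs (Countable {A : Fin 2 → Fin 2 → ℤ // Matrix.det (Matrix.of A) = 1})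

theorem measurable_SL2Z_smul (γ : SL(2, ℤ)) : Measurable fun τ : ℍ => γ • τ :=
  (continuous_const_smul (γ : GL (Fin 2) ℝ)).measurable

theorem volume_SL2Z_preimage (γ : SL(2, ℤ)) (s : Set ℍ) :
    volume ((fun τ : ℍ => γ • τ) ⁻¹' s) = volume s :=
  measure_preimage_smul volume (γ : GL (Fin 2) ℝ) s

theorem volume_setOf_re_eq (c : ℝ) : volume {z : ℂ | z.re = c} = 0 := by
  have h := Complex.volume_preserving_equiv_real_prod.measure_preimage
    (s := ({c} : Set ℝ) ×ˢ (Set.univ : Set ℝ))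
    ((measurableSet_singleton c).prod MeasurableSet.univ).nullMeasurableSet
  rw [Measure.volume_eq_prod, Measure.prod_prod, Real.volume_singleton, zero_mul] at h
  rw [← h]
  congr 1
  ext z
  simp [Complex.measurableEquivRealProd]

theorem volume_fd_diff_fdo : volume (ModularGroup.fd \ ModularGroup.fdo) = 0 := by
  rw [UpperHalfPlane.volume_eq_lintegral]
  refine setLIntegral_measure_zero _ _ (measure_mono_null (t := Metric.sphere (0 : ℂ) 1 ∪
    ({z : ℂ | z.re = 1 / 2} ∪ {z : ℂ | z.re = -(1 / 2)})) ?_ ?_)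
  · rintro _ ⟨τ, ⟨h1, h2⟩, rfl⟩
    by_cases h : Complex.normSq (τ : ℂ) = 1
    · left
      rw [mem_sphere_zero_iff_norm, ← sq_eq_sq₀ (norm_nonneg _) zero_le_one,
        ← Complex.normSq_eq_norm_sq, h, one_pow]
    · right
      have h3 : |τ.re| = 1 / 2 := by
        by_contra h4
        exact h2 ⟨lt_of_le_of_ne h1.1 (Ne.symm h), lt_of_le_of_ne h1.2 h4⟩
      exact eq_or_eq_neg_of_abs_eq h3
  · rw [measure_union_null_iff, measure_union_null_iff]
    exact ⟨Measure.addHaar_sphere _ _ _, volume_setOf_re_eq _, volume_setOf_re_eq _⟩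

theorem ae_tsum_indicator_fd : ∀ᵐ τ : ℍ,
    ∑' γ : SL(2, ℤ), ModularGroup.fd.indicator (1 : ℍ → ENNReal) (γ • τ) = 2 := by
  have := countable_SL2Z
  have h : ∀ᵐ τ : ℍ, ∀ γ : SL(2, ℤ), γ • τ ∉ ModularGroup.fd \ ModularGroup.fdo := by
    rw [ae_all_iff]
    intro γ
    have := volume_SL2Z_preimage γ (ModularGroup.fd \ ModularGroup.fdo)
    rw [volume_fd_diff_fdo] at this
    exact measure_eq_zero_iff_ae_notMem.1 this
  filter_upwards [h] with τ hτ
  obtain ⟨γ, hγ⟩ := ModularGroup.exists_smul_mem_fd τ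
  have hγo : γ • τ ∈ ModularGroup.fdo := by
    by_contra h
    exact hτ γ ⟨hγ, h⟩
  have hne : γ ≠ -γ := fun h => by
    have h2 : (γ : Matrix (Fin 2) (Fin 2) ℤ) = -γ := by
      conv_lhs => rw [h]
      simp
    have h3 : ∀ i j, γ i j = 0 := fun i j => by
      have := congrFun (congrFun h2 i) j
      simp only [Matrix.neg_apply] at this
      omega
    have := γ.det_coe
    rw [Matrix.det_fin_two, h3, h3, h3] at this
    simp at this
  have hmem : ∀ γ' : SL(2, ℤ), γ' ∉ ({γ, -γ} : Finset SL(2, ℤ)) →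
      ModularGroup.fd.indicator (1 : ℍ → ENNReal) (γ' • τ) = 0 := by
    intro γ' h'
    refine Set.indicator_of_notMem (fun hfd => h' ?_) _
    have h1 : (γ' * γ⁻¹) • γ • τ ∈ ModularGroup.fd := by
      rwa [mul_smul, inv_smul_smul]
    rcases ModularGroup.eq_one_or_neg_one_of_mem_fdo_mem_fd hγo h1 with h2 | h2
    · simp [mul_inv_eq_one.1 h2]
    · have : γ' = -γ := by
        rw [← inv_mul_cancel_right γ' γ, h2, neg_mul, one_mul]
      simp [this]
  rw [tsum_eq_sum (s := {γ, -γ}) (fun γ' h' => hmem γ' h'), Finset.sum_pair hne,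
    ModularGroup.SL_neg_smul, Set.indicator_of_mem hγ]
  norm_num

theorem sum_map_restrict_fd : Measure.sum (fun γ : SL(2, ℤ) =>
    ((volume : Measure ℍ).restrict ModularGroup.fd).map (fun τ => γ • τ)) =
      (2 : ENNReal) • volume := by
  have := countable_SL2Z
  have hfd : MeasurableSet ModularGroup.fd := ModularGroup.isClosed_fd.measurableSet
  ext s hs
  rw [Measure.sum_apply _ hs, Measure.smul_apply, smul_eq_mul]
  have h1 : ∀ γ : SL(2, ℤ), ((volume : Measure ℍ).restrict ModularGroup.fd).map
      (fun τ => γ • τ) s =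
      ∫⁻ τ in s, ModularGroup.fd.indicator (1 : ℍ → ENNReal) (γ⁻¹ • τ) := by
    intro γ
    rw [Measure.map_apply (measurable_SL2Z_smul γ) hs,
      Measure.restrict_apply (measurable_SL2Z_smul γ hs), ← volume_SL2Z_preimage γ⁻¹]
    have h2 : (fun τ : ℍ => ModularGroup.fd.indicator (1 : ℍ → ENNReal)
        (γ⁻¹ • τ)) =
        ((fun τ : ℍ => γ⁻¹ • τ) ⁻¹' ModularGroup.fd).indicator 1 := rfl
    rw [h2, lintegral_indicator_one ((measurable_SL2Z_smul γ⁻¹) hfd),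
      Measure.restrict_apply ((measurable_SL2Z_smul γ⁻¹) hfd), Set.preimage_inter, Set.inter_comm]
    congr 2
    ext τ
    simp
  simp only [h1]
  rw [← lintegral_tsum, ← setLIntegral_const]
  · refine setLIntegral_congr_fun_ae hs ?_
    filter_upwards [ae_tsum_indicator_fd] with τ hτ _
    rw [← hτ]
    exact (Equiv.inv SL(2, ℤ)).tsum_eq
      (fun γ => ModularGroup.fd.indicator (1 : ℍ → ENNReal) (γ • τ))
  · intro γ
    exact ((measurable_one.indicator hfd).comp (measurable_SL2Z_smul γ⁻¹)).aemeasurable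

/-- A fundamental domain for the translations. -/
def strip : Set ℍ := {τ | 0 ≤ τ.re ∧ τ.re < 1}

theorem measurableSet_strip : MeasurableSet strip :=
  (measurableSet_le measurable_const UpperHalfPlane.continuous_re.measurable).inter
    (measurableSet_lt UpperHalfPlane.continuous_re.measurable measurable_const)

theorem gcd_bottom_row (γ : SL(2, ℤ)) (n : ℕ) :
    Int.gcd (((n + 1 : ℕ) : ℤ) * γ 1 0) (((n + 1 : ℕ) : ℤ) * γ 1 1) = n + 1 := by
  have h := Int.isCoprime_iff_gcd_eq_one.1 (ModularGroup.bottom_row_coprime γ)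
  rw [Int.gcd_mul_left, h, mul_one, Int.natAbs_natCast]

theorem bijective_bottom_row (τ : ℍ) :
    Function.Bijective (fun i : {i : ℕ × SL(2, ℤ) // i.2 • τ ∈ strip} =>
      (⟨((i.1.1 + 1 : ℕ) : ℤ) • (i.1.2 : Matrix (Fin 2) (Fin 2) ℤ) 1, fun h => by
        have h0 := gcd_bottom_row i.1.2 i.1.1
        have h1 := congrFun h 0
        have h2 := congrFun h 1
        simp only [Pi.smul_apply, smul_eq_mul, Pi.zero_apply] at h1 h2
        rw [h1, h2] at h0
        simp at h0⟩ : {w : Fin 2 → ℤ // w ≠ 0})) := by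
  constructor
  · rintro ⟨⟨n, γ⟩, h⟩ ⟨⟨n', γ'⟩, h'⟩ hh
    simp only [Subtype.mk.injEq] at hh
    have hn : n = n' := by
      have h0 := congrFun hh 0
      have h1 := congrFun hh 1
      simp only [Pi.smul_apply, smul_eq_mul] at h0 h1
      have := gcd_bottom_row γ n
      rw [h0, h1, gcd_bottom_row] at this
      omega
    subst hn
    have hrow : ∀ j, γ 1 j = γ' 1 j := fun j => by
      have h0 := congrFun hh j
      simp only [Pi.smul_apply, smul_eq_mul] at h0
      exact mul_left_cancel₀ (by positivity) h0
    set M := γ' * γ⁻¹ with hM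
    have hM0 : M 1 0 = 0 := by
      simp [hM, Matrix.mul_apply, Fin.sum_univ_two, Matrix.adjugate_fin_two, ← hrow]; ring
    have hM1 : M 1 1 = 1 := by
      have := γ.det_coe
      rw [Matrix.det_fin_two] at this
      simp [hM, Matrix.mul_apply, Fin.sum_univ_two, Matrix.adjugate_fin_two, ← hrow]
      linarith
    have hM2 : M 0 0 = 1 := by
      have := M.det_coe
      rw [Matrix.det_fin_two, hM0, hM1] at this
      simpa using this
    have hMT : M = ModularGroup.T ^ (M 0 1) := by
      ext i j
      rw [ModularGroup.coe_T_zpow]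
      fin_cases i <;> fin_cases j <;> simp [hM0, hM1, hM2]
    have hγ' : γ' = ModularGroup.T ^ (M 0 1) * γ := by
      rw [← hMT, hM, inv_mul_cancel_right]
    have hz : M 0 1 = 0 := by
      have h1 := h
      have h2 := h'
      simp only at h1 h2
      rw [hγ', mul_smul] at h2
      have e1 := h2.1
      have e2 := h2.2
      rw [ModularGroup.re_T_zpow_smul] at e1 e2
      have e3 := h1.1
      have e4 := h1.2
      have e5 : (-1 : ℝ) < M 0 1 := by linarith
      have e6 : ((M 0 1 : ℤ) : ℝ) < 1 := by linarith
      have e7 : -1 < M 0 1 := by exact_mod_cast e5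
      have e8 : M 0 1 < 1 := by exact_mod_cast e6
      omega
    rw [hz, zpow_zero, one_mul] at hγ'
    simp [hγ']
  · rintro ⟨w, hw⟩
    have hg : 0 < Int.gcd (w 0) (w 1) := by
      rw [Int.gcd_pos_iff]
      by_contra h
      push Not at h
      exact hw (by ext j; fin_cases j; exacts [h.1, h.2])
    obtain ⟨a, b, hab, ha, hb⟩ := Int.exists_gcd_one hg
    obtain ⟨γ, -, hγ⟩ := ModularGroup.bottom_row_surj (R := ℤ)
      (show ![a, b] ∈ {cd : Fin 2 → ℤ | IsCoprime (cd 0) (cd 1)} from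
        Int.isCoprime_iff_gcd_eq_one.2 hab)
    obtain ⟨n, hn⟩ : ∃ n : ℕ, Int.gcd (w 0) (w 1) = n + 1 := ⟨_, (Nat.succ_pred_eq_of_pos hg).symm⟩
    have hs : (ModularGroup.T ^ (-⌊(γ • τ).re⌋) * γ) • τ ∈ strip := by
      rw [mul_smul]
      refine ⟨?_, ?_⟩
      · rw [ModularGroup.re_T_zpow_smul]
        have := Int.floor_le (γ • τ).re
        push_cast; linarith
      · rw [ModularGroup.re_T_zpow_smul]
        have := Int.lt_floor_add_one (γ • τ).re
        push_cast; linarith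
    refine ⟨⟨(n, _), hs⟩, Subtype.ext ?_⟩
    simp only [ModularGroup.T_pow_mul_apply_one]
    have hγ' : (γ : Matrix (Fin 2) (Fin 2) ℤ) 1 = ![a, b] := hγ
    rw [hγ', ← hn]
    ext j
    fin_cases j
    · simp only [Pi.smul_apply, smul_eq_mul]
      rw [mul_comm]; exact ha.symm
    · simp only [Pi.smul_apply, smul_eq_mul]
      rw [mul_comm]; exact hb.symm

section Unfold
variable {f : ℍ → ℝ → ℝ → ℂ}

/-- The contribution of the translate by `γ` of the fundamental domain. -/
def unfoldTerm (f : ℍ → ℝ → ℝ → ℂ) (i : ℕ × SL(2, ℤ)) (τ : ℍ) : ℂ :=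
  strip.indicator (torusCoeff f ![0, ((i.1 + 1 : ℕ) : ℤ)]) (i.2 • τ)

theorem IsTorusFamily.unfoldTerm_eq (hf : IsTorusFamily f) {i : ℕ × SL(2, ℤ)} {τ : ℍ}
    (h : i.2 • τ ∈ strip) : unfoldTerm f i τ =
      torusCoeff f (((i.1 + 1 : ℕ) : ℤ) • (i.2 : Matrix (Fin 2) (Fin 2) ℤ) 1) τ := by
  rw [unfoldTerm, Set.indicator_of_mem h, hf.torusCoeff_smul]
  congr 1
  ext j
  simp [Matrix.vecMul, dotProduct, Fin.sum_univ_two]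

theorem IsTorusFamily.summable_torusCoeff (hf : IsTorusFamily f) {τ : ℍ}
    (h : Summable fun i => ‖unfoldTerm f i τ‖) :
    HasSum (fun w => torusCoeff f w τ) (torusCoeff f 0 τ + ∑' i, unfoldTerm f i τ) := by
  let s : Set (ℕ × SL(2, ℤ)) := {i | i.2 • τ ∈ strip}
  have h1 : ∀ i, i ∉ s → unfoldTerm f i τ = 0 := fun i hi =>
    Set.indicator_of_notMem (show i.2 • τ ∉ strip from hi) _
  have h2 : HasSum (fun i : s => unfoldTerm f i τ) (∑' i, unfoldTerm f i τ) :=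
    (hasSum_subtype_iff_of_support_subset (fun i hi => by
      by_contra h; exact hi (h1 i h))).2 h.of_norm.hasSum
  let e := Equiv.ofBijective _ (bijective_bottom_row τ)
  have h3 : HasSum (fun w : {w : Fin 2 → ℤ // w ≠ 0} => torusCoeff f w τ)
      (∑' i, unfoldTerm f i τ) := by
    rw [← e.hasSum_iff]
    have he : (fun w : {w : Fin 2 → ℤ // w ≠ 0} => torusCoeff f w τ) ∘ e =
        fun i : s => unfoldTerm f i τ := funext fun i => (hf.unfoldTerm_eq i.2).symm
    rwa [he]
  have h4 : HasSum (fun w : ({0} : Set (Fin 2 → ℤ)) => torusCoeff f w τ) (torusCoeff f 0 τ) := by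
    exact hasSum_unique (fun w : ({0} : Set (Fin 2 → ℤ)) => torusCoeff f w τ)
  exact HasSum.add_isCompl (s := ({0} : Set (Fin 2 → ℤ))) (t := {w | w ≠ 0}) isCompl_compl h4 h3

theorem integrable_comp_smul_fd {E : Type*} [NormedAddCommGroup E] [NormedSpace ℝ E]
    {G : ℍ → E} (hG : Integrable G) :
    (∀ γ : SL(2, ℤ), IntegrableOn (fun τ => G (γ • τ)) ModularGroup.fd) ∧
    HasSum (fun γ : SL(2, ℤ) => ∫ τ in ModularGroup.fd, G (γ • τ)) ((2 : ℝ) • ∫ τ, G τ) := by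
  have := countable_SL2Z
  have h1 : Integrable G (Measure.sum (fun γ : SL(2, ℤ) =>
      ((volume : Measure ℍ).restrict ModularGroup.fd).map (fun τ => γ • τ))) := by
    rw [sum_map_restrict_fd]
    exact hG.smul_measure (by simp)
  have h2 : ∀ γ : SL(2, ℤ), Integrable G
      (((volume : Measure ℍ).restrict ModularGroup.fd).map (fun τ => γ • τ)) :=
    fun γ => h1.mono_measure (Measure.le_sum _ γ)
  refine ⟨fun γ => (integrable_map_measure (h2 γ).aestronglyMeasurable
    (measurable_SL2Z_smul γ).aemeasurable).1 (h2 γ), ?_⟩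
  have h3 := hasSum_integral_measure h1
  rw [sum_map_restrict_fd, integral_smul_measure] at h3
  simp only [ENNReal.toReal_ofNat] at h3
  convert h3 using 2 with γ
  exact (integral_map (measurable_SL2Z_smul γ).aemeasurable (h2 γ).aestronglyMeasurable).symm

theorem IsTorusFamily.hasSum_unfold (hf : IsTorusFamily f)
    (h0 : IntegrableOn (torusCoeff f 0) ModularGroup.fd)
    (h1 : IntegrableOn (fun τ => f τ 0 0) ModularGroup.fd)
    (hi : ∀ n : ℕ, IntegrableOn (torusCoeff f ![0, ((n + 1 : ℕ) : ℤ)]) strip)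
    (hs : Summable fun n : ℕ => ∫ τ in strip, ‖torusCoeff f ![0, ((n + 1 : ℕ) : ℤ)] τ‖) :
    HasSum (fun n : ℕ => (2 : ℝ) • ∫ τ in strip, torusCoeff f ![0, ((n + 1 : ℕ) : ℤ)] τ)
      ((∫ τ in ModularGroup.fd, f τ 0 0) - ∫ τ in ModularGroup.fd, torusCoeff f 0 τ) := by
  have := countable_SL2Z
  have hG : ∀ n : ℕ, Integrable (strip.indicator (torusCoeff f ![0, ((n + 1 : ℕ) : ℤ)])) :=
    fun n => (integrable_indicator_iff measurableSet_strip).2 (hi n)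
  have hint : ∀ i, IntegrableOn (unfoldTerm f i) ModularGroup.fd := fun i =>
    (integrable_comp_smul_fd (hG i.1)).1 i.2
  have hnorm : ∀ n : ℕ, HasSum (fun γ => ∫ τ in ModularGroup.fd, ‖unfoldTerm f (n, γ) τ‖)
      ((2 : ℝ) • ∫ τ in strip, ‖torusCoeff f ![0, ((n + 1 : ℕ) : ℤ)] τ‖) := by
    intro n
    have h := (integrable_comp_smul_fd (hG n).norm).2
    have h' : ∫ τ in strip, ‖torusCoeff f ![0, ((n + 1 : ℕ) : ℤ)] τ‖ =
        ∫ τ, ‖strip.indicator (torusCoeff f ![0, ((n + 1 : ℕ) : ℤ)]) τ‖ := by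
      rw [← integral_indicator measurableSet_strip]
      congr 1
      funext τ
      exact (norm_indicator_eq_indicator_norm _ _).symm
    rw [h']
    exact h
  have hsum : Summable fun i => ∫ τ in ModularGroup.fd, ‖unfoldTerm f i τ‖ := by
    rw [summable_prod_of_nonneg (fun i => integral_nonneg fun τ => norm_nonneg _)]
    refine ⟨fun n => (hnorm n).summable, ?_⟩
    simp only [(hnorm _).tsum_eq]
    exact hs.const_smul _
  have hmain := hasSum_integral_of_summable_integral_norm (μ := volume.restrict ModularGroup.fd)
    hint hsum
  have hae : ∀ᵐ τ ∂(volume.restrict ModularGroup.fd), Summable fun i => ‖unfoldTerm f i τ‖ := by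
    have h2 : ∫⁻ τ in ModularGroup.fd, ∑' i, ‖unfoldTerm f i τ‖ₑ ≠ ⊤ := by
      rw [lintegral_tsum fun i => (hint i).aestronglyMeasurable.enorm]
      simp only [← ofReal_integral_norm_eq_lintegral_enorm (hint _)]
      exact hsum.tsum_ofReal_ne_top
    filter_upwards [ae_lt_top' (AEMeasurable.tsum fun i =>
      (hint i).aestronglyMeasurable.enorm) h2] with τ hτ
    have := ENNReal.tsum_coe_ne_top_iff_summable.1 hτ.ne
    exact NNReal.summable_coe.2 this
  have hval : ∫ τ in ModularGroup.fd, ∑' i, unfoldTerm f i τ =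
      (∫ τ in ModularGroup.fd, f τ 0 0) - ∫ τ in ModularGroup.fd, torusCoeff f 0 τ := by
    rw [← integral_sub h1 h0]
    refine integral_congr_ae ?_
    filter_upwards [hae] with τ hτ
    have h2 := hf.summable_torusCoeff hτ
    rw [(hf.hasSum_torusCoeff τ h2.summable).unique h2, add_sub_cancel_left]
  rw [hval] at hmain
  refine hmain.prod_fiberwise fun n => ?_
  have h := (integrable_comp_smul_fd (hG n)).2
  rwa [integral_indicator measurableSet_strip] at h

end Unfold

end

section

/-! ### Integrating theta functions over the isotropic directions -/

theorem squareIntegral_eq {f : ℝ → ℝ → ℂ} (hf : Continuous (Function.uncurry f)) :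
    squareIntegral f = ∫ p, f p.1 p.2 ∂((volume.restrict (Set.Ioc (0 : ℝ) 1)).prod
      (volume.restrict (Set.Ioc (0 : ℝ) 1))) := by
  have h := integral_prod _ (integrable_square hf)
  simp only [squareIntegral, intervalIntegral.integral_of_le zero_le_one]
  exact h.symm

theorem hasSum_squareIntegral {ι : Type*} [Countable ι] {F : ι → ℝ → ℝ → ℂ} {S : ℝ → ℝ → ℂ}
    {b : ι → ℝ} (hF : ∀ i, Continuous (Function.uncurry (F i)))
    (hS : Continuous (Function.uncurry S)) (hsum : ∀ x y, HasSum (fun i => F i x y) (S x y))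
    (hb : ∀ i, ∀ x ∈ Set.Ioc (0 : ℝ) 1, ∀ y ∈ Set.Ioc (0 : ℝ) 1, ‖F i x y‖ ≤ b i)
    (hbs : Summable b) : HasSum (fun i => squareIntegral (F i)) (squareIntegral S) := by
  set μ := (volume.restrict (Set.Ioc (0 : ℝ) 1)).prod (volume.restrict (Set.Ioc (0 : ℝ) 1)) with hμ
  have hμ1 : μ.real Set.univ = 1 := by
    rw [hμ, Measure.prod_restrict, measureReal_def, Measure.restrict_apply_univ, Measure.prod_prod]
    simp
  have hbound : ∀ i, ∫ p, ‖F i p.1 p.2‖ ∂μ ≤ b i := by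
    intro i
    have h : ∀ᵐ p ∂μ, ‖F i p.1 p.2‖ ≤ b i := by
      rw [hμ, Measure.prod_restrict]
      filter_upwards [ae_restrict_mem (measurableSet_Ioc.prod measurableSet_Ioc)] with p hp
      exact hb i _ hp.1 _ hp.2
    calc _ ≤ ∫ _, b i ∂μ := integral_mono_ae (integrable_square (hF i)).norm
          (by have : IsFiniteMeasure μ := by rw [hμ]; infer_instance
              exact integrable_const _) h
      _ = b i := by rw [integral_const, hμ1, one_smul]
  have h := hasSum_integral_of_summable_integral_norm (μ := μ) (F := fun i p => F i p.1 p.2)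
    (fun i => integrable_square (hF i))
    (Summable.of_nonneg_of_le (fun i => integral_nonneg fun p => norm_nonneg _) hbound hbs)
  simp only [(hsum _ _).tsum_eq] at h
  rw [squareIntegral_eq hS]
  simp only [squareIntegral_eq (hF _)]
  exact h

theorem integral_ee_mul (n : ℤ) : ∫ x in (0 : ℝ)..1, ee ((x * n : ℝ) : ℂ) = if n = 0 then 1 else 0 := by
  split_ifs with h
  · simp [h, ee_zero]
  · have hc : (2 * π * I * n : ℂ) ≠ 0 := by
      simp [Real.pi_ne_zero, h]
    have h1 := integral_exp_mul_complex (a := 0) (b := 1) hc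
    have h2 : ∀ x : ℝ, ee ((x * n : ℝ) : ℂ) = Complex.exp (2 * π * I * n * x) :=
      fun x => by rw [ee]; congr 1; push_cast; ring
    simp only [h2, h1]
    have h3 := ee_int n
    rw [ee] at h3
    simp [h3]

section Line
variable {L K : Submodule ℤ (QSpace bp bm)} {u u' η : QSpace bp bm}
  {g : QSpace bp bm ≃ₗ[ℝ] QSpace bp bm}

/-- The functions `P_h(g_K(X)) e(q(X_{w⊥}) τ + q(X_w) τ̄)`. -/
def subGauss (g : QSpace bp bm ≃ₗ[ℝ] QSpace bp bm) (u : QSpace bp bm)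
    (P : MvPolynomial (Fin bp) ℂ) (h : ℕ) (τ : ℂ) (X : QSpace bp bm) : ℂ :=
  polyAt (subPoly g u P h) (gSub g u X) * Complex.exp (π * I *
    (τ * (‖(gSub g u X).1‖ ^ 2 : ℝ) - conj τ * (‖(gSub g u X).2‖ ^ 2 : ℝ)))

theorem gaussPoly_add_smul (H : Splitting L K u u' η) (hg : IsIsom g)
    {P : MvPolynomial (Fin bp) ℂ} {m : ℕ} (hP : P.IsHomogeneous m)
    (hlap : ∀ h, laplacian (subPoly g u P h) = 0) (τ : ℂ)
    (X : QSpace bp bm) (t : ℝ) :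
    gaussPoly P τ (gSub g u X + t • g u) =
      ∑ h ∈ Finset.range (m + 1), subGauss g u P h τ X *
        ((herm ((1 / (4 * π * τ.im) : ℝ) * (‖(g u).1‖ ^ 2 : ℝ)) h).eval
          ((t * ‖(g u).1‖ ^ 2 : ℝ) : ℂ) *
          Complex.exp (-(2 * π * τ.im * ‖(g u).1‖ ^ 2 * t ^ 2 : ℝ))) := by
  have hω : (g u).1 ≠ 0 := norm_pos_iff.1 (H.norm_pos hg)
  have h1 := eval_heat_split hω hP hlap ((1 / (4 * π * τ.im) : ℝ) : ℂ)
    (gSub_fst_orth hg u X) t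
  have h2 : ‖(gSub g u X + t • g u).1‖ ^ 2 = ‖(gSub g u X).1‖ ^ 2 + t ^ 2 * ‖(g u).1‖ ^ 2 := by
    rw [Prod.fst_add, Prod.smul_fst, norm_add_sq_real, inner_smul_right, gSub_fst_orth hg,
      norm_smul, mul_pow, Real.norm_eq_abs, sq_abs]
    ring
  have h3 : ‖(gSub g u X + t • g u).2‖ ^ 2 = ‖(gSub g u X).2‖ ^ 2 + t ^ 2 * ‖(g u).1‖ ^ 2 := by
    rw [Prod.snd_add, Prod.smul_snd, norm_add_sq_real, inner_smul_right, gSub_snd_orth hg,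
      norm_smul, mul_pow, Real.norm_eq_abs, sq_abs, H.norm_eq hg]
    ring
  have h4 : polyAt (heat τ.im P) (gSub g u X + t • g u) =
      ∑ h ∈ Finset.range (m + 1),
        (herm ((1 / (4 * π * τ.im) : ℝ) * (‖(g u).1‖ ^ 2 : ℝ)) h).eval
          ((t * ‖(g u).1‖ ^ 2 : ℝ) : ℂ) *
        MvPolynomial.eval (fun i => (((gSub g u X).1 i : ℝ) : ℂ)) (polyCoeff (g u).1 P h) := by
    rw [polyAt, heat_eq_heatOp]
    exact h1
  have h5 : Complex.exp (π * I *
      (τ * (‖(gSub g u X + t • g u).1‖ ^ 2 : ℝ) -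
        conj τ * (‖(gSub g u X + t • g u).2‖ ^ 2 : ℝ))) =
      Complex.exp (π * I *
        (τ * (‖(gSub g u X).1‖ ^ 2 : ℝ) - conj τ * (‖(gSub g u X).2‖ ^ 2 : ℝ))) *
      Complex.exp (-(2 * π * τ.im * ‖(g u).1‖ ^ 2 * t ^ 2 : ℝ)) := by
    rw [← Complex.exp_add, h2, h3]
    congr 1
    have : τ - conj τ = 2 * τ.im * I := by
      rw [Complex.sub_conj]; push_cast; ring
    have e : conj τ = τ - 2 * τ.im * I := by rw [← this]; ring
    rw [e]
    push_cast
    ring_nf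
    rw [Complex.I_sq]
    ring
  rw [gaussPoly, h4, h5, Finset.sum_mul]
  refine Finset.sum_congr rfl fun h _ => ?_
  rw [subGauss, polyAt, subPoly]
  ring

theorem integral_herm_line {N y : ℝ} (hN : 0 < N) (hy : 0 < y) (h : ℕ) (n : ℝ) :
    Integrable (fun t : ℝ => ((herm ((1 / (4 * π * y) : ℝ) * (N : ℝ)) h).eval
          ((t * N : ℝ) : ℂ) * Complex.exp (-(2 * π * y * N * t ^ 2 : ℝ))) *
          ee ((n * t : ℝ) : ℂ)) ∧
    ∫ t : ℝ, ((herm ((1 / (4 * π * y) : ℝ) * (N : ℝ)) h).eval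
          ((t * N : ℝ) : ℂ) * Complex.exp (-(2 * π * y * N * t ^ 2 : ℝ))) *
          ee ((n * t : ℝ) : ℂ) =
      (1 / sqrt (2 * y * N) : ℝ) * exp (-(π * n ^ 2 / (2 * y * N))) *
        (n * I / (2 * y)) ^ h := by
  set τ : ℂ := ((2 * y / N : ℝ) : ℂ) * I with hτ
  have him : 0 < τ.im := by rw [hτ]; simp; positivity
  have hτ0 : τ ≠ 0 := fun h => by simp [h] at him
  set c : ℂ := (1 / (4 * π * y) : ℝ) * (N : ℝ) with hc
  have hpi : (π : ℂ) ≠ 0 := by exact_mod_cast Real.pi_ne_zero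
  have hNc : (N : ℂ) ≠ 0 := by exact_mod_cast hN.ne'
  have hyc : (y : ℂ) ≠ 0 := by exact_mod_cast hy.ne'
  set F : ℝ → ℂ := fun x => (herm c h).eval (x : ℂ) *
      Complex.exp (π * I * τ * x ^ 2 - 2 * π * I * (-(n / N) : ℝ) * x)
    with hF
  have hFi : Integrable F := integrable_herm_gauss _ him _
  have hrew : (fun t : ℝ => ((herm c h).eval
          ((t * N : ℝ) : ℂ) * Complex.exp (-(2 * π * y * N * t ^ 2 : ℝ))) *
          ee ((n * t : ℝ) : ℂ)) = fun t => F (t * N) := by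
    funext t
    simp only [hF]
    rw [ee, mul_assoc, ← Complex.exp_add]
    congr 2
    rw [hτ]
    push_cast
    field_simp
    ring_nf
    rw [Complex.I_sq]
    ring
  have h1 := integral_herm_gauss c him (-(n / N)) h
  have hc0 : c * τ ^ 2 - I * τ / (2 * π) = 0 := by
    rw [hc, hτ]
    push_cast
    field_simp
    ring_nf
  rw [hc0, herm_zero, Polynomial.eval_pow, Polynomial.eval_X] at h1
  rw [hrew]
  refine ⟨hFi.comp_mul_right' hN.ne', ?_⟩
  rw [Measure.integral_comp_mul_right F N, abs_of_pos (by positivity)]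
  have h2 : ∫ x, F x = ((-(n / N) : ℝ) : ℂ) ^ h / τ ^ h * (1 / (-I * τ) ^ (1 / 2 : ℂ) *
      Complex.exp (-(π * I * ((-(n / N) : ℝ) : ℂ) ^ 2 / τ))) := by
    rw [div_mul_eq_mul_div, eq_div_iff (pow_ne_zero _ hτ0), mul_comm]
    exact h1
  rw [h2, ← div_pow]
  have h3 : ((-(n / N) : ℝ) : ℂ) / τ = n * I / (2 * y) := by
    rw [hτ]
    push_cast
    field_simp
    rw [Complex.I_sq]; ring
  have h4 : (-I * τ) ^ (1 / 2 : ℂ) = (sqrt (2 * y / N) : ℝ) := by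
    rw [hτ, Real.sqrt_eq_rpow, Complex.ofReal_cpow (by positivity)]
    congr 1
    · rw [mul_left_comm, neg_mul, Complex.I_mul_I]; simp
    · simp
  have h5 : Complex.exp (-(π * I * ((-(n / N) : ℝ) : ℂ) ^ 2 / τ)) =
      exp (-(π * n ^ 2 / (2 * y * N))) := by
    rw [Complex.ofReal_exp]
    congr 1
    rw [hτ]
    push_cast
    field_simp
  rw [h3, h4, h5]
  have h6 : |N⁻¹| * (1 / sqrt (2 * y / N)) = 1 / sqrt (2 * y * N) := by
    rw [abs_of_pos (by positivity)]
    have : sqrt (2 * y * N) = N * sqrt (2 * y / N) := by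
      rw [show 2 * y * N = N ^ 2 * (2 * y / N) by field_simp, Real.sqrt_mul (by positivity),
        Real.sqrt_sq hN.le]
    rw [this]; field_simp
  rw [← h6, abs_of_pos (by positivity), Complex.real_smul]
  push_cast
  ring

/-- The Fourier transform of the theta summand in the isotropic direction. -/
def lineTerm (g : QSpace bp bm ≃ₗ[ℝ] QSpace bp bm) (u : QSpace bp bm)
    (P : MvPolynomial (Fin bp) ℂ) (m : ℕ) (n : ℝ) (τ : ℂ) (X : QSpace bp bm) : ℂ :=
  ee (-(n * (bil X (posPart g u) / ‖(g u).1‖ ^ 2)) : ℝ) *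
    ((1 / sqrt (2 * τ.im * ‖(g u).1‖ ^ 2) : ℝ) *
      exp (-(π * n ^ 2 / (2 * τ.im * ‖(g u).1‖ ^ 2)))) *
    ∑ h ∈ Finset.range (m + 1), (n * I / (2 * τ.im)) ^ h * subGauss g u P h τ X

theorem integral_gaussPoly_line (H : Splitting L K u u' η) (hg : IsIsom g)
    {P : MvPolynomial (Fin bp) ℂ} {m : ℕ} (hP : P.IsHomogeneous m)
    (hlap : ∀ h, laplacian (subPoly g u P h) = 0) {τ : ℂ} (hτ : 0 < τ.im)
    {X : QSpace bp bm} (hX : bil X u = 0) (n : ℝ) :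
    Integrable (fun β : ℝ => gaussPoly P τ (g (X + β • u)) * ee ((n * β : ℝ) : ℂ)) ∧
    ∫ β : ℝ, gaussPoly P τ (g (X + β • u)) * ee ((n * β : ℝ) : ℂ) = lineTerm g u P m n τ X := by
  have hN : 0 < ‖(g u).1‖ ^ 2 := pow_pos (H.norm_pos hg) 2
  set N := ‖(g u).1‖ ^ 2 with hN'
  set b := bil X (posPart g u) / N with hb
  set F : ℝ → ℂ := fun t => ee (-(n * b) : ℝ) *
    ∑ h ∈ Finset.range (m + 1), subGauss g u P h τ X *
        (((herm ((1 / (4 * π * τ.im) : ℝ) * (N : ℝ)) h).eval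
          ((t * N : ℝ) : ℂ) *
          Complex.exp (-(2 * π * τ.im * N * t ^ 2 : ℝ))) * ee ((n * t : ℝ) : ℂ)) with hF
  have hrew : (fun β : ℝ => gaussPoly P τ (g (X + β • u)) * ee ((n * β : ℝ) : ℂ)) =
      fun β => F (β + b) := by
    funext β
    rw [H.g_add_smul hg hX, gaussPoly_add_smul H hg hP hlap, Finset.sum_mul]
    simp only [hF]
    rw [Finset.mul_sum]
    refine Finset.sum_congr rfl fun h _ => ?_
    rw [bil_posPart_self hg, ← hN', ← hb, add_comm b β]
    have : ee ((n * β : ℝ) : ℂ) = ee (-(n * b) : ℝ) * ee ((n * (β + b) : ℝ) : ℂ) := by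
      rw [← ee_add]; congr 1; push_cast; ring
    rw [this]
    ring
  have hi : ∀ h ∈ Finset.range (m + 1), Integrable (fun t : ℝ => subGauss g u P h τ X *
        (((herm ((1 / (4 * π * τ.im) : ℝ) * (N : ℝ)) h).eval
          ((t * N : ℝ) : ℂ) *
          Complex.exp (-(2 * π * τ.im * N * t ^ 2 : ℝ))) * ee ((n * t : ℝ) : ℂ))) :=
    fun h _ => (integral_herm_line hN hτ h n).1.const_mul _
  have hFi : Integrable F := (integrable_finsetSum _ hi).const_mul _
  rw [hrew]
  refine ⟨hFi.comp_add_right b, ?_⟩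
  rw [integral_add_right_eq_self F b, hF, integral_const_mul, integral_finsetSum _ hi, lineTerm,
    ← hN', ← hb, Finset.mul_sum, Finset.mul_sum]
  refine Finset.sum_congr rfl fun h _ => ?_
  rw [integral_const_mul, (integral_herm_line hN hτ h n).2]
  ring

end Line

end

section

section PartialTheta
variable {L K : Submodule ℤ (QSpace bp bm)} {u u' η : QSpace bp bm}
  {g : QSpace bp bm ≃ₗ[ℝ] QSpace bp bm}

/-- The vectors of `K'` in a given class of `D_L`. -/
def cosetK (L K : Submodule ℤ (QSpace bp bm)) (σ : Disc L) : Set (QSpace bp bm) :=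
  {v | v ∈ dualLat K ∧ cls L v = σ}

theorem Splitting.cls_add_zsmul_u [DiscreteTopology L] [IsZLattice ℝ L] (H : Splitting L K u u' η)
    {v : QSpace bp bm} (hv : v ∈ dualLat L) (a : ℤ) : cls L (v + a • u) = cls L v := by
  have hu := L.smul_mem a H.u_mem
  rw [cls_eq_iff (add_mem hv (le_dualLat H.even hu)) hv, add_sub_cancel_left]
  exact hu

/-- The vectors of `L'` orthogonal to `u` are the vectors `κ + a u` with `κ ∈ K'`. -/
def cosetKEmb [DiscreteTopology L] [IsZLattice ℝ L] (H : Splitting L K u u' η) (σ : Disc L)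
    (p : cosetK L K σ × ℤ) : coset L σ :=
  ⟨p.1 + p.2 • u, add_mem (H.mem_dualLat_of_mem_dualK p.1.2.1)
    (le_dualLat H.even (L.smul_mem _ H.u_mem)), by
      rw [H.cls_add_zsmul_u (H.mem_dualLat_of_mem_dualK p.1.2.1), p.1.2.2]⟩

theorem cosetKEmb_injective [DiscreteTopology L] [IsZLattice ℝ L] (H : Splitting L K u u' η)
    (σ : Disc L) : Function.Injective (cosetKEmb H σ) := by
  rintro ⟨⟨κ, hκ⟩, a⟩ ⟨⟨κ', hκ'⟩, a'⟩ h
  have h1 : κ + a • u = κ' + a' • u := congrArg Subtype.val h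
  have h2 : (a : ℝ) = a' := by
    have := congrArg (fun x => bil x u') h1
    simpa [(H.dualK_orth hκ.1).2, (H.dualK_orth hκ'.1).2, H.bil_uu'] using this
  have h3 : a = a' := by exact_mod_cast h2
  subst h3
  simpa using h1

theorem mem_range_cosetKEmb [DiscreteTopology L] [IsZLattice ℝ L] (H : Splitting L K u u' η)
    {σ : Disc L} {v : coset L σ} (hv : bil (v : QSpace bp bm) u = 0) :
    v ∈ Set.range (cosetKEmb H σ) := by
  obtain ⟨a, ha⟩ := H.bil_u'_int v.2.1
  have hm := H.sub_mem_dualK v.2.1 hv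
  have he : bil (v : QSpace bp bm) u' • u = a • u := by rw [ha, Int.cast_smul_eq_zsmul]
  rw [he] at hm
  have hc : cls L ((v : QSpace bp bm) - a • u) = σ := by
    have := H.cls_add_zsmul_u v.2.1 (-a)
    rw [neg_smul, ← sub_eq_add_neg] at this
    rw [this, v.2.2]
  exact ⟨(⟨_, hm, hc⟩, a), Subtype.ext (by simp [cosetKEmb])⟩

theorem hasSum_squareIntegral_thetaChar [DiscreteTopology L] [IsZLattice ℝ L]
    (H : Splitting L K u u' η) (hg : IsIsom g)
    {P : MvPolynomial (Fin bp) ℂ} {m : ℕ} (hP : P.IsHomogeneous m)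
    (hlap : ∀ h, laplacian (subPoly g u P h) = 0) {τ : ℂ} (hτ : 0 < τ.im) (ρ ω : ℝ) (n : ℤ)
    (σ : Disc L) :
    HasSum (fun κ : cosetK L K σ => ((τ.im ^ ((bm : ℝ) / 2) : ℝ) : ℂ) *
        (ee ((ρ * bil (κ : QSpace bp bm) η + ω * ρ * q η : ℝ) : ℂ) *
          lineTerm g u P m n τ (κ + ω • η)))
      (squareIntegral fun α β =>
        thetaChar L g P τ (ρ • η + α • u) (ω • η + β • u) σ * ee ((n * β : ℝ) : ℂ)) := by
  have hcount : Countable (dualLat L) :=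
    TopologicalSpace.separableSpace_iff_countable.1 inferInstance
  have hcount' : Countable (coset L σ) :=
    Function.Injective.countable (f := fun v : coset L σ => (⟨v, v.2.1⟩ : dualLat L))
      fun v w h => Subtype.ext (by simpa using h)
  set Y : ℂ := ((τ.im ^ ((bm : ℝ) / 2) : ℝ) : ℂ) with hY
  let F : coset L σ → ℝ → ℝ → ℂ := fun v α β =>
    Y * (thetaTerm g P τ (ρ • η + α • u) (ω • η + β • u) v * ee ((n * β : ℝ) : ℂ))
  have hbil : ∀ (v : QSpace bp bm) (α β : ℝ),
      bil (v + (1 / 2 : ℝ) • (ω • η + β • u)) (ρ • η + α • u) =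
        (ρ * bil v η + ω * ρ * q η) + α * bil v u := by
    intro v α β
    simp [H.bil_uu, H.bil_uη, H.η_u, bil_self]
    ring
  have hgc : ∀ v : QSpace bp bm, Continuous fun β : ℝ => gaussPoly P τ (g (v + (ω • η + β • u))) := by
    intro v
    refine (continuousOn_gaussPoly P).comp_continuous (f := fun β : ℝ =>
      (τ, g (v + (ω • η + β • u)))) ?_ fun _ => hτ
    have : Continuous g := g.toLinearMap.continuous_of_finiteDimensional
    fun_prop
  have hFc : ∀ v, Continuous (Function.uncurry (F v)) := by
    intro v
    simp only [F, thetaTerm, hbil, Function.uncurry_def]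
    refine continuous_const.mul ((((hgc v).comp continuous_snd).mul ?_).mul ?_)
    · exact continuous_ee.comp (by fun_prop)
    · exact continuous_ee.comp (by fun_prop)
  have hSc : Continuous (Function.uncurry fun α β : ℝ =>
      thetaChar L g P τ (ρ • η + α • u) (ω • η + β • u) σ * ee ((n * β : ℝ) : ℂ)) := by
    refine Continuous.mul ?_ (continuous_ee.comp (by fun_prop))
    exact (continuousOn_thetaChar L g P σ).comp_continuous (f := fun p : ℝ × ℝ =>
      (τ, ρ • η + p.1 • u, ω • η + p.2 • u)) (by fun_prop) fun _ => hτ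
  have hsum : ∀ α β, HasSum (fun v => F v α β)
      (thetaChar L g P τ (ρ • η + α • u) (ω • η + β • u) σ * ee ((n * β : ℝ) : ℂ)) := by
    intro α β
    have h := ((summable_thetaTerm_coset L g P hτ (ρ • η + α • u) (ω • η + β • u) σ).hasSum.mul_right
      (ee ((n * β : ℝ) : ℂ))).mul_left Y
    rwa [← mul_assoc] at h
  obtain ⟨C, d, hC, hbd⟩ := norm_thetaTerm_le g P (Module.finrank ℤ (dualLat L) + 1)
  set j := Module.finrank ℤ (dualLat L) + 1 with hj
  have hb : ∀ v : coset L σ, ∀ α ∈ Set.Ioc (0 : ℝ) 1, ∀ β ∈ Set.Ioc (0 : ℝ) 1, ‖F v α β‖ ≤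
      ‖Y‖ * (C * (1 + 1 / τ.im) ^ d * (1 + (‖ω • η‖ + ‖u‖) ^ 2) ^ j) * wt j (v : QSpace bp bm) := by
    intro v α _ β hβ
    simp only [F]
    rw [norm_mul, norm_mul, norm_ee_ofReal, mul_one, mul_assoc]
    gcongr
    refine (hbd τ hτ _ _ _).trans ?_
    have h1 : ‖ω • η + β • u‖ ≤ ‖ω • η‖ + ‖u‖ := by
      refine (norm_add_le _ _).trans ?_
      rw [norm_smul β, Real.norm_of_nonneg hβ.1.le]
      gcongr
      exact mul_le_of_le_one_left (norm_nonneg _) hβ.2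
    have := (wt_pos j (v : QSpace bp bm)).le
    gcongr
  have hmain := hasSum_squareIntegral hFc hSc hsum hb
    ((summable_wt_coset L (j := j) (by omega) σ).mul_left _)
  -- the integral over `α`
  have hval : ∀ v : coset L σ, squareIntegral (F v) = if bil (v : QSpace bp bm) u = 0 then
      Y * (ee ((ρ * bil (v : QSpace bp bm) η + ω * ρ * q η : ℝ) : ℂ) *
        ∫ β in (0 : ℝ)..1, gaussPoly P τ (g (v + (ω • η + β • u))) * ee ((n * β : ℝ) : ℂ))
      else 0 := by
    intro v
    obtain ⟨a, ha⟩ := dual_bil_int v.2.1 H.u_mem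
    have h1 : ∀ α β, F v α β = ee ((α * a : ℝ) : ℂ) *
        (Y * (ee ((ρ * bil (v : QSpace bp bm) η + ω * ρ * q η : ℝ) : ℂ) *
          (gaussPoly P τ (g (v + (ω • η + β • u))) * ee ((n * β : ℝ) : ℂ)))) := by
      intro α β
      simp only [F, thetaTerm, hbil, ha]
      rw [Complex.ofReal_add, ee_add]
      ring
    rw [squareIntegral]
    simp only [h1, intervalIntegral.integral_const_mul, intervalIntegral.integral_mul_const]
    rw [integral_ee_mul, ha]
    by_cases h0 : a = 0
    · simp [h0]
    · simp [h0]
  simp only [hval] at hmain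
  rw [← (cosetKEmb_injective H σ).hasSum_iff fun v hv => if_neg fun h0 =>
    hv (mem_range_cosetKEmb H h0)] at hmain
  refine hmain.prod_fiberwise fun κ => ?_
  have hκu := (H.dualK_orth κ.2.1).1
  have hX : bil ((κ : QSpace bp bm) + ω • η) u = 0 := by simp [hκu, H.η_u]
  obtain ⟨hi, hint⟩ := integral_gaussPoly_line H hg hP hlap hτ hX n
  have h1 := ((hi.hasSum_intervalIntegral 0).mul_left
    (ee ((ρ * bil (κ : QSpace bp bm) η + ω * ρ * q η : ℝ) : ℂ))).mul_left Y
  rw [hint] at h1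
  refine (congrArg (fun f => HasSum f _) (funext fun a => ?_)).mpr h1
  have e1 : bil ((κ : QSpace bp bm) + a • u) u = 0 := by simp [hκu, H.bil_uu]
  have e2 : bil ((κ : QSpace bp bm) + a • u) η = bil (κ : QSpace bp bm) η := by simp [H.bil_uη]
  simp only [Function.comp, cosetKEmb, e1, e2, if_true]
  congr 2
  have h2 := intervalIntegral.integral_comp_add_right (a := 0) (b := 1)
    (fun β : ℝ => gaussPoly P τ (g (κ + ω • η + β • u)) * ee ((n * β : ℝ) : ℂ)) (a : ℝ)
  rw [zero_add, add_comm (1 : ℝ)] at h2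
  rw [zero_add, ← h2]
  refine intervalIntegral.integral_congr fun β _ => ?_
  have e3 : (κ : QSpace bp bm) + a • u + (ω • η + β • u) =
      (κ : QSpace bp bm) + ω • η + (β + (a : ℝ)) • u := by
    rw [← Int.cast_smul_eq_zsmul ℝ]; module
  have e4 : ee ((n * β : ℝ) : ℂ) = ee ((n * (β + a) : ℝ) : ℂ) :=
    ee_congr ⟨-(n * a), by push_cast; ring⟩
  simp only [e3, e4]

/-! ### Bounds -/

theorem norm_subGauss_le (H : Splitting L K u u' η) [DiscreteTopology L] [IsZLattice ℝ L]
    (hg : IsIsom g) (P : MvPolynomial (Fin bp) ℂ) (h j : ℕ) :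
    ∃ (C : ℝ) (d : ℕ), 0 < C ∧ ∀ τ : ℂ, 0 < τ.im → ∀ κ ∈ dualLat K, ∀ ω ∈ Set.Icc (0 : ℝ) 1,
      ‖subGauss g u P h τ (κ + ω • η)‖ ≤ C * (1 + 1 / τ.im) ^ d * wt j κ := by
  obtain ⟨c, hc, hcg⟩ := H.exists_norm_le_gSub hg
  obtain ⟨C, hC, h1⟩ := norm_eval_le (subPoly g u P h) le_rfl
  set d := (subPoly g u P h).totalDegree
  obtain ⟨C', hC', h2⟩ := gauss_decay d j
  set b := ‖etaK u u' η‖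
  refine ⟨(C + 1) * C' * ((1 + 1 / c ^ 2) ^ j * (2 ^ j * (1 + b ^ 2) ^ j)), d + j, by positivity,
    fun τ hτ κ hκ ω hω => ?_⟩
  set x := gSub g u (κ + ω • η) with hx
  have hxe : x = gSub g u (κ + ω • etaK u u' η) := by
    rw [hx, gSub_add hg, gSub_add hg, gSub_smul hg, gSub_smul hg, H.gSub_etaK hg]
  have hnx : c * ‖κ + ω • etaK u u' η‖ ≤ ‖x‖ := by
    rw [hxe]
    refine hcg _ ?_ ?_
    · simp [(H.dualK_orth hκ).1, H.bil_etaK_u]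
    · simp [(H.dualK_orth hκ).2, H.bil_etaK_u']
  rw [subGauss, norm_mul, norm_exp_gauss, polyAt, ← hx]
  have hx1 : ‖x.1‖ ≤ ‖x‖ := norm_fst_le x
  have hx2 : ‖x‖ ^ 2 ≤ ‖x.1‖ ^ 2 + ‖x.2‖ ^ 2 := by
    rcases max_cases ‖x.1‖ ‖x.2‖ with h | h <;> rw [Prod.norm_def, h.1] <;>
      nlinarith [sq_nonneg ‖x.1‖, sq_nonneg ‖x.2‖]
  have h3 := h1 x.1
  have h4 : exp (-(π * τ.im * (‖x.1‖ ^ 2 + ‖x.2‖ ^ 2))) ≤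
      exp (-(π * τ.im * ‖x‖ ^ 2)) := by
    refine Real.exp_le_exp.2 (neg_le_neg ?_)
    exact mul_le_mul_of_nonneg_left hx2 (by positivity)
  have h5 := h2 τ.im hτ ‖x‖ (norm_nonneg _)
  have h6 := wt_scale j hc hnx
  have h7 : wt j (κ + ω • etaK u u' η) ≤ 2 ^ j * (1 + b ^ 2) ^ j * wt j κ := by
    refine (wt_shift j κ _).trans ?_
    have h8 : ‖ω • etaK u u' η‖ ≤ b := by
      rw [norm_smul, Real.norm_of_nonneg hω.1]
      exact mul_le_of_le_one_left (norm_nonneg _) hω.2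
    have := (wt_pos j κ).le
    gcongr
  have hw := (wt_pos j κ).le
  calc _ ≤ (C + 1) * (1 + ‖x‖) ^ d * exp (-(π * τ.im * ‖x‖ ^ 2)) := by
        refine mul_le_mul (h3.trans ?_) h4 (Real.exp_pos _).le (by positivity)
        gcongr
        linarith
    _ = (C + 1) * ((1 + ‖x‖) ^ d * exp (-(π * τ.im * ‖x‖ ^ 2))) := by ring
    _ ≤ (C + 1) * (C' * (1 + 1 / τ.im) ^ (d + j) * ((1 + 1 / c ^ 2) ^ j *
        (2 ^ j * (1 + b ^ 2) ^ j * wt j κ))) := by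
      refine mul_le_mul_of_nonneg_left (h5.trans ?_) (by positivity)
      gcongr
      exact h6.trans (by gcongr)
    _ = _ := by ring

end PartialTheta

end

section

/-! ### The pairing of a Jacobi form with a theta function with characteristics -/

theorem squareIntegral_comm {F : ℝ → ℝ → ℝ → ℝ → ℂ}
    (hF : Continuous fun p : (ℝ × ℝ) × ℝ × ℝ => F p.1.1 p.1.2 p.2.1 p.2.2) :
    squareIntegral (fun α β => squareIntegral fun ρ ω => F α β ρ ω) =
      squareIntegral fun ρ ω => squareIntegral fun α β => F α β ρ ω := by
  have h1 : ∀ α β, Continuous (Function.uncurry fun ρ ω => F α β ρ ω) := fun α β =>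
    hF.comp (f := fun p : ℝ × ℝ => ((α, β), p)) (by fun_prop)
  have h2 : ∀ ρ ω, Continuous (Function.uncurry fun α β => F α β ρ ω) := fun ρ ω =>
    hF.comp (f := fun p : ℝ × ℝ => (p, (ρ, ω))) (by fun_prop)
  have h3 : Continuous (Function.uncurry fun α β => squareIntegral fun ρ ω => F α β ρ ω) := by
    refine intervalIntegral.continuous_parametric_intervalIntegral_of_continuous'
      (f := fun (p : ℝ × ℝ) (ρ : ℝ) => ∫ ω in (0 : ℝ)..1, F p.1 p.2 ρ ω) ?_ 0 1
    refine intervalIntegral.continuous_parametric_intervalIntegral_of_continuous'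
      (f := fun (p : (ℝ × ℝ) × ℝ) (ω : ℝ) => F p.1.1 p.1.2 p.2 ω) ?_ 0 1
    exact hF.comp (f := fun p : ((ℝ × ℝ) × ℝ) × ℝ => (p.1.1, p.1.2, p.2)) (by fun_prop)
  have h4 : Continuous (Function.uncurry fun ρ ω => squareIntegral fun α β => F α β ρ ω) := by
    refine intervalIntegral.continuous_parametric_intervalIntegral_of_continuous'
      (f := fun (p : ℝ × ℝ) (α : ℝ) => ∫ β in (0 : ℝ)..1, F α β p.1 p.2) ?_ 0 1
    refine intervalIntegral.continuous_parametric_intervalIntegral_of_continuous'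
      (f := fun (p : (ℝ × ℝ) × ℝ) (β : ℝ) => F p.2 β p.1.1 p.1.2) ?_ 0 1
    exact hF.comp (f := fun p : ((ℝ × ℝ) × ℝ) × ℝ => ((p.1.2, p.2), p.1.1)) (by fun_prop)
  rw [squareIntegral_eq h3, squareIntegral_eq h4]
  simp only [squareIntegral_eq (h1 _ _), squareIntegral_eq (h2 _ _)]
  refine integral_integral_swap (f := fun p p' : ℝ × ℝ => F p.1 p.2 p'.1 p'.2) ?_
  simp only [Measure.prod_restrict]
  have h : IntegrableOn (Function.uncurry fun p p' : ℝ × ℝ => F p.1 p.2 p'.1 p'.2)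
      ((Set.Icc (0 : ℝ) 1 ×ˢ Set.Icc (0 : ℝ) 1) ×ˢ (Set.Icc (0 : ℝ) 1 ×ˢ Set.Icc (0 : ℝ) 1))
      ((volume.prod volume).prod (volume.prod volume)) :=
    ContinuousOn.integrableOn_compact
      ((isCompact_Icc.prod isCompact_Icc).prod (isCompact_Icc.prod isCompact_Icc)) hF.continuousOn
  refine h.mono_set (Set.prod_mono ?_ ?_) <;>
    exact Set.prod_mono Set.Ioc_subset_Icc_self Set.Ioc_subset_Icc_self

theorem squareIntegral_sum_conj {ι : Type*} [Fintype ι] {T : ι → ℝ → ℝ → ℂ}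
    (hT : ∀ i, Continuous (Function.uncurry (T i))) (c : ι → ℂ) :
    squareIntegral (fun x y => ∑ i, c i * conj (T i x y)) =
      ∑ i, c i * conj (squareIntegral (T i)) := by
  have hc : ∀ i, Continuous fun p : ℝ × ℝ => c i * conj (T i p.1 p.2) := fun i =>
    continuous_const.mul (Complex.continuous_conj.comp (hT i))
  rw [squareIntegral_eq (f := fun x y => ∑ i, c i * conj (T i x y))
    (continuous_finsetSum _ fun i _ => hc i), integral_finsetSum]
  · refine Finset.sum_congr rfl fun i _ => ?_
    rw [integral_const_mul, integral_conj, squareIntegral_eq (hT i)]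
  · intro i _
    exact integrable_square (f := fun x y => c i * conj (T i x y)) (hc i)

section Psi
variable {L K : Submodule ℤ (QSpace bp bm)} {u u' η : QSpace bp bm}
  {g : QSpace bp bm ≃ₗ[ℝ] QSpace bp bm} {P : MvPolynomial (Fin bp) ℂ} {m : ℕ} {k : ℝ}
  {φ : ℂ → ℂ → Disc L → ℂ}

/-- The invariant pairing of `φ` with the theta function with characteristics in the plane spanned
by `η` and `u`. -/
def psi (η u : QSpace bp bm) (k : ℝ) (φ : ℂ → ℂ → Disc L → ℂ)
    (g : QSpace bp bm ≃ₗ[ℝ] QSpace bp bm) (P : MvPolynomial (Fin bp) ℂ) (τ : ℂ)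
    (ρ ω α β : ℝ) : ℂ :=
  ((τ.im ^ k : ℝ) : ℂ) * ∑ᶠ σ, phiChar η φ τ ρ ω σ *
    conj (thetaChar L g P τ (ρ • η + α • u) (ω • η + β • u) σ)

theorem continuous_phiChar (hφ : IsJacobiForm L η k φ) (σ : Disc L) :
    Continuous fun p : ℍ × ℝ × ℝ => phiChar η φ p.1 p.2.1 p.2.2 σ :=
  (continuousOn_phiChar hφ σ).comp_continuous (f := fun p : ℍ × ℝ × ℝ =>
    ((p.1 : ℂ), p.2.1, p.2.2)) (by fun_prop) fun p => p.1.im_pos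

variable [DiscreteTopology L] [IsZLattice ℝ L]

theorem psi_add_one (hL : IsEven L) (hg : IsIsom g) (hφ : IsJacobiForm L η k φ) {τ : ℂ}
    (hτ : 0 < τ.im) (ρ ω α β : ℝ) :
    psi η u k φ g P (τ + 1) (ρ - ω) ω (α - β) β = psi η u k φ g P τ ρ ω α β := by
  have := disc_finite L hL
  have h1 : (ρ - ω) • η + (α - β) • u = (ρ • η + α • u) - (ω • η + β • u) := by module
  rw [psi, h1, thetaChar_add_one L hL hg, phiChar_add_one hφ hτ, pairing_add_one L, psi]
  simp

theorem psi_neg_inv (hL : IsEven L) (hg : IsIsom g) (hP : P.IsHomogeneous m)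
    (hk : k = m + ((bp : ℝ) - bm) / 2) (hφ : IsJacobiForm L η k φ) {τ : ℂ}
    (hτ : 0 < τ.im) (ρ ω α β : ℝ) :
    psi η u k φ g P (-1 / τ) ω (-ρ) β (-α) = psi η u k φ g P τ ρ ω α β := by
  have := disc_finite L hL
  have h1 : -ρ • η + -α • u = -(ρ • η + α • u) := by module
  rw [psi, h1, thetaChar_neg_inv L hL hg hP hk hτ, phiChar_neg_inv hφ hτ, pairing_neg_inv L hτ, psi]

theorem psi_add_int (H : Splitting L K u u' η) (hφ : IsJacobiForm L η k φ) {τ : ℂ}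
    (hτ : 0 < τ.im) (ρ ω α β : ℝ) (h r a b : ℤ) :
    psi η u k φ g P τ (ρ + h) (ω + r) (α + a) (β + b) = psi η u k φ g P τ ρ ω α β := by
  have := disc_finite L H.even
  have := Fintype.ofFinite (Disc L)
  have hηL := H.η_mem
  have huL := le_dualLat H.even H.u_mem
  have hA : (ρ + h) • η + (α + a) • u = (ρ • η + α • u) + (h • η + a • u) := by
    rw [← Int.cast_smul_eq_zsmul ℝ, ← Int.cast_smul_eq_zsmul ℝ]; module
  have hB : (ω + r) • η + (β + b) • u = (ω • η + β • u) + (r • η + b • u) := by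
    rw [← Int.cast_smul_eq_zsmul ℝ, ← Int.cast_smul_eq_zsmul ℝ]; module
  have ha : h • η + a • u ∈ dualLat L :=
    add_mem (Submodule.smul_mem _ _ hηL) (Submodule.smul_mem _ _ huL)
  have hb : r • η + b • u ∈ dualLat L :=
    add_mem (Submodule.smul_mem _ _ hηL) (Submodule.smul_mem _ _ huL)
  have hcls : cls L (r • η + b • u) = r • cls L η := by
    rw [H.cls_add_zsmul_u (Submodule.smul_mem _ _ hηL), cls_zsmul _ hηL]
  rw [psi, psi]
  congr 1
  simp only [finsum_eq_sum_of_fintype]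
  have hterm : ∀ σ, phiChar η φ τ (ρ + h) (ω + r) σ *
      conj (thetaChar L g P τ ((ρ + h) • η + (α + a) • u)
        ((ω + r) • η + (β + b) • u) σ) =
      phiChar η φ τ ρ ω (σ + r • cls L η) *
      conj (thetaChar L g P τ (ρ • η + α • u) (ω • η + β • u) (σ + r • cls L η)) := by
    intro σ
    obtain ⟨c, hc⟩ := dual_bil_int (rep_mem (σ + r • cls L η)) H.u_mem
    rw [hA, hB, thetaChar_shift L g P τ _ _ ha hb, hcls, phiChar_shift hφ hτ, map_mul,
      mul_mul_mul_comm, conj_ee_ofReal, ← ee_add, ← Complex.ofReal_add]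
    refine mul_left_eq_self₀.2 (Or.inl ?_) |>.trans rfl
    rw [ee_eq_one_iff]
    refine ⟨-(a * c), ?_⟩
    simp [H.bil_uu, H.bil_uη, H.η_u, bil_self, hc]
    ring
  rw [Finset.sum_congr rfl fun σ _ => hterm σ]
  exact Equiv.sum_comp (Equiv.addRight (r • cls L η)) fun σ => phiChar η φ τ ρ ω σ *
      conj (thetaChar L g P τ (ρ • η + α • u) (ω • η + β • u) σ)

theorem continuous_thetaChar (g : QSpace bp bm ≃ₗ[ℝ] QSpace bp bm) (P : MvPolynomial (Fin bp) ℂ)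
    (η u : QSpace bp bm) (σ : Disc L) :
    Continuous fun p : ℍ × (ℝ × ℝ) × ℝ × ℝ =>
      thetaChar L g P p.1 (p.2.1.1 • η + p.2.2.1 • u) (p.2.1.2 • η + p.2.2.2 • u) σ :=
  (continuousOn_thetaChar L g P σ).comp_continuous
    (f := fun p : ℍ × (ℝ × ℝ) × ℝ × ℝ =>
    ((p.1 : ℂ), p.2.1.1 • η + p.2.2.1 • u, p.2.1.2 • η + p.2.2.2 • u)) (by fun_prop)
    fun p => p.1.im_pos

theorem continuous_psi (hL : IsEven L) (hφ : IsJacobiForm L η k φ) :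
    Continuous fun p : ℍ × (ℝ × ℝ) × ℝ × ℝ =>
      psi η u k φ g P p.1 p.2.1.1 p.2.1.2 p.2.2.1 p.2.2.2 := by
  have := disc_finite L hL
  have := Fintype.ofFinite (Disc L)
  simp only [psi, finsum_eq_sum_of_fintype]
  refine Continuous.mul (Complex.continuous_ofReal.comp ?_) (continuous_finsetSum _ fun σ _ => ?_)
  · refine Continuous.rpow_const ?_ fun p => Or.inl p.1.im_pos.ne'
    exact Complex.continuous_im.comp (UpperHalfPlane.continuous_coe.comp continuous_fst)
  · refine Continuous.mul ?_ (Complex.continuous_conj.comp (continuous_thetaChar g P η u σ))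
    exact (continuous_phiChar hφ σ).comp (f := fun p : ℍ × (ℝ × ℝ) × ℝ × ℝ =>
      (p.1, p.2.1.1, p.2.1.2)) (by fun_prop)

/-- The average of the pairing over the characteristics in the direction of `η`. -/
def avgPsi (η u : QSpace bp bm) (k : ℝ) (φ : ℂ → ℂ → Disc L → ℂ)
    (g : QSpace bp bm ≃ₗ[ℝ] QSpace bp bm) (P : MvPolynomial (Fin bp) ℂ) (τ : ℍ)
    (α β : ℝ) : ℂ :=
  squareIntegral fun ρ ω => psi η u k φ g P τ ρ ω α β

theorem isBiperiodic_psi (H : Splitting L K u u' η) (hφ : IsJacobiForm L η k φ)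
    (τ : ℍ) (α β : ℝ) : IsBiperiodic fun ρ ω => psi η u k φ g P τ ρ ω α β where
  cont := (continuous_psi H.even hφ).comp (f := fun p : ℝ × ℝ => (τ, p, α, β)) (by fun_prop)
  left ρ ω := by simpa using psi_add_int H hφ τ.im_pos ρ ω α β 1 0 0 0
  right ρ ω := by simpa using psi_add_int H hφ τ.im_pos ρ ω α β 0 1 0 0

theorem isTorusFamily_avgPsi (H : Splitting L K u u' η) (hg : IsIsom g) (hP : P.IsHomogeneous m)
    (hk : k = m + ((bp : ℝ) - bm) / 2) (hφ : IsJacobiForm L η k φ) :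
    IsTorusFamily (avgPsi η u k φ g P) where
  cont := by
    refine intervalIntegral.continuous_parametric_intervalIntegral_of_continuous'
      (f := fun (p : ℍ × ℝ × ℝ) (ρ : ℝ) =>
        ∫ ω in (0 : ℝ)..1, psi η u k φ g P p.1 ρ ω p.2.1 p.2.2) ?_ 0 1
    refine intervalIntegral.continuous_parametric_intervalIntegral_of_continuous'
      (f := fun (p : (ℍ × ℝ × ℝ) × ℝ) (ω : ℝ) =>
        psi η u k φ g P p.1.1 p.2 ω p.1.2.1 p.1.2.2) ?_ 0 1
    exact (continuous_psi H.even hφ).comp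
      (f := fun p : ((ℍ × ℝ × ℝ) × ℝ) × ℝ =>
        (p.1.1.1, (p.1.2, p.2), p.1.1.2.1, p.1.1.2.2)) (by fun_prop)
  per τ α β a b := by
    have h : ∀ ρ ω, psi η u k φ g P τ ρ ω (α + a) (β + b) = psi η u k φ g P τ ρ ω α β :=
      fun ρ ω => by simpa using psi_add_int H hφ τ.im_pos ρ ω α β 0 0 a b
    simp only [avgPsi, h]
  transT τ α β := by
    rw [avgPsi, ← squareIntegral_sub (isBiperiodic_psi H hφ _ _ _), avgPsi, coe_T_smul]
    simp only [psi_add_one H.even hg hφ τ.im_pos]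
  transS τ α β := by
    rw [avgPsi, ← squareIntegral_swap_neg (isBiperiodic_psi H hφ _ _ _), avgPsi, coe_S_smul]
    simp only [psi_neg_inv H.even hg hP hk hφ τ.im_pos]

theorem torusCoeff_avgPsi (H : Splitting L K u u' η) (hφ : IsJacobiForm L η k φ) (n : ℤ)
    (τ : ℍ) : torusCoeff (avgPsi η u k φ g P) ![0, -n] τ =
      squareIntegral fun ρ ω => (((τ : ℂ).im ^ k : ℝ) : ℂ) * ∑ᶠ σ, phiChar η φ τ ρ ω σ *
        conj (squareIntegral fun α β =>
          thetaChar L g P τ (ρ • η + α • u) (ω • η + β • u) σ * ee ((n * β : ℝ) : ℂ)) := by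
  have := disc_finite L H.even
  have := Fintype.ofFinite (Disc L)
  have h1 : torusCoeff (avgPsi η u k φ g P) ![0, -n] τ = squareIntegral fun α β =>
      squareIntegral fun ρ ω => psi η u k φ g P τ ρ ω α β * ee ((-(n * β) : ℝ) : ℂ) := by
    rw [torusCoeff]
    congr 1
    funext α β
    simp only [avgPsi, squareIntegral, ← intervalIntegral.integral_mul_const]
    simp
  rw [h1, squareIntegral_comm]
  · congr 1
    funext ρ ω
    have h2 := squareIntegral_sum_conj (T := fun (σ : Disc L) α β =>
      thetaChar L g P τ (ρ • η + α • u) (ω • η + β • u) σ * ee ((n * β : ℝ) : ℂ))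
      (fun σ => by
        refine Continuous.mul ?_ (continuous_ee.comp (by fun_prop))
        exact (continuous_thetaChar g P η u σ).comp (f := fun p : ℝ × ℝ => (τ, (ρ, ω), p))
          (by fun_prop))
      (fun σ => (((τ : ℂ).im ^ k : ℝ) : ℂ) * phiChar η φ τ ρ ω σ)
    rw [finsum_eq_sum_of_fintype, Finset.mul_sum]
    simp only [← mul_assoc]
    rw [← h2]
    congr 1
    funext α β
    rw [psi, finsum_eq_sum_of_fintype, Finset.mul_sum, Finset.sum_mul]
    refine Finset.sum_congr rfl fun σ _ => ?_
    rw [map_mul, conj_ee_ofReal]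
    ring
  · refine Continuous.mul ?_ (continuous_ee.comp (by fun_prop))
    exact (continuous_psi H.even hφ).comp (f := fun p : (ℝ × ℝ) × ℝ × ℝ => (τ, p.2, p.1))
      (by fun_prop)

end Psi

theorem IsTorusFamily.torusCoeff_neg {f : ℍ → ℝ → ℝ → ℂ} (hf : IsTorusFamily f)
    (w : Fin 2 → ℤ) : torusCoeff f (-w) = torusCoeff f w := by
  funext τ
  have h := hf.torusCoeff_smul (-1 : SL(2, ℤ)) w τ
  rw [ModularGroup.SL_neg_smul, one_smul] at h
  rw [h]
  congr 1
  ext j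
  fin_cases j <;> simp [Matrix.vecMul, dotProduct, Fin.sum_univ_two]

end

section

variable {L K : Submodule ℤ (QSpace bp bm)} {u u' η : QSpace bp bm}
  {g : QSpace bp bm ≃ₗ[ℝ] QSpace bp bm} {P : MvPolynomial (Fin bp) ℂ} {m : ℕ} {k : ℝ}
  {φ : ℂ → ℂ → Disc L → ℂ}

/-! ### The Fourier coefficients of the averaged pairing as sums over `K'` -/

/-- The contribution of `κ ∈ K'` to the `n`-th Fourier coefficient of the pairing. -/
def kTerm (η u : QSpace bp bm) (k : ℝ) (φ : ℂ → ℂ → Disc L → ℂ)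
    (g : QSpace bp bm ≃ₗ[ℝ] QSpace bp bm) (P : MvPolynomial (Fin bp) ℂ) (m : ℕ) (n : ℤ)
    (κ : QSpace bp bm) (τ : ℂ) (ρ ω : ℝ) : ℂ :=
  ((τ.im ^ k : ℝ) : ℂ) * (phiChar η φ τ ρ ω (cls L κ) *
    conj (((τ.im ^ ((bm : ℝ) / 2) : ℝ) : ℂ) *
      (ee ((ρ * bil κ η + ω * ρ * q η : ℝ) : ℂ) * lineTerm g u P m n τ (κ + ω • η))))

theorem hasSum_kTerm [DiscreteTopology L] [IsZLattice ℝ L] (H : Splitting L K u u' η)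
    (hg : IsIsom g) (hP : P.IsHomogeneous m) (hlap : ∀ h, laplacian (subPoly g u P h) = 0)
    {τ : ℂ} (hτ : 0 < τ.im) (ρ ω : ℝ) (n : ℤ) :
    HasSum (fun κ : dualLat K => kTerm η u k φ g P m n κ τ ρ ω)
      (((τ.im ^ k : ℝ) : ℂ) * ∑ᶠ σ, phiChar η φ τ ρ ω σ *
        conj (squareIntegral fun α β =>
          thetaChar L g P τ (ρ • η + α • u) (ω • η + β • u) σ * ee ((n * β : ℝ) : ℂ))) := by
  have := disc_finite L H.even
  have := Fintype.ofFinite (Disc L)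
  rw [finsum_eq_sum_of_fintype]
  refine HasSum.mul_left _ ?_
  set f : QSpace bp bm → ℂ := fun κ => phiChar η φ τ ρ ω (cls L κ) *
    conj (((τ.im ^ ((bm : ℝ) / 2) : ℝ) : ℂ) *
      (ee ((ρ * bil κ η + ω * ρ * q η : ℝ) : ℂ) * lineTerm g u P m n τ (κ + ω • η))) with hf
  have h1 : ∀ σ : Disc L, HasSum ((cosetK L K σ).indicator f) (phiChar η φ τ ρ ω σ *
        conj (squareIntegral fun α β =>
          thetaChar L g P τ (ρ • η + α • u) (ω • η + β • u) σ * ee ((n * β : ℝ) : ℂ))) := by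
    intro σ
    rw [← hasSum_subtype_iff_indicator]
    have h2 := ((hasSum_squareIntegral_thetaChar H hg hP hlap hτ ρ ω n σ).map
      conj Complex.continuous_conj).mul_left (phiChar η φ τ ρ ω σ)
    have he : (f ∘ Subtype.val : cosetK L K σ → ℂ) = fun κ : cosetK L K σ => phiChar η φ τ ρ ω σ *
      conj (((τ.im ^ ((bm : ℝ) / 2) : ℝ) : ℂ) *
      (ee ((ρ * bil (κ : QSpace bp bm) η + ω * ρ * q η : ℝ) : ℂ) *
        lineTerm g u P m n τ (κ + ω • η))) := by
      funext κ
      simp only [hf, Function.comp_apply, κ.2.2]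
    rw [he]
    exact h2
  have h3 := hasSum_sum (s := Finset.univ) fun σ _ => h1 σ
  have h4 : (fun κ => ∑ σ : Disc L, (cosetK L K σ).indicator f κ) =
      (dualLat K : Set (QSpace bp bm)).indicator f := by
    funext κ
    by_cases hκ : κ ∈ dualLat K
    · rw [Finset.sum_eq_single (cls L κ), Set.indicator_of_mem (by exact ⟨hκ, rfl⟩),
        Set.indicator_of_mem (by exact hκ)]
      · intro σ _ hσ
        exact Set.indicator_of_notMem (fun h => hσ h.2.symm) _
      · simp
    · rw [Set.indicator_of_notMem (by exact hκ)]
      exact Finset.sum_eq_zero fun σ _ => Set.indicator_of_notMem (fun h => hκ h.1) _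
  rw [h4, ← hasSum_subtype_iff_indicator] at h3
  exact h3

theorem norm_lineTerm_le (H : Splitting L K u u' η) [DiscreteTopology L] [IsZLattice ℝ L]
    (hg : IsIsom g) (P : MvPolynomial (Fin bp) ℂ) (m j : ℕ) :
    ∃ (C : ℝ) (d : ℕ), 0 < C ∧ ∀ τ : ℂ, 0 < τ.im → ∀ κ ∈ dualLat K, ∀ ω ∈ Set.Icc (0 : ℝ) 1,
      ∀ n : ℤ, ‖lineTerm g u P m n τ (κ + ω • η)‖ ≤
        C * (1 / sqrt (2 * τ.im * ‖(g u).1‖ ^ 2)) * (1 + 1 / τ.im) ^ d *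
          (1 + |(n : ℝ)|) ^ m * wt j κ *
          exp (-(π * n ^ 2 / (2 * τ.im * ‖(g u).1‖ ^ 2))) := by
  choose C d hC h using fun h => norm_subGauss_le H hg P h j
  refine ⟨∑ h ∈ Finset.range (m + 1), C h, m + ∑ h ∈ Finset.range (m + 1), d h,
    Finset.sum_pos (fun i _ => hC i) (by simp), ?_⟩
  intro τ hτ κ hκ ω hω n
  have hy : 1 ≤ 1 + 1 / τ.im := by have : 0 < 1 / τ.im := by positivity
                                   linarith
  have hn : 1 ≤ 1 + |(n : ℝ)| := by linarith [abs_nonneg (n : ℝ)]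
  have hsum : ‖∑ h ∈ Finset.range (m + 1), ((n : ℝ) * I / (2 * τ.im)) ^ h *
      subGauss g u P h τ (κ + ω • η)‖ ≤ ∑ h ∈ Finset.range (m + 1), C h *
        ((1 + 1 / τ.im) ^ (m + ∑ h ∈ Finset.range (m + 1), d h) *
          (1 + |(n : ℝ)|) ^ m * wt j κ) := by
    refine norm_sum_le_of_le _ fun i hi => ?_
    rw [norm_mul, norm_pow]
    have h1 : ‖((n : ℝ) : ℂ) * I / (2 * τ.im)‖ ≤ (1 + |(n : ℝ)|) * (1 + 1 / τ.im) := by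
      rw [norm_div, norm_mul, Complex.norm_I, mul_one, norm_mul, Complex.norm_real,
        Complex.norm_real, Real.norm_eq_abs, Real.norm_eq_abs, abs_of_pos hτ, RCLike.norm_ofNat,
        div_eq_mul_one_div]
      refine mul_le_mul (by linarith) ?_ (by positivity) (by positivity)
      have : 1 / (2 * τ.im) ≤ 1 / τ.im := one_div_le_one_div_of_le hτ (by linarith)
      linarith
    have him : i ≤ m := by simpa [Nat.lt_succ_iff] using hi
    have h2 : ‖((n : ℝ) : ℂ) * I / (2 * τ.im)‖ ^ i ≤
        (1 + |(n : ℝ)|) ^ m * (1 + 1 / τ.im) ^ m := by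
      rw [← mul_pow]
      refine (pow_le_pow_left₀ (norm_nonneg _) h1 i).trans (pow_le_pow_right₀ ?_ him)
      exact one_le_mul_of_one_le_of_one_le hn hy
    have h3 : (1 + 1 / τ.im) ^ d i ≤ (1 + 1 / τ.im) ^ ∑ h ∈ Finset.range (m + 1), d h :=
      pow_le_pow_right₀ hy (Finset.single_le_sum (f := d) (fun _ _ => Nat.zero_le _) hi)
    have hw := wt_pos j κ
    calc _ ≤ ((1 + |(n : ℝ)|) ^ m * (1 + 1 / τ.im) ^ m) *
          (C i * (1 + 1 / τ.im) ^ (∑ h ∈ Finset.range (m + 1), d h) * wt j κ) := by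
          refine mul_le_mul h2 ((h i τ hτ κ hκ ω hω).trans ?_) (norm_nonneg _) (by positivity)
          have := (hC i).le
          gcongr
      _ = _ := by rw [pow_add]; ring
  rw [← Finset.sum_mul] at hsum
  rw [lineTerm, norm_mul, norm_mul, norm_ee_ofReal, one_mul, norm_mul, Complex.norm_real,
    Complex.norm_real, Real.norm_eq_abs, Real.norm_eq_abs, Real.abs_exp, abs_of_nonneg (by positivity)]
  calc _ ≤ _ := mul_le_mul_of_nonneg_left hsum (by positivity)
    _ = _ := by ring

theorem norm_kTerm_le [DiscreteTopology L] [IsZLattice ℝ L] (H : Splitting L K u u' η)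
    (hg : IsIsom g) (hφ : IsJacobiCuspForm L η k φ) (P : MvPolynomial (Fin bp) ℂ) (m j : ℕ) :
    ∃ (C ε : ℝ) (d : ℕ), 0 < C ∧ 0 < ε ∧ ∀ τ : ℂ, 0 < τ.im → ∀ κ ∈ dualLat K, ∀ ρ : ℝ,
      ∀ ω ∈ Set.Icc (0 : ℝ) 1, ∀ n : ℤ, ‖kTerm η u k φ g P m n κ τ ρ ω‖ ≤
        C * (1 + 1 / τ.im) ^ d * (1 + |(n : ℝ)|) ^ m * wt j κ * exp (-(ε * τ.im)) *
          exp (-(π * n ^ 2 / (2 * τ.im * ‖(g u).1‖ ^ 2))) := by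
  have := disc_finite L H.even
  obtain ⟨C₁, ε, d₁, hC₁, hε, h1⟩ := exists_norm_phiChar_le hφ H.η_pos
  obtain ⟨C₂, d₂, hC₂, h2⟩ := norm_lineTerm_le H hg P m j
  obtain ⟨N, hN⟩ := exists_rpow_le (k + (bm : ℝ) / 2 - 1 / 2)
  obtain ⟨M, hM, h3⟩ := one_add_pow_mul_exp_le (half_pos hε) N
  have hu := H.norm_pos hg
  have hs2 : 0 < sqrt (2 * ‖(g u).1‖ ^ 2) := Real.sqrt_pos.2 (by positivity)
  refine ⟨C₁ * C₂ * M / sqrt (2 * ‖(g u).1‖ ^ 2), ε / 2, N + d₁ + d₂, by positivity,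
    half_pos hε, ?_⟩
  intro τ hτ κ hκ ρ ω hω n
  have hw := wt_pos j κ
  set y := τ.im
  have hsq : 1 / sqrt (2 * y * ‖(g u).1‖ ^ 2) =
      y ^ (-(1 / 2 : ℝ)) / sqrt (2 * ‖(g u).1‖ ^ 2) := by
    rw [show 2 * y * ‖(g u).1‖ ^ 2 = y * (2 * ‖(g u).1‖ ^ 2) by ring, Real.sqrt_mul hτ.le,
      Real.rpow_neg hτ.le, ← Real.sqrt_eq_rpow]
    field_simp
  have hpow : y ^ k * (y ^ ((bm : ℝ) / 2) * y ^ (-(1 / 2 : ℝ))) =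
      y ^ (k + (bm : ℝ) / 2 - 1 / 2) := by
    rw [← Real.rpow_add hτ, ← Real.rpow_add hτ]
    congr 1
    ring
  have hexp : (1 + y) ^ N * exp (-(ε * y)) ≤ M * exp (-(ε / 2 * y)) := by
    have := mul_le_mul_of_nonneg_right (h3 y hτ.le) (Real.exp_pos (-(ε / 2 * y))).le
    refine le_trans (le_of_eq ?_) this
    rw [mul_assoc, ← Real.exp_add]
    congr 2
    ring
  have hA := h1 τ ρ ω (cls L κ) hτ
  have hB := h2 τ hτ κ hκ ω hω n
  rw [hsq] at hB
  rw [kTerm, norm_mul, norm_mul, RCLike.norm_conj, norm_mul, norm_mul, norm_ee_ofReal, one_mul,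
    Complex.norm_real, Complex.norm_real, Real.norm_eq_abs, Real.norm_eq_abs,
    abs_of_pos (by positivity), abs_of_pos (by positivity)]
  set E := exp (-(π * n ^ 2 / (2 * y * ‖(g u).1‖ ^ 2))) with hE
  have hE0 : 0 < E := Real.exp_pos _
  calc _ ≤ y ^ k * (C₁ * (1 + 1 / y) ^ d₁ * exp (-(ε * y)) * (y ^ ((bm : ℝ) / 2) *
        (C₂ * (y ^ (-(1 / 2 : ℝ)) / sqrt (2 * ‖(g u).1‖ ^ 2)) * (1 + 1 / y) ^ d₂ *
          (1 + |(n : ℝ)|) ^ m * wt j κ * E))) := by gcongr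
    _ = C₁ * C₂ / sqrt (2 * ‖(g u).1‖ ^ 2) * (1 + 1 / y) ^ (d₁ + d₂) *
        (1 + |(n : ℝ)|) ^ m * wt j κ * E *
        (y ^ k * (y ^ ((bm : ℝ) / 2) * y ^ (-(1 / 2 : ℝ))) * exp (-(ε * y))) := by
      rw [pow_add]; ring
    _ ≤ C₁ * C₂ / sqrt (2 * ‖(g u).1‖ ^ 2) * (1 + 1 / y) ^ (d₁ + d₂) *
        (1 + |(n : ℝ)|) ^ m * wt j κ * E *
        ((1 + 1 / y) ^ N * (M * exp (-(ε / 2 * y)))) := by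
      refine mul_le_mul_of_nonneg_left ?_ (by positivity)
      rw [hpow]
      calc _ ≤ ((1 + y) * (1 + 1 / y)) ^ N * exp (-(ε * y)) := by
            refine mul_le_mul_of_nonneg_right (hN y hτ) (Real.exp_pos _).le
        _ = (1 + 1 / y) ^ N * ((1 + y) ^ N * exp (-(ε * y))) := by rw [mul_pow]; ring
        _ ≤ _ := mul_le_mul_of_nonneg_left hexp (by positivity)
    _ = _ := by rw [pow_add, pow_add, pow_add]; ring

/-- The decay in `n` and `y` of the terms which are integrated over the strip. -/
theorem norm_kTerm_le_of_ne_zero [DiscreteTopology L] [IsZLattice ℝ L] (H : Splitting L K u u' η)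
    (hg : IsIsom g) (hφ : IsJacobiCuspForm L η k φ) (P : MvPolynomial (Fin bp) ℂ) (m j : ℕ) :
    ∃ C ε : ℝ, 0 < C ∧ 0 < ε ∧ ∀ τ : ℂ, 0 < τ.im → ∀ κ ∈ dualLat K, ∀ ρ : ℝ,
      ∀ ω ∈ Set.Icc (0 : ℝ) 1, ∀ n : ℤ, n ≠ 0 → ‖kTerm η u k φ g P m n κ τ ρ ω‖ ≤
        C * wt j κ * (1 / (n : ℝ) ^ 2) * exp (-(ε * τ.im)) * τ.im ^ 2 := by
  obtain ⟨C₁, ε, d, hC₁, hε, h1⟩ := norm_kTerm_le H hg hφ P m j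
  have hu := H.norm_pos hg
  obtain ⟨M, hM, h2⟩ := one_add_pow_mul_exp_le
    (c := π / (2 * ‖(g u).1‖ ^ 2)) (by positivity) (d + 2 + (m + 2))
  obtain ⟨M', hM', h3⟩ := one_add_pow_mul_exp_le (half_pos hε) (m + 2)
  refine ⟨C₁ * 2 ^ m * M * M', ε / 2, by positivity, half_pos hε, ?_⟩
  intro τ hτ κ hκ ρ ω hω n hn
  have hw := wt_pos j κ
  refine (h1 τ hτ κ hκ ρ ω hω n).trans ?_
  set y := τ.im
  set a := |(n : ℝ)| with ha
  have ha1 : 1 ≤ a := by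
    rw [ha, ← Int.cast_abs]
    exact_mod_cast Int.one_le_abs hn
  have han : (n : ℝ) ^ 2 = a ^ 2 := (sq_abs _).symm
  rw [han]
  set s := a ^ 2 / y with hs
  have hs0 : 0 < s := by positivity
  have hsE : exp (-(π * a ^ 2 / (2 * y * ‖(g u).1‖ ^ 2))) =
      exp (-(π / (2 * ‖(g u).1‖ ^ 2) * s)) := by
    congr 2
    rw [hs]
    field_simp
  have hy1 : 1 + 1 / y ≤ 1 + s := by
    have : 1 / y ≤ s := by
      rw [hs]
      gcongr
      nlinarith
    linarith
  have hsy : a ^ 2 ≤ (1 + s) * (1 + y) := by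
    have : a ^ 2 = s * y := by rw [hs]; field_simp
    nlinarith [mul_pos hs0 hτ]
  have h4 : (1 + a) ^ m * a ^ 2 ≤ 2 ^ m * ((1 + s) ^ (m + 2) * (1 + y) ^ (m + 2)) := by
    calc (1 + a) ^ m * a ^ 2 ≤ (2 * a) ^ m * a ^ 2 := by gcongr; linarith
      _ = 2 ^ m * a ^ (m + 2) := by rw [mul_pow]; ring
      _ ≤ 2 ^ m * (a ^ 2) ^ (m + 2) := by
          gcongr
          nlinarith
      _ ≤ 2 ^ m * ((1 + s) * (1 + y)) ^ (m + 2) := by gcongr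
      _ = _ := by rw [mul_pow]
  have h5 : (1 + 1 / y) ^ d ≤ (1 + s) ^ (d + 2) * y ^ 2 := by
    have h6 : 1 ≤ (1 + 1 / y) ^ 2 * y ^ 2 := by
      rw [← mul_pow]
      refine one_le_pow₀ ?_
      rw [add_mul, one_div_mul_cancel hτ.ne']
      linarith
    calc (1 + 1 / y) ^ d ≤ (1 + 1 / y) ^ d * ((1 + 1 / y) ^ 2 * y ^ 2) :=
          le_mul_of_one_le_right (by positivity) h6
      _ = (1 + 1 / y) ^ (d + 2) * y ^ 2 := by ring
      _ ≤ _ := by gcongr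
  have hexp : (1 + y) ^ (m + 2) * exp (-(ε * y)) ≤ M' * exp (-(ε / 2 * y)) := by
    have := mul_le_mul_of_nonneg_right (h3 y hτ.le) (Real.exp_pos (-(ε / 2 * y))).le
    refine le_trans (le_of_eq ?_) this
    rw [mul_assoc, ← Real.exp_add]
    congr 2
    ring
  rw [hsE]
  set E := exp (-(π / (2 * ‖(g u).1‖ ^ 2) * s)) with hE
  have hE0 : 0 < E := Real.exp_pos _
  have h7 : (1 + s) ^ (d + 2 + (m + 2)) * E ≤ M := h2 s hs0.le
  calc _ = C₁ * wt j κ * (1 / a ^ 2) * ((1 + 1 / y) ^ d * ((1 + a) ^ m * a ^ 2) *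
        exp (-(ε * y)) * E) := by field_simp
    _ ≤ C₁ * wt j κ * (1 / a ^ 2) * (((1 + s) ^ (d + 2) * y ^ 2) *
        (2 ^ m * ((1 + s) ^ (m + 2) * (1 + y) ^ (m + 2))) * exp (-(ε * y)) * E) := by
      gcongr
    _ = C₁ * wt j κ * (1 / a ^ 2) * 2 ^ m * y ^ 2 * (((1 + y) ^ (m + 2) * exp (-(ε * y))) *
        ((1 + s) ^ (d + 2 + (m + 2)) * E)) := by
      rw [pow_add (1 + s)]; ring
    _ ≤ C₁ * wt j κ * (1 / a ^ 2) * 2 ^ m * y ^ 2 * ((M' * exp (-(ε / 2 * y))) * M) := by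
      gcongr
    _ = _ := by ring

end

section

/-! ### Integrals over subsets of the upper half plane -/

section Measure
variable {E : Type*} [NormedAddCommGroup E] [NormedSpace ℝ E]

theorem measurable_inv_im_sq : Measurable fun z : ℍ =>
    (1 / NNReal.mk z.im z.im_pos.le : NNReal) ^ 2 := by
  refine Continuous.measurable (Continuous.pow (Continuous.div₀ continuous_const ?_ ?_) _)
  · exact UpperHalfPlane.continuous_im.subtype_mk _
  · exact fun x => NNReal.ne_iff.mp x.im_ne_zero

theorem integrableOn_coe_iff {s : Set ℍ} (hs : MeasurableSet s) (f : ℂ → E) :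
    IntegrableOn (fun τ : ℍ => f τ) s ↔
      IntegrableOn (fun z : ℂ => (1 / z.im ^ 2) • f z) (UpperHalfPlane.coe '' s) := by
  have he := UpperHalfPlane.measurableEmbedding_coe
  rw [he.integrableOn_iff_comap, Set.preimage_image_eq _ he.injective, IntegrableOn,
    UpperHalfPlane.volume_def, restrict_withDensity hs,
    integrable_withDensity_iff_integrable_smul measurable_inv_im_sq, IntegrableOn]
  · have : (fun z : ℍ => (1 / NNReal.mk z.im z.im_pos.le : NNReal) ^ 2 • f z) =
        (fun z : ℂ => (1 / z.im ^ 2) • f z) ∘ UpperHalfPlane.coe := by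
      funext z
      rw [Function.comp_apply, NNReal.smul_def]
      simp
    rw [this]
  · exact Set.image_subset_range _ _

theorem setIntegral_coe {s : Set ℍ} (hs : MeasurableSet s) (f : ℂ → E) :
    ∫ τ : ℍ in s, f τ =
      ∫ z : ℂ in UpperHalfPlane.coe '' s, (1 / z.im ^ 2) • f z := by
  have he := UpperHalfPlane.measurableEmbedding_coe
  rw [UpperHalfPlane.volume_def, restrict_withDensity hs,
    integral_withDensity_eq_integral_smul measurable_inv_im_sq]
  have : (fun z : ℍ => (1 / NNReal.mk z.im z.im_pos.le : NNReal) ^ 2 • f z) =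
        fun τ : ℍ => (1 / (τ : ℂ).im ^ 2) • f (τ : ℂ) := by
    funext z
    rw [NNReal.smul_def]
    simp
  rw [this, ← Set.preimage_image_eq s he.injective, ← he.setIntegral_map (μ := volume.comap _)
    (fun z : ℂ => (1 / z.im ^ 2) • f z), he.map_comap, Measure.restrict_restrict',
    Set.preimage_image_eq _ he.injective,
    Set.inter_eq_self_of_subset_left (Set.image_subset_range _ _)]
  exact he.measurableSet_range

theorem image_strip : UpperHalfPlane.coe '' strip =
    Complex.measurableEquivRealProd ⁻¹' (Set.Ico (0 : ℝ) 1 ×ˢ Set.Ioi (0 : ℝ)) := by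
  ext z
  constructor
  · rintro ⟨τ, ⟨h1, h2⟩, rfl⟩
    exact ⟨⟨h1, h2⟩, τ.im_pos⟩
  · rintro ⟨⟨h1, h2⟩, h3⟩
    exact ⟨⟨z, h3⟩, ⟨h1, h2⟩, rfl⟩

theorem integrableOn_strip_iff (f : ℂ → E) :
    IntegrableOn (fun τ : ℍ => f τ) strip ↔
      IntegrableOn (fun p : ℝ × ℝ => (1 / p.2 ^ 2) • f (p.1 + p.2 * I))
        (Set.Ico (0 : ℝ) 1 ×ˢ Set.Ioi (0 : ℝ)) := by
  rw [integrableOn_coe_iff measurableSet_strip, image_strip,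
    ← Complex.volume_preserving_equiv_real_prod.integrableOn_comp_preimage
      Complex.measurableEquivRealProd.measurableEmbedding]
  refine iff_of_eq (congrArg (fun F : ℂ → E => IntegrableOn F _ volume) (funext fun z => ?_))
  simp [Complex.measurableEquivRealProd, Complex.re_add_im]

theorem setIntegral_strip (f : ℂ → E) (hf : IntegrableOn (fun τ : ℍ => f τ) strip) :
    ∫ τ : ℍ in strip, f τ =
      ∫ y in Set.Ioi (0 : ℝ), ∫ x in (0 : ℝ)..1, (1 / y ^ 2) • f (x + y * I) := by
  rw [integrableOn_strip_iff] at hf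
  rw [setIntegral_coe measurableSet_strip, image_strip]
  have h1 := Complex.volume_preserving_equiv_real_prod.setIntegral_preimage_emb
      Complex.measurableEquivRealProd.measurableEmbedding
      (fun p : ℝ × ℝ => (1 / p.2 ^ 2) • f (p.1 + p.2 * I))
      (Set.Ico (0 : ℝ) 1 ×ˢ Set.Ioi (0 : ℝ))
  have h2 : (fun z : ℂ => (1 / z.im ^ 2) • f z) = fun z =>
      (fun p : ℝ × ℝ => (1 / p.2 ^ 2) • f (p.1 + p.2 * I))
        (Complex.measurableEquivRealProd z) := by
    funext z
    simp [Complex.measurableEquivRealProd, Complex.re_add_im]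
  rw [h2, h1]
  rw [IntegrableOn, Measure.volume_eq_prod, ← Measure.prod_restrict] at hf
  rw [Measure.volume_eq_prod, ← Measure.prod_restrict, integral_prod_symm _ hf]
  refine integral_congr_ae (.of_forall fun y => ?_)
  simp only [intervalIntegral.integral_of_le zero_le_one, integral_Ico_eq_integral_Ioc]

theorem integrableOn_strip_exp {ε : ℝ} (hε : 0 < ε) :
    IntegrableOn (fun τ : ℍ => exp (-(ε * τ.im)) * τ.im ^ 2) strip := by
  have h := (integrableOn_strip_iff (E := ℝ) fun z => exp (-(ε * z.im)) * z.im ^ 2).2 ?_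
  · exact h
  have h1 : IntegrableOn (fun p : ℝ × ℝ => (1 : ℝ) * exp (-ε * p.2))
      (Set.Ico (0 : ℝ) 1 ×ˢ Set.Ioi (0 : ℝ)) := by
    rw [IntegrableOn, Measure.volume_eq_prod, ← Measure.prod_restrict]
    refine Integrable.mul_prod (f := fun _ : ℝ => (1 : ℝ)) (g := fun y => exp (-ε * y)) ?_ ?_
    · exact integrable_const _
    · exact exp_neg_integrableOn_Ioi 0 hε
  refine h1.congr_fun (fun p hp => ?_) (measurableSet_Ico.prod measurableSet_Ioi)
  have : p.2 ≠ 0 := (Set.mem_Ioi.1 hp.2).ne'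
  simp
  field_simp

end Measure

variable {L K : Submodule ℤ (QSpace bp bm)} {u u' η : QSpace bp bm}
  {g : QSpace bp bm ≃ₗ[ℝ] QSpace bp bm} {P : MvPolynomial (Fin bp) ℂ} {m : ℕ} {k : ℝ}
  {φ : ℂ → ℂ → Disc L → ℂ}

theorem continuous_gSub (hg : IsIsom g) (u : QSpace bp bm) :
    Continuous (gSub g u) := by
  have h : gSub g u = (⟨⟨gSub g u, gSub_add hg u⟩, gSub_smul hg u⟩ :
      QSpace bp bm →ₗ[ℝ] QSpace bp bm) := rfl
  rw [h]
  exact LinearMap.continuous_of_finiteDimensional _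

theorem continuous_polyAt (p : MvPolynomial (Fin bp) ℂ) :
    Continuous (polyAt p : QSpace bp bm → ℂ) := by
  refine (MvPolynomial.continuous_eval p).comp (continuous_pi fun i => ?_)
  exact Complex.continuous_ofReal.comp (by fun_prop)

theorem continuous_kTerm (hg : IsIsom g) (hφ : IsJacobiForm L η k φ) (hu : 0 < ‖(g u).1‖) (n : ℤ)
    (κ : QSpace bp bm) :
    Continuous fun p : ℍ × ℝ × ℝ => kTerm η u k φ g P m n κ p.1 p.2.1 p.2.2 := by
  have him : Continuous fun p : ℍ × ℝ × ℝ => (p.1 : ℂ).im :=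
    Complex.continuous_im.comp (UpperHalfPlane.continuous_coe.comp continuous_fst)
  have hpos : ∀ p : ℍ × ℝ × ℝ, 0 < (p.1 : ℂ).im := fun p => p.1.im_pos
  have hX : Continuous fun p : ℍ × ℝ × ℝ => κ + p.2.2 • η := by fun_prop
  have hG := (continuous_gSub hg u).comp hX
  have hsub : ∀ h, Continuous fun p : ℍ × ℝ × ℝ =>
      subGauss g u P h p.1 (κ + p.2.2 • η) := by
    intro h
    refine ((continuous_polyAt _).comp hG).mul (Complex.continuous_exp.comp ?_)
    have h1 : Continuous fun p : ℍ × ℝ × ℝ => conj (p.1 : ℂ) :=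
      Complex.continuous_conj.comp (by fun_prop)
    have h2 : Continuous fun p : ℍ × ℝ × ℝ => gSub g u (κ + p.2.2 • η) := hG
    fun_prop
  refine (Complex.continuous_ofReal.comp (him.rpow_const fun p => Or.inl (hpos p).ne')).mul
    ((continuous_phiChar hφ _).mul (Complex.continuous_conj.comp ?_))
  refine (Complex.continuous_ofReal.comp (him.rpow_const fun p => Or.inl (hpos p).ne')).mul
    ((continuous_ee.comp (Complex.continuous_ofReal.comp (by fun_prop))).mul ?_)
  refine ((continuous_ee.comp (Complex.continuous_ofReal.comp ?_)).mul
    ((Complex.continuous_ofReal.comp ?_).mul (Complex.continuous_ofReal.comp ?_))).mul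
    (continuous_finsetSum _ fun h _ => Continuous.mul ?_ (hsub h))
  · exact (continuous_const.mul ((continuous_bil hX continuous_const).div_const _)).neg
  · exact continuous_const.div (Real.continuous_sqrt.comp (by fun_prop)) fun p =>
      (Real.sqrt_pos.2 (mul_pos (mul_pos two_pos (hpos p)) (pow_pos hu 2))).ne'
  · refine Real.continuous_exp.comp (Continuous.neg (continuous_const.div (by fun_prop) fun p =>
      (mul_pos (mul_pos two_pos (hpos p)) (pow_pos hu 2)).ne'))
  · refine Continuous.pow (continuous_const.div (by fun_prop) fun p => ?_) h
    exact mul_ne_zero two_ne_zero (by exact_mod_cast (hpos p).ne')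

theorem Splitting.summable_wt_dualK [DiscreteTopology L] [IsZLattice ℝ L]
    (H : Splitting L K u u' η) :
    Summable fun κ : dualLat K => wt (Module.finrank ℤ (dualLat L) + 1) (κ : QSpace bp bm) :=
  (summable_wt (dualLat L) (j := Module.finrank ℤ (dualLat L) + 1) (by omega)).comp_injective
    (i := fun κ : dualLat K => (⟨κ, H.mem_dualLat_of_mem_dualK κ.2⟩ : dualLat L))
    fun v w h => Subtype.ext (by simpa using h)

theorem Splitting.countable_dualK [DiscreteTopology L] [IsZLattice ℝ L]
    (H : Splitting L K u u' η) : Countable (dualLat K) := by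
  have : Countable (dualLat L) := 
    TopologicalSpace.separableSpace_iff_countable.1 inferInstance
  exact Function.Injective.countable
    (f := fun κ : dualLat K => (⟨κ, H.mem_dualLat_of_mem_dualK κ.2⟩ : dualLat L))
    fun v w h => Subtype.ext (by simpa using h)

theorem norm_squareIntegral_le {f : ℝ → ℝ → ℂ} {B : ℝ}
    (h : ∀ ρ, ∀ ω ∈ Set.Icc (0 : ℝ) 1, ‖f ρ ω‖ ≤ B) : ‖squareIntegral f‖ ≤ B := by
  have h1 : ∀ ρ, ‖∫ ω in (0 : ℝ)..1, f ρ ω‖ ≤ B := fun ρ => by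
    have := intervalIntegral.norm_integral_le_of_norm_le_const (a := (0 : ℝ)) (b := 1)
      (f := f ρ) (C := B) fun ω hω => h ρ ω (by
        rw [Set.uIoc_of_le zero_le_one] at hω; exact ⟨hω.1.le, hω.2⟩)
    simpa using this
  have := intervalIntegral.norm_integral_le_of_norm_le_const (a := (0 : ℝ)) (b := 1)
      (f := fun ρ => ∫ ω in (0 : ℝ)..1, f ρ ω) (C := B) fun ρ _ => h1 ρ
  simpa [squareIntegral] using this

theorem continuous_squareIntegral {X : Type*} [TopologicalSpace X]
    {f : X → ℝ → ℝ → ℂ} (hf : Continuous fun p : X × ℝ × ℝ => f p.1 p.2.1 p.2.2) :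
    Continuous fun x => squareIntegral (f x) := by
  refine intervalIntegral.continuous_parametric_intervalIntegral_of_continuous'
    (f := fun (x : X) (ρ : ℝ) => ∫ ω in (0 : ℝ)..1, f x ρ ω) ?_ 0 1
  refine intervalIntegral.continuous_parametric_intervalIntegral_of_continuous'
    (f := fun (p : X × ℝ) (ω : ℝ) => f p.1 p.2 ω) ?_ 0 1
  exact hf.comp (f := fun p : (X × ℝ) × ℝ => (p.1.1, p.1.2, p.2)) (by fun_prop)

/-- The Fourier coefficient of the averaged pairing as a sum over `K'`. -/
theorem hasSum_torusCoeff_avgPsi [DiscreteTopology L] [IsZLattice ℝ L] (H : Splitting L K u u' η)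
    (hg : IsIsom g) (hP : P.IsHomogeneous m) (hlap : ∀ h, laplacian (subPoly g u P h) = 0)
    (hφ : IsJacobiCuspForm L η k φ) (n : ℤ) (τ : ℍ) :
    HasSum (fun κ : dualLat K => squareIntegral (kTerm η u k φ g P m n κ τ))
      (torusCoeff (avgPsi η u k φ g P) ![0, -n] τ) := by
  have := disc_finite L H.even
  have := Fintype.ofFinite (Disc L)
  have := H.countable_dualK
  obtain ⟨C, ε, d, hC, hε, hb⟩ := norm_kTerm_le H hg hφ P m (Module.finrank ℤ (dualLat L) + 1)
  rw [torusCoeff_avgPsi H hφ.toIsJacobiForm]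
  refine hasSum_squareIntegral (b := fun κ : dualLat K => C * (1 + 1 / (τ : ℂ).im) ^ d *
      (1 + |(n : ℝ)|) ^ m * wt (Module.finrank ℤ (dualLat L) + 1) (κ : QSpace bp bm) *
      exp (-(ε * (τ : ℂ).im)) *
      exp (-(π * n ^ 2 / (2 * (τ : ℂ).im * ‖(g u).1‖ ^ 2)))) (fun κ => ?_) ?_
    (fun ρ ω => hasSum_kTerm H hg hP hlap τ.im_pos ρ ω n) (fun κ ρ hρ ω hω => ?_) ?_
  · exact (continuous_kTerm hg hφ.toIsJacobiForm (H.norm_pos hg) n κ).comp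
      (f := fun p : ℝ × ℝ => (τ, p)) (by fun_prop)
  · simp only [finsum_eq_sum_of_fintype]
    refine continuous_const.mul (continuous_finsetSum _ fun σ _ => Continuous.mul ?_
      (Complex.continuous_conj.comp ?_))
    · exact (continuous_phiChar hφ.toIsJacobiForm σ).comp (f := fun p : ℝ × ℝ => (τ, p))
        (by fun_prop)
    · refine continuous_squareIntegral (X := ℝ × ℝ) (f := fun p α β => thetaChar L g P τ
        (p.1 • η + α • u) (p.2 • η + β • u) σ * ee ((n * β : ℝ) : ℂ)) ?_
      refine Continuous.mul ?_ (continuous_ee.comp (by fun_prop))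
      exact (continuous_thetaChar g P η u σ).comp
        (f := fun p : (ℝ × ℝ) × ℝ × ℝ => (τ, p.1, p.2)) (by fun_prop)
  · exact hb τ τ.im_pos κ κ.2 ρ ω ⟨hω.1.le, hω.2⟩ n
  · exact ((H.summable_wt_dualK.mul_left _).mul_right _).mul_right _

end

section

variable {L K : Submodule ℤ (QSpace bp bm)} {u u' η : QSpace bp bm}
  {g : QSpace bp bm ≃ₗ[ℝ] QSpace bp bm} {P : MvPolynomial (Fin bp) ℂ} {m : ℕ} {k : ℝ}
  {φ : ℂ → ℂ → Disc L → ℂ}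

/-! ### The integral over the strip -/

/-- The factor of `kTerm` which does not depend on the real parts of `τ` and `ζ`. -/
def kFactor (η u : QSpace bp bm) (k : ℝ) (g : QSpace bp bm ≃ₗ[ℝ] QSpace bp bm)
    (P : MvPolynomial (Fin bp) ℂ) (m : ℕ) (n : ℤ) (κ : QSpace bp bm) (y ω : ℝ) : ℂ :=
  ((y ^ k * y ^ ((bm : ℝ) / 2) : ℝ) : ℂ) *
    (ee ((n * (bil (κ + ω • η) (posPart g u) / ‖(g u).1‖ ^ 2) : ℝ) : ℂ) *
      ((1 / sqrt (2 * y * ‖(g u).1‖ ^ 2) *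
        exp (-(π * n ^ 2 / (2 * y * ‖(g u).1‖ ^ 2))) : ℝ) : ℂ)) *
    (∑ h ∈ Finset.range (m + 1), (-(n * I) / (2 * y)) ^ h *
      conj (polyAt (subPoly g u P h) (gSub g u (κ + ω • η)))) *
    (exp (-(2 * π * y * ‖(gSub g u (κ + ω • η)).1‖ ^ 2)) : ℝ)

theorem phiChar_mul_conj_subGauss (H : Splitting L K u u' η) (hg : IsIsom g) {κ : QSpace bp bm}
    (hκ : bil κ u = 0) (τ : ℂ) (ρ ω : ℝ) (h : ℕ) :
    phiChar η φ τ ρ ω (cls L κ) * (conj (ee ((ρ * bil κ η + ω * ρ * q η : ℝ) : ℂ)) *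
      conj (subGauss g u P h τ (κ + ω • η))) =
    (φ τ (ρ + τ * ω) (cls L κ) *
      ee (-((q κ : ℝ) * τ + (bil κ η : ℝ) * (ρ + τ * ω)))) *
    (conj (polyAt (subPoly g u P h) (gSub g u (κ + ω • η))) *
      (exp (-(2 * π * τ.im * ‖(gSub g u (κ + ω • η)).1‖ ^ 2)) : ℝ)) := by
  have hX : bil (κ + ω • η) u = 0 := by simp [hκ, H.η_u]
  have hq := H.q_eq_gSub hg hX
  rw [q_add, q_smul, bil_comm κ, bil_smul_left, bil_comm η] at hq
  set A := ‖(gSub g u (κ + ω • η)).1‖ ^ 2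
  set B := ‖(gSub g u (κ + ω • η)).2‖ ^ 2
  have hB : B = A - 2 * (q κ + ω ^ 2 * q η + ω * bil κ η) := by linarith
  have hτ : conj τ = τ - 2 * τ.im * I := by
    have : τ - conj τ = 2 * τ.im * I := by
      rw [Complex.sub_conj]; push_cast; ring
    rw [← this]; ring
  have hE : ee (q η * (ω ^ 2 * τ + ω * ρ)) * (ee (-(ρ * bil κ η + ω * ρ * q η) : ℝ) *
      conj (Complex.exp (π * I * (τ * (A : ℝ) -
        conj τ * (B : ℝ))))) =
      ee (-((q κ : ℝ) * τ + (bil κ η : ℝ) * (ρ + τ * ω))) *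
        (exp (-(2 * π * τ.im * A)) : ℝ) := by
    rw [← Complex.exp_conj, ee, ee, ee, Complex.ofReal_exp, ← Complex.exp_add, ← Complex.exp_add,
      ← Complex.exp_add]
    congr 1
    simp only [map_mul, map_sub, Complex.conj_conj, Complex.conj_I, Complex.conj_ofReal]
    rw [hτ, hB]
    push_cast
    ring_nf
    rw [Complex.I_sq]
    ring
  rw [phiChar, subGauss, conj_ee_ofReal, map_mul]
  calc _ = φ τ (ρ + τ * ω) (cls L κ) *
        conj (polyAt (subPoly g u P h) (gSub g u (κ + ω • η))) *
        (ee (q η * (ω ^ 2 * τ + ω * ρ)) * (ee (-(ρ * bil κ η + ω * ρ * q η) : ℝ) *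
      conj (Complex.exp (π * I * (τ * (A : ℝ) -
        conj τ * (B : ℝ)))))) := by ring
    _ = _ := by rw [hE]; ring

theorem kTerm_eq (H : Splitting L K u u' η) (hg : IsIsom g) {κ : QSpace bp bm}
    (hκ : bil κ u = 0) (τ : ℂ) (ρ ω : ℝ) (n : ℤ) :
    kTerm η u k φ g P m n κ τ ρ ω = kFactor η u k g P m n κ τ.im ω *
      (φ τ (ρ + τ * ω) (cls L κ) *
        ee (-((q κ : ℝ) * τ + (bil κ η : ℝ) * (ρ + τ * ω)))) := by
  set c : ℂ := ((τ.im ^ k * τ.im ^ ((bm : ℝ) / 2) : ℝ) : ℂ) *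
    (ee ((n * (bil (κ + ω • η) (posPart g u) / ‖(g u).1‖ ^ 2) : ℝ) : ℂ) *
      ((1 / sqrt (2 * τ.im * ‖(g u).1‖ ^ 2) *
        exp (-(π * n ^ 2 / (2 * τ.im * ‖(g u).1‖ ^ 2))) : ℝ) : ℂ)) with hc
  have h1 : kTerm η u k φ g P m n κ τ ρ ω = c * ∑ h ∈ Finset.range (m + 1),
      (-(n * I) / (2 * τ.im)) ^ h *
      (phiChar η φ τ ρ ω (cls L κ) * (conj (ee ((ρ * bil κ η + ω * ρ * q η : ℝ) : ℂ)) *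
        conj (subGauss g u P h τ (κ + ω • η)))) := by
    rw [kTerm, lineTerm, hc]
    simp only [map_mul, Complex.conj_ofReal, map_sum, map_pow, map_div₀, Complex.conj_I, map_ofNat]
    rw [conj_ee_ofReal (-(_ * _)), neg_neg]
    simp only [Finset.mul_sum]
    refine Finset.sum_congr rfl fun h _ => ?_
    push_cast
    ring
  rw [h1, kFactor, ← hc]
  simp only [phiChar_mul_conj_subGauss H hg hκ, Finset.mul_sum, Finset.sum_mul]
  refine Finset.sum_congr rfl fun h _ => ?_
  ring

theorem Splitting.exists_int_q_rep [DiscreteTopology L] [IsZLattice ℝ L] (H : Splitting L K u u' η)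
    {κ : QSpace bp bm} (hκ : κ ∈ dualLat K) : (∃ n : ℤ, q κ = q (rep (cls L κ)) + n) ∧
      ∃ n : ℤ, bil κ η = bil (rep (cls L κ)) η + n := by
  have hκL := H.mem_dualLat_of_mem_dualK hκ
  have h := rep_cls_sub hκL
  obtain ⟨a, ha⟩ := q_congr H.even hκL h
  obtain ⟨b, hb⟩ := dual_bil_int' H.η_mem h
  refine ⟨⟨-a, by push_cast; linarith⟩, ⟨-b, ?_⟩⟩
  rw [map_sub, LinearMap.sub_apply] at hb
  push_cast
  linarith

theorem integral_kTerm [DiscreteTopology L] [IsZLattice ℝ L] (H : Splitting L K u u' η)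
    (hg : IsIsom g) (hφ : IsJacobiForm L η k φ) {κ : QSpace bp bm} (hκ : κ ∈ dualLat K)
    {y : ℝ} (hy : 0 < y) (ω : ℝ) (n : ℤ) :
    ∫ x in (0 : ℝ)..1, ∫ ρ in (0 : ℝ)..1, kTerm η u k φ g P m n κ (x + y * I) ρ ω =
      kFactor η u k g P m n κ y ω * jacCoeff φ (cls L κ) (q κ) (bil κ η) := by
  obtain ⟨hr, hs⟩ := H.exists_int_q_rep hκ
  have him : ∀ x : ℝ, ((x : ℂ) + y * I).im = y := fun x => by simp
  simp only [kTerm_eq H hg (H.dualK_orth hκ).1, him, intervalIntegral.integral_const_mul]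
  rw [← coeffAt_eq hφ (cls L κ) hr hs hy (y * ω), coeffAt]
  congr 2
  funext x
  set F : ℝ → ℂ := fun ξ => φ (x + y * I) (ξ + (y * ω : ℝ) * I) (cls L κ) *
    ee (-((q κ : ℝ) * (x + y * I) + (bil κ η : ℝ) * (ξ + (y * ω : ℝ) * I)))
    with hF
  have hper : Function.Periodic F 1 := by
    intro ξ
    have h1 : (((ξ + 1 : ℝ) : ℂ) + (y * ω : ℝ) * I) =
        (ξ + (y * ω : ℝ) * I) + 1 := by push_cast; ring
    have h2 := ee_mul_add_one hs (ξ + (y * ω : ℝ) * I) ((q κ : ℝ) * (x + y * I))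
    simp only [hF]
    rw [h1, phi_add_one_right hφ (by rw [him]; exact hy), add_comm ((q κ : ℝ) * _ : ℂ), mul_right_comm,
      h2, add_comm (((bil κ η : ℝ) : ℂ) * _)]
    ring
  have h3 : ∫ ρ in (0 : ℝ)..1, F (ρ + x * ω) = ∫ ρ in (0 : ℝ)..1, F ρ := by
    rw [intervalIntegral.integral_comp_add_right]
    have := hper.intervalIntegral_add_eq (x * ω) 0
    rw [zero_add] at this
    rw [zero_add, add_comm 1, this]
  rw [← h3]
  congr 1
  funext ρ
  have h4 : ((ρ : ℂ) + (x + y * I) * ω) =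
      ((ρ + x * ω : ℝ) : ℂ) + (y * ω : ℝ) * I := by push_cast; ring
  simp only [hF]
  rw [h4]

theorem squareIntegral_strip_eq {F : ℝ → ℝ → ℝ → ℂ}
    (hF : Continuous fun p : ℝ × ℝ × ℝ => F p.1 p.2.1 p.2.2) :
    ∫ x in (0 : ℝ)..1, squareIntegral (F x) =
      ∫ ω in (0 : ℝ)..1, ∫ x in (0 : ℝ)..1, ∫ ρ in (0 : ℝ)..1, F x ρ ω := by
  have h1 : ∀ x, squareIntegral (F x) = ∫ ω in (0 : ℝ)..1, ∫ ρ in (0 : ℝ)..1, F x ρ ω := fun x =>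
    intervalIntegral_swap (hF.comp (f := fun p : ℝ × ℝ => (x, p)) (by fun_prop))
  simp only [h1]
  refine intervalIntegral_swap ?_
  refine intervalIntegral.continuous_parametric_intervalIntegral_of_continuous'
    (f := fun (p : ℝ × ℝ) (ρ : ℝ) => F p.1 ρ p.2) ?_ 0 1
  exact hF.comp (f := fun p : (ℝ × ℝ) × ℝ => (p.1.1, p.2, p.1.2)) (by fun_prop)

/-- The contribution of `κ ∈ K'` to the integral of the `n`-th Fourier coefficient over the
strip. -/
def stripTerm (η u : QSpace bp bm) (k : ℝ) (φ : ℂ → ℂ → Disc L → ℂ)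
    (g : QSpace bp bm ≃ₗ[ℝ] QSpace bp bm) (P : MvPolynomial (Fin bp) ℂ) (m : ℕ) (n : ℤ)
    (κ : QSpace bp bm) : ℂ :=
  ∫ y in Set.Ioi (0 : ℝ), ((1 / y ^ 2 : ℝ) : ℂ) * ((∫ ω in (0 : ℝ)..1,
    kFactor η u k g P m n κ y ω) * jacCoeff φ (cls L κ) (q κ) (bil κ η))

theorem exists_strip_bound [DiscreteTopology L] [IsZLattice ℝ L] (H : Splitting L K u u' η)
    (hg : IsIsom g) (hφ : IsJacobiCuspForm L η k φ) (P : MvPolynomial (Fin bp) ℂ) (m j : ℕ) :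
    ∃ C : ℝ, 0 ≤ C ∧ ∀ κ ∈ dualLat K, ∀ n : ℤ, n ≠ 0 →
      IntegrableOn (fun τ : ℍ => squareIntegral (kTerm η u k φ g P m n κ τ)) strip ∧
      ∫ τ : ℍ in strip, ‖squareIntegral (kTerm η u k φ g P m n κ τ)‖ ≤
        C * wt j κ * (1 / (n : ℝ) ^ 2) := by
  obtain ⟨C, ε, hC, hε, hb⟩ := norm_kTerm_le_of_ne_zero H hg hφ P m j
  have hi := integrableOn_strip_exp hε
  refine ⟨C * ∫ τ : ℍ in strip, exp (-(ε * τ.im)) * τ.im ^ 2,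
    mul_nonneg hC.le (integral_nonneg fun τ => by positivity), ?_⟩
  intro κ hκ n hn
  have hle : ∀ τ : ℍ, ‖squareIntegral (kTerm η u k φ g P m n κ τ)‖ ≤
      C * wt j κ * (1 / (n : ℝ) ^ 2) * (exp (-(ε * τ.im)) * τ.im ^ 2) := fun τ => by
    refine norm_squareIntegral_le fun ρ ω hω => (hb τ τ.im_pos κ hκ ρ ω hω n hn).trans (le_of_eq ?_)
    rw [mul_assoc]; rfl
  have hint : IntegrableOn (fun τ : ℍ =>
      squareIntegral (kTerm η u k φ g P m n κ τ)) strip := by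
    refine Integrable.mono' (hi.const_mul _) ?_ (.of_forall hle)
    exact (continuous_squareIntegral (continuous_kTerm hg hφ.toIsJacobiForm (H.norm_pos hg)
      n κ)).aestronglyMeasurable
  refine ⟨hint, ?_⟩
  calc _ ≤ ∫ τ : ℍ in strip, C * wt j κ * (1 / (n : ℝ) ^ 2) *
        (exp (-(ε * τ.im)) * τ.im ^ 2) :=
        integral_mono hint.norm (hi.const_mul _) hle
    _ = _ := by rw [integral_const_mul]; ring

theorem integral_strip_kTerm [DiscreteTopology L] [IsZLattice ℝ L] (H : Splitting L K u u' η)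
    (hg : IsIsom g) (hφ : IsJacobiCuspForm L η k φ) {κ : QSpace bp bm} (hκ : κ ∈ dualLat K)
    {n : ℤ} (hn : n ≠ 0) :
    ∫ τ : ℍ in strip, squareIntegral (kTerm η u k φ g P m n κ τ) =
      stripTerm η u k φ g P m n κ := by
  obtain ⟨C, -, hC⟩ := exists_strip_bound H hg hφ P m 0
  rw [setIntegral_strip (fun z : ℂ => squareIntegral (kTerm η u k φ g P m n κ z)) (hC κ hκ n hn).1,
    stripTerm]
  refine setIntegral_congr_fun measurableSet_Ioi fun y hy => ?_
  have hy : 0 < y := hy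
  have him : ∀ x : ℝ, 0 < ((x : ℂ) + y * I).im := fun x => by simpa using hy
  have hcont : Continuous fun p : ℝ × ℝ × ℝ =>
      kTerm η u k φ g P m n κ (p.1 + y * I) p.2.1 p.2.2 :=
    (continuous_kTerm hg hφ.toIsJacobiForm (H.norm_pos hg) n κ).comp
      (f := fun p : ℝ × ℝ × ℝ => ((⟨p.1 + y * I, him p.1⟩ : ℍ), p.2)) (by
        refine Continuous.prodMk ?_ continuous_snd
        exact UpperHalfPlane.isEmbedding_coe.continuous_iff.2 (by
          change Continuous fun p : ℝ × ℝ × ℝ => (p.1 : ℂ) + y * I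
          fun_prop))
  simp only [Complex.real_smul, intervalIntegral.integral_const_mul]
  congr 1
  rw [squareIntegral_strip_eq (F := fun x ρ ω =>
    kTerm η u k φ g P m n κ (x + y * I) ρ ω) hcont]
  simp only [integral_kTerm H hg hφ.toIsJacobiForm hκ hy, intervalIntegral.integral_mul_const]

theorem exists_torusCoeff_bound [DiscreteTopology L] [IsZLattice ℝ L] (H : Splitting L K u u' η)
    (hg : IsIsom g) (hP : P.IsHomogeneous m) (hk : k = m + ((bp : ℝ) - bm) / 2)
    (hlap : ∀ h, laplacian (subPoly g u P h) = 0) (hφ : IsJacobiCuspForm L η k φ) :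
    ∃ C : ℝ, ∀ n : ℤ, n ≠ 0 →
      IntegrableOn (torusCoeff (avgPsi η u k φ g P) ![0, -n]) strip ∧
      ∫ τ in strip, ‖torusCoeff (avgPsi η u k φ g P) ![0, -n] τ‖ ≤ C * (1 / (n : ℝ) ^ 2) := by
  obtain ⟨C, ε, hC, hε, hb⟩ :=
    norm_kTerm_le_of_ne_zero H hg hφ P m (Module.finrank ℤ (dualLat L) + 1)
  have hi := integrableOn_strip_exp hε
  set W := ∑' κ : dualLat K, wt (Module.finrank ℤ (dualLat L) + 1) (κ : QSpace bp bm)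
  refine ⟨C * W * ∫ τ : ℍ in strip, exp (-(ε * τ.im)) * τ.im ^ 2, ?_⟩
  intro n hn
  have hle : ∀ τ : ℍ, ‖torusCoeff (avgPsi η u k φ g P) ![0, -n] τ‖ ≤
      C * W * (1 / (n : ℝ) ^ 2) * (exp (-(ε * τ.im)) * τ.im ^ 2) := fun τ => by
    have h1 : ∀ κ : dualLat K, ‖squareIntegral (kTerm η u k φ g P m n κ τ)‖ ≤
        wt (Module.finrank ℤ (dualLat L) + 1) (κ : QSpace bp bm) *
        (C * (1 / (n : ℝ) ^ 2) * (exp (-(ε * τ.im)) * τ.im ^ 2)) := fun κ =>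
      norm_squareIntegral_le fun ρ ω hω =>
        (hb τ τ.im_pos κ κ.2 ρ ω hω n hn).trans (le_of_eq (by
          rw [mul_assoc _ (exp _), UpperHalfPlane.coe_im]; ring))
    have h2 := hasSum_torusCoeff_avgPsi H hg hP hlap hφ n τ
    rw [← h2.tsum_eq]
    refine (tsum_of_norm_bounded (H.summable_wt_dualK.mul_right _).hasSum h1).trans
      (le_of_eq ?_)
    rw [tsum_mul_right]
    ring
  have hint : IntegrableOn (torusCoeff (avgPsi η u k φ g P) ![0, -n]) strip := by
    refine Integrable.mono' (hi.const_mul _) ?_ (.of_forall hle)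
    exact ((isTorusFamily_avgPsi H hg hP hk hφ.toIsJacobiForm).continuous_torusCoeff
      _).aestronglyMeasurable
  refine ⟨hint, ?_⟩
  calc _ ≤ ∫ τ : ℍ in strip, C * W * (1 / (n : ℝ) ^ 2) *
        (exp (-(ε * τ.im)) * τ.im ^ 2) :=
        integral_mono hint.norm (hi.const_mul _) hle
    _ = _ := by rw [integral_const_mul]; ring

theorem hasSum_strip [DiscreteTopology L] [IsZLattice ℝ L] (H : Splitting L K u u' η)
    (hg : IsIsom g) (hP : P.IsHomogeneous m) (hlap : ∀ h, laplacian (subPoly g u P h) = 0)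
    (hφ : IsJacobiCuspForm L η k φ) {n : ℤ} (hn : n ≠ 0) :
    HasSum (fun κ : dualLat K => stripTerm η u k φ g P m n κ)
      (∫ τ in strip, torusCoeff (avgPsi η u k φ g P) ![0, -n] τ) := by
  have := H.countable_dualK
  obtain ⟨C, hC0, hC⟩ := exists_strip_bound H hg hφ P m (Module.finrank ℤ (dualLat L) + 1)
  have hs : Summable fun κ : dualLat K => ∫ τ : ℍ in strip,
      ‖squareIntegral (kTerm η u k φ g P m n κ τ)‖ := by
    refine Summable.of_nonneg_of_le (fun κ => integral_nonneg fun τ => norm_nonneg _)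
      (fun κ => (hC κ κ.2 n hn).2) ((H.summable_wt_dualK.mul_left C).mul_right _)
  have h1 := hasSum_integral_of_summable_integral_norm (μ := volume.restrict strip)
    (F := fun (κ : dualLat K) (τ : ℍ) => squareIntegral (kTerm η u k φ g P m n κ τ))
    (fun κ => (hC κ κ.2 n hn).1) hs
  have h2 : (fun τ : ℍ => ∑' κ : dualLat K,
      squareIntegral (kTerm η u k φ g P m n κ τ)) =
      torusCoeff (avgPsi η u k φ g P) ![0, -n] := by
    funext τ
    exact (hasSum_torusCoeff_avgPsi H hg hP hlap hφ n τ).tsum_eq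
  have h3 : (fun κ : dualLat K => stripTerm η u k φ g P m n κ) = fun κ : dualLat K =>
      ∫ τ : ℍ in strip, squareIntegral (kTerm η u k φ g P m n κ τ) := by
    funext κ
    rw [integral_strip_kTerm H hg hφ κ.2 hn]
  rw [h3, ← h2]
  exact h1

theorem norm_stripTerm_le [DiscreteTopology L] [IsZLattice ℝ L] (H : Splitting L K u u' η)
    (hg : IsIsom g) (hφ : IsJacobiCuspForm L η k φ) (P : MvPolynomial (Fin bp) ℂ) (m j : ℕ) :
    ∃ C : ℝ, 0 ≤ C ∧ ∀ κ ∈ dualLat K, ∀ n : ℤ, n ≠ 0 →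
      ‖stripTerm η u k φ g P m n κ‖ ≤ C * wt j κ * (1 / (n : ℝ) ^ 2) := by
  obtain ⟨C, hC0, hC⟩ := exists_strip_bound H hg hφ P m j
  refine ⟨C, hC0, fun κ hκ n hn => ?_⟩
  rw [← integral_strip_kTerm H hg hφ hκ hn]
  exact (norm_integral_le_integral_norm _).trans (hC κ hκ n hn).2

theorem hasSum_prod_of_summable {α β : Type*} {f : α × β → ℂ} {a : α → ℂ} {s : ℂ}
    (hf : Summable f) (h1 : ∀ x, HasSum (fun y => f (x, y)) (a x)) (h2 : HasSum a s) :
    HasSum f s := by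
  have h3 := hf.hasSum.prod_fiberwise h1
  rw [← h3.unique h2]
  exact hf.hasSum

/-- The unfolded integral as a sum over positive integers and `K'`. -/
theorem hasSum_stripTerm [DiscreteTopology L] [IsZLattice ℝ L] (H : Splitting L K u u' η)
    (hg : IsIsom g) (hP : P.IsHomogeneous m) (hk : k = m + ((bp : ℝ) - bm) / 2)
    (hlap : ∀ h, laplacian (subPoly g u P h) = 0) (hφ : IsJacobiCuspForm L η k φ)
    (h0 : IntegrableOn (torusCoeff (avgPsi η u k φ g P) 0) ModularGroup.fd)
    (h1 : IntegrableOn (fun τ => avgPsi η u k φ g P τ 0 0) ModularGroup.fd) :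
    HasSum (fun p : ℕ × dualLat K => 2 * stripTerm η u k φ g P m ((p.1 + 1 : ℕ) : ℤ) p.2)
      ((∫ τ in ModularGroup.fd, avgPsi η u k φ g P τ 0 0) -
        ∫ τ in ModularGroup.fd, torusCoeff (avgPsi η u k φ g P) 0 τ) := by
  have hT := isTorusFamily_avgPsi H hg hP hk hφ.toIsJacobiForm
  have hne : ∀ n : ℕ, ((n + 1 : ℕ) : ℤ) ≠ 0 := fun n => by omega
  have hneg : ∀ n : ℕ, torusCoeff (avgPsi η u k φ g P) ![0, ((n + 1 : ℕ) : ℤ)] =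
      torusCoeff (avgPsi η u k φ g P) ![0, -((n + 1 : ℕ) : ℤ)] := fun n => by
    rw [← hT.torusCoeff_neg]
    congr 1
    simp
  have hsq : Summable fun n : ℕ => 1 / (((n + 1 : ℕ) : ℤ) : ℝ) ^ 2 := by
    have := (summable_nat_add_iff 1).2 (Real.summable_one_div_nat_pow.2 one_lt_two)
    simpa using this
  obtain ⟨C, hC⟩ := exists_torusCoeff_bound H hg hP hk hlap hφ
  obtain ⟨C', hC0', hC'⟩ := norm_stripTerm_le H hg hφ P m (Module.finrank ℤ (dualLat L) + 1)
  have hunf := hT.hasSum_unfold h0 h1 (fun n => by rw [hneg]; exact (hC _ (hne n)).1) (by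
    refine Summable.of_nonneg_of_le (fun n => integral_nonneg fun τ => norm_nonneg _)
      (fun n => ?_) (hsq.mul_left C)
    rw [hneg]
    exact (hC _ (hne n)).2)
  refine hasSum_prod_of_summable ?_ (fun n => ?_) hunf
  · have hprod := Summable.mul_of_nonneg hsq H.summable_wt_dualK (fun n => by positivity)
      (fun κ => (wt_pos _ _).le)
    refine Summable.of_norm_bounded (hprod.mul_left (2 * C')) fun p => ?_
    rw [norm_mul, RCLike.norm_ofNat]
    have := hC' p.2 p.2.2 _ (hne p.1)
    exact (mul_le_mul_of_nonneg_left this zero_le_two).trans (le_of_eq (by ring))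
  · have := (hasSum_strip H hg hP hlap hφ (hne n)).mul_left 2
    rw [← hneg] at this
    rw [Complex.real_smul]
    exact_mod_cast this

end

/-! ### Integrals over the fundamental domain of the Jacobi group -/

/-- The coordinates `τ`, `ρ + i ω` of a point `(τ, ρ + τ ω)`. -/
def shear (p : ℂ × ℂ) : ℂ × ℂ := (p.1, p.2.re + p.1 * p.2.im)

/-- The derivative of `shear`. -/
def shearDeriv (p : ℂ × ℂ) : ℂ × ℂ →L[ℝ] ℂ × ℂ :=
  (ContinuousLinearMap.fst ℝ ℂ ℂ).prod
    (Complex.ofRealCLM.comp (Complex.reCLM.comp (ContinuousLinearMap.snd ℝ ℂ ℂ)) +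
      (p.1 • (Complex.ofRealCLM.comp (Complex.imCLM.comp (ContinuousLinearMap.snd ℝ ℂ ℂ))) +
        (p.2.im : ℂ) • ContinuousLinearMap.fst ℝ ℂ ℂ))

theorem hasFDerivAt_shear (p : ℂ × ℂ) : HasFDerivAt shear (shearDeriv p) p := by
  have h1 : HasFDerivAt (fun p : ℂ × ℂ => (p.2.re : ℂ))
      (Complex.ofRealCLM.comp (Complex.reCLM.comp (ContinuousLinearMap.snd ℝ ℂ ℂ))) p :=
    (Complex.ofRealCLM.comp (Complex.reCLM.comp (ContinuousLinearMap.snd ℝ ℂ ℂ))).hasFDerivAt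
  have h2 : HasFDerivAt (fun p : ℂ × ℂ => (p.2.im : ℂ))
      (Complex.ofRealCLM.comp (Complex.imCLM.comp (ContinuousLinearMap.snd ℝ ℂ ℂ))) p :=
    (Complex.ofRealCLM.comp (Complex.imCLM.comp (ContinuousLinearMap.snd ℝ ℂ ℂ))).hasFDerivAt
  have h3 : HasFDerivAt (fun p : ℂ × ℂ => p.1) (ContinuousLinearMap.fst ℝ ℂ ℂ) p :=
    (ContinuousLinearMap.fst ℝ ℂ ℂ).hasFDerivAt
  exact h3.prodMk (h1.add (h3.mul h2))

theorem det_shearDeriv (p : ℂ × ℂ) : (shearDeriv p).det = p.1.im := by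
  have h : LinearMap.toMatrix (Complex.basisOneI.prod Complex.basisOneI)
      (Complex.basisOneI.prod Complex.basisOneI) (shearDeriv p : ℂ × ℂ →ₗ[ℝ] ℂ × ℂ) =
      Matrix.fromBlocks 1 0 !![p.2.im, 0; 0, p.2.im] !![1, p.1.re; 0, p.1.im] := by
    ext i j
    rcases i with i | i <;> rcases j with j | j <;> fin_cases i <;> fin_cases j <;>
      simp [LinearMap.toMatrix_apply, shearDeriv]
  rw [ContinuousLinearMap.det, ← LinearMap.det_toMatrix (Complex.basisOneI.prod Complex.basisOneI),
    h, Matrix.det_fromBlocks_zero₁₂]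
  simp [Matrix.det_fin_two]

/-- The unit square in `ℂ`. -/
def unitSquare : Set ℂ :=
  Complex.measurableEquivRealProd ⁻¹' (Set.Icc (0 : ℝ) 1 ×ˢ Set.Icc (0 : ℝ) 1)

theorem measurableSet_unitSquare : MeasurableSet unitSquare :=
  Complex.measurableEquivRealProd.measurable (measurableSet_Icc.prod measurableSet_Icc)

theorem mem_unitSquare {w : ℂ} :
    w ∈ unitSquare ↔ w.re ∈ Set.Icc (0 : ℝ) 1 ∧ w.im ∈ Set.Icc (0 : ℝ) 1 := Iff.rfl

theorem volume_unitSquare : volume unitSquare = 1 := by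
  rw [unitSquare, Complex.volume_preserving_equiv_real_prod.measure_preimage
    (measurableSet_Icc.prod measurableSet_Icc).nullMeasurableSet, Measure.volume_eq_prod,
    Measure.prod_prod]
  simp

theorem setIntegral_unitSquare {f : ℝ → ℝ → ℂ} (hf : Continuous (Function.uncurry f)) :
    ∫ w in unitSquare, f w.re w.im = squareIntegral f := by
  have h1 := Complex.volume_preserving_equiv_real_prod.setIntegral_preimage_emb
      Complex.measurableEquivRealProd.measurableEmbedding (fun p : ℝ × ℝ => f p.1 p.2)
      (Set.Icc (0 : ℝ) 1 ×ˢ Set.Icc (0 : ℝ) 1)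
  refine Eq.trans h1 ?_
  rw [Measure.volume_eq_prod, setIntegral_prod, squareIntegral]
  · simp only [integral_Icc_eq_integral_Ioc, intervalIntegral.integral_of_le zero_le_one]
  · exact ContinuousOn.integrableOn_compact (isCompact_Icc.prod isCompact_Icc) hf.continuousOn

theorem image_shear :
    shear '' ((UpperHalfPlane.coe '' ModularGroup.fd) ×ˢ unitSquare) = jacDomain := by
  rw [ModularGroup.coe_fd]
  ext ⟨τ, z⟩
  constructor
  · rintro ⟨⟨τ', w⟩, ⟨⟨h1, h2, h3⟩, h4⟩, h⟩
    obtain ⟨⟨h5, h6⟩, h7, h8⟩ := mem_unitSquare.1 h4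
    rw [shear, Prod.mk.injEq] at h
    obtain ⟨rfl, rfl⟩ := h
    dsimp only at h1 h2 h3 h5 h6 h7 h8
    refine ⟨h1, h3, h2, ?_, ?_, ?_, ?_⟩ <;> simp
    · positivity
    · nlinarith
    · rw [div_le_iff₀ h1]; nlinarith
    · have : τ'.im * w.im * τ'.re / τ'.im = w.im * τ'.re := by field_simp
      rw [this]; linarith
  · rintro ⟨h1, h2, h3, h4, h5, h6, h7⟩
    dsimp only at h1 h2 h3 h4 h5 h6 h7
    refine ⟨(τ, ⟨z.re - z.im * τ.re / τ.im, z.im / τ.im⟩), ⟨⟨h1, h3, h2⟩, ?_⟩, ?_⟩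
    · refine mem_unitSquare.2 ⟨⟨by simpa using h6, by simpa using h7⟩, by positivity, ?_⟩
      rw [div_le_one h1]; exact h5
    · rw [shear, Prod.mk.injEq]
      refine ⟨rfl, Complex.ext ?_ ?_⟩
      · simp; ring
      · simp; field_simp

theorem injOn_shear {s : Set (ℂ × ℂ)} (hs : ∀ p ∈ s, 0 < p.1.im) : Set.InjOn shear s := by
  rintro ⟨τ, w⟩ h1 ⟨τ', w'⟩ h2 h
  rw [shear, shear, Prod.mk.injEq] at h
  obtain ⟨rfl, h⟩ := h
  have him : 0 < τ.im := hs _ h1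
  have h3 := congrArg Complex.im h
  have h4 := congrArg Complex.re h
  simp only [Complex.add_im, Complex.ofReal_im, Complex.mul_im, Complex.ofReal_re, mul_zero,
    zero_add, Complex.add_re, Complex.mul_re, sub_zero] at h3 h4
  have h5 : w.im = w'.im := mul_left_cancel₀ him.ne' h3
  rw [h5] at h4
  exact Prod.ext rfl (Complex.ext (by linarith) h5)

theorem continuousOn_of_continuous_coe {X Y : Type*} [TopologicalSpace X] [TopologicalSpace Y]
    {f : ℂ × X → Y} (h : Continuous fun p : ℍ × X => f (p.1, p.2)) :
    ContinuousOn f {p | 0 < p.1.im} := by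
  rw [continuousOn_iff_continuous_domRestrict]
  refine h.comp (f := fun p : {p : ℂ × X | 0 < p.1.im} =>
    ((⟨p.1.1, p.2⟩ : ℍ), p.1.2)) (Continuous.prodMk ?_ (by fun_prop))
  exact UpperHalfPlane.isEmbedding_coe.continuous_iff.2 (by
    change Continuous fun p : {p : ℂ × X | 0 < p.1.im} => p.1.1
    fun_prop)

theorem measurableSet_coe_fd : MeasurableSet (UpperHalfPlane.coe '' ModularGroup.fd) :=
  ModularGroup.isClosed_coe_fd.measurableSet

theorem half_lt_im_of_mem_fd {τ : ℍ} (h : τ ∈ ModularGroup.fd) : 1 / 2 < τ.im := by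
  have := ModularGroup.three_le_four_mul_im_sq_of_mem_fd h
  nlinarith [τ.im_pos]

theorem integrableOn_fd_exp {ε : ℝ} (hε : 0 < ε) :
    IntegrableOn (fun z : ℂ => exp (-(ε * z.im))) (UpperHalfPlane.coe '' ModularGroup.fd) := by
  have h1 : IntegrableOn (fun p : ℝ × ℝ => (1 : ℝ) * exp (-ε * p.2))
      (Set.Icc (-(1 / 2) : ℝ) (1 / 2) ×ˢ Set.Ioi (0 : ℝ)) := by
    rw [IntegrableOn, Measure.volume_eq_prod, ← Measure.prod_restrict]
    refine Integrable.mul_prod (f := fun _ : ℝ => (1 : ℝ)) (g := fun y => exp (-ε * y)) ?_ ?_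
    · exact integrable_const _
    · exact exp_neg_integrableOn_Ioi 0 hε
  have h2 := (Complex.volume_preserving_equiv_real_prod.integrableOn_comp_preimage
      Complex.measurableEquivRealProd.measurableEmbedding).2 h1
  refine (h2.congr_fun (fun z _ => ?_) ?_).mono_set ?_
  · change (1 : ℝ) * exp (-ε * z.im) = _
    rw [one_mul, neg_mul]
  · exact Complex.measurableEquivRealProd.measurable (measurableSet_Icc.prod measurableSet_Ioi)
  · rw [ModularGroup.coe_fd]
    rintro z ⟨h1, -, h3⟩
    exact ⟨abs_le.1 h3, h1⟩

theorem integral_jacDomain {F : ℂ × ℂ → ℂ} {G : ℂ → ℝ → ℝ → ℂ}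
    (hG : Continuous fun p : ℍ × ℝ × ℝ => G p.1 p.2.1 p.2.2)
    (hF : ∀ τ : ℂ, 0 < τ.im → ∀ ρ ω : ℝ, F (τ, ρ + τ * ω) = ((1 / τ.im ^ 3 : ℝ) : ℂ) * G τ ρ ω)
    {C ε : ℝ} (hε : 0 < ε) (hb : ∀ τ : ℂ, 1 / 2 < τ.im → ∀ ρ ∈ Set.Icc (0 : ℝ) 1,
      ∀ ω ∈ Set.Icc (0 : ℝ) 1, ‖G τ ρ ω‖ ≤ C * exp (-(ε * τ.im))) :
    IntegrableOn F jacDomain ∧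
    IntegrableOn (fun τ : ℍ => squareIntegral (G τ)) ModularGroup.fd ∧
    ∫ p in jacDomain, F p = ∫ τ : ℍ in ModularGroup.fd, squareIntegral (G τ) := by
  set D := UpperHalfPlane.coe '' ModularGroup.fd with hD
  have hDpos : ∀ z ∈ D, 1 / 2 < z.im := by
    rintro _ ⟨τ, hτ, rfl⟩
    exact half_lt_im_of_mem_fd hτ
  have hpos : ∀ p ∈ D ×ˢ unitSquare, 0 < p.1.im := fun p hp => by
    linarith [hDpos _ hp.1]
  have hDm : MeasurableSet D := measurableSet_coe_fd
  have hm := hDm.prod measurableSet_unitSquare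
  set A : ℂ × ℂ → ℂ := fun p => ((1 / p.1.im ^ 2 : ℝ) : ℂ) * G p.1 p.2.re p.2.im with hA
  have hFA : ∀ p ∈ D ×ˢ unitSquare, |(shearDeriv p).det| • F (shear p) = A p := by
    intro p hp
    have h0 := hpos p hp
    rw [det_shearDeriv, abs_of_pos h0, shear, hF _ h0, hA, Complex.real_smul, ← mul_assoc,
      ← Complex.ofReal_mul]
    congr 2
    field_simp
  have hAc : ContinuousOn A (D ×ˢ unitSquare) := by
    have h1 : ContinuousOn (fun p : ℂ × ℝ × ℝ => G p.1 p.2.1 p.2.2) {p | 0 < p.1.im} :=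
      continuousOn_of_continuous_coe hG
    refine ContinuousOn.mul (Complex.continuous_ofReal.comp_continuousOn ?_) ?_
    · exact continuousOn_const.div (by fun_prop) fun p hp => (pow_pos (hpos p hp) 2).ne'
    · refine h1.comp (f := fun p : ℂ × ℂ => (p.1, p.2.re, p.2.im)) ?_ fun p hp => hpos p hp
      exact Continuous.continuousOn (by fun_prop)
  have hAi : IntegrableOn A (D ×ˢ unitSquare) := by
    have h1 : IntegrableOn (fun p : ℂ × ℂ => (4 * C * exp (-(ε * p.1.im))) * (1 : ℝ))
        (D ×ˢ unitSquare) := by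
      rw [IntegrableOn, Measure.volume_eq_prod, ← Measure.prod_restrict]
      refine Integrable.mul_prod (f := fun z : ℂ => 4 * C * exp (-(ε * z.im)))
        (g := fun _ : ℂ => (1 : ℝ)) ?_ ?_
      · exact (integrableOn_fd_exp hε).const_mul _
      · have : IsFiniteMeasure (volume.restrict unitSquare) :=
          ⟨by rw [Measure.restrict_apply_univ, volume_unitSquare]; exact ENNReal.one_lt_top⟩
        exact integrable_const _
    refine Integrable.mono' h1 (hAc.aestronglyMeasurable hm) ?_
    refine (ae_restrict_iff' hm).2 (.of_forall fun p hp => ?_)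
    have h2 := hDpos _ hp.1
    obtain ⟨h3, h4⟩ := mem_unitSquare.1 hp.2
    rw [hA, norm_mul, Complex.norm_real, Real.norm_eq_abs, abs_of_nonneg (by positivity)]
    have h5 : 1 / p.1.im ^ 2 ≤ 4 := by
      rw [div_le_iff₀ (pow_pos (hpos p hp) 2)]; nlinarith
    calc _ ≤ 4 * (C * exp (-(ε * p.1.im))) :=
          mul_le_mul h5 (hb _ h2 _ h3 _ h4) (norm_nonneg _) (by norm_num)
      _ = _ := by ring
  have hfib : ∀ z ∈ D, ∫ w in unitSquare, A (z, w) =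
      (1 / z.im ^ 2) • squareIntegral (G z) := by
    rintro _ ⟨τ, hτ, rfl⟩
    simp only [hA]
    rw [integral_const_mul, setIntegral_unitSquare (f := G τ)
      (hG.comp (f := fun p : ℝ × ℝ => (τ, p)) (by fun_prop)), Complex.real_smul]
  have hder : ∀ p ∈ D ×ˢ unitSquare,
      HasFDerivWithinAt shear (shearDeriv p) (D ×ˢ unitSquare) p :=
    fun p _ => (hasFDerivAt_shear p).hasFDerivWithinAt
  have hfd : MeasurableSet ModularGroup.fd := ModularGroup.isClosed_fd.measurableSet
  have hHaar : (volume : Measure (ℂ × ℂ)).IsAddHaarMeasure :=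
    Measure.prod.instIsAddHaarMeasure volume volume
  rw [← image_shear]
  refine ⟨?_, ?_, ?_⟩
  · rw [integrableOn_image_iff_integrableOn_abs_det_fderiv_smul volume hm hder (injOn_shear hpos)]
    exact hAi.congr_fun (fun p hp => (hFA p hp).symm) hm
  · rw [integrableOn_coe_iff hfd (fun z => squareIntegral (G z))]
    have h1 := hAi
    rw [IntegrableOn, Measure.volume_eq_prod, ← Measure.prod_restrict] at h1
    exact IntegrableOn.congr_fun h1.integral_prod_left hfib hDm
  · rw [integral_image_eq_integral_abs_det_fderiv_smul volume hm hder (injOn_shear hpos),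
      setIntegral_congr_fun hm hFA, Measure.volume_eq_prod,
      setIntegral_prod _ (by rw [← Measure.volume_eq_prod]; exact hAi),
      setIntegral_congr_fun hDm hfib, setIntegral_coe hfd (fun z => squareIntegral (G z))]

section

variable {L K : Submodule ℤ (QSpace bp bm)} {u u' η : QSpace bp bm}
  {g : QSpace bp bm ≃ₗ[ℝ] QSpace bp bm} {P : MvPolynomial (Fin bp) ℂ} {m : ℕ} {k : ℝ}
  {φ : ℂ → ℂ → Disc L → ℂ}

/-! ### The Petersson inner products -/

theorem theta_exponent {τ : ℂ} (hτ : 0 < τ.im) (ρ ω a b e f Q B : ℝ)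
    (v1 e1 : EuclideanSpace ℝ (Fin bp)) (v2 e2 : EuclideanSpace ℝ (Fin bm))
    (ha : a = ‖v1‖ ^ 2 / 2) (hb : b = -(‖v2‖ ^ 2 / 2)) (he : e = inner ℝ v1 e1)
    (hf : f = -inner ℝ v2 e2) (hQ : Q = (‖e1‖ ^ 2 - ‖e2‖ ^ 2) / 2) (hB : B = e + f) :
    ((exp (4 * π * (-(‖e2‖ ^ 2 / 2)) * (τ.im * ω) ^ 2 / τ.im) : ℝ) : ℂ) *
      ee ((a : ℝ) * τ + (b : ℝ) * conj τ + (ρ + τ * ω) * (e : ℝ) +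
        conj (ρ + τ * ω) * (f : ℝ)) =
    ee (-(Q * (ω ^ 2 * τ + ω * ρ))) * (ee ((ρ * B + ω * ρ * Q : ℝ) : ℂ) *
      Complex.exp (π * I * (τ * (‖v1 + ω • e1‖ ^ 2 : ℝ) -
        conj τ * (‖v2 + ω • e2‖ ^ 2 : ℝ)))) := by
  have h1 : ‖v1 + ω • e1‖ ^ 2 = 2 * a + 2 * ω * e + ω ^ 2 * ‖e1‖ ^ 2 := by
    rw [norm_add_sq_real, inner_smul_right, norm_smul, mul_pow, Real.norm_eq_abs, sq_abs, ha, he]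
    ring
  have h2 : ‖v2 + ω • e2‖ ^ 2 = -2 * b - 2 * ω * f + ω ^ 2 * ‖e2‖ ^ 2 := by
    rw [norm_add_sq_real, inner_smul_right, norm_smul, mul_pow, Real.norm_eq_abs, sq_abs, hb, hf]
    ring
  have hc : conj τ = τ - 2 * τ.im * I := by
    have : τ - conj τ = 2 * τ.im * I := by
      rw [Complex.sub_conj]; push_cast; ring
    rw [← this]; ring
  have h3 : 4 * π * (-(‖e2‖ ^ 2 / 2)) * (τ.im * ω) ^ 2 / τ.im =
      -(2 * π * ‖e2‖ ^ 2 * ω ^ 2 * τ.im) := by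
    field_simp; ring
  rw [h1, h2, h3, Complex.ofReal_exp, ee, ee, ee, ← Complex.exp_add, ← Complex.exp_add,
    ← Complex.exp_add]
  congr 1
  rw [map_add, map_mul, Complex.conj_ofReal, Complex.conj_ofReal, hc, hB, hQ]
  push_cast
  ring_nf
  rw [Complex.I_sq]
  ring

theorem add_mul_im {τ : ℂ} (ρ ω : ℝ) : ((ρ : ℂ) + τ * ω).im = τ.im * ω := by simp

theorem thetaL_eq (hg : IsIsom g) {τ : ℂ} (hτ : 0 < τ.im) (ρ ω : ℝ) (σ : Disc L) :
    thetaL L η g P τ (ρ + τ * ω) σ =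
      ee (-(q η * (ω ^ 2 * τ + ω * ρ))) * thetaChar L g P τ (ρ • η) (ω • η) σ := by
  have hdiv : ((ρ : ℂ) + τ * ω).im / τ.im = ω := by rw [add_mul_im]; field_simp
  have hterm : ∀ v : QSpace bp bm,
      ((exp (4 * π * q (negPart g η) * ((ρ : ℂ) + τ * ω).im ^ 2 / τ.im) : ℝ) : ℂ) *
      (polyAt (heat τ.im P) (g (v + (((ρ : ℂ) + τ * ω).im / τ.im) • η)) *
      ee ((q (posPart g v) : ℝ) * τ + (q (negPart g v) : ℝ) * conj τ +
        (ρ + τ * ω) * (bil v (posPart g η) : ℝ) +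
        conj (ρ + τ * ω) * (bil v (negPart g η) : ℝ))) =
      ee (-(q η * (ω ^ 2 * τ + ω * ρ))) * thetaTerm g P τ (ρ • η) (ω • η) v := by
    intro v
    have h1 := theta_exponent hτ ρ ω (q (posPart g v)) (q (negPart g v)) (bil v (posPart g η))
      (bil v (negPart g η)) (q η) (bil v η) (g v).1 (g η).1 (g v).2 (g η).2
      (q_posPart hg v) (q_negPart hg v) (bil_posPart hg v η) (bil_negPart hg v η) (q_isom hg η) (by
        rw [bil_posPart hg, bil_negPart hg, ← hg v η, bil_apply]; ring)
    have h2 : (bil (v + (1 / 2 : ℝ) • ω • η) (ρ • η) : ℝ) = ρ * bil v η + ω * ρ * q η := by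
      simp [bil_self]; ring
    rw [thetaTerm, gaussPoly, hdiv, add_mul_im, q_negPart hg, h2, map_add, map_smul]
    rw [mul_left_comm, h1]
    simp only [Prod.fst_add, Prod.snd_add, Prod.smul_fst, Prod.smul_snd]
    ring
  rw [thetaL, thetaSum, thetaChar, Complex.ofReal_mul, mul_assoc, mul_left_comm (ee _)]
  congr 1
  rw [← tsum_mul_left, ← tsum_mul_left]
  exact tsum_congr fun v => hterm v

theorem thetaK_eq (H : Splitting L K u u' η) (hg : IsIsom g)
    (hlap : laplacian (subPoly g u P 0) = 0) {τ : ℂ} (hτ : 0 < τ.im) (ρ ω : ℝ) (σ : Disc L) :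
    thetaK L K u η g P τ (ρ + τ * ω) σ =
      ee (-(q η * (ω ^ 2 * τ + ω * ρ))) * (((τ.im ^ (((bm : ℝ) - 1) / 2) : ℝ) : ℂ) *
        ∑' κ : cosetK L K σ, ee ((ρ * bil (κ : QSpace bp bm) η + ω * ρ * q η : ℝ) : ℂ) *
          subGauss g u P 0 τ (κ + ω • η)) := by
  have hdiv : ((ρ : ℂ) + τ * ω).im / τ.im = ω := by rw [add_mul_im]; field_simp
  have hheat : heat τ.im (subPoly g u P 0) = subPoly g u P 0 := by
    rw [heat_eq_heatOp]
    exact heatLin_of_lap (by rw [lap_apply, hlap])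
  have hterm : ∀ v ∈ dualLat K,
      ((exp (4 * π * q (wNeg g u η) * ((ρ : ℂ) + τ * ω).im ^ 2 / τ.im) : ℝ) : ℂ) *
      (polyAt (heat τ.im (subPoly g u P 0))
        (gSub g u (v + (((ρ : ℂ) + τ * ω).im / τ.im) • η)) *
      ee ((q (wPos g u v) : ℝ) * τ + (q (wNeg g u v) : ℝ) * conj τ +
        (ρ + τ * ω) * (bil v (wPos g u η) : ℝ) +
        conj (ρ + τ * ω) * (bil v (wNeg g u η) : ℝ))) =
      ee (-(q η * (ω ^ 2 * τ + ω * ρ))) * (ee ((ρ * bil v η + ω * ρ * q η : ℝ) : ℂ) *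
        subGauss g u P 0 τ (v + ω • η)) := by
    intro v hv
    have hvu := (H.dualK_orth hv).1
    have h1 := theta_exponent hτ ρ ω (q (wPos g u v)) (q (wNeg g u v)) (bil v (wPos g u η))
      (bil v (wNeg g u η)) (q η) (bil v η) (gSub g u v).1 (gSub g u η).1 (gSub g u v).2
      (gSub g u η).2 (q_wPos hg u v) (q_wNeg hg u v) (bil_wPos hg u v η) (bil_wNeg hg u v η)
      (H.q_eq_gSub hg H.η_u) (by
        have h2 := H.q_eq_gSub hg (x := v + η) (by simp [hvu, H.η_u])
        have h3 := H.q_eq_gSub hg hvu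
        have h4 := H.q_eq_gSub hg H.η_u
        rw [q_add, gSub_add hg, Prod.fst_add, Prod.snd_add, norm_add_sq_real,
          norm_add_sq_real] at h2
        rw [bil_wPos hg, bil_wNeg hg]
        linarith)
    rw [subGauss, hdiv, hheat, add_mul_im, q_wNeg hg, gSub_add hg, gSub_smul hg]
    rw [mul_left_comm, h1]
    simp only [Prod.fst_add, Prod.snd_add, Prod.smul_fst, Prod.smul_snd]
    ring
  rw [thetaK, thetaSum, Complex.ofReal_mul, mul_assoc, mul_left_comm (ee _)]
  congr 1
  rw [← tsum_mul_left, ← tsum_mul_left]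
  exact tsum_congr fun v => hterm v v.2.1

theorem peterssonIntegrand_eq [Finite (Disc L)] {Θ : ℂ → ℂ → Disc L → ℂ} {Θ' : Disc L → ℂ} {τ : ℂ}
    (hτ : 0 < τ.im) {ρ ω : ℝ} (h : ∀ σ, Θ τ (ρ + τ * ω) σ =
      ee (-(q η * (ω ^ 2 * τ + ω * ρ))) * Θ' σ) :
    peterssonIntegrand η k φ Θ (τ, ρ + τ * ω) = ((1 / τ.im ^ 3 : ℝ) : ℂ) *
      (((τ.im ^ k : ℝ) : ℂ) * ∑ᶠ σ, phiChar η φ τ ρ ω σ * conj (Θ' σ)) := by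
  have hE : conj (ee (-(q η * (ω ^ 2 * τ + ω * ρ)))) *
      ((exp (-4 * π * q η * ((ρ : ℂ) + τ * ω).im ^ 2 / τ.im) : ℝ) : ℂ) =
      ee (q η * (ω ^ 2 * τ + ω * ρ)) := by
    have hc : conj τ = τ - 2 * τ.im * I := by
      have : τ - conj τ = 2 * τ.im * I := by
        rw [Complex.sub_conj]; push_cast; ring
      rw [← this]; ring
    have h3 : -4 * π * q η * (τ.im * ω) ^ 2 / τ.im =
        -(4 * π * q η * ω ^ 2 * τ.im) := by field_simp
    rw [conj_ee, add_mul_im, h3, ee, ee, Complex.ofReal_exp, ← Complex.exp_add]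
    congr 1
    simp only [map_neg, map_mul, map_add, map_pow, Complex.conj_ofReal, hc]
    push_cast
    ring_nf
    rw [Complex.I_sq]
    ring
  have hterm : ∀ σ, phiChar η φ τ ρ ω σ * conj (Θ' σ) =
      (exp (-4 * π * q η * ((ρ : ℂ) + τ * ω).im ^ 2 / τ.im) : ℝ) *
      (φ τ (ρ + τ * ω) σ * conj (Θ τ (ρ + τ * ω) σ)) := by
    intro σ
    rw [h, map_mul, phiChar, ← hE]
    ring
  simp only [hterm]
  rw [peterssonIntegrand, ← mul_finsum' _ _ (Set.toFinite _)]
  push_cast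
  ring

theorem exists_psi_bound [DiscreteTopology L] [IsZLattice ℝ L] (H : Splitting L K u u' η)
    (hφ : IsJacobiCuspForm L η k φ) (g : QSpace bp bm ≃ₗ[ℝ] QSpace bp bm)
    (P : MvPolynomial (Fin bp) ℂ) :
    ∃ C ε : ℝ, 0 < ε ∧ ∀ τ : ℂ, 1 / 2 < τ.im → ∀ ρ ∈ Set.Icc (0 : ℝ) 1,
      ∀ ω ∈ Set.Icc (0 : ℝ) 1, ‖psi η u k φ g P τ ρ ω 0 0‖ ≤ C * exp (-(ε * τ.im)) := by
  have := disc_finite L H.even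
  have := Fintype.ofFinite (Disc L)
  obtain ⟨C₁, ε, d₁, hC₁, hε, h1⟩ := exists_norm_phiChar_le hφ H.η_pos
  obtain ⟨C₂, d₂, hC₂, h2⟩ := norm_thetaChar_le L g P
  obtain ⟨N, hN⟩ := exists_rpow_le (k + (bm : ℝ) / 2)
  obtain ⟨M, hM, h3⟩ := one_add_pow_mul_exp_le (half_pos hε) N
  refine ⟨3 ^ N * M * ∑ _ : Disc L, C₁ * 3 ^ d₁ * (C₂ * 3 ^ d₂ * (1 + ‖η‖ ^ 2) ^ d₂), ε / 2,
    half_pos hε, fun τ hτ ρ hρ ω hω => ?_⟩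
  have hy : 0 < τ.im := by linarith
  set y := τ.im
  have hy3 : 1 + 1 / y ≤ 3 := by
    have : 1 / y ≤ 2 := by rw [div_le_iff₀ hy]; linarith
    linarith
  have hexp : (1 + y) ^ N * exp (-(ε * y)) ≤ M * exp (-(ε / 2 * y)) := by
    have := mul_le_mul_of_nonneg_right (h3 y hy.le) (Real.exp_pos (-(ε / 2 * y))).le
    refine le_trans (le_of_eq ?_) this
    rw [mul_assoc, ← Real.exp_add]
    congr 2
    ring
  have hB : ‖ω • η + (0 : ℝ) • u‖ ^ 2 ≤ ‖η‖ ^ 2 := by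
    rw [zero_smul, add_zero, norm_smul, Real.norm_eq_abs, abs_of_nonneg hω.1, mul_pow]
    exact mul_le_of_le_one_left (by positivity) (pow_le_one₀ hω.1 hω.2)
  have hsum : ‖∑ σ : Disc L, phiChar η φ τ ρ ω σ *
      conj (thetaChar L g P τ (ρ • η + (0 : ℝ) • u) (ω • η + (0 : ℝ) • u) σ)‖ ≤
      ∑ _ : Disc L, (C₁ * 3 ^ d₁ * (C₂ * 3 ^ d₂ * (1 + ‖η‖ ^ 2) ^ d₂)) *
        (y ^ ((bm : ℝ) / 2) * exp (-(ε * y))) := by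
    refine norm_sum_le_of_le _ fun σ _ => ?_
    rw [norm_mul, RCLike.norm_conj]
    calc _ ≤ (C₁ * (1 + 1 / y) ^ d₁ * exp (-(ε * y))) * (C₂ * y ^ ((bm : ℝ) / 2) *
          (1 + 1 / y) ^ d₂ * (1 + ‖ω • η + (0 : ℝ) • u‖ ^ 2) ^ d₂) :=
          mul_le_mul (h1 τ ρ ω σ hy) (h2 τ hy _ _ σ) (norm_nonneg _) (by positivity)
      _ ≤ (C₁ * 3 ^ d₁ * exp (-(ε * y))) * (C₂ * y ^ ((bm : ℝ) / 2) *
          3 ^ d₂ * (1 + ‖η‖ ^ 2) ^ d₂) := by gcongr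
      _ = _ := by ring
  rw [← Finset.sum_mul] at hsum
  set S := ∑ _ : Disc L, C₁ * 3 ^ d₁ * (C₂ * 3 ^ d₂ * (1 + ‖η‖ ^ 2) ^ d₂)
  have hS : 0 ≤ S := Finset.sum_nonneg fun _ _ => by positivity
  rw [psi, finsum_eq_sum_of_fintype, norm_mul, Complex.norm_real, Real.norm_eq_abs,
    abs_of_pos (by positivity)]
  calc _ ≤ y ^ k * (S * (y ^ ((bm : ℝ) / 2) * exp (-(ε * y)))) := by gcongr
    _ = S * (y ^ (k + (bm : ℝ) / 2) * exp (-(ε * y))) := by rw [Real.rpow_add hy]; ring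
    _ ≤ S * (((1 + y) * 3) ^ N * exp (-(ε * y))) := by
      refine mul_le_mul_of_nonneg_left (mul_le_mul_of_nonneg_right ((hN y hy).trans ?_)
        (Real.exp_pos _).le) hS
      gcongr
    _ = S * 3 ^ N * ((1 + y) ^ N * exp (-(ε * y))) := by rw [mul_pow]; ring
    _ ≤ S * 3 ^ N * (M * exp (-(ε / 2 * y))) :=
      mul_le_mul_of_nonneg_left hexp (by positivity)
    _ = _ := by ring

theorem petersson_thetaL [DiscreteTopology L] [IsZLattice ℝ L] (H : Splitting L K u u' η)
    (hg : IsIsom g) (hφ : IsJacobiCuspForm L η k φ) (P : MvPolynomial (Fin bp) ℂ) :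
    IntegrableOn (peterssonIntegrand η k φ (thetaL L η g P)) jacDomain ∧
    IntegrableOn (fun τ => avgPsi η u k φ g P τ 0 0) ModularGroup.fd ∧
    petersson η k φ (thetaL L η g P) = ∫ τ in ModularGroup.fd, avgPsi η u k φ g P τ 0 0 := by
  have := disc_finite L H.even
  obtain ⟨C, ε, hε, hb⟩ := exists_psi_bound H hφ g P
  refine integral_jacDomain (G := fun τ ρ ω => psi η u k φ g P τ ρ ω 0 0) ?_ ?_ hε hb
  · exact (continuous_psi H.even hφ.toIsJacobiForm).comp (f := fun p : ℍ × ℝ × ℝ =>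
      (p.1, p.2, (0 : ℝ), (0 : ℝ))) (by fun_prop)
  · intro τ hτ ρ ω
    rw [peterssonIntegrand_eq hτ (fun σ => thetaL_eq hg hτ ρ ω σ), psi]
    simp

/-- The integrand of the zeroth Fourier coefficient of the averaged pairing. -/
def zeroTerm (η u : QSpace bp bm) (k : ℝ) (φ : ℂ → ℂ → Disc L → ℂ)
    (g : QSpace bp bm ≃ₗ[ℝ] QSpace bp bm) (P : MvPolynomial (Fin bp) ℂ) (τ : ℂ)
    (ρ ω : ℝ) : ℂ :=
  ((τ.im ^ k : ℝ) : ℂ) * ∑ᶠ σ, phiChar η φ τ ρ ω σ *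
    conj (squareIntegral fun α β =>
      thetaChar L g P τ (ρ • η + α • u) (ω • η + β • u) σ * ee (((0 : ℤ) * β : ℝ) : ℂ))

theorem continuous_zeroTerm [DiscreteTopology L] [IsZLattice ℝ L] (hL : IsEven L)
    (hφ : IsJacobiForm L η k φ) :
    Continuous fun p : ℍ × ℝ × ℝ => zeroTerm η u k φ g P p.1 p.2.1 p.2.2 := by
  have := disc_finite L hL
  have := Fintype.ofFinite (Disc L)
  simp only [zeroTerm, finsum_eq_sum_of_fintype]
  refine Continuous.mul (Complex.continuous_ofReal.comp ?_) (continuous_finsetSum _ fun σ _ =>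
    (continuous_phiChar hφ σ).mul (Complex.continuous_conj.comp ?_))
  · refine Continuous.rpow_const ?_ fun p => Or.inl p.1.im_pos.ne'
    exact Complex.continuous_im.comp (UpperHalfPlane.continuous_coe.comp continuous_fst)
  · refine continuous_squareIntegral (X := ℍ × ℝ × ℝ) (f := fun p α β =>
      thetaChar L g P p.1 (p.2.1 • η + α • u) (p.2.2 • η + β • u) σ *
        ee (((0 : ℤ) * β : ℝ) : ℂ)) ?_
    refine Continuous.mul ?_ (continuous_ee.comp (by fun_prop))
    exact (continuous_thetaChar g P η u σ).comp
      (f := fun p : (ℍ × ℝ × ℝ) × ℝ × ℝ => (p.1.1, p.1.2, p.2)) (by fun_prop)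

theorem exists_zeroTerm_bound [DiscreteTopology L] [IsZLattice ℝ L] (H : Splitting L K u u' η)
    (hg : IsIsom g) (hP : P.IsHomogeneous m) (hlap : ∀ h, laplacian (subPoly g u P h) = 0)
    (hφ : IsJacobiCuspForm L η k φ) :
    ∃ C ε : ℝ, 0 < ε ∧ ∀ τ : ℂ, 1 / 2 < τ.im → ∀ ρ ∈ Set.Icc (0 : ℝ) 1,
      ∀ ω ∈ Set.Icc (0 : ℝ) 1, ‖zeroTerm η u k φ g P τ ρ ω‖ ≤ C * exp (-(ε * τ.im)) := by
  obtain ⟨C, ε, d, hC, hε, hb⟩ := norm_kTerm_le H hg hφ P m (Module.finrank ℤ (dualLat L) + 1)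
  set W := ∑' κ : dualLat K, wt (Module.finrank ℤ (dualLat L) + 1) (κ : QSpace bp bm)
  refine ⟨C * 3 ^ d * W, ε, hε, fun τ hτ ρ hρ ω hω => ?_⟩
  have hy : 0 < τ.im := by linarith
  have hy3 : 1 + 1 / τ.im ≤ 3 := by
    have : 1 / τ.im ≤ 2 := by rw [div_le_iff₀ hy]; linarith
    linarith
  have h1 := hasSum_kTerm (φ := φ) (k := k) H hg hP hlap hy ρ ω 0
  have h2 : ∀ κ : dualLat K, ‖kTerm η u k φ g P m 0 κ τ ρ ω‖ ≤
      wt (Module.finrank ℤ (dualLat L) + 1) (κ : QSpace bp bm) *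
        (C * 3 ^ d * exp (-(ε * τ.im))) := fun κ => by
    have hw := wt_pos (Module.finrank ℤ (dualLat L) + 1) (κ : QSpace bp bm)
    have h3 := hb τ hy κ κ.2 ρ ω hω 0
    simp only [Int.cast_zero, abs_zero, add_zero, one_pow, mul_one, ne_eq, OfNat.ofNat_ne_zero,
      not_false_eq_true, zero_pow, mul_zero, zero_div, neg_zero, Real.exp_zero] at h3
    calc _ ≤ _ := h3
      _ ≤ C * 3 ^ d * wt (Module.finrank ℤ (dualLat L) + 1) (κ : QSpace bp bm) *
        exp (-(ε * τ.im)) := by gcongr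
      _ = _ := by ring
  rw [zeroTerm, ← h1.tsum_eq]
  refine (tsum_of_norm_bounded (H.summable_wt_dualK.mul_right _).hasSum h2).trans (le_of_eq ?_)
  rw [tsum_mul_right]
  ring

theorem petersson_thetaK [DiscreteTopology L] [IsZLattice ℝ L] (H : Splitting L K u u' η)
    (hg : IsIsom g) (hP : P.IsHomogeneous m) (hlap : ∀ h, laplacian (subPoly g u P h) = 0)
    (hφ : IsJacobiCuspForm L η k φ) :
    IntegrableOn (peterssonIntegrand η k φ (thetaK L K u η g P)) jacDomain ∧
    IntegrableOn (torusCoeff (avgPsi η u k φ g P) 0) ModularGroup.fd ∧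
    ∫ τ in ModularGroup.fd, torusCoeff (avgPsi η u k φ g P) 0 τ =
      1 / ((sqrt 2 * sqrt (bil (posPart g u) (posPart g u)) : ℝ) : ℂ) *
        petersson η k φ (thetaK L K u η g P) := by
  have := disc_finite L H.even
  have hu := H.norm_pos hg
  set s := sqrt 2 * sqrt (bil (posPart g u) (posPart g u)) with hs
  have hs' : s = sqrt 2 * ‖(g u).1‖ := by
    rw [hs, bil_posPart_self hg, Real.sqrt_sq hu.le]
  have hs0 : 0 < s := by rw [hs']; positivity
  have hsc : (s : ℂ) ≠ 0 := by exact_mod_cast hs0.ne'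
  obtain ⟨C, ε, hε, hb⟩ := exists_zeroTerm_bound H hg hP hlap hφ
  have hcoeff : torusCoeff (avgPsi η u k φ g P) 0 =
      fun τ : ℍ => squareIntegral (zeroTerm η u k φ g P τ) := by
    funext τ
    have h1 := torusCoeff_avgPsi (P := P) (g := g) H hφ.toIsJacobiForm 0 τ
    have h2 : ![(0 : ℤ), -0] = 0 := by simp
    rw [h2] at h1
    exact h1
  have hΘ : ∀ τ : ℂ, 0 < τ.im → ∀ ρ ω : ℝ, ∀ σ : Disc L,
      (((τ.im ^ (((bm : ℝ) - 1) / 2) : ℝ) : ℂ) *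
        ∑' κ : cosetK L K σ, ee ((ρ * bil (κ : QSpace bp bm) η + ω * ρ * q η : ℝ) : ℂ) *
          subGauss g u P 0 τ (κ + ω • η)) = s * squareIntegral fun α β =>
      thetaChar L g P τ (ρ • η + α • u) (ω • η + β • u) σ * ee (((0 : ℤ) * β : ℝ) : ℂ) := by
    intro τ hτ ρ ω σ
    rw [← (hasSum_squareIntegral_thetaChar H hg hP hlap hτ ρ ω 0 σ).tsum_eq, ← tsum_mul_left,
      ← tsum_mul_left]
    refine tsum_congr fun κ => ?_
    have h1 : lineTerm g u P m ((0 : ℤ) : ℝ) τ (κ + ω • η) =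
        ((1 / sqrt (2 * τ.im * ‖(g u).1‖ ^ 2) : ℝ) : ℂ) *
          subGauss g u P 0 τ (κ + ω • η) := by
      rw [lineTerm, Finset.sum_eq_single 0]
      · simp [ee_zero]
      · intro h _ hh
        simp [hh]
      · simp
    have h2 : τ.im ^ (((bm : ℝ) - 1) / 2) = s * τ.im ^ ((bm : ℝ) / 2) *
        (1 / sqrt (2 * τ.im * ‖(g u).1‖ ^ 2)) := by
      rw [show 2 * τ.im * ‖(g u).1‖ ^ 2 = 2 * ‖(g u).1‖ ^ 2 * τ.im by ring,
        Real.sqrt_mul (by positivity), Real.sqrt_mul (by positivity), Real.sqrt_sq hu.le, ← hs',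
        sub_div, Real.rpow_sub hτ, ← Real.sqrt_eq_rpow]
      field_simp
    rw [h1, h2]
    push_cast
    ring
  have h := integral_jacDomain (F := peterssonIntegrand η k φ (thetaK L K u η g P))
    (G := fun τ ρ ω => s * zeroTerm η u k φ g P τ ρ ω) (C := s * C)
    (continuous_const.mul (continuous_zeroTerm H.even hφ.toIsJacobiForm)) (fun τ hτ ρ ω => by
      rw [peterssonIntegrand_eq hτ (fun σ => thetaK_eq H hg (hlap 0) hτ ρ ω σ), zeroTerm]
      congr 1
      rw [mul_left_comm]
      congr 1
      rw [mul_finsum' _ _ (Set.toFinite _)]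
      refine finsum_congr fun σ => ?_
      rw [hΘ τ hτ ρ ω σ, map_mul, Complex.conj_ofReal, mul_left_comm]) hε
    (fun τ hτ ρ hρ ω hω => by
      rw [norm_mul, Complex.norm_real, Real.norm_eq_abs, abs_of_pos hs0, mul_assoc s C]
      exact mul_le_mul_of_nonneg_left (hb τ hτ ρ hρ ω hω) hs0.le)
  have hsq : ∀ τ : ℂ, squareIntegral (fun ρ ω => s * zeroTerm η u k φ g P τ ρ ω) =
      s * squareIntegral (zeroTerm η u k φ g P τ) := fun τ => by
    simp only [squareIntegral, intervalIntegral.integral_const_mul]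
  simp only [hsq, integral_const_mul] at h
  obtain ⟨h1, h2, h3⟩ := h
  refine ⟨h1, ?_, ?_⟩
  · rw [hcoeff]
    have := h2.const_mul (s : ℂ)⁻¹
    refine this.congr (.of_forall fun τ => ?_)
    simp only [inv_mul_cancel_left₀ hsc]
  · rw [hcoeff, petersson, h3]
    field_simp

/-! ### The Gaussian integral along `η` and the Bessel integrals -/

theorem integrableOn_rpow_mul_exp (a : ℝ) {A B : ℝ} (hA : 0 < A) (hB : 0 < B) :
    IntegrableOn (fun y : ℝ => y ^ a * exp (-(A / y) - B * y)) (Set.Ioi 0) := by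
  obtain ⟨N, hN⟩ := exists_rpow_le a
  obtain ⟨M, hM, h1⟩ := one_add_pow_mul_exp_le hA N
  obtain ⟨M', hM', h2⟩ := one_add_pow_mul_exp_le (half_pos hB) N
  have h3 : IntegrableOn (fun y : ℝ => M * M' * exp (-(B / 2) * y)) (Set.Ioi 0) :=
    (exp_neg_integrableOn_Ioi 0 (half_pos hB)).const_mul _
  refine Integrable.mono' h3 (ContinuousOn.aestronglyMeasurable ?_ measurableSet_Ioi) ?_
  · refine ContinuousOn.mul (continuousOn_id.rpow_const fun y hy => Or.inl (ne_of_gt hy)) ?_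
    refine Real.continuous_exp.comp_continuousOn (ContinuousOn.sub (ContinuousOn.neg ?_)
      (by fun_prop))
    exact continuousOn_const.div continuousOn_id fun y hy => ne_of_gt hy
  · refine (ae_restrict_iff' measurableSet_Ioi).2 (.of_forall fun y hy => ?_)
    have hy : 0 < y := hy
    rw [norm_mul, Real.norm_eq_abs, Real.norm_eq_abs, Real.abs_exp, abs_of_pos (by positivity)]
    have e1 : exp (-(A / y) - B * y) = exp (-(A * (1 / y))) *
        (exp (-(B / 2 * y)) * exp (-(B / 2) * y)) := by
      rw [← Real.exp_add, ← Real.exp_add]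
      congr 1
      ring
    calc _ ≤ ((1 + y) * (1 + 1 / y)) ^ N * exp (-(A / y) - B * y) :=
          mul_le_mul_of_nonneg_right (hN y hy) (Real.exp_pos _).le
      _ = ((1 + 1 / y) ^ N * exp (-(A * (1 / y)))) *
          ((1 + y) ^ N * exp (-(B / 2 * y))) * exp (-(B / 2) * y) := by
        rw [e1, mul_pow]; ring
      _ ≤ M * M' * exp (-(B / 2) * y) := by
        refine mul_le_mul_of_nonneg_right ?_ (Real.exp_pos _).le
        exact mul_le_mul (h1 _ (by positivity)) (h2 _ hy.le) (by positivity) hM.le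

theorem Splitting.gSub_η_pos (H : Splitting L K u u' η) (hg : IsIsom g) :
    0 < ‖(gSub g u η).1‖ ^ 2 := by
  have h := H.q_eq_gSub hg H.η_u
  nlinarith [H.η_pos, sq_nonneg ‖(gSub g u η).2‖]

theorem Splitting.norm_gSub_η_pos (H : Splitting L K u u' η) (hg : IsIsom g) :
    0 < ‖(gSub g u η).1‖ :=
  lt_of_le_of_ne (norm_nonneg _) fun h => (H.gSub_η_pos hg).ne' (by rw [← h]; simp)

theorem norm_gSub_add_smul (hg : IsIsom g) (x : QSpace bp bm) (ω : ℝ) :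
    ‖(gSub g u (x + ω • η)).1‖ ^ 2 = ‖(gSub g u x).1‖ ^ 2 +
      2 * ω * inner ℝ (gSub g u x).1 (gSub g u η).1 + ω ^ 2 * ‖(gSub g u η).1‖ ^ 2 := by
  rw [gSub_add hg, gSub_smul hg, Prod.fst_add, Prod.smul_fst, norm_add_sq_real, inner_smul_right,
    norm_smul, mul_pow, Real.norm_eq_abs, sq_abs]
  ring

theorem Splitting.gSub_gap_pos (H : Splitting L K u u' η) (hg : IsIsom g) {x : QSpace bp bm}
    (hxu : bil x u = 0) (hxη : bil x η = 0) (hq : 0 < q x) :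
    0 < ‖(gSub g u x).1‖ ^ 2 -
      inner ℝ (gSub g u x).1 (gSub g u η).1 ^ 2 / ‖(gSub g u η).1‖ ^ 2 := by
  have hE := H.gSub_η_pos hg
  set E := ‖(gSub g u η).1‖ ^ 2
  set F := inner ℝ (gSub g u x).1 (gSub g u η).1 with hF
  have h1 := H.q_eq_gSub hg (x := x + (-(F / E)) • η) (by simp [hxu, H.η_u])
  have h2 := norm_gSub_add_smul (u := u) (η := η) hg x (-(F / E))
  rw [q_add, q_smul, bil_comm x, bil_smul_left, bil_comm η, hxη, mul_zero, add_zero, h2,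
    ← hF] at h1
  have h3 : 0 < (-(F / E)) ^ 2 * q η + q x := by
    have := H.η_pos
    positivity
  have h4 : 2 * -(F / E) * F + (-(F / E)) ^ 2 * E = -(F ^ 2 / E) := by field_simp; ring
  nlinarith [sq_nonneg ‖(gSub g u (x + (-(F / E)) • η)).2‖]

/-- The factor of `kFactor` which does not depend on `ω`. -/
def kAmplitude (u : QSpace bp bm) (k : ℝ) (g : QSpace bp bm ≃ₗ[ℝ] QSpace bp bm)
    (P : MvPolynomial (Fin bp) ℂ) (m : ℕ) (n : ℤ) (x : QSpace bp bm) (y : ℝ) : ℂ :=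
  ((y ^ k * y ^ ((bm : ℝ) / 2) * (1 / sqrt (2 * y * ‖(g u).1‖ ^ 2) *
    exp (-(π * n ^ 2 / (2 * y * ‖(g u).1‖ ^ 2)))) : ℝ) : ℂ) *
    ∑ h ∈ Finset.range (m + 1), (-(n * I) / (2 * y)) ^ h *
      conj (polyAt (subPoly g u P h) (gSub g u x))

theorem kFactor_eq (hg : IsIsom g) (n : ℤ) {x : QSpace bp bm}
    (hpol : ∀ h (ω : ℝ), polyAt (subPoly g u P h) (gSub g u (x + ω • η)) =
      polyAt (subPoly g u P h) (gSub g u x)) (y ω : ℝ) :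
    kFactor η u k g P m n x y ω = kAmplitude u k g P m n x y *
      Complex.exp (((-(2 * π * y * ‖(gSub g u η).1‖ ^ 2) : ℝ) : ℂ) * ω ^ 2 +
        (2 * π * I * (n * bil η (posPart g u) / ‖(g u).1‖ ^ 2 : ℝ) -
          (4 * π * y * inner ℝ (gSub g u x).1 (gSub g u η).1 : ℝ)) * ω +
        (2 * π * I * (n * bil x (posPart g u) / ‖(g u).1‖ ^ 2 : ℝ) -
          (2 * π * y * ‖(gSub g u x).1‖ ^ 2 : ℝ))) := by
  rw [kFactor, norm_gSub_add_smul hg]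
  simp only [hpol]
  have h1 : ee ((n * (bil (x + ω • η) (posPart g u) / ‖(g u).1‖ ^ 2) : ℝ) : ℂ) *
      ((exp (-(2 * π * y * (‖(gSub g u x).1‖ ^ 2 +
      2 * ω * inner ℝ (gSub g u x).1 (gSub g u η).1 + ω ^ 2 * ‖(gSub g u η).1‖ ^ 2))) : ℝ) : ℂ) =
      Complex.exp (((-(2 * π * y * ‖(gSub g u η).1‖ ^ 2) : ℝ) : ℂ) * ω ^ 2 +
        (2 * π * I * (n * bil η (posPart g u) / ‖(g u).1‖ ^ 2 : ℝ) -
          (4 * π * y * inner ℝ (gSub g u x).1 (gSub g u η).1 : ℝ)) * ω +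
        (2 * π * I * (n * bil x (posPart g u) / ‖(g u).1‖ ^ 2 : ℝ) -
          (2 * π * y * ‖(gSub g u x).1‖ ^ 2 : ℝ))) := by
    rw [ee, Complex.ofReal_exp, ← Complex.exp_add, map_add, map_smul]
    congr 1
    simp only [LinearMap.add_apply, LinearMap.smul_apply, smul_eq_mul]
    push_cast
    ring
  rw [← h1, kAmplitude]
  push_cast
  ring

theorem norm_kFactor (hg : IsIsom g) (n : ℤ) {x : QSpace bp bm}
    (hpol : ∀ h (ω : ℝ), polyAt (subPoly g u P h) (gSub g u (x + ω • η)) =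
      polyAt (subPoly g u P h) (gSub g u x)) (y ω : ℝ) :
    ‖kFactor η u k g P m n x y ω‖ = ‖kAmplitude u k g P m n x y‖ *
      exp (-(2 * π * y * ‖(gSub g u (x + ω • η)).1‖ ^ 2)) := by
  rw [kFactor_eq hg n hpol, norm_mul, Complex.norm_exp, norm_gSub_add_smul hg]
  congr 2
  simp [← Complex.ofReal_pow]
  ring

theorem besselIntegrand_eq (hg : IsIsom g) (x : QSpace bp bm) (h : ℕ) {n : ℕ} (hn : n ≠ 0)
    {y : ℝ} (hy : y ≠ 0) :
    besselIntegrand g u η ((n : ℝ) • x) k h n y = y ^ ((bm : ℝ) / 2 + k - h - 3) *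
      exp (-((π * n ^ 2 / (2 * ‖(g u).1‖ ^ 2) +
        π * n ^ 2 * bil η (posPart g u) ^ 2 /
          (2 * ‖(gSub g u η).1‖ ^ 2 * (‖(g u).1‖ ^ 2) ^ 2)) / y) -
        2 * π * (‖(gSub g u x).1‖ ^ 2 -
          inner ℝ (gSub g u x).1 (gSub g u η).1 ^ 2 / ‖(gSub g u η).1‖ ^ 2) * y) := by
  have hn' : (n : ℝ) ≠ 0 := by exact_mod_cast hn
  rw [besselIntegrand, bil_posPart_self hg, q_wPos hg, q_wPos hg, bil_wPos hg, gSub_smul hg,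
    Prod.smul_fst, norm_smul, inner_smul_left, mul_pow, Real.norm_eq_abs, sq_abs]
  congr 2
  simp only [conj_trivial]
  field_simp
  ring

theorem integrableOn_besselIntegrand (H : Splitting L K u u' η) (hg : IsIsom g)
    {x : QSpace bp bm} (hxu : bil x u = 0) (hxη : bil x η = 0) (hq : 0 < q x) (h : ℕ) {n : ℕ}
    (hn : n ≠ 0) : IntegrableOn (besselIntegrand g u η ((n : ℝ) • x) k h n) (Set.Ioi 0) := by
  have hu := H.norm_pos hg
  have hE := H.gSub_η_pos hg
  have hn' : (0 : ℝ) < n := by exact_mod_cast Nat.pos_of_ne_zero hn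
  have hgap := H.gSub_gap_pos hg hxu hxη hq
  refine (integrableOn_rpow_mul_exp ((bm : ℝ) / 2 + k - h - 3)
    (A := π * n ^ 2 / (2 * ‖(g u).1‖ ^ 2) + π * n ^ 2 * bil η (posPart g u) ^ 2 /
          (2 * ‖(gSub g u η).1‖ ^ 2 * (‖(g u).1‖ ^ 2) ^ 2)) (by positivity)
    (B := 2 * π * (‖(gSub g u x).1‖ ^ 2 -
          inner ℝ (gSub g u x).1 (gSub g u η).1 ^ 2 / ‖(gSub g u η).1‖ ^ 2))
    (by positivity)).congr_fun (fun y hy => ?_) measurableSet_Ioi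
  rw [besselIntegrand_eq hg x h hn (ne_of_gt hy)]

theorem rpow_amplitude {a b y : ℝ} (ha : 0 < a) (hb : 0 < b) (hy : 0 < y) (k l : ℝ) (h : ℕ) :
    1 / y ^ 2 * (y ^ k * y ^ l * (1 / sqrt (2 * y * a ^ 2)) *
      (1 / sqrt (2 * y * b ^ 2))) * (1 / y ^ h) =
      1 / (2 * a * b) * y ^ (l + k - h - 3) := by
  have h1 : y ^ (l + k - h - 3) = y ^ k * y ^ l / y ^ h / y ^ 3 := by
    rw [Real.rpow_sub hy, Real.rpow_sub hy, Real.rpow_add hy, Real.rpow_natCast,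
      ← Real.rpow_natCast y 3]
    push_cast
    ring
  have h2 : 1 / sqrt (2 * y * a ^ 2) * (1 / sqrt (2 * y * b ^ 2)) =
      1 / (2 * y * a * b) := by
    rw [Real.sqrt_mul (show 0 ≤ 2 * y by positivity) (a ^ 2),
      Real.sqrt_mul (show 0 ≤ 2 * y by positivity) (b ^ 2), Real.sqrt_sq ha.le, Real.sqrt_sq hb.le]
    have := Real.mul_self_sqrt (show 0 ≤ 2 * y by positivity)
    field_simp
    rw [sq, this]
  rw [mul_assoc (y ^ k * _), h2, h1]
  field_simp

/-- The integral of `kFactor` along the line in the direction of `η`. -/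
theorem integral_kFactor (H : Splitting L K u u' η) (hg : IsIsom g)
    {x : QSpace bp bm} (hpol : ∀ h (ω : ℝ), polyAt (subPoly g u P h) (gSub g u (x + ω • η)) =
      polyAt (subPoly g u P h) (gSub g u x)) {n : ℕ} (hn : n ≠ 0) {y : ℝ} (hy : 0 < y) :
    ((1 / y ^ 2 : ℝ) : ℂ) * ∫ ω : ℝ, kFactor η u k g P m n x y ω =
      ((1 / (2 * ‖(g u).1‖ * ‖(gSub g u η).1‖) : ℝ) : ℂ) *
      ee ((bil ((n : ℝ) • x) (posPart g u) / ‖(g u).1‖ ^ 2 : ℝ) : ℂ) *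
      ee (-(bil η (posPart g u) * bil ((n : ℝ) • x) (wPos g u η) /
        (2 * bil (posPart g u) (posPart g u) * q (wPos g u η)) : ℝ)) *
      ∑ h ∈ Finset.range (m + 1), (-(n * I) / 2) ^ h *
        conj (polyAt (subPoly g u P h) (gSub g u x)) *
        (besselIntegrand g u η ((n : ℝ) • x) k h n y : ℝ) := by
  have hu := H.norm_pos hg
  have hE := H.gSub_η_pos hg
  have hE' := H.norm_gSub_η_pos hg
  simp only [kFactor_eq hg n hpol, integral_const_mul]
  rw [integral_cexp_quadratic (by
    rw [Complex.ofReal_re, neg_lt_zero]; positivity)]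
  simp only [besselIntegrand_eq hg x _ hn hy.ne']
  set N := ‖(g u).1‖ ^ 2 with hN
  set s := bil η (posPart g u)
  set F := inner ℝ (gSub g u x).1 (gSub g u η).1 with hF
  set G := ‖(gSub g u x).1‖ ^ 2
  set E := ‖(gSub g u η).1‖ ^ 2 with hEdef
  have hN0 : 0 < N := pow_pos hu 2
  set A := π * n ^ 2 / (2 * N) + π * n ^ 2 * s ^ 2 / (2 * E * N ^ 2) with hA
  have hsqrt : ((π : ℂ) / -((-(2 * π * y * E) : ℝ) : ℂ)) ^ (1 / 2 : ℂ) =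
      ((1 / sqrt (2 * y * E) : ℝ) : ℂ) := by
    have h1 : (π : ℂ) / -((-(2 * π * y * E) : ℝ) : ℂ) =
        ((1 / (2 * y * E) : ℝ) : ℂ) := by
      have := Real.pi_ne_zero
      push_cast
      field_simp
    have h2 : (1 / 2 : ℂ) = ((1 / 2 : ℝ) : ℂ) := by push_cast; rfl
    rw [h1, h2, ← Complex.ofReal_cpow (by positivity), ← Real.sqrt_eq_rpow, one_div,
      Real.sqrt_inv, one_div]
  have hexp : ((exp (-(π * n ^ 2 / (2 * y * N))) : ℝ) : ℂ) *
      Complex.exp (2 * π * I * (n * bil x (posPart g u) / N : ℝ) -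
          (2 * π * y * G : ℝ) -
        (2 * π * I * (n * s / N : ℝ) - (4 * π * y * F : ℝ)) ^ 2 /
          (4 * ((-(2 * π * y * E) : ℝ) : ℂ))) =
      ee ((bil ((n : ℝ) • x) (posPart g u) / N : ℝ) : ℂ) *
      ee (-(s * bil ((n : ℝ) • x) (wPos g u η) /
        (2 * bil (posPart g u) (posPart g u) * q (wPos g u η)) : ℝ)) *
      ((exp (-(A / y) - 2 * π * (G - F ^ 2 / E) * y) : ℝ) : ℂ) := by
    rw [bil_smul_left, bil_smul_left, bil_posPart_self hg, q_wPos hg, bil_wPos hg, ← hF, ← hN,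
      ← hEdef, ee, ee, Complex.ofReal_exp, Complex.ofReal_exp, ← Complex.exp_add,
      ← Complex.exp_add, ← Complex.exp_add, hA]
    congr 1
    have hyc : (y : ℂ) ≠ 0 := by exact_mod_cast hy.ne'
    have hNc : (N : ℂ) ≠ 0 := by exact_mod_cast hN0.ne'
    have hEc : (E : ℂ) ≠ 0 := by exact_mod_cast hE.ne'
    have hpc : (π : ℂ) ≠ 0 := by exact_mod_cast Real.pi_ne_zero
    push_cast
    field_simp
    ring_nf
    rw [Complex.I_sq]
    ring
  have hpow : ∀ h : ℕ, ((1 / y ^ 2 * (y ^ k * y ^ ((bm : ℝ) / 2) * (1 / sqrt (2 * y * N)) *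
      (1 / sqrt (2 * y * E))) : ℝ) : ℂ) * (-((n : ℝ) * I) / (2 * y)) ^ h =
      ((1 / (2 * ‖(g u).1‖ * ‖(gSub g u η).1‖) : ℝ) : ℂ) * (-(n * I) / 2) ^ h *
        ((y ^ ((bm : ℝ) / 2 + k - h - 3) : ℝ) : ℂ) := by
    intro h
    have h1 : (-((n : ℝ) * I) / (2 * y)) ^ h = (-(n * I) / 2) ^ h * ((1 / y ^ h : ℝ) : ℂ) := by
      push_cast
      rw [mul_one_div, ← div_pow]
      congr 1
      field_simp
    rw [h1, mul_left_comm, ← Complex.ofReal_mul, hN, hEdef, rpow_amplitude hu hE' hy]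
    push_cast
    ring
  rw [hsqrt, kAmplitude, ← hN]
  simp only [Int.cast_natCast]
  calc _ = ∑ h ∈ Finset.range (m + 1), (((1 / y ^ 2 * (y ^ k * y ^ ((bm : ℝ) / 2) *
        (1 / sqrt (2 * y * N)) * (1 / sqrt (2 * y * E))) : ℝ) : ℂ) *
        (-((n : ℝ) * I) / (2 * y)) ^ h) *
        conj (polyAt (subPoly g u P h) (gSub g u x)) *
        (((exp (-(π * n ^ 2 / (2 * y * N))) : ℝ) : ℂ) *
      Complex.exp (2 * π * I * (n * bil x (posPart g u) / N : ℝ) -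
          (2 * π * y * G : ℝ) -
        (2 * π * I * (n * s / N : ℝ) - (4 * π * y * F : ℝ)) ^ 2 /
          (4 * ((-(2 * π * y * E) : ℝ) : ℂ)))) := by
        simp only [Finset.mul_sum, Finset.sum_mul]
        refine Finset.sum_congr rfl fun h _ => ?_
        push_cast
        ring
    _ = _ := by
        simp only [hpow, hexp, Finset.mul_sum]
        refine Finset.sum_congr rfl fun h _ => ?_
        push_cast
        ring

/-! ### Unfolding along `η` -/

theorem jacCoeff_heis (hφ : IsJacobiForm L η k φ) (σ : Disc L) {r s : ℝ}
    (hr : ∃ n : ℤ, r = q (rep σ) + n) (hs : ∃ n : ℤ, s = bil (rep σ) η + n) :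
    jacCoeff φ (σ + cls L η) (r + s + q η) (s + 2 * q η) = jacCoeff φ σ r s := by
  rw [← coeffAt_eq hφ σ hr hs one_pos 1, coeffAt, jacCoeff]
  congr 1
  funext x
  have him : 0 < ((x : ℂ) + (1 : ℝ) * I).im := by simp
  set F : ℝ → ℂ := fun ξ => φ (x + (1 : ℝ) * I) (ξ + (1 : ℝ) * I) σ *
    ee (-((r : ℝ) * (x + (1 : ℝ) * I) + (s : ℝ) * (ξ + (1 : ℝ) * I))) with hF
  have hper : Function.Periodic F 1 := by
    intro ξ
    have h1 : (((ξ + 1 : ℝ) : ℂ) + (1 : ℝ) * I) =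
        (ξ + (1 : ℝ) * I) + 1 := by push_cast; ring
    have h2 := ee_mul_add_one hs (ξ + (1 : ℝ) * I) ((r : ℝ) * (x + (1 : ℝ) * I))
    simp only [hF]
    rw [h1, phi_add_one_right hφ him, add_comm ((r : ℝ) * _ : ℂ), mul_right_comm,
      h2, add_comm (((s : ℝ) : ℂ) * _)]
    ring
  have h3 : ∫ ρ in (0 : ℝ)..1, F (ρ + x) = ∫ ρ in (0 : ℝ)..1, F ρ := by
    rw [intervalIntegral.integral_comp_add_right]
    have := hper.intervalIntegral_add_eq x 0
    rw [zero_add] at this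
    rw [zero_add, add_comm 1, this]
  rw [← h3]
  congr 1
  funext ξ
  have h4 : (((ξ + x : ℝ) : ℂ) + (1 : ℝ) * I) =
      ξ + ((0 : ℤ) : ℂ) + ((1 : ℤ) : ℂ) * ((x : ℂ) + (1 : ℝ) * I) := by push_cast; ring
  have h5 := congrFun (hφ.heis 0 1 0 (x + (1 : ℝ) * I) ξ him) σ
  simp only [hF]
  rw [h4, h5, Pi.smul_apply, weilH, smul_eq_mul, one_zsmul]
  simp only [Complex.ofReal_one, one_mul, Int.cast_zero, Int.cast_one, zero_mul, mul_one, sub_zero,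
    add_zero, ee_zero]
  rw [mul_right_comm, ← ee_add, mul_comm]
  congr 2
  push_cast
  ring

theorem Splitting.jacCoeff_add_zsmul [DiscreteTopology L] [IsZLattice ℝ L]
    (H : Splitting L K u u' η) (hφ : IsJacobiForm L η k φ) {κ : QSpace bp bm}
    (hκ : κ ∈ dualLat K) (j : ℤ) :
    jacCoeff φ (cls L (κ + j • etaK u u' η)) (q (κ + j • etaK u u' η))
      (bil (κ + j • etaK u u' η) η) = jacCoeff φ (cls L κ) (q κ) (bil κ η) := by
  have hηK : cls L (etaK u u' η) = cls L η := by
    rw [cls_eq_iff (H.mem_dualLat_of_mem_dualK H.etaK_mem) H.η_mem, ← neg_sub]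
    exact neg_mem H.η_sub_etaK_mem
  have hstep : ∀ κ ∈ dualLat K, jacCoeff φ (cls L (κ + etaK u u' η)) (q (κ + etaK u u' η))
      (bil (κ + etaK u u' η) η) = jacCoeff φ (cls L κ) (q κ) (bil κ η) := by
    intro κ hκ
    obtain ⟨hr, hs⟩ := H.exists_int_q_rep hκ
    rw [← jacCoeff_heis hφ (cls L κ) hr hs, cls_add (H.mem_dualLat_of_mem_dualK hκ)
      (H.mem_dualLat_of_mem_dualK H.etaK_mem), hηK, q_add, H.q_etaK,
      H.bil_etaK (H.dualK_orth hκ).1, map_add, LinearMap.add_apply, H.etaK_η, bil_self η]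
    congr 1
    ring
  induction j using Int.induction_on with
  | zero => simp
  | succ i ih =>
    rw [← ih, add_smul, one_smul, ← add_assoc]
    exact hstep _ (add_mem hκ (Submodule.smul_mem _ _ H.etaK_mem))
  | pred i ih =>
    rw [← ih, ← hstep _ (add_mem hκ (Submodule.smul_mem _ _ H.etaK_mem)), sub_smul, one_smul,
      add_assoc, sub_add_cancel]

theorem kFactor_add_smul (H : Splitting L K u u' η) (hg : IsIsom g) (n : ℤ) (x : QSpace bp bm)
    (t y ω : ℝ) : kFactor η u k g P m n (x + t • etaK u u' η) y ω =
      ee (-(n * t * bil η u') : ℝ) * kFactor η u k g P m n x y (ω + t) := by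
  have hX : x + t • etaK u u' η + ω • η = (x + (ω + t) • η) + (-(t * bil η u')) • u := by
    rw [etaK]; module
  have hG : gSub g u (x + t • etaK u u' η + ω • η) = gSub g u (x + (ω + t) • η) := by
    rw [hX, gSub_add hg, gSub_smul hg, H.gSub_u hg, smul_zero, add_zero]
  have hu : ‖(g u).1‖ ≠ 0 := (H.norm_pos hg).ne'
  have hB : n * (bil (x + t • etaK u u' η + ω • η) (posPart g u) / ‖(g u).1‖ ^ 2) =
      -(n * t * bil η u') + n * (bil (x + (ω + t) • η) (posPart g u) / ‖(g u).1‖ ^ 2) := by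
    rw [hX, map_add, map_smul, LinearMap.add_apply, LinearMap.smul_apply, bil_posPart hg u,
      real_inner_self_eq_norm_sq, smul_eq_mul]
    field_simp
    ring
  rw [kFactor, kFactor, hG, hB, Complex.ofReal_add, ee_add]
  ring

theorem integral_exp_quadratic {E : ℝ} (hE : 0 < E) (F G : ℝ) {y : ℝ} (hy : 0 < y) :
    ∫ ω : ℝ, exp (-(2 * π * y * (G + 2 * ω * F + ω ^ 2 * E))) =
      1 / sqrt (2 * y * E) * exp (-(2 * π * y * (G - F ^ 2 / E))) := by
  have h1 : (fun ω : ℝ => exp (-(2 * π * y * (G + 2 * ω * F + ω ^ 2 * E)))) =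
      fun ω => exp (-(2 * π * y * E) * (ω + F / E) ^ 2) *
        exp (-(2 * π * y * (G - F ^ 2 / E))) := by
    funext ω
    rw [← Real.exp_add]
    congr 1
    field_simp
    ring
  rw [h1, integral_mul_const,
    integral_add_right_eq_self (fun ω : ℝ => exp (-(2 * π * y * E) * ω ^ 2)) (F / E),
    integral_gaussian]
  congr 1
  rw [show π / (2 * π * y * E) = (2 * y * E)⁻¹ by
    have := Real.pi_ne_zero
    field_simp, Real.sqrt_inv, one_div]

theorem continuousOn_kAmplitude (hu : 0 < ‖(g u).1‖) (n : ℤ) (x : QSpace bp bm) :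
    ContinuousOn (kAmplitude u k g P m n x) (Set.Ioi 0) := by
  have hid : ContinuousOn (fun y : ℝ => y) (Set.Ioi 0) := continuousOn_id
  have hne : ∀ y ∈ Set.Ioi (0 : ℝ), y ≠ 0 := fun y hy => ne_of_gt hy
  have hpos : ∀ y ∈ Set.Ioi (0 : ℝ), 0 < 2 * y * ‖(g u).1‖ ^ 2 := fun y hy => by
    have : 0 < y := hy
    positivity
  refine ContinuousOn.mul (Complex.continuous_ofReal.comp_continuousOn ?_)
    (continuousOn_finsetSum _ fun h _ => ContinuousOn.mul (ContinuousOn.pow ?_ h)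
      continuousOn_const)
  · refine ((hid.rpow_const fun y hy => Or.inl (hne y hy)).mul
      (hid.rpow_const fun y hy => Or.inl (hne y hy))).mul (ContinuousOn.mul ?_ ?_)
    · exact continuousOn_const.div (Real.continuous_sqrt.comp_continuousOn (by fun_prop))
        fun y hy => (Real.sqrt_pos.2 (hpos y hy)).ne'
    · exact Real.continuous_exp.comp_continuousOn (ContinuousOn.neg
        (continuousOn_const.div (by fun_prop) fun y hy => (hpos y hy).ne'))
  · refine continuousOn_const.div (by fun_prop) fun y hy => ?_
    exact mul_ne_zero two_ne_zero (by exact_mod_cast hne y hy)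

theorem norm_kAmplitude_le (n : ℤ) (x : QSpace bp bm) {y : ℝ} (hy : 0 < y) :
    ‖kAmplitude u k g P m n x y‖ ≤ ∑ h ∈ Finset.range (m + 1),
      (|(n : ℝ)| / 2) ^ h * ‖polyAt (subPoly g u P h) (gSub g u x)‖ *
      (y ^ k * y ^ ((bm : ℝ) / 2) * (1 / sqrt (2 * y * ‖(g u).1‖ ^ 2)) * (1 / y ^ h) *
        exp (-(π * n ^ 2 / (2 * y * ‖(g u).1‖ ^ 2)))) := by
  have h1 : ∀ h : ℕ, (|(n : ℝ)| / (2 * y)) ^ h = (|(n : ℝ)| / 2) ^ h * (1 / y ^ h) := fun h => by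
    rw [← one_div_pow, ← mul_pow]; congr 1; field_simp
  rw [kAmplitude, Finset.mul_sum]
  refine norm_sum_le_of_le _ fun h _ => le_of_eq ?_
  rw [norm_mul, norm_mul, Complex.norm_real, Real.norm_eq_abs, abs_of_nonneg (by positivity),
    norm_pow, norm_div, norm_neg, norm_mul, Complex.norm_I, RCLike.norm_conj, norm_mul,
    Complex.norm_real, Real.norm_eq_abs, abs_of_pos hy, RCLike.norm_ofNat, Complex.norm_intCast,
    mul_one, h1]
  ring

theorem integrable_kFactor (H : Splitting L K u u' η) (hg : IsIsom g)
    {x : QSpace bp bm} (hpol : ∀ h (ω : ℝ), polyAt (subPoly g u P h) (gSub g u (x + ω • η)) =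
      polyAt (subPoly g u P h) (gSub g u x)) (hxu : bil x u = 0) (hxη : bil x η = 0)
    (hq : 0 < q x) {n : ℤ} (hn : n ≠ 0) :
    Integrable (fun p : ℝ × ℝ => ((1 / p.1 ^ 2 : ℝ) : ℂ) * kFactor η u k g P m n x p.1 p.2)
      ((volume.restrict (Set.Ioi 0)).prod volume) := by
  have hu := H.norm_pos hg
  have hE := H.gSub_η_pos hg
  have hgap := H.gSub_gap_pos hg hxu hxη hq
  have hE' := H.norm_gSub_η_pos hg
  have hn' : (0 : ℝ) < (n : ℝ) ^ 2 := by positivity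
  have hmeas : AEStronglyMeasurable
      (fun p : ℝ × ℝ => ((1 / p.1 ^ 2 : ℝ) : ℂ) * kFactor η u k g P m n x p.1 p.2)
      ((volume.restrict (Set.Ioi 0)).prod volume) := by
    rw [← Measure.restrict_univ (μ := (volume : Measure ℝ)), Measure.restrict_restrict
      measurableSet_Ioi, Set.inter_univ, Measure.prod_restrict]
    refine ContinuousOn.aestronglyMeasurable ?_ (measurableSet_Ioi.prod MeasurableSet.univ)
    simp only [kFactor_eq hg n hpol]
    refine ContinuousOn.mul (Complex.continuous_ofReal.comp_continuousOn
      (continuousOn_const.div (by fun_prop) fun p hp => pow_ne_zero 2 (ne_of_gt hp.1)))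
      (ContinuousOn.mul ?_ (Continuous.continuousOn (by fun_prop)))
    exact (continuousOn_kAmplitude hu n x).comp continuousOn_fst fun p hp => hp.1
  rw [integrable_prod_iff hmeas]
  constructor
  · refine (ae_restrict_iff' measurableSet_Ioi).2 (.of_forall fun y hy => ?_)
    have hy : 0 < y := hy
    simp only [kFactor_eq hg n hpol]
    refine Integrable.const_mul (Integrable.const_mul ?_ _) _
    have h1 := integrable_cexp_quadratic (b := ((2 * π * y * ‖(gSub g u η).1‖ ^ 2 : ℝ) : ℂ))
      (by rw [Complex.ofReal_re]; positivity)
      (2 * π * I * (n * bil η (posPart g u) / ‖(g u).1‖ ^ 2 : ℝ) -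
          (4 * π * y * inner ℝ (gSub g u x).1 (gSub g u η).1 : ℝ))
      (2 * π * I * (n * bil x (posPart g u) / ‖(g u).1‖ ^ 2 : ℝ) -
          (2 * π * y * ‖(gSub g u x).1‖ ^ 2 : ℝ))
    simp only [Complex.ofReal_neg]
    exact h1
  · set A := π * n ^ 2 / (2 * ‖(g u).1‖ ^ 2) with hA
    set B := 2 * π * (‖(gSub g u x).1‖ ^ 2 -
      inner ℝ (gSub g u x).1 (gSub g u η).1 ^ 2 / ‖(gSub g u η).1‖ ^ 2) with hB
    have hdom : IntegrableOn (fun y : ℝ => ∑ h ∈ Finset.range (m + 1),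
        (|(n : ℝ)| / 2) ^ h * ‖polyAt (subPoly g u P h) (gSub g u x)‖ *
        (1 / (2 * ‖(g u).1‖ * ‖(gSub g u η).1‖)) *
        (y ^ ((bm : ℝ) / 2 + k - h - 3) * exp (-(A / y) - B * y))) (Set.Ioi 0) :=
      integrable_finsetSum _ fun h _ => (integrableOn_rpow_mul_exp _ (by positivity)
        (by positivity)).const_mul _
    refine Integrable.mono' hdom hmeas.norm.integral_prod_right' ?_
    refine (ae_restrict_iff' measurableSet_Ioi).2 (.of_forall fun y hy => ?_)
    have hy : 0 < y := hy
    rw [Real.norm_eq_abs, abs_of_nonneg (integral_nonneg fun _ => norm_nonneg _)]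
    simp only [norm_mul, norm_kFactor hg n hpol, integral_const_mul, norm_gSub_add_smul hg]
    rw [integral_exp_quadratic hE _ _ hy, Complex.norm_real, Real.norm_eq_abs,
      abs_of_pos (by positivity)]
    calc _ ≤ 1 / y ^ 2 * ((∑ h ∈ Finset.range (m + 1),
          (|(n : ℝ)| / 2) ^ h * ‖polyAt (subPoly g u P h) (gSub g u x)‖ *
          (y ^ k * y ^ ((bm : ℝ) / 2) * (1 / sqrt (2 * y * ‖(g u).1‖ ^ 2)) * (1 / y ^ h) *
            exp (-(π * n ^ 2 / (2 * y * ‖(g u).1‖ ^ 2))))) * _) :=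
          mul_le_mul_of_nonneg_left (mul_le_mul_of_nonneg_right
            (norm_kAmplitude_le n x hy) (by positivity)) (by positivity)
      _ = _ := by
        rw [Finset.sum_mul, Finset.mul_sum]
        refine Finset.sum_congr rfl fun h _ => ?_
        have h1 : exp (-(A / y) - B * y) =
            exp (-(π * n ^ 2 / (2 * y * ‖(g u).1‖ ^ 2))) *
            exp (-(2 * π * y * (‖(gSub g u x).1‖ ^ 2 -
              inner ℝ (gSub g u x).1 (gSub g u η).1 ^ 2 / ‖(gSub g u η).1‖ ^ 2))) := by
          rw [← Real.exp_add]
          congr 1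
          rw [hA, hB, div_div, mul_right_comm 2 y]
          ring
        rw [h1]
        linear_combination (|(n : ℝ)| / 2) ^ h * ‖polyAt (subPoly g u P h) (gSub g u x)‖ *
          (exp (-(π * n ^ 2 / (2 * y * ‖(g u).1‖ ^ 2))) *
            exp (-(2 * π * y * (‖(gSub g u x).1‖ ^ 2 -
              inner ℝ (gSub g u x).1 (gSub g u η).1 ^ 2 / ‖(gSub g u η).1‖ ^ 2)))) *
          rpow_amplitude hu hE' hy k ((bm : ℝ) / 2) h

/-- The sum over the translates of `κ` by multiples of `η_K`. -/
theorem hasSum_stripTerm_add_zsmul [DiscreteTopology L] [IsZLattice ℝ L]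
    (H : Splitting L K u u' η) (hg : IsIsom g) (hφ : IsJacobiForm L η k φ)
    {x : QSpace bp bm} (hpol : ∀ h (ω : ℝ), polyAt (subPoly g u P h) (gSub g u (x + ω • η)) =
      polyAt (subPoly g u P h) (gSub g u x)) (hxu : bil x u = 0) (hxη : bil x η = 0)
    (hq : 0 < q x) {n : ℤ} (hn : n ≠ 0) (t : ℝ) (hκ : x + t • etaK u u' η ∈ dualLat K) :
    HasSum (fun j : ℤ => stripTerm η u k φ g P m n (x + t • etaK u u' η + j • etaK u u' η))
      ((∫ y in Set.Ioi (0 : ℝ), ((1 / y ^ 2 : ℝ) : ℂ) * ∫ ω : ℝ, kFactor η u k g P m n x y ω) *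
        (ee (-(n * t * bil η u') : ℝ) * jacCoeff φ (cls L (x + t • etaK u u' η))
          (q (x + t • etaK u u' η)) (bil (x + t • etaK u u' η) η))) := by
  set a := jacCoeff φ (cls L (x + t • etaK u u' η))
          (q (x + t • etaK u u' η)) (bil (x + t • etaK u u' η) η) with ha
  set μ := (volume.restrict (Set.Ioi (0 : ℝ))).prod (volume : Measure ℝ) with hμ
  set f : ℝ × ℝ → ℂ := fun p => ((1 / p.1 ^ 2 : ℝ) : ℂ) * kFactor η u k g P m n x p.1 p.2 with hf
  have hfi : Integrable f μ := integrable_kFactor H hg hpol hxu hxη hq hn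
  have hU : (⋃ j : ℤ, (Set.univ : Set ℝ) ×ˢ Set.Ioc (t + j) (t + j + 1)) = Set.univ := by
    rw [← Set.prod_iUnion, iUnion_Ioc_add_intCast, Set.univ_prod_univ]
  have h1 := hasSum_integral_iUnion (μ := μ) (f := f)
    (s := fun j : ℤ => (Set.univ : Set ℝ) ×ˢ Set.Ioc (t + j) (t + j + 1))
    (fun j => MeasurableSet.univ.prod measurableSet_Ioc)
    (fun i j hij => Set.Disjoint.set_prod_right (Set.pairwise_disjoint_Ioc_add_intCast t hij) _ _)
    hfi.integrableOn
  rw [hU, Measure.restrict_univ, hμ, integral_prod _ hfi] at h1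
  have h2 := h1.mul_right (ee (-(n * t * bil η u') : ℝ) * a)
  simp only [hf, integral_const_mul] at h2
  refine (congrArg (fun F => HasSum F _) (funext fun j => ?_)).mpr h2
  obtain ⟨b, hb⟩ := dual_bil_int H.η_mem H.u'_mem
  have hee : ee (-(n * (t + j) * bil η u') : ℝ) = ee (-(n * t * bil η u') : ℝ) :=
    ee_congr ⟨-(n * j * b), by rw [hb]; push_cast; ring⟩
  have hκj : x + t • etaK u u' η + j • etaK u u' η = x + (t + j) • etaK u u' η := by
    rw [← Int.cast_smul_eq_zsmul ℝ]; module
  rw [setIntegral_prod _ hfi.integrableOn, stripTerm, H.jacCoeff_add_zsmul hφ hκ, ← ha, hκj]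
  simp only [kFactor_add_smul H hg, hee, intervalIntegral.integral_const_mul, Measure.restrict_univ]
  rw [← integral_mul_const]
  congr 1
  funext y
  rw [intervalIntegral.integral_comp_add_right (fun ω => kFactor η u k g P m n x y ω),
    intervalIntegral.integral_of_le (by linarith), zero_add, add_comm 1]
  simp only [hf, integral_const_mul]
  ring

end

section

/-! ### Regrouping the sum over `K'` -/

variable {L K : Submodule ℤ (QSpace bp bm)} {u u' η : QSpace bp bm}

theorem projEta_add_smul (u u' η κ : QSpace bp bm) :
    projEta u u' η κ + (bil κ η / bil η η) • etaK u u' η = κ := by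
  rw [projEta, etaK]; module

theorem Splitting.bil_add_zsmul_etaK (H : Splitting L K u u' η) (κ : QSpace bp bm) (j : ℤ) :
    bil (κ + j • etaK u u' η) η = bil κ η + j * bil η η := by
  rw [map_add, LinearMap.add_apply, bil_zsmul_left, H.etaK_η]

/-- Vectors of `K'` that represent the classes modulo `ℤ η_K`. -/
def IsReduced (K : Submodule ℤ (QSpace bp bm)) (η κ : QSpace bp bm) : Prop :=
  κ ∈ dualLat K ∧ 0 ≤ bil κ η ∧ bil κ η < bil η η

open Classical in
theorem Splitting.hasSum_translates [DiscreteTopology L] [IsZLattice ℝ L]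
    (H : Splitting L K u u' η) {f F : ℕ → QSpace bp bm → ℂ} {a : ℂ}
    (hf : HasSum (fun p : ℕ × dualLat K => f (p.1 + 1) p.2) a)
    (hF : ∀ n κ, 1 ≤ n → κ ∈ dualLat K →
      HasSum (fun j : ℤ => f n (κ + j • etaK u u' η)) (F n κ)) :
    HasSum (fun c : ℕ × QSpace bp bm => if 1 ≤ c.1 ∧ IsReduced K η c.2 then F c.1 c.2 else 0) a := by
  have hη := H.bil_ηη_pos
  set red : ℕ × dualLat K → ℕ × QSpace bp bm := fun p =>
    (p.1 + 1, (p.2 : QSpace bp bm) - ⌊bil (p.2 : QSpace bp bm) η / bil η η⌋ • etaK u u' η) with hred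
  have hbil : ∀ κ : QSpace bp bm, bil (κ - ⌊bil κ η / bil η η⌋ • etaK u u' η) η =
      bil κ η - ⌊bil κ η / bil η η⌋ * bil η η := fun κ => by
    rw [map_sub, LinearMap.sub_apply, bil_zsmul_left, H.etaK_η]
  refine (congrArg (fun F => HasSum F a) (funext fun c => ?_)).mp (hf.tsum_fiberwise red)
  split_ifs with hc
  · obtain ⟨hn, hκ, h0, h1⟩ := hc
    have hfl : ∀ j : ℤ, ⌊bil (c.2 + j • etaK u u' η) η / bil η η⌋ = j := fun j => by
      rw [H.bil_add_zsmul_etaK, add_div, mul_div_cancel_right₀ _ hη.ne', Int.floor_add_intCast,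
        Int.floor_eq_zero_iff.2 ⟨by positivity, (div_lt_one hη).2 h1⟩, zero_add]
    set i : ℤ → red ⁻¹' {c} := fun j => ⟨(c.1 - 1, ⟨c.2 + j • etaK u u' η,
      add_mem hκ (Submodule.smul_mem _ _ H.etaK_mem)⟩), by
        simp only [hred, Set.mem_preimage, Set.mem_singleton_iff, hfl]
        ext1
        · simp only; omega
        · simp⟩ with hi
    have hinj : Function.Injective i := fun j j' h => by
      have := congrArg (fun b : red ⁻¹' {c} => ((b.1.2 : dualLat K) : QSpace bp bm)) h
      simp only [hi] at this
      rw [← hfl j, this, hfl]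
    have hsurj : Function.Surjective i := fun ⟨b, hb⟩ => by
      have hb' : red b = c := hb
      refine ⟨⌊bil (b.2 : QSpace bp bm) η / bil η η⌋, Subtype.ext (Prod.ext ?_ (Subtype.ext ?_))⟩
      · simp [hi, ← hb', hred]
      · simp [hi, ← hb', hred]
    rw [← (hF c.1 c.2 hn hκ).tsum_eq, ← (Equiv.ofBijective i ⟨hinj, hsurj⟩).tsum_eq]
    refine tsum_congr fun j => ?_
    simp only [Equiv.ofBijective_apply, hi]
    rw [Nat.sub_add_cancel hn]
  · have : IsEmpty (red ⁻¹' {c}) := ⟨fun ⟨b, hb⟩ => hc (by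
      have hb' : red b = c := hb
      rw [← hb']
      refine ⟨Nat.le_add_left _ _, sub_mem b.2.2 (Submodule.smul_mem _ _ H.etaK_mem), ?_, ?_⟩
      · rw [hbil, sub_nonneg, ← le_div_iff₀ hη]
        exact Int.floor_le _
      · rw [hbil, sub_lt_iff_lt_add, ← one_add_mul, ← div_lt_iff₀ hη, add_comm]
        exact Int.lt_floor_add_one _)⟩
    exact tsum_empty

theorem Splitting.finite_reduced [DiscreteTopology L] [IsZLattice ℝ L]
    (H : Splitting L K u u' η) {lam : QSpace bp bm} (hlam : lam ∈ dualLat (orthIn K η))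
    (hq : 0 < q lam) : {c : ℕ × QSpace bp bm | 1 ≤ c.1 ∧ IsReduced K η c.2 ∧
      projEta u u' η c.2 = (c.1 : ℝ)⁻¹ • lam}.Finite := by
  have hη := H.bil_ηη_pos
  obtain ⟨w, hw, hw0⟩ : ∃ w ∈ orthIn K η, bil lam w ≠ 0 := by
    by_contra! h
    have : ∀ x ∈ Submodule.span ℝ (orthIn K η : Set (QSpace bp bm)), bil lam x = 0 := by
      intro x hx
      induction hx using Submodule.span_induction with
      | mem x hx => exact h x hx
      | zero => simp
      | add x y _ _ hx hy => simp [hx, hy]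
      | smul c x _ hx => simp [hx]
    have := this lam hlam.2
    rw [bil_self] at this
    linarith
  obtain ⟨N, hN⟩ := dual_bil_int hlam hw
  obtain ⟨d, hd, hdK⟩ := H.exists_smul_dualK_mem
  have hd' : (0 : ℝ) < d := by exact_mod_cast hd
  refine ((Set.finite_Icc 1 N.natAbs).prod (Set.finite_Ico (0 : ℤ) ⌈(d : ℝ) * bil η η⌉)).image
    (fun p : ℕ × ℤ => (p.1, (p.1 : ℝ)⁻¹ • lam + ((p.2 : ℝ) / d / bil η η) • etaK u u' η)) |>.subset ?_
  rintro ⟨n, κ⟩ ⟨hn, ⟨hκ, h0, h1⟩, hpr⟩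
  simp only at hn hκ h0 h1 hpr
  have hn' : (0 : ℝ) < n := by exact_mod_cast hn
  obtain ⟨M, hM⟩ := dual_bil_int (H.projEta_mem hκ) hw
  obtain ⟨l, hl⟩ := dual_bil_int H.etaK_mem (hdK κ hκ)
  have hl' : (l : ℝ) = d * bil κ η := by
    rw [← hl, bil_comm, bil_zsmul_left, H.bil_etaK (H.dualK_orth hκ).1]; simp
  have hNM : N = n * M := by
    rw [hpr, bil_smul_left, hN] at hM
    have : (N : ℝ) = n * M := by rw [← hM]; field_simp
    exact_mod_cast this
  refine ⟨(n, l), ⟨⟨hn, ?_⟩, ?_, ?_⟩, Prod.ext rfl ?_⟩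
  · rw [hNM, Int.natAbs_mul, Int.natAbs_natCast]
    refine Nat.le_mul_of_pos_right n (Int.natAbs_pos.2 fun hM0 => hw0 ?_)
    rw [hN, hNM, hM0]; simp
  · have : (0 : ℝ) ≤ l := by rw [hl']; positivity
    exact_mod_cast this
  · rw [Int.lt_ceil, hl']
    exact mul_lt_mul_of_pos_left h1 hd'
  · simp only
    rw [← hpr, hl', mul_div_cancel_left₀ _ hd'.ne', projEta_add_smul]

open Classical in
theorem Splitting.hasSum_regroup [DiscreteTopology L] [IsZLattice ℝ L]
    (H : Splitting L K u u' η) {F : ℕ → QSpace bp bm → ℂ} {a : ℂ}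
    (hF : HasSum (fun c : ℕ × QSpace bp bm =>
      if 1 ≤ c.1 ∧ IsReduced K η c.2 then F c.1 c.2 else 0) a)
    (h0 : ∀ n κ, IsReduced K η κ → q (projEta u u' η κ) ≤ 0 → F n κ = 0) :
    HasSum (fun lam : dualLat (orthIn K η) => if 0 < q (lam : QSpace bp bm) then
      ∑ᶠ (n : ℕ) (κ : QSpace bp bm), if 1 ≤ n ∧ IsReduced K η κ ∧
        projEta u u' η κ = (n : ℝ)⁻¹ • (lam : QSpace bp bm) then F n κ else 0 else 0) a := by
  set ψ : ℕ × QSpace bp bm → QSpace bp bm := fun c => (c.1 : ℝ) • projEta u u' η c.2 with hψ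
  have h1 := hF.tsum_fiberwise ψ
  have hiff : ∀ (lam : QSpace bp bm) (c : ℕ × QSpace bp bm), 1 ≤ c.1 →
      (ψ c = lam ↔ projEta u u' η c.2 = (c.1 : ℝ)⁻¹ • lam) := fun lam c hc => by
    have hc' : (c.1 : ℝ) ≠ 0 := by exact_mod_cast (by omega : c.1 ≠ 0)
    rw [eq_comm, eq_inv_smul_iff₀ hc', eq_comm]
  have hval : ∀ lam : QSpace bp bm, lam ∈ dualLat (orthIn K η) →
      ∑' c : ψ ⁻¹' {lam}, (if 1 ≤ c.1.1 ∧ IsReduced K η c.1.2 then F c.1.1 c.1.2 else 0) =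
      if 0 < q lam then ∑ᶠ (n : ℕ) (κ : QSpace bp bm), if 1 ≤ n ∧ IsReduced K η κ ∧
        projEta u u' η κ = (n : ℝ)⁻¹ • lam then F n κ else 0 else 0 := by
    intro lam hlam
    split_ifs with hq
    · rw [tsum_subtype (ψ ⁻¹' {lam}) (fun c : ℕ × QSpace bp bm =>
        if 1 ≤ c.1 ∧ IsReduced K η c.2 then F c.1 c.2 else 0)]
      have hfin := H.finite_reduced hlam hq
      have heq : (ψ ⁻¹' {lam}).indicator (fun c : ℕ × QSpace bp bm =>
          if 1 ≤ c.1 ∧ IsReduced K η c.2 then F c.1 c.2 else 0) = fun c =>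
          if 1 ≤ c.1 ∧ IsReduced K η c.2 ∧ projEta u u' η c.2 = (c.1 : ℝ)⁻¹ • lam
            then F c.1 c.2 else 0 := by
        funext c
        rw [Set.indicator_apply, ← ite_and]
        refine if_congr ?_ rfl rfl
        rw [Set.mem_preimage, Set.mem_singleton_iff]
        constructor
        · rintro ⟨h, hc, hr⟩; exact ⟨hc, hr, (hiff lam c hc).1 h⟩
        · rintro ⟨hc, hr, h⟩; exact ⟨(hiff lam c hc).2 h, hc, hr⟩
      have hsupp : (Function.support fun c : ℕ × QSpace bp bm =>
          if 1 ≤ c.1 ∧ IsReduced K η c.2 ∧ projEta u u' η c.2 = (c.1 : ℝ)⁻¹ • lam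
            then F c.1 c.2 else 0).Finite := hfin.subset fun c hc => by
        by_contra h
        exact hc (if_neg h)
      rw [heq, tsum_eq_finsum hsupp, finsum_curry _ hsupp]
    · refine (tsum_congr fun c => ?_).trans tsum_zero
      split_ifs with hc
      · have hc' : (c.1.1 : ℝ) ≠ 0 := by exact_mod_cast (by omega : c.1.1 ≠ 0)
        have hψc : ψ c = lam := c.2
        refine h0 _ _ hc.2 ?_
        rw [(hiff lam c hc.1).1 hψc, q_smul]
        exact mul_nonpos_of_nonneg_of_nonpos (sq_nonneg _) (not_lt.1 hq)
      · rfl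
  have h2 : HasSum ((fun lam : QSpace bp bm => ∑' c : ψ ⁻¹' {lam},
      (if 1 ≤ c.1.1 ∧ IsReduced K η c.1.2 then F c.1.1 c.1.2 else 0)) ∘
      ((↑) : dualLat (orthIn K η) → QSpace bp bm)) a := by
    refine (Function.Injective.hasSum_iff Subtype.val_injective fun lam hlam => ?_).2 h1
    refine (tsum_congr fun c => if_neg ?_).trans tsum_zero
    rintro ⟨-, hr⟩
    refine hlam ⟨⟨lam, ?_⟩, rfl⟩
    have hc : ψ c = lam := c.2
    have hmem : ψ c ∈ dualLat (orthIn K η) := by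
      simp only [hψ]
      rw [Nat.cast_smul_eq_nsmul]
      exact nsmul_mem (H.projEta_mem hr.1) _
    rwa [hc] at hmem
  exact (congrArg (fun F => HasSum F a) (funext fun lam : dualLat (orthIn K η) =>
    hval lam lam.2)).mp h2

end

section

variable {L K : Submodule ℤ (QSpace bp bm)} {u u' η : QSpace bp bm}
  {g : QSpace bp bm ≃ₗ[ℝ] QSpace bp bm} {P : MvPolynomial (Fin bp) ℂ} {m : ℕ} {k : ℝ}
  {φ : ℂ → ℂ → Disc L → ℂ}

/-! ### The coefficients at vectors of positive norm -/

theorem polyAt_subPoly_smul (hg : IsIsom g) (hP : P.IsHomogeneous m) {h : ℕ} (hm : h ≤ m) {c : ℝ}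
    (hc : c ≠ 0) (x : QSpace bp bm) : polyAt (subPoly g u P h) (gSub g u (c • x)) =
      (c : ℂ) ^ (m - h) * polyAt (subPoly g u P h) (gSub g u x) := by
  have := eval_polyCoeff_smul (g u).1 hP hm (c := (c : ℂ)) (by exact_mod_cast hc)
    (fun i => (((gSub g u x).1 i : ℝ) : ℂ))
  simp only [polyAt, subPoly]
  rw [← this, gSub_smul hg]
  congr 2
  funext i
  simp

theorem Splitting.polyAt_projEta_add_smul [DiscreteTopology L] [IsZLattice ℝ L]
    (H : Splitting L K u u' η) (hg : IsIsom g) (hP : P.IsHomogeneous m)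
    (hinv : ∀ h, ∀ v ∈ K, ∀ C : ℂ,
      MvPolynomial.eval (fun i => (((gSub g u v).1 i : ℝ) : ℂ) +
          C * (((gSub g u η).1 i : ℝ) : ℂ)) (subPoly g u P h) =
        MvPolynomial.eval (fun i => (((gSub g u v).1 i : ℝ) : ℂ)) (subPoly g u P h))
    {κ : QSpace bp bm} (hκ : κ ∈ dualLat K) (h : ℕ) (ω : ℝ) :
    polyAt (subPoly g u P h) (gSub g u (projEta u u' η κ + ω • η)) =
      polyAt (subPoly g u P h) (gSub g u (projEta u u' η κ)) := by
  rcases lt_or_ge m h with hm | hm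
  · rw [subPoly, polyCoeff_eq_zero hP hm, polyAt, polyAt, map_zero, map_zero]
  obtain ⟨d, hd, hdK⟩ := H.exists_smul_dualK_mem
  have hd' : (d : ℝ) ≠ 0 := by positivity
  have key : ∀ t : ℝ, polyAt (subPoly g u P h) (gSub g u (κ + t • η)) =
      polyAt (subPoly g u P h) (gSub g u κ) := fun t => by
    have h1 := hinv h _ (hdK κ hκ) ((d * t : ℝ) : ℂ)
    have h2 : (d : ℤ) • κ = (d : ℝ) • κ := by rw [← Int.cast_smul_eq_zsmul ℝ]; simp
    have h3 : polyAt (subPoly g u P h) (gSub g u ((d : ℝ) • (κ + t • η))) =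
        polyAt (subPoly g u P h) (gSub g u ((d : ℝ) • κ)) := by
      rw [polyAt, polyAt, ← h2, ← h1, h2, smul_add, smul_smul, gSub_add hg, gSub_smul hg _ (_ * _)]
      congr 2
      funext i
      simp
    rw [polyAt_subPoly_smul hg hP hm hd', polyAt_subPoly_smul hg hP hm hd'] at h3
    exact mul_left_cancel₀ (pow_ne_zero _ (by exact_mod_cast hd')) h3
  have hG : ∀ ω : ℝ, gSub g u (projEta u u' η κ + ω • η) =
      gSub g u (κ + (ω - bil κ η / bil η η) • η) := fun ω => by
    have h0 : gSub g u κ = gSub g u (projEta u u' η κ) + (bil κ η / bil η η) • gSub g u η := by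
      conv_lhs => rw [← projEta_add_smul u u' η κ]
      rw [gSub_add hg, gSub_smul hg, H.gSub_etaK hg]
    rw [gSub_add hg, gSub_add hg, gSub_smul hg, gSub_smul hg, h0]
    module
  have h0 := hG 0
  rw [zero_smul, add_zero] at h0
  rw [hG, h0, key, key]

theorem Splitting.bil_mu (H : Splitting L K u u' η) (hg : IsIsom g) {x : QSpace bp bm}
    (hxu : bil x u = 0) (hxu' : bil x u' = 0) :
    bil x (mu g u u') = bil x (posPart g u) / ‖(g u).1‖ ^ 2 := by
  have hu := H.norm_pos hg
  rw [mu, bil_posPart_self hg, bil_negPart_self hg, H.norm_eq hg, map_add, map_add, map_neg,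
    map_smul, map_smul, hxu', bil_negPart hg, H.inner_eq hg hxu, ← bil_posPart hg, smul_eq_mul,
    smul_eq_mul]
  field_simp
  ring

/-- The factor of the coefficient at `lam` that belongs to the divisor `n`. -/
def divisorFactor (g : QSpace bp bm ≃ₗ[ℝ] QSpace bp bm) (u η : QSpace bp bm)
    (P : MvPolynomial (Fin bp) ℂ) (m : ℕ) (k : ℝ) (lam : QSpace bp bm) (h n : ℕ) : ℂ :=
  (n : ℂ) ^ (2 * (h : ℤ) - m) / (2 * I) ^ h *
    conj (polyAt (subPoly g u P h) (gSub g u lam)) *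
    ((∫ y in Set.Ioi (0 : ℝ), besselIntegrand g u η lam k h n y : ℝ) : ℂ)

/-- The factor of the coefficient at `lam` in front of the sums. -/
def commonFactor (g : QSpace bp bm ≃ₗ[ℝ] QSpace bp bm) (u η lam : QSpace bp bm) : ℂ :=
  1 / (sqrt (bil (posPart g u) (posPart g u)) *
      sqrt (bil (wPos g u η) (wPos g u η)) : ℂ) *
    ee (-(bil η (posPart g u) * bil lam (wPos g u η) /
      (2 * bil (posPart g u) (posPart g u) * q (wPos g u η)) : ℝ))

theorem two_mul_integral_kFactor (H : Splitting L K u u' η) (hg : IsIsom g)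
    (hP : P.IsHomogeneous m) {x : QSpace bp bm}
    (hpol : ∀ h (ω : ℝ), polyAt (subPoly g u P h) (gSub g u (x + ω • η)) =
      polyAt (subPoly g u P h) (gSub g u x)) (hxu : bil x u = 0) (hxu' : bil x u' = 0)
    (hxη : bil x η = 0) (hq : 0 < q x) {n : ℕ} (hn : n ≠ 0) :
    2 * ∫ y in Set.Ioi (0 : ℝ), ((1 / y ^ 2 : ℝ) : ℂ) * ∫ ω : ℝ, kFactor η u k g P m n x y ω =
      ee ((bil ((n : ℝ) • x) (mu g u u') : ℝ) : ℂ) * (commonFactor g u η ((n : ℝ) • x) *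
        ∑ h ∈ Finset.range (m + 1), divisorFactor g u η P m k ((n : ℝ) • x) h n) := by
  have hu := H.norm_pos hg
  have hE' := H.norm_gSub_η_pos hg
  have hn' : (n : ℂ) ≠ 0 := by exact_mod_cast hn
  have hnr : (n : ℝ) ≠ 0 := by exact_mod_cast hn
  have hw : bil (wPos g u η) (wPos g u η) = ‖(gSub g u η).1‖ ^ 2 := by
    rw [bil_self, q_wPos hg]; ring
  rw [setIntegral_congr_fun measurableSet_Ioi fun y hy => integral_kFactor H hg hpol hn hy,
    integral_const_mul, integral_finsetSum _ fun h _ =>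
      ((integrableOn_besselIntegrand H hg hxu hxη hq h hn).ofReal).const_mul _]
  simp only [integral_const_mul, integral_complex_ofReal]
  rw [commonFactor, H.bil_mu hg (by rw [bil_smul_left, hxu, mul_zero])
    (by rw [bil_smul_left, hxu', mul_zero]), hw, Real.sqrt_sq hE'.le, bil_posPart_self hg,
    Real.sqrt_sq hu.le]
  have hsum : ∀ h ∈ Finset.range (m + 1), divisorFactor g u η P m k ((n : ℝ) • x) h n =
      (-(n * I) / 2) ^ h * conj (polyAt (subPoly g u P h) (gSub g u x)) *
        ((∫ y in Set.Ioi (0 : ℝ), besselIntegrand g u η ((n : ℝ) • x) k h n y : ℝ) : ℂ) := by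
    intro h hh
    have hm : h ≤ m := Nat.lt_succ_iff.1 (Finset.mem_range.1 hh)
    rw [divisorFactor, polyAt_subPoly_smul hg hP hm hnr, map_mul, map_pow, Complex.conj_ofReal]
    have h1 : -((n : ℂ) * I) / 2 = n / (2 * I) := by
      rw [div_mul_eq_div_div, Complex.div_I]; ring
    have h2 : (n : ℂ) ^ (2 * (h : ℤ) - m) * (n : ℂ) ^ (m - h) = (n : ℂ) ^ h := by
      rw [← zpow_natCast, ← zpow_natCast, ← zpow_add₀ hn', Nat.cast_sub hm]
      congr 1
      ring
    rw [h1, div_pow, ← h2, Complex.ofReal_natCast]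
    ring
  rw [Finset.sum_congr rfl hsum]
  push_cast
  have h3 : (‖(g u).1‖ : ℂ) ≠ 0 := by exact_mod_cast hu.ne'
  have h4 : (‖(gSub g u η).1‖ : ℂ) ≠ 0 := by exact_mod_cast hE'.ne'
  field_simp

open Classical in
theorem unfoldCoeff_eq [DiscreteTopology L] [IsZLattice ℝ L] (H : Splitting L K u u' η)
    (P : MvPolynomial (Fin bp) ℂ) (m : ℕ) (k : ℝ) (φ : ℂ → ℂ → Disc L → ℂ)
    (g : QSpace bp bm ≃ₗ[ℝ] QSpace bp bm) {lam : QSpace bp bm}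
    (hlam : lam ∈ dualLat (orthIn K η)) (hq : 0 < q lam) (c : ℂ) :
    c * unfoldCoeff L K u u' η P m k φ g lam = ∑ᶠ (n : ℕ) (κ : QSpace bp bm),
      if 1 ≤ n ∧ IsReduced K η κ ∧ projEta u u' η κ = (n : ℝ)⁻¹ • lam then
        c * (commonFactor g u η lam * ∑ h ∈ Finset.range (m + 1),
          divisorFactor g u η P m k lam h n) *
          (ee (-(n * bil κ η * bil η u' / bil η η : ℝ)) * jacCoeff φ (cls L κ) (q κ) (bil κ η))
      else 0 := by
  have hfin := H.finite_reduced hlam hq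
  set A : ℕ → QSpace bp bm → ℂ := fun n κ =>
    ee (-(n * bil κ η * bil η u' / bil η η : ℝ)) * jacCoeff φ (cls L κ) (q κ) (bil κ η) with hA
  set T : ℕ → QSpace bp bm → ℂ := fun n κ => if 1 ≤ n ∧ IsReduced K η κ ∧
    projEta u u' η κ = (n : ℝ)⁻¹ • lam then A n κ else 0 with hT
  have hT2 : (Function.support fun n => ∑ᶠ κ, T n κ).Finite :=
    (hfin.image Prod.fst).subset fun n hn => by
      obtain ⟨κ, hκ⟩ : ∃ κ, T n κ ≠ 0 := by
        by_contra! h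
        exact hn (by simp [h])
      exact ⟨(n, κ), by by_contra h; exact hκ (if_neg h), rfl⟩
  have h1 : ∀ h n : ℕ, (∑ᶠ (_ : 1 ≤ n ∧ ((n : ℝ)⁻¹) • lam ∈ dualLat (orthIn K η)),
      divisorFactor g u η P m k lam h n * ∑ᶠ (κ : QSpace bp bm) (_ : κ ∈ dualLat K ∧
        projEta u u' η κ = ((n : ℝ)⁻¹) • lam ∧ 0 ≤ bil κ η ∧ bil κ η < bil η η), A n κ) =
      divisorFactor g u η P m k lam h n * ∑ᶠ κ, T n κ := by
    intro h n
    rw [finsum_eq_if]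
    split_ifs with hc
    · congr 1
      refine finsum_congr fun κ => ?_
      rw [finsum_eq_if]
      exact if_congr ⟨fun h => ⟨hc.1, ⟨h.1, h.2.2⟩, h.2.1⟩, fun h => ⟨h.2.1.1, h.2.2, h.2.1.2⟩⟩
        rfl rfl
    · have : ∀ κ, T n κ = 0 := fun κ => by
        simp only [hT]
        rw [if_neg]
        rintro ⟨h1, h2, h3⟩
        exact hc ⟨h1, h3 ▸ H.projEta_mem h2.1⟩
      simp [this]
  have h2 : unfoldCoeff L K u u' η P m k φ g lam = commonFactor g u η lam *
      ∑ h ∈ Finset.range (m + 1), ∑ᶠ n, divisorFactor g u η P m k lam h n * ∑ᶠ κ, T n κ := by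
    rw [unfoldCoeff, commonFactor]
    simp only [← h1]
    rfl
  rw [h2, ← finsum_sum_comm _ _ fun h _ => hT2.subset fun n hn => right_ne_zero_of_mul hn]
  simp only [← Finset.sum_mul]
  rw [← mul_assoc c, mul_finsum]
  refine finsum_congr fun n => ?_
  rw [← mul_assoc, mul_assoc c, mul_finsum]
  exact finsum_congr fun κ => mul_ite_zero _ _ _

theorem hasSum_unfoldCoeff [DiscreteTopology L] [IsZLattice ℝ L] (H : Splitting L K u u' η)
    (hg : IsIsom g) (hP : P.IsHomogeneous m) (hφ : IsJacobiCuspForm L η k φ)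
    (hinv : ∀ h, ∀ v ∈ K, ∀ C : ℂ,
      MvPolynomial.eval (fun i => (((gSub g u v).1 i : ℝ) : ℂ) +
          C * (((gSub g u η).1 i : ℝ) : ℂ)) (subPoly g u P h) =
        MvPolynomial.eval (fun i => (((gSub g u v).1 i : ℝ) : ℂ)) (subPoly g u P h)) {a : ℂ}
    (ha : HasSum (fun p : ℕ × dualLat K => 2 * stripTerm η u k φ g P m ((p.1 + 1 : ℕ) : ℤ) p.2) a) :
    HasSum (fun lam : dualLat (orthIn K η) => if 0 < q (lam : QSpace bp bm) then
      unfoldCoeff L K u u' η P m k φ g lam *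
        ee ((bil (lam : QSpace bp bm) (mu g u u') : ℝ) : ℂ) else 0) a := by
  classical
  have hη := H.bil_ηη_pos
  set F : ℕ → QSpace bp bm → ℂ := fun n κ => if 0 < q (projEta u u' η κ) then
    ee ((bil ((n : ℝ) • projEta u u' η κ) (mu g u u') : ℝ) : ℂ) *
      (commonFactor g u η ((n : ℝ) • projEta u u' η κ) * ∑ h ∈ Finset.range (m + 1),
        divisorFactor g u η P m k ((n : ℝ) • projEta u u' η κ) h n) *
      (ee (-(n * bil κ η * bil η u' / bil η η : ℝ)) * jacCoeff φ (cls L κ) (q κ) (bil κ η))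
    else 0 with hF
  have h1 := H.hasSum_translates (f := fun n κ => 2 * stripTerm η u k φ g P m n κ) (F := F) ha (by
    intro n κ hn hκ
    have hn0 : n ≠ 0 := by omega
    obtain ⟨hxu, hxu', hxη⟩ := H.span_orthIn (H.projEta_mem hκ).2
    simp only [hF]
    split_ifs with hq
    · have h2 := (hasSum_stripTerm_add_zsmul (n := n) (k := k) (m := m) (P := P) H hg hφ.toIsJacobiForm
        (H.polyAt_projEta_add_smul hg hP hinv hκ) hxu hxη hq (by exact_mod_cast hn0)
        (bil κ η / bil η η) (by rwa [projEta_add_smul])).mul_left 2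
      rw [projEta_add_smul, ← mul_assoc, two_mul_integral_kFactor H hg hP
        (H.polyAt_projEta_add_smul hg hP hinv hκ) hxu hxu' hxη hq hn0] at h2
      have h3 : (-(n * bil κ η * bil η u' / bil η η : ℝ) : ℂ) =
          ((-(((n : ℤ) : ℝ) * (bil κ η / bil η η) * bil η u') : ℝ) : ℂ) := by
        push_cast; ring
      rw [h3]
      exact h2
    · have hcusp : jacCoeff φ (cls L κ) (q κ) (bil κ η) = 0 := by
        by_contra h
        have := hφ.cusp κ (H.mem_dualLat_of_mem_dualK hκ) 0 0 (by simpa using h)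
        refine hq ?_
        have hqκ : q κ = q (projEta u u' η κ) + (bil κ η / bil η η) ^ 2 * q η := by
          conv_lhs => rw [← projEta_add_smul u u' η κ]
          rw [q_add, q_smul, H.q_etaK, map_smul, H.bil_etaK hxu, hxη]
          simp
        rw [bil_self η] at hqκ
        have h3 : (bil κ η / (2 * q η)) ^ 2 * q η = bil κ η ^ 2 / (4 * q η) := by
          have := H.η_pos.ne'
          field_simp
          ring
        have h4 : bil κ η ^ 2 / (4 * q η) < q κ := by
          rw [div_lt_iff₀ (by linarith [H.η_pos])]
          simp only [Int.cast_zero, add_zero] at this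
          linarith
        linarith
      refine (congrArg (fun f => HasSum f _) (funext fun j => ?_)).mpr hasSum_zero
      simp only [stripTerm, H.jacCoeff_add_zsmul hφ.toIsJacobiForm hκ, hcusp, mul_zero,
        integral_zero])
  refine (congrArg (fun f => HasSum f a) (funext fun lam : dualLat (orthIn K η) => ?_)).mp
    (H.hasSum_regroup h1 fun n κ _ hq => if_neg (not_lt.2 hq))
  refine ite_congr rfl (fun hq => ?_) fun _ => rfl
  rw [mul_comm, unfoldCoeff_eq H P m k φ g lam.2 hq]
  refine finsum_congr fun n => finsum_congr fun κ => ite_congr rfl (fun hc => ?_) fun _ => rfl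
  have hn : (0 : ℝ) < n := by exact_mod_cast hc.1
  have hx : (n : ℝ) • projEta u u' η κ = lam := by rw [hc.2.2, smul_inv_smul₀ hn.ne']
  simp only [hF]
  rw [if_pos (by rw [hc.2.2, q_smul]; positivity), hx]

end

section

/-! ### Invariance under Eichler transformations -/

variable {L K : Submodule ℤ (QSpace bp bm)} {u u' η ν : QSpace bp bm}
  {g g' : QSpace bp bm ≃ₗ[ℝ] QSpace bp bm}

theorem eichler_of_orth {x : QSpace bp bm}
    (hx : bil x u = 0) : eichler u ν x = x + bil x ν • u := by
  simp [eichler, hx]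

theorem Splitting.isIsom_eichler (H : Splitting L K u u' η) (hg : IsIsom g) (hν : bil ν u = 0)
    (hE : ∀ v, g' v = g (eichler u ν v)) : IsIsom g' := by
  intro x y
  have h := bil_comm u ν
  rw [hν] at h
  rw [hE, hE, hg, eichler, eichler]
  simp only [map_add, map_sub, map_smul, LinearMap.add_apply, LinearMap.sub_apply,
    LinearMap.smul_apply, smul_eq_mul, H.bil_uu, hν, h, bil_self ν, bil_comm u y, bil_comm ν y]
  ring

section
variable (H : Splitting L K u u' η) (hg : IsIsom g) (hg' : IsIsom g')
  (hE : ∀ v, g' v = g (eichler u ν v))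
include H hE

theorem Splitting.eichler_u (hν : bil ν u = 0) : g' u = g u := by
  rw [hE, eichler_of_orth H.bil_uu, bil_comm, hν, zero_smul, add_zero]

theorem Splitting.eichler_η (hη : bil ν η = 0) : g' η = g η := by
  rw [hE, eichler_of_orth H.η_u, bil_comm, hη, zero_smul, add_zero]

include hg hg'

theorem Splitting.gSub_eichler (hν : bil ν u = 0) {x : QSpace bp bm} (hx : bil x u = 0) :
    gSub g' u x = gSub g u x := by
  have h1 : gSub g' u x = gSub g u (eichler u ν x) := by
    rw [gSub_eq hg', gSub_eq hg, H.eichler_u hE hν, hE]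
  rw [h1, eichler_of_orth hx, gSub_add hg, gSub_smul hg, H.gSub_u hg, smul_zero, add_zero]

theorem Splitting.thetaK_eichler (hν : bil ν u = 0) (P : MvPolynomial (Fin bp) ℂ) :
    thetaK L K u η g' P = thetaK L K u η g P := by
  funext τ z σ
  have hG := fun x (hx : bil x u = 0) => H.gSub_eichler hg hg' hE hν hx
  have hη := hG η H.η_u
  simp only [thetaK, thetaSum, q_wNeg hg', q_wNeg hg, q_wPos hg', q_wPos hg, bil_wPos hg',
    bil_wPos hg, bil_wNeg hg', bil_wNeg hg, hη, subPoly, H.eichler_u hE hν]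
  congr 1
  refine tsum_congr fun v => ?_
  have hv := (H.dualK_orth v.2.1).1
  rw [hG v hv, hG _ (by simp [hv, H.η_u])]

theorem Splitting.besselIntegrand_eichler (hν : bil ν u = 0) (hη : bil ν η = 0)
    {lam : QSpace bp bm} (hlam : bil lam u = 0) (k : ℝ) (h n : ℕ) :
    besselIntegrand g' u η lam k h n = besselIntegrand g u η lam k h n := by
  funext y
  simp only [besselIntegrand, bil_posPart_self hg', bil_posPart_self hg, bil_posPart hg',
    bil_posPart hg, q_wPos hg', q_wPos hg, bil_wPos hg', bil_wPos hg, H.eichler_u hE hν,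
    H.eichler_η hE hη, H.gSub_eichler hg hg' hE hν hlam, H.gSub_eichler hg hg' hE hν H.η_u]

theorem Splitting.unfoldCoeff_eichler (hν : bil ν u = 0) (hη : bil ν η = 0)
    {lam : QSpace bp bm} (hlam : bil lam u = 0) (P : MvPolynomial (Fin bp) ℂ) (m : ℕ) (k : ℝ)
    (φ : ℂ → ℂ → Disc L → ℂ) :
    unfoldCoeff L K u u' η P m k φ g' lam = unfoldCoeff L K u u' η P m k φ g lam := by
  simp only [unfoldCoeff, bil_posPart_self hg', bil_posPart_self hg, bil_posPart hg',
    bil_posPart hg, q_wPos hg', q_wPos hg, bil_self (wPos _ _ _), bil_wPos hg', bil_wPos hg,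
    H.eichler_u hE hν, H.eichler_η hE hη, H.gSub_eichler hg hg' hE hν hlam,
    H.gSub_eichler hg hg' hE hν H.η_u, H.besselIntegrand_eichler hg hg' hE hν hη hlam, subPoly]

end

end

end JacobiUnfolding

end

theorem mainTheorem6 {bp bm : ℕ}
    (L : Submodule ℤ (QSpace bp bm)) [DiscreteTopology L] [IsZLattice ℝ L] (hL : IsEven L)
    (u u' : QSpace bp bm) (hu : u ∈ L) (hu' : u' ∈ L) (huu : q u = 0) (huu' : bil u u' = 1)
    (K : Submodule ℤ (QSpace bp bm)) (hK : K = orthIn (orthIn L u) u')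
    (η : QSpace bp bm) (hη : η ∈ dualLat L) (hηu : bil η u = 0) (hη_pos : 0 < q η)
    (m : ℕ) (P : MvPolynomial (Fin bp) ℂ) (hP : P.IsHomogeneous m)
    (k : ℝ) (hk : k = m + ((bp : ℝ) - bm) / 2)
    (φ : ℂ → ℂ → Disc L → ℂ) (hφ : IsJacobiCuspForm L η k φ) :
    ∃ c : (QSpace bp bm ≃ₗ[ℝ] QSpace bp bm) → QSpace bp bm → ℂ,
      ∀ g : QSpace bp bm ≃ₗ[ℝ] QSpace bp bm, IsIsom g →
        (∀ h, laplacian (subPoly g u P h) = 0) →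
        (∀ h, ∀ v ∈ K, ∀ C : ℂ,
          MvPolynomial.eval (fun i => (((gSub g u v).1 i : ℝ) : ℂ) +
              C * (((gSub g u η).1 i : ℝ) : ℂ)) (subPoly g u P h) =
            MvPolynomial.eval (fun i => (((gSub g u v).1 i : ℝ) : ℂ)) (subPoly g u P h)) →
        -- both Petersson inner products converge absolutely
        MeasureTheory.IntegrableOn (peterssonIntegrand η k φ (thetaL L η g P)) jacDomain ∧
        MeasureTheory.IntegrableOn (peterssonIntegrand η k φ (thetaK L K u η g P)) jacDomain ∧
        -- the expansion
        HasSum (fun lam : ↥(dualLat (orthIn K η)) =>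
            c g lam * ee ((bil (lam : QSpace bp bm) (mu g u u') : ℝ) : ℂ))
          (petersson η k φ (thetaL L η g P)) ∧
        -- its coefficients are invariant under the Eichler transformations `E(u, ν)`
        (∀ ν ∈ Submodule.span ℝ (K : Set (QSpace bp bm)), bil ν η = 0 →
          ∀ g' : QSpace bp bm ≃ₗ[ℝ] QSpace bp bm, (∀ v, g' v = g (eichler u ν v)) →
            ∀ lam ∈ dualLat (orthIn K η), c g' lam = c g lam) ∧
        -- the constant term
        c g 0 = 1 / ((Real.sqrt 2 * Real.sqrt (bil (posPart g u) (posPart g u)) : ℝ) : ℂ) *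
          petersson η k φ (thetaK L K u η g P) ∧
        -- the coefficients at vectors of positive norm
        (∀ lam ∈ dualLat (orthIn K η), 0 < q lam →
          (∀ h n : ℕ, 1 ≤ n →
            MeasureTheory.IntegrableOn (besselIntegrand g u η lam k h n) (Set.Ioi 0)) ∧
          c g lam = unfoldCoeff L K u u' η P m k φ g lam) ∧
        -- the remaining coefficients
        (∀ lam ∈ dualLat (orthIn K η), lam ≠ 0 → q lam ≤ 0 → c g lam = 0) := by
  have H : Splitting L K u u' η := ⟨hL, hu, hu', huu, huu', hK, hη, hηu, hη_pos⟩
  classical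
  refine ⟨fun g lam => if lam = 0 then
      1 / ((Real.sqrt 2 * Real.sqrt (bil (posPart g u) (posPart g u)) : ℝ) : ℂ) *
        petersson η k φ (thetaK L K u η g P)
    else if 0 < q lam then unfoldCoeff L K u u' η P m k φ g lam else 0,
    fun g hg hlap hinv => ?_⟩
  obtain ⟨hL1, hL2, hL3⟩ := petersson_thetaL H hg hφ P
  obtain ⟨hK1, hK2, hK3⟩ := petersson_thetaK H hg hP hlap hφ
  have hq0 : ∀ lam : QSpace bp bm, 0 < q lam → lam ≠ 0 := fun lam h h0 => by
    rw [h0, q_zero] at h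
    exact lt_irrefl _ h
  refine ⟨hL1, hK1, ?_, ?_, if_pos rfl, fun lam hlam hq => ⟨fun h n hn => ?_, ?_⟩,
    fun lam _ h0 hq => ?_⟩
  · have h1 := hasSum_unfoldCoeff H hg hP hφ hinv
      (hasSum_stripTerm H hg hP hk hlap hφ hK2 hL2)
    have h2 := h1.add (hasSum_ite_eq (0 : dualLat (orthIn K η))
      (∫ τ in ModularGroup.fd, torusCoeff (avgPsi η u k φ g P) 0 τ))
    rw [sub_add_cancel, ← hL3, hK3] at h2
    refine (congrArg (fun f => HasSum f _)
      (funext fun lam : dualLat (orthIn K η) => ?_)).mpr h2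
    by_cases h0 : lam = 0
    · simp [h0]
    · have h0' : (lam : QSpace bp bm) ≠ 0 := fun h => h0 (Subtype.ext h)
      simp only [h0, h0', if_false, add_zero]
      rw [ite_mul, zero_mul]
  · intro ν hν hνη g' hE lam hlam
    have hνu := (H.span_K_orth hν).1
    have hg' := H.isIsom_eichler hg hνu hE
    have hlu := (H.span_orthIn hlam.2).1
    simp only [H.thetaK_eichler hg hg' hE hνu, H.unfoldCoeff_eichler hg hg' hE hνu hνη hlu,
      bil_posPart_self hg', bil_posPart_self hg, H.eichler_u hE hνu]
  · have hn' : (0 : ℝ) < n := by exact_mod_cast hn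
    obtain ⟨hlu, -, hlη⟩ := H.span_orthIn hlam.2
    have := integrableOn_besselIntegrand (k := k) (x := (n : ℝ)⁻¹ • lam) H hg
      (by rw [bil_smul_left, hlu, mul_zero]) (by rw [bil_smul_left, hlη, mul_zero])
      (by rw [q_smul]; positivity) h (by omega : n ≠ 0)
    rwa [smul_inv_smul₀ hn'.ne'] at this
  · simp only [hq0 lam hq, if_false, hq, if_true]
  · simp only [h0, if_false, not_lt.2 hq]
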